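/- Let $q\in\mathbb C^\times$ not be a root of unity, $\theta=q-q^{-1}$, $[n]_q=\frac{q^n-q^{-n}}{q-q^{-1}}$. Let $\mathbb V$ be the braided vector space with basis $x_1,x_2$ and diagonal braiding $c(x_i\otimes x_j)=q_{ij}\,x_j\otimes x_i$, $(q_{ij})=\begin{pmatrix} q&q^{-1}\\ q^{-1}&-q\end{pmatrix}$, and let $B=B(\mathbb V)$ be its Nichols algebra, $\mathbb N_0^2$-graded with $\deg x_i=\alpha_i$; $B^\alpha$ denotes the component of degree $\alpha$ and $\delta=\alpha_1+\alpha_2$. Let $\chi$ be the bicharacter on $\mathbb Z^2$ with $\chi(\alpha_i,\alpha_j)=q_{ij}$; the braided bracket of $x\in B^\alpha$, $y\in B^\beta$ is $[x,y]=xy-\chi(\alpha,\beta)yx$ (extended bilinearly). Order words in $x_1<x_2$ lexicographically. For a Lyndon word $w$ define $[w]\in B$ by $[x_i]=x_i$ and $[w]=[[u],[v]]$, where $w=uv$ is the factorization into two Lyndon words with $u$ of minimal length. A root vector candidate is $[v^k]:=[v]^k$ with $v$ a Lyndon word and $k=1$ or $k$ the order of $\chi(\deg v,\deg v)$, if that is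 finite. A candidate $[w]$ is a root vector if it is not a linear combination of products $[w_1]^{m_1}\cdots[w_r]^{m_r}$ of candidates with $w_1>\dots>w_r>w$ and $m_i\ge1$; it is imaginary if its degree is $N\delta$ with $N\ge1$. For $n\ge1$ let $X_n=[x_1(x_1x_2)^{n-1}]$, $Y_n=[(x_1x_2)^{n-1}x_2]$, $L_n=[X_1,Y_n]$; let $L_n'=[X_2,Y_{n-1}]$ for $n\ge2$, $L_1'=L_1$, $L_0=L_0'=1/\theta$, and $\tilde L_n=\frac12(L_n+L_n')$. Let $M_1=L_1$ and $M_{2n+3}=[L_2,M_{2n+1}]$. Put $B_{\ge1}=\bigoplus_{a_1\ge a_2}B^{a_1\alpha_1+a_2\alpha_2}$, $B_{>1}=\bigoplus_{a_1>a_2}B^{a_1\alpha_1+a_2\alpha_2}$, $K_{\ge1}=\{x\in B:\Delta(x)\in B_{\ge1}\otimes B\}$, where $\Delta$ is the braided coproduct, and $K_{>1}=K_{\ge1}\cap B_{>1}$, an ideal of the algebra $K_{\ge1}$. Then: 1. For $m,n\ge0$: $[M_{2m+1},M_{2n+1}]=0$ if $m+n$ is odd, and $[M_{2m+1},M_{2n+1}]=(-1)^{\frac{m-n}2}\,2M_{m+n+1}^2$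 if $m+n$ is even. 2. For $m,n\ge0$, $M_{2m+1}^2$ commutes with $L_n$ (equivalently, $[M_{2m+1}^2,L_n]=0$). 3. For $m\ge0$, $M_{2m+1}^2$ lies in $K_{\ge1}$ and its class is central in the algebra $K_{\ge1}/K_{>1}$. 4. $[\tilde L_{2m},\tilde L_{2n}]=0$ for $m,n\ge0$. There is exactly one sequence $(\bar L_{2n})_{n\ge1}$ in $B$ with $\theta\sum_{n\ge0}\tilde L_{2n}u^{2n}=\exp\bigl(\theta\sum_{n\ge1}\bar L_{2n}u^{2n}\bigr)$, and $[\bar L_{2m},\bar L_{2n}]=0$ for $m,n\ge1$. For $n\ge0$: $[\bar L_{4m},M_{2n+1}]=0$ for $m\ge1$, and $[\bar L_{4m+2},M_{2n+1}]=\frac1{2^{2m}}\frac{[2m+1]_q}{2m+1}M_{4m+2n+3}$ for $m\ge0$. 5. The only possible imaginary root vectors are $L_{4n}$ ($n\ge1$) in degree $4n\delta$, $L_{4n+2}$ and $M_{2n+1}^2$ ($n\ge0$) in degree $(4n+2)\delta$, and $M_{2n+1}$ ($n\ge0$) in degree $(2n+1)\delta$: every root vector of degree $N\delta$, $N\ge1$,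 is one of these elements in the degree indicated. -/

import Mathlib

open scoped TensorProduct

noncomputable section

namespace NicholsA02

/-! ### The braided vector space, its tensor algebra and the braided coproduct -/

/-- Degrees in `ℕ₀²`; `(a₁, a₂)` is `a₁ α₁ + a₂ α₂`. -/
abbrev Deg : Type := ℕ × ℕ

/-- The degrees `α₁`, `α₂` of the two letters `x₁`, `x₂` (indexed by `0`, `1`). -/
def letterDeg (i : Fin 2) : Deg := if i = 0 then (1, 0) else (0, 1)

/-- The braiding matrix `(q_{ij})`. -/
def braidingMatrix (q : ℂ) : Matrix (Fin 2) (Fin 2) ℂ := !![q, q⁻¹; q⁻¹, -q]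

/-- The bicharacter with `χ(αᵢ, αⱼ) = q_{ij}`. -/
def chi (q : ℂ) (α β : Deg) : ℂ :=
  braidingMatrix q 0 0 ^ (α.1 * β.1) * braidingMatrix q 0 1 ^ (α.1 * β.2) *
    braidingMatrix q 1 0 ^ (α.2 * β.1) * braidingMatrix q 1 1 ^ (α.2 * β.2)

/-- The tensor algebra `T(V)`: the free algebra on `x₁`, `x₂`. -/
abbrev TV : Type := FreeAlgebra ℂ (Fin 2)

/-- The `ℕ₀²`-grading of `T(V)`: the coefficient of `gradT x` at `α` is the homogeneous component
of `x` of degree `α`. -/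
def gradT : TV →ₐ[ℂ] AddMonoidAlgebra TV Deg :=
  FreeAlgebra.lift ℂ fun i => AddMonoidAlgebra.single (letterDeg i) (FreeAlgebra.ι ℂ i)

/-- The automorphism of `T(V)` that multiplies `y` of degree `β` by `χ(α, β)`. -/
def twistT (q : ℂ) (α : Deg) : TV →ₐ[ℂ] TV :=
  FreeAlgebra.lift ℂ fun i => chi q α (letterDeg i) • FreeAlgebra.ι ℂ i

/-- Left multiplication by `Δ(x)` on the braided tensor square, whose product is
`(a ⊗ b)(c ⊗ d) = χ(deg b, deg c) ac ⊗ bd`; on letters `Δ(xᵢ) = xᵢ ⊗ 1 + 1 ⊗ xᵢ`. -/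
def coprodOpT (q : ℂ) : TV →ₐ[ℂ] Module.End ℂ (TV ⊗[ℂ] TV) :=
  FreeAlgebra.lift ℂ fun i =>
    TensorProduct.map (LinearMap.mulLeft ℂ (FreeAlgebra.ι ℂ i)) LinearMap.id +
      TensorProduct.map (twistT q (letterDeg i)).toLinearMap
        (LinearMap.mulLeft ℂ (FreeAlgebra.ι ℂ i))

/-- The braided coproduct `Δ` of `T(V)`. -/
def coprodT (q : ℂ) (x : TV) : TV ⊗[ℂ] TV := coprodOpT q x (1 ⊗ₜ 1)

/-! ### The Nichols algebra -/

/-- Two-sided homogeneous ideals of `T(V)` that lie in degrees at least two and are coideals: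
`Δ(I) ⊆ I ⊗ T(V) + T(V) ⊗ I`. -/
structure IsGradedCoideal (q : ℂ) (I : Ideal TV) : Prop where
  twoSided : I.IsTwoSided
  homogeneous : ∀ x ∈ I, ∀ α, (gradT x).coeff α ∈ I
  two_le : ∀ x ∈ I, ∀ α : Deg, α.1 + α.2 < 2 → (gradT x).coeff α = 0
  coideal : ∀ x ∈ I, coprodT q x ∈
    LinearMap.range (TensorProduct.map (I.restrictScalars ℂ).subtype
        (LinearMap.id : TV →ₗ[ℂ] TV)) ⊔
      LinearMap.range (TensorProduct.map (LinearMap.id : TV →ₗ[ℂ] TV)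
        (I.restrictScalars ℂ).subtype)

/-- The defining ideal of the Nichols algebra: the sum of all such ideals. -/
def nicholsIdeal (q : ℂ) : Ideal TV := sSup {I | IsGradedCoideal q I}

theorem nicholsIdeal_induction {q : ℂ} {P : TV → Prop}
    (mem : ∀ I, IsGradedCoideal q I → ∀ x ∈ I, P x) (zero : P 0)
    (add : ∀ x y, P x → P y → P (x + y)) : ∀ x ∈ nicholsIdeal q, P x := by
  intro x hx
  rw [nicholsIdeal, sSup_eq_iSup'] at hx
  exact Submodule.iSup_induction _ (motive := P) hx (fun I y hy => mem I.1 I.2 y hy) zero add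

theorem le_nicholsIdeal {q : ℂ} {I : Ideal TV} (hI : IsGradedCoideal q I) : I ≤ nicholsIdeal q :=
  le_sSup hI

instance nicholsIdeal_isTwoSided (q : ℂ) : (nicholsIdeal q).IsTwoSided where
  mul_mem_of_left {a} b ha := by
    refine nicholsIdeal_induction (P := fun a => a * b ∈ nicholsIdeal q) ?_ ?_ ?_ a ha
    · intro I hI x hx
      have := hI.twoSided
      exact le_nicholsIdeal hI (I.mul_mem_right b hx)
    · simp
    · intro x y hx hy
      rw [add_mul]
      exact add_mem hx hy

theorem coeff_gradT_mem {q : ℂ} {x : TV} (hx : x ∈ nicholsIdeal q) (α : Deg) :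
    (gradT x).coeff α ∈ nicholsIdeal q := by
  refine nicholsIdeal_induction (P := fun x => (gradT x).coeff α ∈ nicholsIdeal q)
    ?_ ?_ ?_ x hx
  · intro I hI x hx
    exact le_nicholsIdeal hI (hI.homogeneous x hx α)
  · simp
  · intro x y hx hy
    simpa using add_mem hx hy

/-- The Nichols algebra `B(V) = T(V)/J`. -/
abbrev NA (q : ℂ) : Type := TV ⧸ nicholsIdeal q

/-- The projection `T(V) → B(V)`. -/
abbrev proj (q : ℂ) : TV →ₐ[ℂ] NA q := Ideal.Quotient.mkₐ ℂ (nicholsIdeal q)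

/-- The generators `x₁`, `x₂` of `B(V)`. -/
def gen (q : ℂ) (i : Fin 2) : NA q := proj q (FreeAlgebra.ι ℂ i)

/-- The `ℕ₀²`-grading of `B(V)`: the coefficient of `grad q x` at `α` is the homogeneous component
of `x` of degree `α`. -/
def grad (q : ℂ) : NA q →ₐ[ℂ] AddMonoidAlgebra (NA q) Deg :=
  Ideal.Quotient.liftₐ (nicholsIdeal q) ((AddMonoidAlgebra.mapAlgHom Deg (proj q)).comp gradT)
    (by
      intro x hx
      ext α
      simp only [AlgHom.comp_apply, AddMonoidAlgebra.coeff_mapAlgHom, AddMonoidAlgebra.coeff_zero,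
        Finsupp.coe_zero, Pi.zero_apply]
      exact Ideal.Quotient.eq_zero_iff_mem.2 (coeff_gradT_mem hx α))

theorem grad_proj (q : ℂ) (x : TV) :
    grad q (proj q x) = AddMonoidAlgebra.mapAlgHom Deg (proj q) (gradT x) := rfl

theorem grad_gen (q : ℂ) (i : Fin 2) :
    grad q (gen q i) = AddMonoidAlgebra.single (letterDeg i) (gen q i) := by
  rw [gen, grad_proj, gradT, FreeAlgebra.lift_ι_apply, AddMonoidAlgebra.mapAlgHom_single]

/-- The homogeneous component of degree `α` of `B(V)`. -/
def homComp (q : ℂ) (α : Deg) : Submodule ℂ (NA q) where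
  carrier := {x | grad q x = AddMonoidAlgebra.single α x}
  zero_mem' := by simp
  add_mem' {x y} hx hy := by
    simp only [Set.mem_ofPred_eq] at *
    rw [map_add, hx, hy, AddMonoidAlgebra.single_add]
  smul_mem' c x hx := by
    simp only [Set.mem_ofPred_eq] at *
    rw [map_smul, hx, AddMonoidAlgebra.smul_single]

theorem mem_homComp {q : ℂ} {α : Deg} {x : NA q} :
    x ∈ homComp q α ↔ grad q x = AddMonoidAlgebra.single α x := Iff.rfl

/-- The braided bracket `[x, y] = m ∘ (id - c)(x ⊗ y)`, where `c(a ⊗ b) = χ(α, β) b ⊗ a` for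
homogeneous `a`, `b` of degrees `α`, `β`. -/
def bracket (q : ℂ) (x y : NA q) : NA q :=
  x * y - (grad q x).coeff.sum fun α a => (grad q y).coeff.sum fun β b => chi q α β • (b * a)

theorem bracket_of_mem {q : ℂ} {α β : Deg} {x y : NA q} (hx : x ∈ homComp q α)
    (hy : y ∈ homComp q β) : bracket q x y = x * y - chi q α β • (y * x) := by
  rw [mem_homComp] at hx hy
  rw [bracket, hx, hy]
  simp

/-! ### Root vectors -/

/-- Words in the letters `x₁ < x₂` (indexed by `0 < 1`), with the lexicographic order. -/
abbrev Word : Type := List (Fin 2)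

/-- The degree of a word. -/
def wordDeg (w : Word) : Deg := (w.count 0, w.count 1)

/-- A Lyndon word is a nonempty word that is smaller than each of its proper nonempty suffixes. -/
def IsLyndon (w : Word) : Prop :=
  w ≠ [] ∧ ∀ u v : Word, u ≠ [] → v ≠ [] → w = u ++ v → w < v

/-- The length of the first factor of the Shirshov decomposition: the smallest `i` for which `w`
is the product of two Lyndon words, the first of length `i` (and `0` if there is none). -/
def shirshovLength (w : Word) : ℕ :=
  sInf {i | 0 < i ∧ i < w.length ∧ IsLyndon (w.take i) ∧ IsLyndon (w.drop i)}

open Classical in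
/-- The image in `B(V)` of the super-letter `[w]` of a Lyndon word `w`: a letter is its own
super-letter, and `[w] = [[u], [v]]` if `w = uv` is the Shirshov decomposition. (If `w` is not a
Lyndon word, the value is not used.) -/
def superLetter (q : ℂ) (w : Word) : NA q :=
  if _h : 0 < shirshovLength w ∧ shirshovLength w < w.length then
    bracket q (superLetter q (w.take (shirshovLength w)))
      (superLetter q (w.drop (shirshovLength w)))
  else (w.map (gen q)).prod
termination_by w.length
decreasing_by
  · simp only [List.length_take]; omega
  · simp only [List.length_drop]; omega

/-- The `k`-th power of a word. -/
def wordPow (v : Word) (k : ℕ) : Word := (List.replicate k v).flatten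

/-- `[v^k] = [v]^k` is a root vector candidate: `v` is a Lyndon word, and `k` is `1` or the order
of `χ(deg v, deg v)`, if that is finite (`orderOf` is `0` if it is infinite). -/
def IsCandidate (q : ℂ) (v : Word) (k : ℕ) : Prop :=
  IsLyndon v ∧ (k = 1 ∨ (k = orderOf (chi q (wordDeg v) (wordDeg v)) ∧ 0 < k))

/-- The element `[v^k] = [v]^k` of `B(V)`. -/
def candidateVector (q : ℂ) (v : Word) (k : ℕ) : NA q := superLetter q v ^ k

/-- The products `[w₁]^{m₁} ⋯ [wᵣ]^{mᵣ}` of root vector candidates with `w₁ > ⋯ > wᵣ > w` and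
positive exponents. An entry `((v, k), m)` of the list stands for `[v^k]^m`. -/
def largerProducts (q : ℂ) (w : Word) : Set (NA q) :=
  {z | ∃ l : List ((Word × ℕ) × ℕ),
    (∀ t ∈ l, IsCandidate q t.1.1 t.1.2 ∧ 0 < t.2 ∧ w < wordPow t.1.1 t.1.2) ∧
    l.Pairwise (fun s t => wordPow t.1.1 t.1.2 < wordPow s.1.1 s.1.2) ∧
    z = (l.map fun t => candidateVector q t.1.1 t.1.2 ^ t.2).prod}

/-- The candidate `[v^k]` is a root vector of `B(V)`: it is not a linear combination of products
of larger candidates. -/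
def IsRootVector (q : ℂ) (v : Word) (k : ℕ) : Prop :=
  IsCandidate q v k ∧
    candidateVector q v k ∉ Submodule.span ℂ (largerProducts q (wordPow v k))

/-! ### The elements `X_n`, `Y_n`, `L_n`, `M_{2n+1}` -/

/-- `θ = q - q⁻¹`. -/
def theta (q : ℂ) : ℂ := q - q⁻¹

/-- `[n]_q`. -/
def qInt (q : ℂ) (n : ℕ) : ℂ := (q ^ n - q⁻¹ ^ n) / (q - q⁻¹)

/-- `X_n`, the super-letter of `x₁(x₁x₂)^{n-1}`, for `n ≥ 1`. -/
def X (q : ℂ) (n : ℕ) : NA q := superLetter q (0 :: wordPow [0, 1] (n - 1))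

/-- `Y_n`, the super-letter of `(x₁x₂)^{n-1}x₂`, for `n ≥ 1`. -/
def Y (q : ℂ) (n : ℕ) : NA q := superLetter q (wordPow [0, 1] (n - 1) ++ [1])

/-- `L_n = [X_1, Y_n]` for `n ≥ 1`, and `L_0 = 1/θ`. -/
def L (q : ℂ) (n : ℕ) : NA q :=
  if n = 0 then algebraMap ℂ (NA q) (theta q)⁻¹ else bracket q (X q 1) (Y q n)

/-- `L'_n = [X_2, Y_{n-1}]` for `n ≥ 2`, `L'_1 = L_1` and `L'_0 = L_0`. -/
def L' (q : ℂ) (n : ℕ) : NA q :=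
  if n ≤ 1 then L q n else bracket q (X q 2) (Y q (n - 1))

/-- `L̃_n = (L_n + L'_n)/2`. -/
def Ltilde (q : ℂ) (n : ℕ) : NA q := (1 / 2 : ℂ) • (L q n + L' q n)

/-- `M_i` for odd `i`: `M_1 = L_1` and `M_{2n+3} = [L_2, M_{2n+1}]`. -/
def M (q : ℂ) (i : ℕ) : NA q := (bracket q (L q 2))^[i / 2] (L q 1)

/-- The exponential of a power series `f` without constant term over a `ℂ`-algebra; the terms
`f^k/k!` with `k > n` do not contribute to the coefficient of degree `n`. -/
def expSeries {A : Type*} [Ring A] [Algebra ℂ A] (f : PowerSeries A) : PowerSeries A :=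
  PowerSeries.mk fun n =>
    ∑ k ∈ Finset.range (n + 1), ((k.factorial : ℂ)⁻¹) • PowerSeries.coeff n (f ^ k)

/-- `b n = L̄_{2n}` for `n ≥ 1`: the sequence with
`θ ∑_{n ≥ 0} L̃_{2n} u^{2n} = exp(θ ∑_{n ≥ 1} L̄_{2n} u^{2n})`, as power series in `u²`. -/
def IsLbar (q : ℂ) (b : ℕ → NA q) : Prop :=
  b 0 = 0 ∧
    PowerSeries.mk (fun n => theta q • Ltilde q (2 * n)) =
      expSeries (PowerSeries.mk fun n => theta q • b n)

/-! ### The coproduct of the Nichols algebra -/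

theorem chi_zero_right (q : ℂ) (α : Deg) : chi q α 0 = 1 := by simp [chi]

theorem chi_add_right (q : ℂ) (α β γ : Deg) : chi q α (β + γ) = chi q α β * chi q α γ := by
  simp only [chi, Prod.fst_add, Prod.snd_add, mul_add, pow_add]
  ring

theorem chi_symm (q : ℂ) (α β : Deg) : chi q α β = chi q β α := by
  simp only [chi, braidingMatrix, Matrix.of_apply, Matrix.cons_val', Matrix.cons_val_zero,
    Matrix.cons_val_one, Matrix.cons_val_fin_one]
  rw [mul_comm α.1 β.1, mul_comm α.1 β.2, mul_comm α.2 β.1, mul_comm α.2 β.2]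
  ring

theorem rescale_commute (q : ℂ) (g : Multiplicative Deg →* ℂ) (x : NA q)
    (y : Multiplicative Deg) : Commute (AlgHom.id ℂ (NA q) x)
      (((algebraMap ℂ (NA q) : ℂ →* NA q).comp g) y) :=
  (Algebra.commutes (g y) x).symm

/-- The algebra endomorphism of `B(V)` that multiplies the component of degree `β` by the
scalar `g β`. -/
def rescale (q : ℂ) (g : Multiplicative Deg →* ℂ) : NA q →ₐ[ℂ] NA q :=
  (AddMonoidAlgebra.liftNCAlgHom (AlgHom.id ℂ (NA q))
    ((algebraMap ℂ (NA q) : ℂ →* NA q).comp g)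
    (rescale_commute q g)).comp (grad q)

theorem rescale_of_mem {q : ℂ} (g : Multiplicative Deg →* ℂ) {β : Deg} {x : NA q}
    (hx : x ∈ homComp q β) : rescale q g x = g (Multiplicative.ofAdd β) • x := by
  rw [mem_homComp] at hx
  rw [rescale, AlgHom.comp_apply, hx, AddMonoidAlgebra.coe_liftNCAlgHom]
  simp [AddMonoidAlgebra.liftNC_single, Algebra.smul_def, Algebra.commutes]

/-- `χ(α, ·)` as a character. -/
def chiHom (q : ℂ) (α : Deg) : Multiplicative Deg →* ℂ where
  toFun β := chi q α β.toAdd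
  map_one' := chi_zero_right q α
  map_mul' β γ := chi_add_right q α β.toAdd γ.toAdd

/-- The automorphism of `B(V)` that multiplies `y` of degree `β` by `χ(α, β)`. -/
def twist (q : ℂ) (α : Deg) : NA q →ₐ[ℂ] NA q := rescale q (chiHom q α)

theorem gen_mem (q : ℂ) (i : Fin 2) : gen q i ∈ homComp q (letterDeg i) := grad_gen q i

theorem twist_of_mem {q : ℂ} (α : Deg) {β : Deg} {x : NA q} (hx : x ∈ homComp q β) :
    twist q α x = chi q α β • x := rescale_of_mem _ hx

theorem twist_proj (q : ℂ) (α : Deg) (x : TV) : twist q α (proj q x) = proj q (twistT q α x) := by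
  have : (twist q α).comp (proj q) = (proj q).comp (twistT q α) := by
    apply FreeAlgebra.hom_ext
    funext i
    simp only [Function.comp_apply, AlgHom.comp_apply, twistT, FreeAlgebra.lift_ι_apply, map_smul]
    exact twist_of_mem α (gen_mem q i)
  exact DFunLike.congr_fun this x

/-- Left multiplication by `Δ(x)` on the braided tensor square of `B(V)`, for `x` in `T(V)`. -/
def coprodOpAux (q : ℂ) : TV →ₐ[ℂ] Module.End ℂ (NA q ⊗[ℂ] NA q) :=
  FreeAlgebra.lift ℂ fun i =>
    TensorProduct.map (LinearMap.mulLeft ℂ (gen q i)) LinearMap.id +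
      TensorProduct.map (twist q (letterDeg i)).toLinearMap (LinearMap.mulLeft ℂ (gen q i))

theorem coprodOpAux_proj (q : ℂ) (x : TV) (z : TV ⊗[ℂ] TV) :
    coprodOpAux q x (TensorProduct.map (proj q).toLinearMap (proj q).toLinearMap z) =
      TensorProduct.map (proj q).toLinearMap (proj q).toLinearMap (coprodOpT q x z) := by
  induction x using FreeAlgebra.induction generalizing z with
  | grade0 r => simp [Module.algebraMap_end_apply]
  | grade1 i =>
    simp only [coprodOpAux, coprodOpT, FreeAlgebra.lift_ι_apply]
    induction z using TensorProduct.induction_on with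
    | zero => simp
    | tmul a b =>
      simp only [TensorProduct.map_tmul, LinearMap.add_apply, LinearMap.mulLeft_apply, map_add,
        LinearMap.id_apply, AlgHom.toLinearMap_apply, twist_proj, map_mul]
      rfl
    | add a b ha hb => simp only [map_add, ha, hb]
  | mul a b ha hb => simp only [map_mul, Module.End.mul_apply, ha, hb]
  | add a b ha hb => simp only [map_add, LinearMap.add_apply, ha, hb]

/-- Right multiplication by `a ⊗ b` on the braided tensor square, for `a` of degree `β`. -/
def rightMul (q : ℂ) (β : Deg) (a b : NA q) : Module.End ℂ (NA q ⊗[ℂ] NA q) :=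
  TensorProduct.map (LinearMap.mulRight ℂ a)
    ((LinearMap.mulRight ℂ b).comp (twist q β).toLinearMap)

theorem coprodOpAux_rightMul {q : ℂ} {β : Deg} {a : NA q} (ha : a ∈ homComp q β) (b : NA q)
    (x : TV) (z : NA q ⊗[ℂ] NA q) :
    coprodOpAux q x (rightMul q β a b z) = rightMul q β a b (coprodOpAux q x z) := by
  induction x using FreeAlgebra.induction generalizing z with
  | grade0 r => simp [Module.algebraMap_end_apply]
  | grade1 i =>
    simp only [coprodOpAux, FreeAlgebra.lift_ι_apply, rightMul]
    induction z using TensorProduct.induction_on with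
    | zero => simp
    | tmul c d =>
      simp only [TensorProduct.map_tmul, LinearMap.add_apply, LinearMap.mulLeft_apply, map_add,
        LinearMap.id_apply, AlgHom.toLinearMap_apply, map_mul, LinearMap.mulRight_apply,
        LinearMap.comp_apply, twist_of_mem _ ha, twist_of_mem _ (gen_mem q i), mul_assoc,
        smul_mul_assoc, mul_smul_comm, TensorProduct.smul_tmul, chi_symm q β]
    | add c d hc hd => simp only [map_add, hc, hd]
  | mul c d hc hd => simp only [map_mul, Module.End.mul_apply, hc, hd]
  | add c d hc hd => simp only [map_add, LinearMap.add_apply, hc, hd]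

theorem one_mem_homComp (q : ℂ) : (1 : NA q) ∈ homComp q 0 := by
  rw [mem_homComp, map_one]; rfl

theorem mul_mem_homComp {q : ℂ} {α β : Deg} {x y : NA q} (hx : x ∈ homComp q α)
    (hy : y ∈ homComp q β) : x * y ∈ homComp q (α + β) := by
  rw [mem_homComp] at *
  rw [map_mul, hx, hy, AddMonoidAlgebra.single_mul_single]

theorem mem_iSup_homComp (q : ℂ) (x : NA q) : x ∈ ⨆ α, homComp q α := by
  obtain ⟨t, rfl⟩ := Ideal.Quotient.mkₐ_surjective ℂ (nicholsIdeal q) x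
  induction t using FreeAlgebra.induction with
  | grade0 r =>
    rw [AlgHom.commutes, Algebra.algebraMap_eq_smul_one]
    exact Submodule.smul_mem _ _ (Submodule.mem_iSup_of_mem 0 (one_mem_homComp q))
  | grade1 i => exact Submodule.mem_iSup_of_mem _ (gen_mem q i)
  | mul a b ha hb =>
    rw [map_mul]
    refine Submodule.iSup_induction _ (motive := fun x => x * _ ∈ ⨆ α, homComp q α) ha ?_ ?_ ?_
    · intro α x hx
      refine Submodule.iSup_induction _ (motive := fun y => x * y ∈ ⨆ α, homComp q α) hb ?_ ?_ ?_
      · intro β y hy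
        exact Submodule.mem_iSup_of_mem _ (mul_mem_homComp hx hy)
      · simp
      · intro y z hy hz
        rw [mul_add]
        exact add_mem hy hz
    · simp
    · intro y z hy hz
      rw [add_mul]
      exact add_mem hy hz
  | add a b ha hb =>
    rw [map_add]
    exact add_mem ha hb

theorem proj_coprodT {q : ℂ} {x : TV} (hx : x ∈ nicholsIdeal q) :
    TensorProduct.map (proj q).toLinearMap (proj q).toLinearMap (coprodT q x) = 0 := by
  refine nicholsIdeal_induction (P := fun x =>
    TensorProduct.map (proj q).toLinearMap (proj q).toLinearMap (coprodT q x) = 0) ?_ ?_ ?_ x hx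
  · intro I hI x hx
    have key : ∀ y ∈ I, (proj q).toLinearMap y = 0 := fun y hy =>
      Ideal.Quotient.eq_zero_iff_mem.2 (le_nicholsIdeal hI hy)
    have h := hI.coideal x hx
    rw [← LinearMap.mem_ker]
    refine (sup_le ?_ ?_ : _ ≤ LinearMap.ker _) h
    · rintro _ ⟨z, rfl⟩
      rw [LinearMap.mem_ker]
      induction z using TensorProduct.induction_on with
      | zero => simp
      | tmul a b =>
        rw [TensorProduct.map_tmul, TensorProduct.map_tmul, Submodule.subtype_apply,
          key _ a.2, TensorProduct.zero_tmul]
      | add a b ha hb => simp only [map_add, ha, hb, add_zero]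
    · rintro _ ⟨z, rfl⟩
      rw [LinearMap.mem_ker]
      induction z using TensorProduct.induction_on with
      | zero => simp
      | tmul a b =>
        rw [TensorProduct.map_tmul, TensorProduct.map_tmul, Submodule.subtype_apply,
          key _ b.2, TensorProduct.tmul_zero]
      | add a b ha hb => simp only [map_add, ha, hb, add_zero]
  · simp [coprodT]
  · intro x y hx hy
    simp only [coprodT, map_add, LinearMap.add_apply] at *
    rw [hx, hy, add_zero]

theorem coprodOpAux_eq_zero {q : ℂ} {x : TV} (hx : x ∈ nicholsIdeal q) :
    coprodOpAux q x = 0 := by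
  have h1 : coprodOpAux q x (1 ⊗ₜ 1) = 0 := by
    have := coprodOpAux_proj q x (1 ⊗ₜ 1)
    rw [← coprodT, proj_coprodT hx] at this
    simpa using this
  have h2 : ∀ a b : NA q, coprodOpAux q x (a ⊗ₜ b) = 0 := by
    intro a b
    refine Submodule.iSup_induction _ (motive := fun a => coprodOpAux q x (a ⊗ₜ b) = 0)
      (mem_iSup_homComp q a) ?_ ?_ ?_
    · intro β a ha
      have := coprodOpAux_rightMul ha b x (1 ⊗ₜ 1)
      rw [h1, map_zero] at this
      simpa [rightMul] using this
    · simp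
    · intro c d hc hd
      rw [TensorProduct.add_tmul, map_add, hc, hd, add_zero]
  apply TensorProduct.ext'
  intro a b
  rw [h2, LinearMap.zero_apply]

/-- Left multiplication by `Δ(x)` on the braided tensor square of `B(V)`. -/
def coprodOp (q : ℂ) : NA q →ₐ[ℂ] Module.End ℂ (NA q ⊗[ℂ] NA q) :=
  Ideal.Quotient.liftₐ (nicholsIdeal q) (coprodOpAux q) (fun _ hx => coprodOpAux_eq_zero hx)

theorem coprodOp_proj (q : ℂ) (x : TV) : coprodOp q (proj q x) = coprodOpAux q x := rfl

/-- The braided coproduct `Δ` of `B(V)`. -/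
def coprod (q : ℂ) (x : NA q) : NA q ⊗[ℂ] NA q := coprodOp q x (1 ⊗ₜ 1)

/-- `Δ` on `B(V)` is induced by `Δ` on `T(V)`. -/
theorem coprod_proj (q : ℂ) (x : TV) : coprod q (proj q x) =
    TensorProduct.map (proj q).toLinearMap (proj q).toLinearMap (coprodT q x) := by
  rw [coprodT, ← coprodOpAux_proj, coprod, coprodOp_proj]
  simp

/-! ### The subquotient -/

/-- `B_{≥ 1}`. -/
def Bge (q : ℂ) : Submodule ℂ (NA q) := ⨆ α : Deg, ⨆ _ : α.2 ≤ α.1, homComp q α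

/-- `B_{> 1}`. -/
def Bgt (q : ℂ) : Submodule ℂ (NA q) := ⨆ α : Deg, ⨆ _ : α.2 < α.1, homComp q α

/-- `B_{≥ 1} ⊗ B(V)` inside `B(V) ⊗ B(V)`. -/
def BgeTensor (q : ℂ) : Submodule ℂ (NA q ⊗[ℂ] NA q) :=
  LinearMap.range (TensorProduct.map (Bge q).subtype (LinearMap.id : NA q →ₗ[ℂ] NA q))

theorem Bge_induction {q : ℂ} {P : NA q → Prop}
    (mem : ∀ α : Deg, α.2 ≤ α.1 → ∀ x ∈ homComp q α, P x) (zero : P 0)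
    (add : ∀ x y, P x → P y → P (x + y)) : ∀ x ∈ Bge q, P x := by
  intro x hx
  refine Submodule.iSup_induction _ (motive := P) hx ?_ zero add
  intro α y hy
  refine Submodule.iSup_induction _ (motive := P) hy ?_ zero add
  exact fun h z hz => mem α h z hz

theorem Bgt_induction {q : ℂ} {P : NA q → Prop}
    (mem : ∀ α : Deg, α.2 < α.1 → ∀ x ∈ homComp q α, P x) (zero : P 0)
    (add : ∀ x y, P x → P y → P (x + y)) : ∀ x ∈ Bgt q, P x := by
  intro x hx
  refine Submodule.iSup_induction _ (motive := P) hx ?_ zero add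
  intro α y hy
  refine Submodule.iSup_induction _ (motive := P) hy ?_ zero add
  exact fun h z hz => mem α h z hz

theorem mem_Bge {q : ℂ} {α : Deg} (h : α.2 ≤ α.1) {x : NA q} (hx : x ∈ homComp q α) :
    x ∈ Bge q := Submodule.mem_iSup_of_mem α (Submodule.mem_iSup_of_mem h hx)

theorem mem_Bgt {q : ℂ} {α : Deg} (h : α.2 < α.1) {x : NA q} (hx : x ∈ homComp q α) :
    x ∈ Bgt q := Submodule.mem_iSup_of_mem α (Submodule.mem_iSup_of_mem h hx)

theorem mul_mem_Bge {q : ℂ} {x y : NA q} (hx : x ∈ Bge q) (hy : y ∈ Bge q) : x * y ∈ Bge q := by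
  refine Bge_induction (P := fun x => x * y ∈ Bge q) ?_ ?_ ?_ x hx
  · intro α hα x hx
    refine Bge_induction (P := fun y => x * y ∈ Bge q) ?_ ?_ ?_ y hy
    · intro β hβ y hy
      exact mem_Bge (by simpa using add_le_add hα hβ) (mul_mem_homComp hx hy)
    · simp
    · intro y z hy hz
      rw [mul_add]
      exact add_mem hy hz
  · simp
  · intro y z hy hz
    rw [add_mul]
    exact add_mem hy hz

theorem Bgt_mul_mem {q : ℂ} {x y : NA q} (hx : x ∈ Bgt q) (hy : y ∈ Bge q) : x * y ∈ Bgt q := by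
  refine Bgt_induction (P := fun x => x * y ∈ Bgt q) ?_ ?_ ?_ x hx
  · intro α hα x hx
    refine Bge_induction (P := fun y => x * y ∈ Bgt q) ?_ ?_ ?_ y hy
    · intro β hβ y hy
      exact mem_Bgt (by simpa using add_lt_add_of_lt_of_le hα hβ) (mul_mem_homComp hx hy)
    · simp
    · intro y z hy hz
      rw [mul_add]
      exact add_mem hy hz
  · simp
  · intro y z hy hz
    rw [add_mul]
    exact add_mem hy hz

theorem mul_mem_Bgt {q : ℂ} {x y : NA q} (hx : x ∈ Bge q) (hy : y ∈ Bgt q) : x * y ∈ Bgt q := by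
  refine Bge_induction (P := fun x => x * y ∈ Bgt q) ?_ ?_ ?_ x hx
  · intro α hα x hx
    refine Bgt_induction (P := fun y => x * y ∈ Bgt q) ?_ ?_ ?_ y hy
    · intro β hβ y hy
      exact mem_Bgt (by simpa using add_lt_add_of_le_of_lt hα hβ) (mul_mem_homComp hx hy)
    · simp
    · intro y z hy hz
      rw [mul_add]
      exact add_mem hy hz
  · simp
  · intro y z hy hz
    rw [add_mul]
    exact add_mem hy hz

theorem tmul_mem_BgeTensor {q : ℂ} {a : NA q} (ha : a ∈ Bge q) (b : NA q) :
    a ⊗ₜ[ℂ] b ∈ BgeTensor q := ⟨(⟨a, ha⟩ : Bge q) ⊗ₜ b, by simp⟩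

theorem BgeTensor_induction {q : ℂ} {P : NA q ⊗[ℂ] NA q → Prop}
    (tmul : ∀ a ∈ Bge q, ∀ b, P (a ⊗ₜ b)) (add : ∀ x y, P x → P y → P (x + y)) :
    ∀ z ∈ BgeTensor q, P z := by
  rintro _ ⟨z, rfl⟩
  induction z using TensorProduct.induction_on with
  | zero => simpa using tmul 0 (zero_mem _) 0
  | tmul a b => exact tmul a.1 a.2 b
  | add a b ha hb => rw [map_add]; exact add _ _ ha hb

theorem coprod_mul_mem {q : ℂ} {x y : NA q} (hx : coprod q x ∈ BgeTensor q)
    (hy : coprod q y ∈ BgeTensor q) : coprod q (x * y) ∈ BgeTensor q := by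
  rw [coprod, map_mul, Module.End.mul_apply, ← coprod]
  refine BgeTensor_induction (P := fun z => coprodOp q x z ∈ BgeTensor q) ?_ ?_ _ hy
  · intro a ha b
    refine Bge_induction (P := fun a => coprodOp q x (a ⊗ₜ b) ∈ BgeTensor q) ?_ ?_ ?_ a ha
    · intro β hβ a ha
      obtain ⟨t, rfl⟩ := Ideal.Quotient.mkₐ_surjective ℂ (nicholsIdeal q) x
      have h := coprodOpAux_rightMul ha b t (1 ⊗ₜ 1)
      have h' : rightMul q β a b (1 ⊗ₜ 1) = a ⊗ₜ b := by simp [rightMul]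
      rw [h', ← coprodOp_proj] at h
      rw [h, ← coprod]
      refine BgeTensor_induction (P := fun z => rightMul q β a b z ∈ BgeTensor q) ?_ ?_ _ hx
      · intro c hc d
        rw [rightMul, TensorProduct.map_tmul]
        exact tmul_mem_BgeTensor (mul_mem_Bge hc (mem_Bge hβ ha)) _
      · intro c d hc hd
        rw [map_add]
        exact add_mem hc hd
    · simp
    · intro c d hc hd
      rw [TensorProduct.add_tmul, map_add]
      exact add_mem hc hd
  · intro c d hc hd
    rw [map_add]
    exact add_mem hc hd

/-- The subalgebra `K_{≥ 1} = {x | Δ(x) ∈ B_{≥ 1} ⊗ B(V)}` of `B(V)`. -/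
def Kge (q : ℂ) : Subalgebra ℂ (NA q) where
  carrier := {x | coprod q x ∈ BgeTensor q}
  mul_mem' hx hy := coprod_mul_mem hx hy
  add_mem' {x y} hx hy := by
    simp only [Set.mem_ofPred_eq, coprod, map_add, LinearMap.add_apply] at *
    exact add_mem hx hy
  algebraMap_mem' r := by
    simp only [Set.mem_ofPred_eq, coprod, AlgHom.commutes, Module.algebraMap_end_apply]
    exact Submodule.smul_mem _ _ (tmul_mem_BgeTensor (mem_Bge le_rfl (one_mem_homComp q)) 1)

/-- The character of `ℕ₀²` that is `1` in degree `0` and `0` elsewhere. -/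
def zeroHom : Multiplicative Deg →* ℂ where
  toFun β := if β.toAdd = 0 then 1 else 0
  map_one' := by simp
  map_mul' β γ := by
    by_cases h : β.toAdd = 0 <;> by_cases h' : γ.toAdd = 0 <;>
      simp [toAdd_mul, h, h']

/-- The counit of `B(V)`, followed by the unit. -/
def counit (q : ℂ) : NA q →ₐ[ℂ] NA q := rescale q zeroHom

theorem counit_gen (q : ℂ) (i : Fin 2) : counit q (gen q i) = 0 := by
  rw [counit, rescale_of_mem _ (gen_mem q i)]
  fin_cases i <;> simp [zeroHom, letterDeg]

theorem counit_scalar (q : ℂ) (x : NA q) : ∃ r : ℂ, counit q x = algebraMap ℂ (NA q) r := by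
  obtain ⟨t, rfl⟩ := Ideal.Quotient.mkₐ_surjective ℂ (nicholsIdeal q) x
  refine ⟨FreeAlgebra.algebraMapInv t, ?_⟩
  have : (counit q).comp (proj q) = (Algebra.ofId ℂ (NA q)).comp FreeAlgebra.algebraMapInv := by
    apply FreeAlgebra.hom_ext
    funext i
    simp only [Function.comp_apply, AlgHom.comp_apply, FreeAlgebra.algebraMapInv,
      FreeAlgebra.lift_ι_apply, Pi.zero_apply, map_zero]
    exact counit_gen q i
  exact DFunLike.congr_fun this t

/-- `c ⊗ d ↦ c ε(d)`. -/
def counitRight (q : ℂ) : NA q ⊗[ℂ] NA q →ₗ[ℂ] NA q :=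
  (LinearMap.mul' ℂ (NA q)).comp (TensorProduct.map LinearMap.id (counit q).toLinearMap)

theorem counitRight_tmul (q : ℂ) (c d : NA q) :
    counitRight q (c ⊗ₜ d) = c * counit q d := by simp [counitRight]

theorem counitRight_coprodOpAux (q : ℂ) (x : TV) (z : NA q ⊗[ℂ] NA q) :
    counitRight q (coprodOpAux q x z) = proj q x * counitRight q z := by
  induction x using FreeAlgebra.induction generalizing z with
  | grade0 r =>
    rw [AlgHom.commutes, AlgHom.commutes, Module.algebraMap_end_apply, map_smul,
      Algebra.smul_def]
  | grade1 i =>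
    simp only [coprodOpAux, FreeAlgebra.lift_ι_apply]
    induction z using TensorProduct.induction_on with
    | zero => simp
    | tmul c d =>
      simp only [TensorProduct.map_tmul, LinearMap.add_apply, LinearMap.mulLeft_apply, map_add,
        LinearMap.id_apply, AlgHom.toLinearMap_apply, map_mul, counitRight_tmul, counit_gen,
        zero_mul, mul_zero, add_zero, mul_assoc]
      rfl
    | add c d hc hd => simp only [map_add, hc, hd, mul_add]
  | mul c d hc hd => simp only [map_mul, Module.End.mul_apply, hc, hd, mul_assoc]
  | add c d hc hd => simp only [map_add, LinearMap.add_apply, hc, hd, add_mul]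

theorem counitRight_coprod (q : ℂ) (x : NA q) : counitRight q (coprod q x) = x := by
  obtain ⟨t, rfl⟩ := Ideal.Quotient.mkₐ_surjective ℂ (nicholsIdeal q) x
  have := counitRight_coprodOpAux q t (1 ⊗ₜ 1)
  rw [← coprodOp_proj, ← coprod, counitRight_tmul, map_one, mul_one, mul_one] at this
  exact this

theorem Kge_le_Bge {q : ℂ} {x : NA q} (hx : x ∈ Kge q) : x ∈ Bge q := by
  rw [← counitRight_coprod q x]
  refine BgeTensor_induction (P := fun z => counitRight q z ∈ Bge q) ?_ ?_ _ hx
  · intro a ha b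
    obtain ⟨r, hr⟩ := counit_scalar q b
    rw [counitRight_tmul, hr, ← Algebra.commutes, ← Algebra.smul_def]
    exact Submodule.smul_mem _ _ ha
  · intro a b ha hb
    rw [map_add]
    exact add_mem ha hb

/-- The ideal `K_{> 1} = K_{≥ 1} ∩ B_{> 1}` of `K_{≥ 1}`. -/
def Kgt (q : ℂ) : Ideal (Kge q) where
  carrier := {x | (x : NA q) ∈ Bgt q}
  add_mem' hx hy := by
    simp only [Set.mem_ofPred_eq, Subalgebra.coe_add] at *
    exact add_mem hx hy
  zero_mem' := by simp
  smul_mem' c x hx := mul_mem_Bgt (Kge_le_Bge c.2) hx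

instance Kgt_isTwoSided (q : ℂ) : (Kgt q).IsTwoSided where
  mul_mem_of_left b ha := Bgt_mul_mem ha (Kge_le_Bge b.2)

/-- The algebra `K_{≥ 1}/K_{> 1}`. -/
abbrev Subquotient (q : ℂ) : Type := Kge q ⧸ Kgt q

end NicholsA02

end

open NicholsA02

set_option linter.unusedSimpArgs false

noncomputable section

namespace NicholsA02

/-! ### Skew derivations of the tensor algebra -/

/-! Two facts about B carry the proof. First, B has skew derivations ∂₁, ∂₂, and an element with
zero counit that both of them kill is zero (`eq_zero_of_der`): the elements of T(V) all of whose
iterated derivatives have zero constant term form the defining ideal. Second, K_{≥1} is stable under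
the derivations and vanishes in degrees with a₁ < a₂, so an element of K_{≥1} of degree Nδ, N ≥ 1,
that commutes with x₁ is zero (`eq_zero_of_commute_gen`). Direct differentiation is otherwise needed
only for X₁X₂ = qX₂X₁ and Y₂Y₁ = qY₁Y₂.

The bracket with L₁ is an odd superderivation that raises the index of the X's and Y's by one, so
the commutator with L₁² raises it by two, up to sign. Put h = L̃₂ = L₂ - L₁². The relations of h
with X₁, X₂, Y₁, Y₂ force [L₁², h] = 0, and shifting by L₁² then gives the action of h on all X_i
and Y_j. An induction based on the second fact shows that L₁² commutes with every [X_i, Y_j]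
(`ev_sq_comm_zv`). Hence [X_i, Y_j] depends only on i + j and the parity of i: it is an L or an L'.

It follows that h commutes with the L̃_{2n}, that [h, M_{2n+1}] = M_{2n+3}, and that [L̃_{2n},
M_{2j+1}] obeys a three-term recursion; this is `ImaginaryRelations`. For ℓ(u) = θ ∑ 2ⁿ L̃_{2n} uⁿ
the recursion says that conjugation by ℓ multiplies the coefficient series f of ∑ f_j M_{2j+1} u^j
by (1 + θu - u²)/(1 - θu - u²). The logarithmic derivative of this quotient gives the brackets of
the L̄_{2n} with the M's. Since M₁² commutes with the L̃_{2n}, M₁ anticommutes with M_{2n+1} for odd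
n; a second-order recurrence yields all anticommutators of the M's and the commutation of their
squares with everything imaginary.

For the commutativity of the L̃_{2n}, expanding the bracket of an L' with [X₁, Y_j] in two ways
gives quadratic exchange relations between the L's and L''s. Rewritten through ℓ and series in the
M's, they become (1 + c + uF)·[ℓ(u), ℓ(cu)] = 0. The factor is invertible for c ≠ -1, and comparing
powers of c finishes (`ImaginaryRelations.genSeries_commute`, `commute_of_genSeries_commute`).

For centrality, B is spanned by products of Y's times elements of the algebra P generated by the
X_i, L̃_{2k} and M_{2j+1}. The left degrees in Δ then show K_{≥1} = P (`Kge_le_posAlg`); the X_i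
vanish modulo K_{>1}, and the other generators commute with the squares.

For root vectors, call the words of X_n, Y_n, L_{2n}, M_{2n+1} basic. The bracket of [u] and [b] for
basic u < b lies in the algebra of the basic words c ≥ ub (`sk_superLetter_mem_adj`). So the
super-letter of any other Lyndon word is a polynomial in larger basic ones
(`superLetter_mem_adj_lt`), and reordering makes the products decreasing. In degree Nδ only L_{2n}
and M_{2n+1} survive as super-letters. As χ(Nδ, Nδ) = (-1)^N, the only proper powers to consider are
the squares M_{2n+1}². -/

theorem TV_left_induction {P : TV → Prop} (one : P 1) (smul : ∀ (r : ℂ) y, P y → P (r • y))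
    (letter : ∀ i y, P y → P (FreeAlgebra.ι ℂ i * y)) (add : ∀ x y, P x → P y → P (x + y)) :
    ∀ x, P x := by
  have key : ∀ x y : TV, P y → P (x * y) := by
    intro x
    induction x using FreeAlgebra.induction with
    | grade0 r => exact fun y hy => by rw [← Algebra.smul_def]; exact smul r y hy
    | grade1 i => exact fun y hy => letter i y hy
    | mul a b ha hb => exact fun y hy => by rw [mul_assoc]; exact ha _ (hb _ hy)
    | add a b ha hb => exact fun y hy => by rw [add_mul]; exact add _ _ (ha _ hy) (hb _ hy)
  exact fun x => by simpa using key x 1 one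

/-- The operators `(y, z) ↦ (x y, x z + ∂ᵢ(x) (χ(αᵢ, deg y) y))`. -/
def derOp (q : ℂ) (i : Fin 2) : TV →ₐ[ℂ] Module.End ℂ (TV × TV) :=
  FreeAlgebra.lift ℂ fun j =>
    LinearMap.prod (LinearMap.mulLeft ℂ (FreeAlgebra.ι ℂ j) ∘ₗ LinearMap.fst ℂ TV TV)
      (LinearMap.mulLeft ℂ (FreeAlgebra.ι ℂ j) ∘ₗ LinearMap.snd ℂ TV TV +
        if j = i then (twistT q (letterDeg i)).toLinearMap ∘ₗ LinearMap.fst ℂ TV TV else 0)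

theorem derOp_letter (q : ℂ) (i j : Fin 2) (y z : TV) :
    derOp q i (FreeAlgebra.ι ℂ j) (y, z) = (FreeAlgebra.ι ℂ j * y, FreeAlgebra.ι ℂ j * z +
      if j = i then twistT q (letterDeg i) y else 0) := by
  rw [derOp, FreeAlgebra.lift_ι_apply]
  split_ifs with h <;> simp [h]

theorem derOp_fst (q : ℂ) (i : Fin 2) (x : TV) : ∀ p : TV × TV, (derOp q i x p).1 = x * p.1 := by
  induction x using FreeAlgebra.induction with
  | grade0 r => intro p; simp [Module.algebraMap_end_apply, Algebra.smul_def]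
  | grade1 j => intro p; rw [← Prod.mk.eta (p := p), derOp_letter]
  | mul a b ha hb => intro p; rw [map_mul, Module.End.mul_apply, ha, hb, mul_assoc]
  | add a b ha hb => intro p; rw [map_add, LinearMap.add_apply, Prod.fst_add, ha, hb, add_mul]

/-- The skew derivation `∂ᵢ` of `T(V)`, with `∂ᵢ(x y) = x ∂ᵢ(y) + χ(αᵢ, deg y) ∂ᵢ(x) y`. -/
def derT (q : ℂ) (i : Fin 2) : TV →ₗ[ℂ] TV :=
  LinearMap.snd ℂ TV TV ∘ₗ LinearMap.applyₗ ((1, 0) : TV × TV) ∘ₗ (derOp q i).toLinearMap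

theorem derT_apply (q : ℂ) (i : Fin 2) (x : TV) : derT q i x = (derOp q i x (1, 0)).2 := rfl

theorem derT_one (q : ℂ) (i : Fin 2) : derT q i 1 = 0 := by
  rw [derT_apply, map_one]; rfl

theorem derT_letter_mul (q : ℂ) (i j : Fin 2) (y : TV) :
    derT q i (FreeAlgebra.ι ℂ j * y) =
      FreeAlgebra.ι ℂ j * derT q i y + if j = i then twistT q (letterDeg i) y else 0 := by
  have h : derOp q i y (1, 0) = (y, derT q i y) := by
    refine Prod.ext ?_ rfl
    rw [derOp_fst, mul_one]
  rw [derT_apply, map_mul, Module.End.mul_apply, h, derOp_letter]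

theorem derT_mul (q : ℂ) (i : Fin 2) (x y : TV) :
    derT q i (x * y) = x * derT q i y + derT q i x * twistT q (letterDeg i) y := by
  refine TV_left_induction (P := fun x => derT q i (x * y) =
    x * derT q i y + derT q i x * twistT q (letterDeg i) y) ?_ ?_ ?_ ?_ x
  · simp [derT_one]
  · intro r x hx
    simp only [smul_mul_assoc, map_smul, hx, smul_add]
  · intro j x hx
    rw [mul_assoc, derT_letter_mul, hx, derT_letter_mul]
    split_ifs <;> simp [mul_add, add_mul, mul_assoc]
    abel
  · intro a b ha hb
    simp only [add_mul, map_add, ha, hb]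
    abel

theorem twistT_letter (q : ℂ) (α : Deg) (i : Fin 2) :
    twistT q α (FreeAlgebra.ι ℂ i) = chi q α (letterDeg i) • FreeAlgebra.ι ℂ i := by
  rw [twistT, FreeAlgebra.lift_ι_apply]

/-- ∂ᵢ lowers the degree by αᵢ, so commuting it past the twist costs the factor χ(α, αᵢ). This makes
the common kernel of the functionals below stable under twists. -/
theorem derT_twistT (q : ℂ) (α : Deg) (i : Fin 2) (x : TV) :
    derT q i (twistT q α x) = chi q α (letterDeg i) • twistT q α (derT q i x) := by
  have hc : ∀ x, twistT q (letterDeg i) (twistT q α x) =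
      twistT q α (twistT q (letterDeg i) x) := by
    intro x
    have : (twistT q (letterDeg i)).comp (twistT q α) =
        (twistT q α).comp (twistT q (letterDeg i)) := by
      apply FreeAlgebra.hom_ext
      funext j
      simp only [Function.comp_apply, AlgHom.comp_apply, twistT_letter, map_smul]
      rw [smul_comm]
    exact DFunLike.congr_fun this x
  refine TV_left_induction (P := fun x => derT q i (twistT q α x) =
    chi q α (letterDeg i) • twistT q α (derT q i x)) ?_ ?_ ?_ ?_ x
  · simp [derT_one]
  · intro r x hx
    simp only [map_smul, hx]
    rw [smul_comm]
  · intro j x hx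
    rw [map_mul, twistT_letter, smul_mul_assoc, map_smul, derT_letter_mul, hx, derT_letter_mul,
      map_add, map_mul, twistT_letter]
    split_ifs with h
    · subst h
      rw [hc]
      simp only [smul_add, mul_smul_comm, smul_mul_assoc]
    · simp only [mul_smul_comm, smul_mul_assoc, map_zero, add_zero]
      rw [smul_comm]
  · intro a b ha hb
    simp only [map_add, ha, hb, smul_add]

/-- The counit of `T(V)`. -/
abbrev epsT : TV →ₐ[ℂ] ℂ := FreeAlgebra.algebraMapInv

theorem epsT_letter (i : Fin 2) : epsT (FreeAlgebra.ι ℂ i) = 0 := by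
  simp [epsT, FreeAlgebra.algebraMapInv]

theorem epsT_twistT (q : ℂ) (α : Deg) (x : TV) : epsT (twistT q α x) = epsT x := by
  have : epsT.comp (twistT q α) = epsT := by
    apply FreeAlgebra.hom_ext
    funext j
    simp only [Function.comp_apply, AlgHom.comp_apply, twistT_letter, map_smul, epsT_letter,
      smul_zero]
  exact DFunLike.congr_fun this x

/-- The functional `ε ∂_{iₙ} ⋯ ∂_{i₁}` attached to a word `i₁ ⋯ iₙ`. -/
def evalWord (q : ℂ) : List (Fin 2) → TV →ₗ[ℂ] ℂ
  | [] => epsT.toLinearMap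
  | i :: w => evalWord q w ∘ₗ derT q i

theorem evalWord_nil (q : ℂ) (x : TV) : evalWord q [] x = epsT x := rfl

theorem evalWord_cons (q : ℂ) (i : Fin 2) (w : List (Fin 2)) (x : TV) :
    evalWord q (i :: w) x = evalWord q w (derT q i x) := rfl

theorem evalWord_twistT (q : ℂ) (α : Deg) (w : List (Fin 2)) : ∀ x : TV,
    (∀ v, evalWord q v x = 0) → evalWord q w (twistT q α x) = 0 := by
  induction w with
  | nil => intro x hx; rw [evalWord_nil, epsT_twistT]; exact hx []
  | cons i w ih =>
    intro x hx
    rw [evalWord_cons, derT_twistT, map_smul, ih _ fun v => hx (i :: v), smul_zero]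

/-- Induction on the word by the Leibniz rule. The vanishing is assumed for all words at once
because each step replaces `y` by a derivative or a twist of it. -/
theorem evalWord_mul_left (q : ℂ) (w : List (Fin 2)) : ∀ x y : TV,
    (∀ v, evalWord q v y = 0) → evalWord q w (x * y) = 0 := by
  induction w with
  | nil =>
    intro x y hy
    have := hy []
    rw [evalWord_nil] at *
    rw [map_mul, this, mul_zero]
  | cons i w ih =>
    intro x y hy
    rw [evalWord_cons, derT_mul, map_add, ih _ _ fun v => hy (i :: v),
      ih _ _ fun v => evalWord_twistT q _ v y hy, add_zero]

theorem evalWord_mul_right (q : ℂ) (w : List (Fin 2)) : ∀ x y : TV,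
    (∀ v, evalWord q v x = 0) → evalWord q w (x * y) = 0 := by
  induction w with
  | nil =>
    intro x y hy
    have := hy []
    rw [evalWord_nil] at *
    rw [map_mul, this, zero_mul]
  | cons i w ih =>
    intro x y hy
    rw [evalWord_cons, derT_mul, map_add, ih _ _ hy,
      ih _ _ fun v => hy (i :: v), add_zero]

/-- The radical of `T(V)`: the elements on which all the functionals `ε ∂_{iₙ} ⋯ ∂_{i₁}` vanish. -/
def radT (q : ℂ) : Ideal TV where
  carrier := {x | ∀ w, evalWord q w x = 0}
  add_mem' {x y} hx hy w := by rw [map_add, hx w, hy w, add_zero]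
  zero_mem' w := map_zero _
  smul_mem' c x hx w := evalWord_mul_left q w c x hx

theorem mem_radT_derT {q : ℂ} {x : TV} (hx : x ∈ radT q) (i : Fin 2) : derT q i x ∈ radT q :=
  fun w => hx (i :: w)

/-- Apply a linear map to all the coefficients. -/
def mapC {S : Type*} [Semiring S] [Module ℂ S] (f : TV →ₗ[ℂ] S) :
    AddMonoidAlgebra TV Deg → AddMonoidAlgebra S Deg := AddMonoidAlgebra.map f.toAddMonoidHom

section mapC

variable {S : Type*} [Semiring S] [Module ℂ S] (f : TV →ₗ[ℂ] S)

theorem coeff_mapC (z : AddMonoidAlgebra TV Deg) (β : Deg) :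
    (mapC f z).coeff β = f (z.coeff β) := by
  simp [mapC]

theorem mapC_zero : mapC f 0 = 0 := AddMonoidAlgebra.map_zero _

theorem mapC_add (a b : AddMonoidAlgebra TV Deg) : mapC f (a + b) = mapC f a + mapC f b :=
  AddMonoidAlgebra.map_add _ _ _

theorem mapC_single (b : TV) (β : Deg) :
    mapC f (AddMonoidAlgebra.single β b) = AddMonoidAlgebra.single β (f b) :=
  AddMonoidAlgebra.map_single _ _ _

end mapC

theorem gradT_letter (i : Fin 2) :
    gradT (FreeAlgebra.ι ℂ i) = AddMonoidAlgebra.single (letterDeg i) (FreeAlgebra.ι ℂ i) := by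
  rw [gradT, FreeAlgebra.lift_ι_apply]

theorem gradT_twistT (q : ℂ) (α : Deg) (x : TV) :
    gradT (twistT q α x) = mapC (twistT q α).toLinearMap (gradT x) := by
  refine TV_left_induction (P := fun x => gradT (twistT q α x) =
    mapC (twistT q α).toLinearMap (gradT x)) ?_ ?_ ?_ ?_ x
  · simp only [map_one, AddMonoidAlgebra.one_def, mapC_single]
    simp
  · intro r x hx
    rw [map_smul, map_smul, hx, map_smul]
    ext β
    simp [coeff_mapC]
  · intro j x hx
    rw [map_mul, map_mul, hx, map_mul, twistT_letter, map_smul, gradT_letter]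
    induction gradT x using AddMonoidAlgebra.induction_linear with
    | zero => simp [mapC_zero]
    | add a b ha hb => rw [mapC_add, mul_add, mul_add, mapC_add, ha, hb]
    | single β b =>
      simp [AddMonoidAlgebra.single_mul_single, mapC_single, twistT_letter,
        AddMonoidAlgebra.smul_single]
  · intro a b ha hb
    simp only [map_add, mapC_add, ha, hb]

/-- Homogeneity of ∂ᵢ of degree -αᵢ, phrased as a shift upwards to avoid truncated subtraction in
ℕ². -/
theorem mapC_derT_gradT (q : ℂ) (i : Fin 2) (x : TV) :
    mapC (derT q i) (gradT x) = AddMonoidAlgebra.single (letterDeg i) 1 * gradT (derT q i x) := by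
  refine TV_left_induction (P := fun x => mapC (derT q i) (gradT x) =
    AddMonoidAlgebra.single (letterDeg i) 1 * gradT (derT q i x)) ?_ ?_ ?_ ?_ x
  · simp only [map_one, AddMonoidAlgebra.one_def, mapC_single]
    simp [derT_one]
  · intro r x hx
    rw [map_smul, map_smul, map_smul, mul_smul_comm, ← hx]
    ext β
    simp [coeff_mapC]
  · intro j x hx
    have key : ∀ z : AddMonoidAlgebra TV Deg, mapC (derT q i)
        (AddMonoidAlgebra.single (letterDeg j) (FreeAlgebra.ι ℂ j) * z) =
        AddMonoidAlgebra.single (letterDeg j) (FreeAlgebra.ι ℂ j) * mapC (derT q i) z +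
        AddMonoidAlgebra.single (letterDeg i) 1 *
          if j = i then mapC (twistT q (letterDeg i)).toLinearMap z else 0 := by
      intro z
      induction z using AddMonoidAlgebra.induction_linear with
      | zero => simp [mapC_zero]
      | add a b ha hb =>
        rw [mul_add, mapC_add, ha, hb, mapC_add, mul_add]
        split_ifs
        · rw [mapC_add, mul_add]; abel
        · simp
      | single β b =>
        rw [AddMonoidAlgebra.single_mul_single, mapC_single,
          mapC_single]
        split_ifs with h
        · subst h
          simp [AddMonoidAlgebra.single_mul_single, mapC_single, derT_letter_mul]
        · simp [AddMonoidAlgebra.single_mul_single, derT_letter_mul, h]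
    rw [map_mul, gradT_letter, key, hx, derT_letter_mul, map_add, map_mul, gradT_letter, mul_add]
    congr 1
    · rw [← mul_assoc, ← mul_assoc, AddMonoidAlgebra.single_mul_single,
        AddMonoidAlgebra.single_mul_single, mul_one, one_mul, add_comm]
    · split_ifs
      · rw [gradT_twistT]
      · simp
  · intro a b ha hb
    simp only [map_add, mapC_add, ha, hb, mul_add]

/-- The functional of a word sees only the component of the degree of that word, which is why the
radical is homogeneous. -/
theorem mapC_evalWord_gradT (q : ℂ) (w : List (Fin 2)) : ∀ x : TV,
    mapC (evalWord q w) (gradT x) =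
      AddMonoidAlgebra.single (w.map letterDeg).sum (evalWord q w x) := by
  induction w with
  | nil =>
    intro x
    have : (AddMonoidAlgebra.mapAlgHom Deg epsT).comp gradT =
        (AddMonoidAlgebra.singleZeroAlgHom (R := ℂ) (A := ℂ) (M := Deg)).comp epsT := by
      apply FreeAlgebra.hom_ext
      funext j
      simp [gradT_letter, epsT_letter]
    refine Eq.trans ?_ (DFunLike.congr_fun this x)
    ext β
    simp [coeff_mapC, evalWord_nil]
  | cons i w ih =>
    intro x
    have h1 : mapC (evalWord q (i :: w)) (gradT x) =
        mapC (evalWord q w) (mapC (derT q i) (gradT x)) := by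
      ext β; simp [evalWord_cons, coeff_mapC]
    have h2 : ∀ z : AddMonoidAlgebra TV Deg, mapC (evalWord q w)
        (AddMonoidAlgebra.single (letterDeg i) 1 * z) =
        AddMonoidAlgebra.single (letterDeg i) 1 * mapC (evalWord q w) z := by
      intro z
      induction z using AddMonoidAlgebra.induction_linear with
      | zero => simp [mapC_zero]
      | add a b ha hb => rw [mul_add, mapC_add, ha, hb, mapC_add, mul_add]
      | single β b =>
        simp [AddMonoidAlgebra.single_mul_single, mapC_single]
    rw [h1, mapC_derT_gradT, h2, ih, AddMonoidAlgebra.single_mul_single, one_mul, List.map_cons,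
      List.sum_cons, evalWord_cons]

theorem coeff_gradT_mem_radT {q : ℂ} {x : TV} (hx : x ∈ radT q) (α : Deg) :
    (gradT x).coeff α ∈ radT q := by
  intro w
  have := congrArg (fun z => z.coeff α) (mapC_evalWord_gradT q w x)
  simpa [hx w, coeff_mapC] using this

/-- The components of degrees 0 and αᵢ are read off by ε and ε∂ᵢ. This shows both that the radical
starts in degree two and that these functionals kill every ideal starting in degree two. -/
theorem coeff_gradT_low (q : ℂ) (x : TV) : (gradT x).coeff 0 = algebraMap ℂ TV (epsT x) ∧
    ∀ i, (gradT x).coeff (letterDeg i) = evalWord q [i] x • FreeAlgebra.ι ℂ i := by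
  refine TV_left_induction (P := fun x => (gradT x).coeff 0 = algebraMap ℂ TV (epsT x) ∧
    ∀ i, (gradT x).coeff (letterDeg i) = evalWord q [i] x • FreeAlgebra.ι ℂ i) ?_ ?_ ?_ ?_ x
  · refine ⟨by simp [AddMonoidAlgebra.one_def], fun i => ?_⟩
    rw [map_one, AddMonoidAlgebra.one_def, evalWord_cons, derT_one, map_zero, zero_smul]
    fin_cases i <;> simp [letterDeg]
  · rintro r x ⟨h1, h2⟩
    constructor
    · rw [map_smul, AddMonoidAlgebra.coeff_smul_apply, h1, map_smul, Algebra.smul_def,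
        smul_eq_mul, map_mul]
    · intro i
      rw [map_smul, AddMonoidAlgebra.coeff_smul_apply, h2, map_smul, smul_assoc]
  · rintro j x ⟨h1, h2⟩
    have hd : ∀ d : Deg, letterDeg j + d ≠ 0 := by
      intro d; fin_cases j <;> simp [letterDeg, Prod.ext_iff]
    constructor
    · rw [map_mul, map_mul, epsT_letter, zero_mul, gradT_letter, map_zero (algebraMap ℂ TV),
        AddMonoidAlgebra.coeff_single_mul_of_forall_add_ne _ _ hd]
    · intro i
      rw [map_mul, gradT_letter, evalWord_cons, derT_letter_mul, map_add, evalWord_nil,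
        evalWord_nil, map_mul, epsT_letter, zero_mul, zero_add]
      by_cases h : j = i
      · subst h
        have := AddMonoidAlgebra.coeff_single_mul_add (gradT x) (FreeAlgebra.ι ℂ j)
          (letterDeg j) 0
        rw [add_zero] at this
        rw [this, h1, if_pos rfl, epsT_twistT, Algebra.smul_def, Algebra.commutes]
      · have hd : ∀ d : Deg, letterDeg j + d ≠ letterDeg i := by
          intro d; fin_cases j <;> fin_cases i <;> simp [letterDeg, Prod.ext_iff] at h ⊢
        rw [AddMonoidAlgebra.coeff_single_mul_of_forall_add_ne _ _ hd, if_neg h, map_zero,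
          zero_smul]
  · rintro a b ⟨ha, ha'⟩ ⟨hb, hb'⟩
    constructor
    · simp only [map_add, AddMonoidAlgebra.coeff_add, Finsupp.add_apply, ha, hb]
    · intro i
      simp only [map_add, AddMonoidAlgebra.coeff_add, Finsupp.add_apply, ha', hb', add_smul]

theorem deg_low {α : Deg} (h : α.1 + α.2 < 2) : α = 0 ∨ ∃ i, α = letterDeg i := by
  obtain ⟨a, b⟩ := α
  simp only at h
  have : (a = 0 ∧ b = 0) ∨ (a = 1 ∧ b = 0) ∨ (a = 0 ∧ b = 1) := by omega
  rcases this with ⟨rfl, rfl⟩ | ⟨rfl, rfl⟩ | ⟨rfl, rfl⟩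
  · exact Or.inl rfl
  · exact Or.inr ⟨0, rfl⟩
  · exact Or.inr ⟨1, rfl⟩

theorem coprodT_letter_mul (q : ℂ) (j : Fin 2) (y : TV) :
    coprodT q (FreeAlgebra.ι ℂ j * y) =
      TensorProduct.map (LinearMap.mulLeft ℂ (FreeAlgebra.ι ℂ j)) LinearMap.id (coprodT q y) +
      TensorProduct.map (twistT q (letterDeg j)).toLinearMap
        (LinearMap.mulLeft ℂ (FreeAlgebra.ι ℂ j)) (coprodT q y) := by
  rw [coprodT, map_mul, Module.End.mul_apply, ← coprodT, coprodOpT, FreeAlgebra.lift_ι_apply]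
  rfl

theorem coprodT_one (q : ℂ) : coprodT q 1 = 1 ⊗ₜ 1 := by rw [coprodT, map_one]; rfl

theorem coprodT_add (q : ℂ) (x y : TV) : coprodT q (x + y) = coprodT q x + coprodT q y := by
  simp [coprodT]

theorem coprodT_smul (q : ℂ) (r : ℂ) (x : TV) : coprodT q (r • x) = r • coprodT q x := by
  simp [coprodT]

theorem coprodT_twistT (q : ℂ) (α : Deg) (x : TV) : coprodT q (twistT q α x) =
    TensorProduct.map (twistT q α).toLinearMap (twistT q α).toLinearMap (coprodT q x) := by
  refine TV_left_induction (P := fun x => coprodT q (twistT q α x) =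
    TensorProduct.map (twistT q α).toLinearMap (twistT q α).toLinearMap (coprodT q x)) ?_ ?_ ?_ ?_ x
  · simp [coprodT_one]
  · intro r x hx
    rw [map_smul, coprodT_smul, hx, coprodT_smul, map_smul]
  · intro j x hx
    rw [map_mul, twistT_letter, smul_mul_assoc, coprodT_smul, coprodT_letter_mul, hx,
      coprodT_letter_mul, map_add]
    generalize coprodT q x = z
    induction z using TensorProduct.induction_on with
    | zero => simp
    | tmul a b =>
      have hc : twistT q (letterDeg j) (twistT q α a) = twistT q α (twistT q (letterDeg j) a) := by
        have : (twistT q (letterDeg j)).comp (twistT q α) =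
            (twistT q α).comp (twistT q (letterDeg j)) := by
          apply FreeAlgebra.hom_ext
          funext k
          simp only [Function.comp_apply, AlgHom.comp_apply, twistT_letter, map_smul]
          rw [smul_comm]
        exact DFunLike.congr_fun this a
      simp [twistT_letter, hc, TensorProduct.smul_tmul]
    | add a b ha hb =>
      simp only [map_add, smul_add] at ha hb ⊢
      linear_combination (norm := abel) ha + hb
  · intro a b ha hb
    simp only [map_add, coprodT_add, ha, hb]

/-- The derivations act on the right tensor factor alone. This is behind the coideal property of the
radical and the stability of K_{≥1}, a condition on the left factor. -/
theorem map_derT_coprodT (q : ℂ) (i : Fin 2) (x : TV) :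
    TensorProduct.map LinearMap.id (derT q i) (coprodT q x) = coprodT q (derT q i x) := by
  refine TV_left_induction (P := fun x => TensorProduct.map LinearMap.id (derT q i) (coprodT q x)
    = coprodT q (derT q i x)) ?_ ?_ ?_ ?_ x
  · simp [derT_one, coprodT]
  · intro r x hx
    rw [map_smul, coprodT_smul, map_smul, hx, coprodT_smul]
  · intro j x hx
    rw [coprodT_letter_mul, derT_letter_mul, coprodT_add, coprodT_letter_mul, ← hx]
    have key : coprodT q (if j = i then twistT q (letterDeg i) x else 0) =
        if j = i then TensorProduct.map (twistT q (letterDeg i)).toLinearMap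
          (twistT q (letterDeg i)).toLinearMap (coprodT q x) else 0 := by
      split_ifs
      · exact coprodT_twistT _ _ _
      · simp [coprodT]
    rw [key]
    clear key hx
    generalize coprodT q x = z
    induction z using TensorProduct.induction_on with
    | zero => simp
    | tmul a b =>
      simp only [map_add, TensorProduct.map_tmul, LinearMap.mulLeft_apply, LinearMap.id_apply,
        AlgHom.toLinearMap_apply, derT_letter_mul, TensorProduct.tmul_add]
      split_ifs with h
      · subst h; abel
      · simp
    | add a b ha hb =>
      simp only [map_add] at ha hb ⊢
      split_ifs at ha hb ⊢ <;> linear_combination (norm := abel) ha + hb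
  · intro a b ha hb
    simp only [map_add, coprodT_add, ha, hb]

/-- In a basis of the left space, each coefficient in `W` is killed by a separating family. -/
theorem eq_zero_of_separating {V W ι : Type*} [AddCommGroup V] [Module ℂ V] [AddCommGroup W]
    [Module ℂ W] (f : ι → W →ₗ[ℂ] ℂ) (hf : ∀ w, (∀ i, f i w = 0) → w = 0) (z : V ⊗[ℂ] W)
    (hz : ∀ i, TensorProduct.map LinearMap.id (f i) z = 0) : z = 0 := by
  obtain ⟨c, rfl⟩ := TensorProduct.eq_repr_basis_left (Module.Basis.ofVectorSpace ℂ V) z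
  have hc : c = 0 := by
    ext k
    refine hf _ fun i => ?_
    have h := hz i
    have h' : (c.mapRange (f i) (map_zero _)).sum
        (fun k n => (Module.Basis.ofVectorSpace ℂ V) k ⊗ₜ[ℂ] n) = 0 := by
      rw [Finsupp.sum_mapRange_index (by simp)]
      simpa [Finsupp.sum, map_sum] using h
    have := TensorProduct.sum_tmul_basis_left_eq_zero _ _ h'
    simpa using DFunLike.congr_fun this k
  simp [hc]

/-- The kernel of T ⊗ T → T/I ⊗ T/I is I ⊗ T + T ⊗ I. Since the functionals separate points of T/I,
it suffices to evaluate them on the right factor of Δ(x); by `map_derT_coprodT` the result is an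
iterated derivative of `x`, which lies in I. -/
theorem radT_isGradedCoideal (q : ℂ) : IsGradedCoideal q (radT q) where
  twoSided := ⟨fun b ha w => evalWord_mul_right q w _ b ha⟩
  homogeneous x hx α := coeff_gradT_mem_radT hx α
  two_le x hx α hα := by
    rcases deg_low hα with rfl | ⟨i, rfl⟩
    · rw [(coeff_gradT_low q x).1, ← evalWord_nil q, hx, map_zero]
    · rw [(coeff_gradT_low q x).2, hx, zero_smul]
  coideal x hx := by
    set I := (radT q).restrictScalars ℂ with hI
    have hex : Function.Exact I.subtype I.mkQ := LinearMap.exact_subtype_mkQ I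
    have hker := TensorProduct.map_ker hex I.mkQ_surjective hex I.mkQ_surjective
    have hmem : coprodT q x ∈ LinearMap.ker (TensorProduct.map I.mkQ I.mkQ) := by
      rw [LinearMap.mem_ker]
      let f : List (Fin 2) → (TV ⧸ I) →ₗ[ℂ] ℂ := fun w => I.liftQ (evalWord q w) fun y hy => hy w
      refine eq_zero_of_separating f ?_ _ ?_
      · intro y
        obtain ⟨y, rfl⟩ := I.mkQ_surjective y
        intro hy
        rw [Submodule.mkQ_apply, Submodule.Quotient.mk_eq_zero]
        exact fun w => hy w
      · intro w
        have hcomp : TensorProduct.map LinearMap.id (f w) (TensorProduct.map I.mkQ I.mkQ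
            (coprodT q x)) = TensorProduct.map I.mkQ LinearMap.id
            (TensorProduct.map LinearMap.id (evalWord q w) (coprodT q x)) := by
          simp only [← LinearMap.comp_apply, ← TensorProduct.map_comp]
          rfl
        rw [hcomp]
        have key : ∀ (w : List (Fin 2)) (x : TV), x ∈ radT q →
            TensorProduct.map I.mkQ (LinearMap.id : ℂ →ₗ[ℂ] ℂ)
              (TensorProduct.map LinearMap.id (evalWord q w) (coprodT q x)) = 0 := by
          intro w
          induction w with
          | nil =>
            intro x hx
            have h0 : TensorProduct.map LinearMap.id (evalWord q []) (coprodT q x) =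
                x ⊗ₜ (1 : ℂ) := by
              refine TV_left_induction (P := fun x => TensorProduct.map LinearMap.id
                (evalWord q []) (coprodT q x) = x ⊗ₜ (1 : ℂ)) ?_ ?_ ?_ ?_ x
              · simp [coprodT_one, evalWord_nil]
              · intro r x hx
                rw [coprodT_smul, map_smul, hx, TensorProduct.smul_tmul']
              · intro j x hx
                have h2 : (FreeAlgebra.ι ℂ j * x) ⊗ₜ[ℂ] (1 : ℂ) = TensorProduct.map
                    (LinearMap.mulLeft ℂ (FreeAlgebra.ι ℂ j)) LinearMap.id (x ⊗ₜ[ℂ] (1 : ℂ)) := by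
                  simp
                rw [h2, ← hx, coprodT_letter_mul]
                generalize coprodT q x = z
                induction z using TensorProduct.induction_on with
                | zero => simp
                | tmul a b => simp [evalWord_nil, epsT_letter]
                | add a b ha hb =>
                  simp only [map_add] at ha hb ⊢
                  linear_combination (norm := abel) ha + hb
              · intro a b ha hb
                rw [coprodT_add, map_add, ha, hb, TensorProduct.add_tmul]
            rw [h0, TensorProduct.map_tmul]
            have : I.mkQ x = 0 := by
              rw [Submodule.mkQ_apply, Submodule.Quotient.mk_eq_zero]; exact hx
            rw [this, TensorProduct.zero_tmul]
          | cons i w ih =>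
            intro x hx
            have : TensorProduct.map LinearMap.id (evalWord q (i :: w)) (coprodT q x) =
                TensorProduct.map LinearMap.id (evalWord q w)
                  (TensorProduct.map LinearMap.id (derT q i) (coprodT q x)) := by
              simp only [← LinearMap.comp_apply, ← TensorProduct.map_comp]
              rfl
            rw [this, map_derT_coprodT]
            exact ih _ (mem_radT_derT hx i)
        exact key w x hx
    rw [hker] at hmem
    rw [sup_comm]
    exact hmem

/-! ### Skew derivations of the Nichols algebra -/

theorem map_epsT_coprodT (q : ℂ) (x : TV) :
    TensorProduct.rid ℂ TV (TensorProduct.map LinearMap.id epsT.toLinearMap (coprodT q x)) = x := by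
  refine TV_left_induction (P := fun x => TensorProduct.rid ℂ TV
    (TensorProduct.map LinearMap.id epsT.toLinearMap (coprodT q x)) = x) ?_ ?_ ?_ ?_ x
  · simp [coprodT_one]
  · intro r x hx
    rw [coprodT_smul, map_smul, map_smul, hx]
  · intro i x hx
    nth_rewrite 2 [← hx]
    rw [coprodT_letter_mul]
    generalize coprodT q x = z
    induction z using TensorProduct.induction_on with
    | zero => simp
    | tmul a b => simp [epsT_letter]
    | add a b ha hb =>
      simp only [map_add, mul_add] at *
      rw [← ha, ← hb]
      abel
  · intro a b ha hb
    rw [coprodT_add, map_add, map_add, ha, hb]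

theorem map_evalWord_coprodT (q : ℂ) (i : Fin 2) (x : TV) :
    TensorProduct.rid ℂ TV (TensorProduct.map LinearMap.id (evalWord q [i]) (coprodT q x)) =
      derT q i x := by
  rw [← map_epsT_coprodT q (derT q i x), ← map_derT_coprodT]
  congr 1
  rw [← LinearMap.comp_apply, ← TensorProduct.map_comp, LinearMap.id_comp]
  rfl

/-- ∂ᵢ = (id ⊗ ε∂ᵢ)Δ, and ε∂ᵢ vanishes on an ideal concentrated in degrees at least two. Applied to
I ⊗ T + T ⊗ I it therefore lands in I. -/
theorem derT_mem_nicholsIdeal {q : ℂ} {x : TV} (hx : x ∈ nicholsIdeal q) (i : Fin 2) :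
    derT q i x ∈ nicholsIdeal q := by
  refine nicholsIdeal_induction (P := fun x => derT q i x ∈ nicholsIdeal q) ?_ ?_ ?_ x hx
  · intro I hI x hx
    refine le_nicholsIdeal hI ?_
    have key : ∀ y ∈ I, evalWord q [i] y = 0 := by
      intro y hy
      have h := hI.two_le y hy (letterDeg i) (by fin_cases i <;> simp [letterDeg])
      rw [(coeff_gradT_low q y).2] at h
      -- The degree-αᵢ component is a multiple of xᵢ, and xᵢ ≠ 0 because ∂ᵢ(xᵢ) = 1.
      by_contra hne
      have h2 : (FreeAlgebra.ι ℂ i : TV) = 0 := (smul_eq_zero.1 h).resolve_left hne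
      have h3 := congrArg (derT q i) h2
      have h4 := derT_letter_mul q i i 1
      rw [mul_one, h3] at h4
      simp [derT_one] at h4
    have h := hI.coideal x hx
    rw [← map_evalWord_coprodT]
    let F : TV ⊗[ℂ] TV →ₗ[ℂ] TV := (TensorProduct.rid ℂ TV).toLinearMap ∘ₗ
      TensorProduct.map LinearMap.id (evalWord q [i])
    suffices hs : coprodT q x ∈ (I.restrictScalars ℂ).comap F from hs
    refine (sup_le ?_ ?_ : _ ≤ (I.restrictScalars ℂ).comap F) h
    · rintro _ ⟨z, rfl⟩
      induction z using TensorProduct.induction_on with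
      | zero => simp
      | tmul a b =>
        have : F ((a : TV) ⊗ₜ b) = evalWord q [i] b • (a : TV) := by simp [F]
        rw [TensorProduct.map_tmul, Submodule.mem_comap, Submodule.subtype_apply,
          LinearMap.id_apply, this]
        exact Submodule.smul_mem _ _ a.2
      | add a b ha hb => rw [map_add]; exact add_mem ha hb
    · rintro _ ⟨z, rfl⟩
      induction z using TensorProduct.induction_on with
      | zero => simp
      | tmul a b =>
        have : F (a ⊗ₜ (b : TV)) = evalWord q [i] b • (a : TV) := by simp [F]
        rw [TensorProduct.map_tmul, Submodule.mem_comap, Submodule.subtype_apply,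
          LinearMap.id_apply, this, key _ b.2, zero_smul]
        exact zero_mem _
      | add a b ha hb => rw [map_add]; exact add_mem ha hb
  · simp
  · intro x y hx hy
    rw [map_add]
    exact add_mem hx hy

theorem proj_surjective (q : ℂ) : Function.Surjective (proj q) :=
  Ideal.Quotient.mkₐ_surjective ℂ (nicholsIdeal q)

theorem proj_eq_zero {q : ℂ} {x : TV} : proj q x = 0 ↔ x ∈ nicholsIdeal q :=
  Ideal.Quotient.eq_zero_iff_mem

theorem proj_derT_surjInv (q : ℂ) (i : Fin 2) (x : TV) :
    proj q (derT q i (Function.surjInv (proj_surjective q) (proj q x))) = proj q (derT q i x) := by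
  rw [← sub_eq_zero, ← map_sub, ← map_sub, proj_eq_zero]
  apply derT_mem_nicholsIdeal
  rw [← proj_eq_zero, map_sub, Function.surjInv_eq (proj_surjective q), sub_self]

/-- The skew derivation `∂ᵢ` of `B(V)`. -/
def der (q : ℂ) (i : Fin 2) : NA q →ₗ[ℂ] NA q where
  toFun z := proj q (derT q i (Function.surjInv (proj_surjective q) z))
  map_add' x y := by
    obtain ⟨x, rfl⟩ := proj_surjective q x
    obtain ⟨y, rfl⟩ := proj_surjective q y
    rw [← map_add]
    simp only [proj_derT_surjInv]
    rw [map_add, map_add]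
  map_smul' r x := by
    obtain ⟨x, rfl⟩ := proj_surjective q x
    rw [← map_smul]
    simp only [proj_derT_surjInv]
    rw [map_smul, map_smul]
    rfl

theorem der_proj (q : ℂ) (i : Fin 2) (x : TV) : der q i (proj q x) = proj q (derT q i x) :=
  proj_derT_surjInv q i x

theorem der_one (q : ℂ) (i : Fin 2) : der q i 1 = 0 := by
  rw [← map_one (proj q), der_proj, derT_one, map_zero]

theorem der_gen_self (q : ℂ) (i : Fin 2) : der q i (gen q i) = 1 := by
  have := derT_letter_mul q i i 1
  rw [mul_one, derT_one, if_pos rfl, map_one, mul_zero, zero_add] at this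
  rw [gen, der_proj, this, map_one]

theorem der_gen_of_ne (q : ℂ) {i j : Fin 2} (h : j ≠ i) : der q i (gen q j) = 0 := by
  have := derT_letter_mul q i j 1
  rw [mul_one, derT_one, if_neg h, mul_zero, zero_add] at this
  rw [gen, der_proj, this, map_zero]

theorem der_mul (q : ℂ) (i : Fin 2) (x y : NA q) :
    der q i (x * y) = x * der q i y + der q i x * twist q (letterDeg i) y := by
  obtain ⟨x, rfl⟩ := proj_surjective q x
  obtain ⟨y, rfl⟩ := proj_surjective q y
  rw [← map_mul, der_proj, derT_mul, der_proj, der_proj, map_add, map_mul, map_mul, twist_proj]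

theorem der_mul_of_mem (q : ℂ) (i : Fin 2) (x : NA q) {y : NA q} {β : Deg}
    (hy : y ∈ homComp q β) :
    der q i (x * y) = x * der q i y + chi q (letterDeg i) β • (der q i x * y) := by
  rw [der_mul, twist_of_mem _ hy, mul_smul_comm]

theorem map_der_coprod (q : ℂ) (i : Fin 2) (x : NA q) :
    TensorProduct.map LinearMap.id (der q i) (coprod q x) = coprod q (der q i x) := by
  obtain ⟨x, rfl⟩ := proj_surjective q x
  rw [coprod_proj, der_proj, coprod_proj, ← map_derT_coprodT]
  simp only [← LinearMap.comp_apply, ← TensorProduct.map_comp]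
  congr 2
  ext x
  exact der_proj q i x

/-- The condition defining K_{≥1} concerns the left factor of Δ, while ∂ᵢ acts on the right factor.
-/
theorem der_mem_Kge {q : ℂ} {x : NA q} (hx : x ∈ Kge q) (i : Fin 2) : der q i x ∈ Kge q := by
  change coprod q (der q i x) ∈ BgeTensor q
  rw [← map_der_coprod]
  refine BgeTensor_induction (P := fun z => TensorProduct.map LinearMap.id (der q i) z ∈
    BgeTensor q) ?_ ?_ _ hx
  · intro a ha b
    rw [TensorProduct.map_tmul]
    exact tmul_mem_BgeTensor ha _
  · intro a b ha hb
    rw [map_add]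
    exact add_mem ha hb

/-- Nondegeneracy. -/
theorem eq_zero_of_der (q : ℂ) {z : NA q} (h0 : counit q z = 0) (h : ∀ i, der q i z = 0) :
    z = 0 := by
  obtain ⟨x, rfl⟩ := proj_surjective q z
  have hrad : ∀ y ∈ nicholsIdeal q, ∀ w, evalWord q w y = 0 := by
    intro y hy w
    induction w generalizing y with
    | nil =>
      refine nicholsIdeal_induction (P := fun y => evalWord q [] y = 0) ?_ ?_ ?_ y hy
      · intro I hI y hy
        have h := hI.two_le y hy 0 (by simp)
        rw [(coeff_gradT_low q y).1] at h
        have h2 := congrArg epsT h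
        rwa [AlgHom.commutes, map_zero] at h2
      · simp
      · intro x y hx hy
        rw [map_add, hx, hy, add_zero]
    | cons i w ih => exact ih _ (derT_mem_nicholsIdeal hy i)
  rw [proj_eq_zero]
  -- It is enough that a representative lies in the radical: a nonempty word first applies some ∂ᵢ,
  -- which lands in the Nichols ideal, where all functionals vanish.
  refine le_nicholsIdeal (radT_isGradedCoideal q) fun w => ?_
  cases w with
  | nil =>
    have hcomp : (counit q).comp (proj q) = (Algebra.ofId ℂ (NA q)).comp epsT := by
      apply FreeAlgebra.hom_ext
      funext i
      simp only [Function.comp_apply, AlgHom.comp_apply, epsT_letter, map_zero]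
      exact counit_gen q i
    have h1 := DFunLike.congr_fun hcomp x
    simp only [AlgHom.comp_apply] at h1
    rw [h0, Algebra.ofId_apply, Algebra.algebraMap_eq_smul_one, ← map_one (proj q), ← map_smul,
      eq_comm, proj_eq_zero] at h1
    have h2 := hrad _ h1 []
    rw [evalWord_nil, map_smul, map_one] at h2
    simpa [evalWord_nil] using h2
  | cons i w =>
    exact hrad _ (proj_eq_zero.1 (by rw [← der_proj]; exact h i)) w

theorem counit_of_mem {q : ℂ} {α : Deg} (hα : α ≠ 0) {x : NA q} (hx : x ∈ homComp q α) :
    counit q x = 0 := by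
  rw [counit, rescale_of_mem _ hx]
  simp [zeroHom, hα]

/-! ### Words span -/

theorem wordDeg_cons (i : Fin 2) (w : Word) : wordDeg (i :: w) = letterDeg i + wordDeg w := by
  fin_cases i <;> simp [wordDeg, letterDeg, add_comm]

theorem wordDeg_append (u v : Word) : wordDeg (u ++ v) = wordDeg u + wordDeg v := by
  simp [wordDeg, List.count_append]

theorem prod_gen_mem (q : ℂ) (w : Word) : (w.map (gen q)).prod ∈ homComp q (wordDeg w) := by
  induction w with
  | nil => exact one_mem_homComp q
  | cons i w ih =>
    rw [List.map_cons, List.prod_cons, wordDeg_cons]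
    exact mul_mem_homComp (gen_mem q i) ih

theorem mem_span_words (q : ℂ) (x : NA q) :
    x ∈ Submodule.span ℂ (Set.range fun w : Word => (w.map (gen q)).prod) := by
  obtain ⟨t, rfl⟩ := proj_surjective q x
  refine TV_left_induction (P := fun t => proj q t ∈
    Submodule.span ℂ (Set.range fun w : Word => (w.map (gen q)).prod)) ?_ ?_ ?_ ?_ t
  · exact Submodule.subset_span ⟨[], by simp⟩
  · intro r y hy
    rw [map_smul]
    exact Submodule.smul_mem _ _ hy
  · intro i y hy
    rw [map_mul]
    refine Submodule.span_induction (p := fun y _ => proj q (FreeAlgebra.ι ℂ i) * y ∈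
      Submodule.span ℂ (Set.range fun w : Word => (w.map (gen q)).prod)) ?_ ?_ ?_ ?_ hy
    · rintro _ ⟨w, rfl⟩
      exact Submodule.subset_span ⟨i :: w, by simp [gen]⟩
    · simp
    · intro a b _ _ ha hb
      rw [mul_add]
      exact add_mem ha hb
    · intro r a _ ha
      rw [mul_smul_comm]
      exact Submodule.smul_mem _ _ ha
  · intro a b ha hb
    rw [map_add]
    exact add_mem ha hb

/-- The projection to the homogeneous component of degree `α`. -/
def comp (q : ℂ) (α : Deg) : NA q →ₗ[ℂ] NA q where
  toFun x := (grad q x).coeff α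
  map_add' x y := by simp
  map_smul' r x := by simp

theorem comp_apply (q : ℂ) (α : Deg) (x : NA q) : comp q α x = (grad q x).coeff α := rfl

theorem comp_of_mem {q : ℂ} {α : Deg} {x : NA q} (hx : x ∈ homComp q α) : comp q α x = x := by
  rw [comp_apply, mem_homComp.1 hx]; simp

theorem comp_of_mem_ne {q : ℂ} {α β : Deg} (h : α ≠ β) {x : NA q} (hx : x ∈ homComp q α) :
    comp q β x = 0 := by
  rw [comp_apply, mem_homComp.1 hx]; simp [h]

/-- If `S` spans, is homogeneous, then its members of degree `α` span the component. -/
theorem mem_span_of_homogeneous {q : ℂ} {ι : Type*} (f : ι → NA q) (d : ι → Deg)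
    (hd : ∀ i, f i ∈ homComp q (d i)) {α : Deg} {x : NA q} (hx : x ∈ homComp q α)
    (hs : x ∈ Submodule.span ℂ (Set.range f)) :
    x ∈ Submodule.span ℂ (f '' {i | d i = α}) := by
  rw [← comp_of_mem hx]
  clear hx
  refine Submodule.span_induction (p := fun x _ => comp q α x ∈
    Submodule.span ℂ (f '' {i | d i = α})) ?_ ?_ ?_ ?_ hs
  · rintro _ ⟨i, rfl⟩
    by_cases h : d i = α
    · rw [comp_of_mem (h ▸ hd i)]
      exact Submodule.subset_span ⟨i, h, rfl⟩
    · rw [comp_of_mem_ne h (hd i)]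
      exact zero_mem _
  · simp
  · intro a b _ _ ha hb
    rw [map_add]
    exact add_mem ha hb
  · intro r a _ ha
    rw [map_smul]
    exact Submodule.smul_mem _ _ ha

theorem homComp_induction {q : ℂ} {α : Deg} {P : NA q → Prop}
    (word : ∀ w, wordDeg w = α → P (w.map (gen q)).prod) (zero : P 0)
    (add : ∀ x y, P x → P y → P (x + y)) (smul : ∀ (r : ℂ) x, P x → P (r • x)) :
    ∀ x ∈ homComp q α, P x := by
  intro x hx
  have h := mem_span_of_homogeneous (fun w : Word => (w.map (gen q)).prod) wordDeg
    (prod_gen_mem q) hx (mem_span_words q x)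
  refine Submodule.span_induction (p := fun x _ => P x) ?_ zero (fun a b _ _ => add a b)
    (fun r a _ => smul r a) h
  rintro _ ⟨w, hw, rfl⟩
  exact word w hw

theorem der_word_mem (q : ℂ) (i : Fin 2) (w : Word) :
    (letterDeg i ≤ wordDeg w →
      der q i (w.map (gen q)).prod ∈ homComp q (wordDeg w - letterDeg i)) ∧
    (¬ letterDeg i ≤ wordDeg w → der q i (w.map (gen q)).prod = 0) := by
  induction w with
  | nil =>
    simp only [List.map_nil, List.prod_nil, der_one]
    exact ⟨fun _ => zero_mem _, fun _ => trivial⟩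
  | cons j w ih =>
    simp only [List.map_cons, List.prod_cons, wordDeg_cons]
    rw [der_mul_of_mem q i _ (prod_gen_mem q w)]
    constructor
    · intro h
      refine add_mem ?_ (Submodule.smul_mem _ _ ?_)
      · by_cases h' : letterDeg i ≤ wordDeg w
        · rw [add_tsub_assoc_of_le h']
          exact mul_mem_homComp (gen_mem q j) (ih.1 h')
        · rw [ih.2 h', mul_zero]
          exact zero_mem _
      · by_cases hj : j = i
        · subst hj
          rw [der_gen_self, one_mul, add_tsub_cancel_left]
          exact prod_gen_mem q w
        · rw [der_gen_of_ne q hj, zero_mul]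
          exact zero_mem _
    · intro h
      have h' : ¬ letterDeg i ≤ wordDeg w := fun h' => h (h'.trans (by simp))
      have hj : j ≠ i := by
        rintro rfl
        exact h (by simp)
      rw [ih.2 h', der_gen_of_ne q hj, mul_zero, zero_mul, smul_zero, add_zero]

theorem der_mem {q : ℂ} {α : Deg} {x : NA q} (hx : x ∈ homComp q α) (i : Fin 2) :
    der q i x ∈ homComp q (α - letterDeg i) := by
  refine homComp_induction (P := fun x => der q i x ∈ homComp q (α - letterDeg i))
    ?_ ?_ ?_ ?_ x hx
  · rintro w rfl
    by_cases h : letterDeg i ≤ wordDeg w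
    · exact (der_word_mem q i w).1 h
    · rw [(der_word_mem q i w).2 h]
      exact zero_mem _
  · simp
  · intro a b ha hb
    rw [map_add]
    exact add_mem ha hb
  · intro r a ha
    rw [map_smul]
    exact Submodule.smul_mem _ _ ha

theorem der_eq_zero {q : ℂ} {α : Deg} {x : NA q} (hx : x ∈ homComp q α) {i : Fin 2}
    (h : ¬ letterDeg i ≤ α) : der q i x = 0 := by
  refine homComp_induction (P := fun x => der q i x = 0) ?_ ?_ ?_ ?_ x hx
  · rintro w rfl
    exact (der_word_mem q i w).2 h
  · simp
  · intro a b ha hb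
    rw [map_add, ha, hb, add_zero]
  · intro r a ha
    rw [map_smul, ha, smul_zero]

theorem eq_zero_of_mem_Bge {q : ℂ} {α : Deg} (h : α.1 < α.2) {x : NA q} (hx : x ∈ homComp q α)
    (hB : x ∈ Bge q) : x = 0 := by
  rw [← comp_of_mem hx]
  refine Bge_induction (P := fun x => comp q α x = 0) ?_ ?_ ?_ x hB
  · intro β hβ y hy
    exact comp_of_mem_ne (by rintro rfl; omega) hy
  · simp
  · intro a b ha hb
    rw [map_add, ha, hb, add_zero]

theorem eq_zero_of_mem_Kge {q : ℂ} {α : Deg} (h : α.1 < α.2) {x : NA q} (hx : x ∈ homComp q α)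
    (hB : x ∈ Kge q) : x = 0 := eq_zero_of_mem_Bge h hx (Kge_le_Bge hB)

theorem letterDeg_zero : letterDeg 0 = (1, 0) := rfl
theorem letterDeg_one : letterDeg 1 = (0, 1) := rfl

theorem theta_ne_zero {q : ℂ} (hq0 : q ≠ 0) (hq : ∀ n : ℕ, 0 < n → q ^ n ≠ 1) :
    theta q ≠ 0 := by
  intro h
  have h2 := hq 2 (by norm_num)
  apply h2
  rw [theta] at h
  field_simp at h
  linear_combination h

/-- An element of `K_{≥ 1}` of degree `N δ` that commutes with `x₁` is zero. -/
theorem eq_zero_of_commute_gen {q : ℂ} (hq0 : q ≠ 0) (hq : ∀ n : ℕ, 0 < n → q ^ n ≠ 1) {N : ℕ}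
    (hN : 1 ≤ N) {z : NA q} (hz : z ∈ homComp q (N, N)) (hK : z ∈ Kge q)
    (hc : z * gen q 0 = gen q 0 * z) : z = 0 := by
  obtain ⟨N, rfl⟩ : ∃ m, N = m + 1 := ⟨N - 1, by omega⟩
  have h0 : der q 0 z = 0 := by
    refine eq_zero_of_mem_Kge (α := (N, N + 1)) (by simp) ?_ (der_mem_Kge hK 0)
    simpa [letterDeg] using der_mem hz 0
  have hw : der q 1 z ∈ homComp q (N + 1, N) := by simpa [letterDeg] using der_mem hz 1
  have hwK := der_mem_Kge hK 1
  set w := der q 1 z with hwd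
  -- The commutation relation differentiated by ∂₂; as ∂₂(x₁) = 0, only `w` = ∂₂(z) remains.
  have h1 : gen q 0 * w = q⁻¹ • (w * gen q 0) := by
    have h := congrArg (der q 1) hc
    rw [der_mul_of_mem q 1 _ (gen_mem q 0), der_mul_of_mem q 1 _ hz, der_gen_of_ne q (by decide),
      mul_zero, zero_add, zero_mul, smul_zero, add_zero] at h
    rw [← h]
    simp [chi, letterDeg, braidingMatrix]
    rfl
  have hp : der q 0 w ∈ homComp q (N, N) := by simpa [letterDeg] using der_mem hw 0
  have hpK := der_mem_Kge hwK 0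
  set p := der q 0 w with hpd
  -- Differentiating again, by ∂₁, turns the q-commutation into a commutator; the coefficient q -
  -- q⁻¹ of `w` is nonzero.
  have h2 : p * gen q 0 - gen q 0 * p = theta q • w := by
    have h := congrArg (der q 0) h1
    rw [map_smul, der_mul_of_mem q 0 _ (gen_mem q 0), der_mul_of_mem q 0 _ hw, der_gen_self,
      mul_one, one_mul] at h
    have e1 : chi q (letterDeg 0) (N + 1, N) = q := by
      simp [chi, letterDeg, braidingMatrix, pow_succ]
      field_simp
    have e2 : chi q (letterDeg 0) (letterDeg 0) = q := by
      simp [chi, letterDeg, braidingMatrix]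
    rw [e1, e2, smul_add, smul_smul, inv_mul_cancel₀ hq0, one_smul] at h
    rw [theta]
    linear_combination (norm := module) -h
  have hpp : der q 0 p = 0 := by
    rcases Nat.eq_zero_or_pos N with rfl | hN
    · exact der_eq_zero hp (by simp [letterDeg])
    · refine eq_zero_of_mem_Kge (α := (N - 1, N)) (by simpa using hN) ?_ (der_mem_Kge hpK 0)
      simpa [letterDeg] using der_mem hp 0
  -- A third differentiation annihilates the commutator because χ(α₁, Nδ) = 1 and ∂₁(p) = 0; thus p
  -- = 0, and then w = 0.
  have h3 : theta q • p = 0 := by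
    have h := congrArg (der q 0) h2
    rw [map_smul, map_sub, der_mul_of_mem q 0 _ (gen_mem q 0), der_mul_of_mem q 0 _ hp,
      der_gen_self, hpp, mul_one, one_mul] at h
    have e1 : chi q (letterDeg 0) (N, N) = 1 := by
      simp [chi, letterDeg, braidingMatrix, hq0]
    rw [e1] at h
    simpa using h.symm
  have hth := theta_ne_zero hq0 hq
  have h4 : p = 0 := (smul_eq_zero.1 h3).resolve_left hth
  have h5 : w = 0 := by
    rw [h4] at h2
    simpa [hth] using h2.symm
  refine eq_zero_of_der q (counit_of_mem (by simp) hz) fun i => ?_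
  fin_cases i
  · exact h0
  · exact h5

/-! ### Lyndon words -/

/-- The comparison is decided at a position inside both words, so it is unaffected by what follows.
-/
theorem append_lt_append_of_not_prefix {u w : Word} (h : u < w) (hp : ¬ u <+: w) (s t : Word) :
    u ++ s < w ++ t := by
  induction u generalizing w with
  | nil => exact absurd List.nil_prefix hp
  | cons a u ih =>
    cases w with
    | nil => exact absurd h (by simp)
    | cons b w =>
      rw [List.cons_lt_cons_iff] at h
      rw [List.cons_append, List.cons_append, List.cons_lt_cons_iff]
      rcases h with h | ⟨rfl, h⟩
      · exact Or.inl h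
      · exact Or.inr ⟨rfl, ih h fun hp' => hp (List.prefix_cons_inj a |>.2 hp')⟩

/-- Used throughout the root vector part: a word larger than `u` and no longer than `u` is also
larger than every extension of `u`. -/
theorem append_lt_of_length_le {u g : Word} (h : u < g) (hl : g.length ≤ u.length) (t : Word) :
    u ++ t < g := by
  have := append_lt_append_of_not_prefix h (fun hp => by
    have := hp.eq_of_length_le hl
    exact absurd h (by rw [this]; exact lt_irrefl _)) t []
  simpa using this

theorem append_lt_append_left_iff (u s t : Word) : u ++ s < u ++ t ↔ s < t := by
  induction u with
  | nil => rfl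
  | cons a u ih => rw [List.cons_append, List.cons_append, List.cons_lt_cons_iff]; simp [ih]

theorem lt_append {u t : Word} (h : t ≠ []) : u < u ++ t := by
  have := (append_lt_append_left_iff u [] t).2 (by cases t; exact absurd rfl h; simp)
  simpa using this

theorem IsLyndon.append_lt_right {u v : Word} (hv : IsLyndon v) (hu : u ≠ [])
    (h : u < v) : u ++ v < v := by
  by_cases hp : u <+: v
  · obtain ⟨t, rfl⟩ := hp
    rw [append_lt_append_left_iff]
    refine hv.2 u t hu ?_ rfl
    rintro rfl
    simp at h
  · simpa using append_lt_append_of_not_prefix h hp v []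

theorem IsLyndon.append {u v : Word} (hu : IsLyndon u) (hv : IsLyndon v) (h : u < v) :
    IsLyndon (u ++ v) := by
  refine ⟨by simp [hu.1], fun a b ha hb hab => ?_⟩
  rcases List.append_eq_append_iff.1 hab with ⟨c, rfl, rfl⟩ | ⟨c, rfl, rfl⟩
  · rcases eq_or_ne c [] with rfl | hc
    · exact hv.append_lt_right hu.1 h
    · exact (hv.append_lt_right hu.1 h).trans (hv.2 c b hc hb rfl)
  · rcases eq_or_ne c [] with rfl | hc
    · exact hv.append_lt_right hu.1 h
    · have h1 := hu.2 a c ha hc rfl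
      have h2 := append_lt_of_length_le (u := a ++ c) h1 (by simp) v
      exact h2.trans (lt_append hv.1)

theorem isLyndon_singleton (i : Fin 2) : IsLyndon [i] := by
  refine ⟨by simp, fun u v hu hv h => ?_⟩
  have := congrArg List.length h
  have h1 := List.length_pos_iff.2 hu
  have h2 := List.length_pos_iff.2 hv
  simp at this
  omega

theorem IsLyndon.drop_lt {w : Word} (hw : IsLyndon w) {i : ℕ} (h0 : 0 < i) (hi : i < w.length) :
    w < w.drop i :=
  hw.2 (w.take i) _ (by simp; exact ⟨by omega, hw.1⟩) (by simpa using hi) (by simp)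

/-- A Lyndon word with at least two letters is the product of two Lyndon words. -/
theorem IsLyndon.exists_factorization {w : Word} (hw : IsLyndon w) (hl : 2 ≤ w.length) :
    ∃ i, 0 < i ∧ i < w.length ∧ IsLyndon (w.take i) ∧ IsLyndon (w.drop i) := by
  have hne : (Finset.Ico 1 w.length).Nonempty := by simp; omega
  -- Cut before the smallest proper suffix. Its own suffixes are suffixes of `w`, so it is Lyndon.
  -- If some suffix `s` of the left factor were below that factor, appending the right factor would
  -- contradict the Lyndon property of `w`, or, when `s` is a prefix, the minimality of the cut.
  obtain ⟨i, hi, hmin⟩ := Finset.exists_min_image (Finset.Ico 1 w.length) (fun i => w.drop i) hne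
  rw [Finset.mem_Ico] at hi
  have hlt : ∀ j, 1 ≤ j → j < w.length → j ≠ i → w.drop i < w.drop j := by
    intro j h1 h2 h3
    refine lt_of_le_of_ne (hmin j (by simp; omega)) fun h => h3 ?_
    have := congrArg List.length h
    simp at this
    omega
  refine ⟨i, hi.1, hi.2, ⟨?_, ?_⟩, ?_, ?_⟩
  · simp; exact ⟨by omega, hw.1⟩
  · intro u s hu hs hus
    have hul := List.length_pos_iff.2 hu
    have hsl := List.length_pos_iff.2 hs
    have hlen := congrArg List.length hus
    simp only [List.length_take, List.length_append] at hlen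
    have hwd : w = u ++ (s ++ w.drop i) := by
      rw [← List.append_assoc, ← hus, List.take_append_drop]
    have h1 : w < s ++ w.drop i := by
      refine hw.2 u _ hu (by simp [hs]) hwd
    by_contra hnot
    have hle : s < w.take i := lt_of_le_of_ne (not_lt.1 hnot) (by
      intro h
      have := congrArg List.length h
      simp at this
      omega)
    by_cases hp : s <+: w.take i
    · obtain ⟨r, hr⟩ := hp
      have hwd2 : w = s ++ (r ++ w.drop i) := by
        rw [← List.append_assoc, hr, List.take_append_drop]
      rw [hwd2, append_lt_append_left_iff, ← hwd2] at h1
      have hrd : r ++ w.drop i = w.drop s.length := by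
        conv_rhs => rw [hwd2]
        simp
      rw [hrd] at h1
      have := hlt s.length hsl (by omega) (by omega)
      exact absurd h1 this.asymm
    · have := append_lt_append_of_not_prefix hle hp (w.drop i) (w.drop i)
      rw [List.take_append_drop] at this
      exact absurd h1 this.asymm
  · simp; omega
  · intro u s hu hs hus
    have hul := List.length_pos_iff.2 hu
    have hsl := List.length_pos_iff.2 hs
    have hlen := congrArg List.length hus
    simp only [List.length_drop, List.length_append] at hlen
    have : s = w.drop (i + u.length) := by
      rw [← List.drop_drop, hus]; simp
    rw [this]
    exact hlt _ (by omega) (by omega) (by omega)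

theorem shirshovLength_spec {w : Word} (hw : IsLyndon w) (hl : 2 ≤ w.length) :
    0 < shirshovLength w ∧ shirshovLength w < w.length ∧ IsLyndon (w.take (shirshovLength w)) ∧
      IsLyndon (w.drop (shirshovLength w)) :=
  Nat.sInf_mem (s := {i | 0 < i ∧ i < w.length ∧ IsLyndon (w.take i) ∧ IsLyndon (w.drop i)})
    (hw.exists_factorization hl)

/-- The shortest admissible left factor corresponds to the longest Lyndon right factor, so only the
longer right factors have to be excluded. -/
theorem shirshovLength_append {u v : Word} (hu : IsLyndon u) (hv : IsLyndon v)
    (h : ∀ j, 0 < j → j < u.length → ¬ IsLyndon (u.drop j ++ v)) :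
    shirshovLength (u ++ v) = u.length := by
  have hul := List.length_pos_iff.2 hu.1
  have hvl := List.length_pos_iff.2 hv.1
  have hmem : u.length ∈ {i | 0 < i ∧ i < (u ++ v).length ∧ IsLyndon ((u ++ v).take i) ∧
      IsLyndon ((u ++ v).drop i)} := by
    refine ⟨hul, by simp; omega, by simpa using hu, by simpa using hv⟩
  apply le_antisymm (Nat.sInf_le hmem)
  by_contra hlt
  rw [not_le] at hlt
  have hspec := Nat.sInf_mem ⟨_, hmem⟩
  rw [← shirshovLength] at hspec
  refine h _ hspec.1 hlt ?_
  have := hspec.2.2.2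
  rwa [List.drop_append_of_le_length (i := shirshovLength (u ++ v)) hlt.le] at this

theorem superLetter_letter (q : ℂ) (i : Fin 2) : superLetter q [i] = gen q i := by
  rw [superLetter, dif_neg]
  · simp
  · simp; omega

theorem superLetter_append (q : ℂ) {u v : Word} (hu : u ≠ []) (hv : v ≠ [])
    (h : shirshovLength (u ++ v) = u.length) :
    superLetter q (u ++ v) = bracket q (superLetter q u) (superLetter q v) := by
  have hul := List.length_pos_iff.2 hu
  have hvl := List.length_pos_iff.2 hv
  rw [superLetter, dif_pos]
  · rw [h]; simp
  · rw [h]; simp; omega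

/-- Since q₁₂ = q₂₁ = q⁻¹, the exponents of q combine to a product of differences. Consequently Nδ
pairs with every degree up to sign, and brackets of imaginary elements are commutators or
anticommutators. -/
theorem chi_eq {q : ℂ} (hq0 : q ≠ 0) (a b c d : ℕ) : chi q (a, b) (c, d) =
    (-1) ^ (b * d) * q ^ (((a : ℤ) - b) * ((c : ℤ) - d)) := by
  have : ((a : ℤ) - b) * ((c : ℤ) - d) = (a * c : ℕ) - (a * d : ℕ) - (b * c : ℕ) + (b * d : ℕ) := by
    push_cast; ring
  rw [this, zpow_add₀ hq0, zpow_sub₀ hq0, zpow_sub₀ hq0]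
  simp only [zpow_natCast, chi, braidingMatrix, Matrix.of_apply, Matrix.cons_val', Matrix.cons_val_zero,
    Matrix.cons_val_one, Matrix.cons_val_fin_one]
  rw [neg_pow q]
  simp only [inv_pow]
  field_simp

theorem bracket_mem {q : ℂ} {α β : Deg} {x y : NA q} (hx : x ∈ homComp q α)
    (hy : y ∈ homComp q β) : bracket q x y ∈ homComp q (α + β) := by
  rw [bracket_of_mem hx hy]
  refine sub_mem (mul_mem_homComp hx hy) (Submodule.smul_mem _ _ ?_)
  rw [add_comm]
  exact mul_mem_homComp hy hx

theorem superLetter_mem (q : ℂ) (w : Word) : superLetter q w ∈ homComp q (wordDeg w) := by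
  induction hn : w.length using Nat.strong_induction_on generalizing w with
  | _ n ih =>
    rw [superLetter]
    split_ifs with h
    · have := bracket_mem (ih _ (by simp; omega) (w.take (shirshovLength w)) rfl)
        (ih _ (by simp; omega) (w.drop (shirshovLength w)) rfl)
      rwa [← wordDeg_append, List.take_append_drop] at this
    · exact prod_gen_mem q w

/-! ### The words of `X_n`, `Y_n`, `L_n` and `M_{2n+1}` -/

theorem wordPow_succ (w : Word) (n : ℕ) : wordPow w (n + 1) = w ++ wordPow w n := by
  simp [wordPow, List.replicate_succ]

theorem wordPow_succ' (w : Word) (n : ℕ) : wordPow w (n + 1) = wordPow w n ++ w := by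
  simp [wordPow, List.replicate_succ']

/-- The word of `X_{n+1}`. -/
def wordX (n : ℕ) : Word := 0 :: wordPow [0, 1] n
/-- The word of `Y_{n+1}`. -/
def wordY (n : ℕ) : Word := wordPow [0, 1] n ++ [1]
/-- The word of `L_{n+1}`. -/
def wordL (n : ℕ) : Word := 0 :: wordY n
/-- The word of `M_{2n+1}`. -/
def wordM (n : ℕ) : Word := wordPow [0, 0, 1, 1] n ++ [0, 1]

theorem wordX_succ (n : ℕ) : wordX (n + 1) = wordX n ++ [0, 1] := by
  rw [wordX, wordPow_succ']; rfl
theorem wordY_succ (n : ℕ) : wordY (n + 1) = [0, 1] ++ wordY n := by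
  rw [wordY, wordPow_succ]; rfl
theorem wordM_succ (n : ℕ) : wordM (n + 1) = [0, 0, 1, 1] ++ wordM n := by
  rw [wordM, wordPow_succ]; rfl
theorem wordM_zero : wordM 0 = [0, 1] := rfl

theorem isLyndon_zero_one : IsLyndon [0, 1] :=
  (isLyndon_singleton 0).append (isLyndon_singleton 1) (by decide)

theorem wordX_lt (n : ℕ) : wordX n < [0, 1] := by
  cases n with
  | zero => decide
  | succ n => rw [wordX, wordPow_succ]; exact List.cons_lt_cons_iff.2 (Or.inr ⟨rfl, List.cons_lt_cons_iff.2 (Or.inl (by decide))⟩)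

theorem isLyndon_wordX (n : ℕ) : IsLyndon (wordX n) := by
  induction n with
  | zero => exact isLyndon_singleton 0
  | succ n ih =>
    rw [wordX_succ]
    exact ih.append isLyndon_zero_one (wordX_lt n)

theorem lt_wordY (n : ℕ) : [0, 1] < wordY n := by
  cases n with
  | zero => decide
  | succ n => rw [wordY_succ]; exact lt_append (by simp [wordY])

theorem isLyndon_wordY (n : ℕ) : IsLyndon (wordY n) := by
  induction n with
  | zero => exact isLyndon_singleton 1
  | succ n ih =>
    rw [wordY_succ]
    exact isLyndon_zero_one.append ih (lt_wordY n)

theorem isLyndon_wordL (n : ℕ) : IsLyndon (wordL n) :=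
  (isLyndon_singleton 0).append (isLyndon_wordY n) (lt_trans (by decide) (lt_wordY n))

theorem lt_wordM (n : ℕ) : [0, 0, 1, 1] < wordM n := by
  cases n with
  | zero => decide
  | succ n => rw [wordM_succ]; exact lt_append (by simp [wordM])

theorem isLyndon_wordM (n : ℕ) : IsLyndon (wordM n) := by
  induction n with
  | zero => exact isLyndon_zero_one
  | succ n ih =>
    rw [wordM_succ]
    exact (isLyndon_wordL 1).append ih (lt_wordM n)

theorem superLetter_wordX_zero (q : ℂ) : superLetter q (wordX 0) = gen q 0 :=
  superLetter_letter q 0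

theorem superLetter_wordY_zero (q : ℂ) : superLetter q (wordY 0) = gen q 1 :=
  superLetter_letter q 1

theorem superLetter_zero_one (q : ℂ) :
    superLetter q [0, 1] = bracket q (gen q 0) (gen q 1) := by
  rw [← superLetter_letter, ← superLetter_letter]
  refine superLetter_append q (u := [0]) (v := [1]) (by simp) (by simp)
    (shirshovLength_append (isLyndon_singleton 0) (isLyndon_singleton 1) ?_)
  intro j h1 h2
  simp at h2
  omega

/-- Excludes longer Lyndon right factors of `wordX (n + 1)`: such a factor would have to be smaller
than its suffix 01. -/
theorem not_drop_wordPow_lt (n : ℕ) : ∀ k, ¬ (wordPow [0, 1] n).drop k ++ [0, 1] < [0, 1] := by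
  induction n with
  | zero => intro k; simp [wordPow]
  | succ n ih =>
    intro k
    rw [wordPow_succ]
    match k with
    | 0 => simp
    | 1 => simp [List.cons_lt_cons_iff]
    | k + 2 => simpa using ih k

theorem superLetter_wordX_succ (q : ℂ) (n : ℕ) :
    superLetter q (wordX (n + 1)) =
      bracket q (superLetter q (wordX n)) (superLetter q [0, 1]) := by
  rw [wordX_succ]
  refine superLetter_append q (isLyndon_wordX n).1 (by simp)
    (shirshovLength_append (isLyndon_wordX n) isLyndon_zero_one ?_)
  intro j h1 h2 h3
  obtain ⟨k, rfl⟩ : ∃ k, j = k + 1 := ⟨j - 1, by omega⟩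
  have := h3.2 _ [0, 1] (by simp; omega) (by simp) rfl
  rw [wordX, List.drop_succ_cons] at this
  exact not_drop_wordPow_lt n k this

theorem not_one_cons_lt (w : Word) : ¬ 1 :: w < w := by
  induction w with
  | nil => simp
  | cons a w ih =>
    rw [List.cons_lt_cons_iff]
    rintro (h | ⟨rfl, h⟩)
    · exact absurd h (by fin_cases a <;> decide)
    · exact ih h

theorem not_isLyndon_one_cons {w : Word} (hw : w ≠ []) : ¬ IsLyndon (1 :: w) :=
  fun h => not_one_cons_lt w (h.2 [1] w (by simp) hw rfl)

theorem superLetter_wordY_succ (q : ℂ) (n : ℕ) :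
    superLetter q (wordY (n + 1)) =
      bracket q (superLetter q [0, 1]) (superLetter q (wordY n)) := by
  rw [wordY_succ]
  refine superLetter_append q (by simp) (isLyndon_wordY n).1
    (shirshovLength_append isLyndon_zero_one (isLyndon_wordY n) ?_)
  intro j h1 h2 h3
  simp at h2
  obtain rfl : j = 1 := by omega
  exact not_isLyndon_one_cons (isLyndon_wordY n).1 h3

theorem superLetter_wordL (q : ℂ) (n : ℕ) :
    superLetter q (wordL n) = bracket q (gen q 0) (superLetter q (wordY n)) := by
  rw [← superLetter_letter]
  refine superLetter_append q (u := [0]) (by simp) (isLyndon_wordY n).1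
    (shirshovLength_append (isLyndon_singleton 0) (isLyndon_wordY n) ?_)
  intro j h1 h2
  simp at h2
  omega

theorem superLetter_wordM_succ (q : ℂ) (n : ℕ) :
    superLetter q (wordM (n + 1)) =
      bracket q (superLetter q (wordL 1)) (superLetter q (wordM n)) := by
  rw [wordM_succ]
  refine superLetter_append q (by simp) (isLyndon_wordM n).1
    (shirshovLength_append (isLyndon_wordL 1) (isLyndon_wordM n) ?_)
  intro j h1 h2 h3
  change j < 4 at h2
  change IsLyndon (List.drop j [0, 0, 1, 1] ++ wordM n) at h3
  have : j = 1 ∨ j = 2 ∨ j = 3 := by omega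
  -- The longer right factors start with 011, 11 or 1. The first exceeds its suffix `wordM n`; the
  -- others begin with the larger letter.
  rcases this with rfl | rfl | rfl
  · have := h3.2 [0, 1, 1] (wordM n) (by simp) (isLyndon_wordM n).1 (by simp)
    cases n with
    | zero => simp [wordM_zero] at this
    | succ n => simp [wordM_succ, List.cons_lt_cons_iff] at this
  · exact not_isLyndon_one_cons (w := 1 :: wordM n) (by simp) (by simpa using h3)
  · exact not_isLyndon_one_cons (isLyndon_wordM n).1 (by simpa using h3)

theorem wordDeg_wordX (n : ℕ) : wordDeg (wordX n) = (n + 1, n) := by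
  induction n with
  | zero => decide
  | succ n ih => rw [wordX_succ, wordDeg_append, ih]; rfl
theorem wordDeg_wordY (n : ℕ) : wordDeg (wordY n) = (n, n + 1) := by
  induction n with
  | zero => decide
  | succ n ih =>
    rw [wordY_succ, wordDeg_append, ih, add_comm]; rfl
theorem wordDeg_wordL (n : ℕ) : wordDeg (wordL n) = (n + 1, n + 1) := by
  rw [wordL, wordDeg_cons, wordDeg_wordY]; simp [letterDeg, add_comm]
theorem wordDeg_wordM (n : ℕ) : wordDeg (wordM n) = (2 * n + 1, 2 * n + 1) := by
  induction n with
  | zero => decide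
  | succ n ih =>
    rw [wordM_succ, wordDeg_append, ih]
    simp [wordDeg]; omega

/-! ### The elements -/

/-- `L_1`. -/
def ev (q : ℂ) : NA q := gen q 0 * gen q 1 - q⁻¹ • (gen q 1 * gen q 0)

/-- `X_{i+1}`. -/
def xv (q : ℂ) : ℕ → NA q
  | 0 => gen q 0
  | i + 1 => xv q i * ev q - (-1 : ℂ) ^ i • (ev q * xv q i)

/-- `Y_{j+1}`. -/
def yv (q : ℂ) : ℕ → NA q
  | 0 => gen q 1
  | j + 1 => ev q * yv q j + (-1 : ℂ) ^ j • (yv q j * ev q)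

/-- `[X_{i+1}, Y_{j+1}]`. -/
def zv (q : ℂ) (i j : ℕ) : NA q :=
  xv q i * yv q j - ((-1 : ℂ) ^ (i * (j + 1)) * q⁻¹) • (yv q j * xv q i)

theorem superLetter_zero_one_eq (q : ℂ) : superLetter q [0, 1] = ev q := by
  rw [superLetter_zero_one, bracket_of_mem (gen_mem q 0) (gen_mem q 1), ev]
  congr 2
  simp [chi, letterDeg, braidingMatrix]

theorem ev_mem (q : ℂ) : ev q ∈ homComp q (1, 1) := by
  rw [← superLetter_zero_one_eq q]
  exact superLetter_mem q _

theorem xv_eq {q : ℂ} (hq0 : q ≠ 0) (n : ℕ) : superLetter q (wordX n) = xv q n := by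
  induction n with
  | zero => exact superLetter_wordX_zero q
  | succ n ih =>
    have h := superLetter_mem q (wordX n)
    rw [superLetter_wordX_succ, superLetter_zero_one_eq, bracket_of_mem h (ev_mem q),
      wordDeg_wordX, chi_eq hq0, ih, xv]
    simp

theorem xv_mem {q : ℂ} (hq0 : q ≠ 0) (n : ℕ) : xv q n ∈ homComp q (n + 1, n) := by
  rw [← xv_eq hq0, ← wordDeg_wordX]
  exact superLetter_mem q _

theorem yv_eq {q : ℂ} (hq0 : q ≠ 0) (n : ℕ) : superLetter q (wordY n) = yv q n := by
  induction n with
  | zero => exact superLetter_wordY_zero q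
  | succ n ih =>
    have h := superLetter_mem q (wordY n)
    rw [superLetter_wordY_succ, superLetter_zero_one_eq, bracket_of_mem (ev_mem q) h,
      wordDeg_wordY, chi_eq hq0, ih, yv, sub_eq_add_neg, ← neg_smul]
    simp [pow_succ]

theorem yv_mem {q : ℂ} (hq0 : q ≠ 0) (n : ℕ) : yv q n ∈ homComp q (n, n + 1) := by
  rw [← yv_eq hq0, ← wordDeg_wordY]
  exact superLetter_mem q _

theorem bracket_xv_yv {q : ℂ} (hq0 : q ≠ 0) (i j : ℕ) : bracket q (xv q i) (yv q j) = zv q i j := by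
  rw [bracket_of_mem (xv_mem hq0 i) (yv_mem hq0 j), zv, chi_eq hq0]
  simp

theorem zv_mem {q : ℂ} (hq0 : q ≠ 0) (i j : ℕ) : zv q i j ∈ homComp q (i + j + 1, i + j + 1) := by
  rw [← bracket_xv_yv hq0]
  have := bracket_mem (xv_mem hq0 i) (yv_mem hq0 j)
  convert this using 2
  simp; omega

theorem X_succ {q : ℂ} (hq0 : q ≠ 0) (n : ℕ) : X q (n + 1) = xv q n := xv_eq hq0 n

theorem Y_succ {q : ℂ} (hq0 : q ≠ 0) (n : ℕ) : Y q (n + 1) = yv q n := yv_eq hq0 n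

theorem L_succ {q : ℂ} (hq0 : q ≠ 0) (n : ℕ) : L q (n + 1) = zv q 0 n := by
  rw [L, if_neg (by omega), X_succ hq0 0, Y_succ hq0, bracket_xv_yv hq0]

theorem L'_succ {q : ℂ} (hq0 : q ≠ 0) (n : ℕ) : L' q (n + 2) = zv q 1 n := by
  rw [L', if_neg (by omega), X_succ hq0 1]
  exact (congrArg _ (Y_succ hq0 n)).trans (bracket_xv_yv hq0 1 n)

theorem L_one {q : ℂ} (hq0 : q ≠ 0) : L q 1 = ev q := by
  rw [L_succ hq0 0, zv, ev]; simp [xv, yv]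

theorem superLetter_wordL_eq {q : ℂ} (hq0 : q ≠ 0) (n : ℕ) : superLetter q (wordL n) = L q (n + 1) := by
  rw [superLetter_wordL, L_succ hq0, yv_eq hq0, ← bracket_xv_yv hq0]; rfl

theorem M_zero {q : ℂ} (hq0 : q ≠ 0) : M q 1 = ev q := by rw [M]; exact L_one hq0

theorem M_succ (q : ℂ) (n : ℕ) : M q (2 * (n + 1) + 1) = bracket q (L q 2) (M q (2 * n + 1)) := by
  have h1 : (2 * (n + 1) + 1) / 2 = (2 * n + 1) / 2 + 1 := by omega
  rw [M, h1, Function.iterate_succ_apply', ← M]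

theorem superLetter_wordM_eq {q : ℂ} (hq0 : q ≠ 0) (n : ℕ) : superLetter q (wordM n) = M q (2 * n + 1) := by
  induction n with
  | zero => rw [wordM_zero, superLetter_zero_one_eq]; exact (M_zero hq0).symm
  | succ n ih => rw [superLetter_wordM_succ, ih, superLetter_wordL_eq hq0, M_succ]

theorem L_mem {q : ℂ} (hq0 : q ≠ 0) (n : ℕ) : L q n ∈ homComp q (n, n) := by
  cases n with
  | zero =>
    rw [L, if_pos rfl, Algebra.algebraMap_eq_smul_one]
    exact Submodule.smul_mem _ _ (one_mem_homComp q)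
  | succ n =>
    rw [L_succ hq0]
    simpa using zv_mem hq0 0 n

theorem L'_mem {q : ℂ} (hq0 : q ≠ 0) (n : ℕ) : L' q n ∈ homComp q (n, n) := by
  match n with
  | 0 => rw [L', if_pos (by omega)]; exact L_mem hq0 0
  | 1 => rw [L', if_pos (by omega)]; exact L_mem hq0 1
  | n + 2 =>
    rw [L'_succ hq0]
    convert zv_mem hq0 1 n using 3 <;> omega

theorem M_mem {q : ℂ} (hq0 : q ≠ 0) (n : ℕ) : M q (2 * n + 1) ∈ homComp q (2 * n + 1, 2 * n + 1) := by
  rw [← superLetter_wordM_eq hq0, ← wordDeg_wordM]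
  exact superLetter_mem q _

/-! ### First relations -/

theorem der_zero_ev (q : ℂ) : der q 0 (ev q) = 0 := by
  rw [ev, map_sub, map_smul, der_mul_of_mem q 0 _ (gen_mem q 1),
    der_mul_of_mem q 0 _ (gen_mem q 0), der_gen_self, der_gen_of_ne q (by decide)]
  simp [chi, letterDeg, braidingMatrix]

theorem der_one_ev (q : ℂ) : der q 1 (ev q) = (1 - q⁻¹ ^ 2) • gen q 0 := by
  rw [ev, map_sub, map_smul, der_mul_of_mem q 1 _ (gen_mem q 1),
    der_mul_of_mem q 1 _ (gen_mem q 0), der_gen_self, der_gen_of_ne q (by decide)]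
  simp [chi, letterDeg, braidingMatrix]
  module

theorem xv_one (q : ℂ) : xv q 1 = gen q 0 * ev q - ev q * gen q 0 := by simp [xv]

theorem yv_one (q : ℂ) : yv q 1 = ev q * gen q 1 + gen q 1 * ev q := by simp [yv]

section

variable {q : ℂ}

theorem chi_letter_zero (hq0 : q ≠ 0) (a b : ℕ) :
    chi q (letterDeg 0) (a, b) = q ^ ((a : ℤ) - b) := by
  rw [letterDeg_zero, chi_eq hq0]; simp

theorem chi_letter_one (hq0 : q ≠ 0) (a b : ℕ) :
    chi q (letterDeg 1) (a, b) = (-1) ^ b * q ^ ((b : ℤ) - a) := by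
  rw [letterDeg_one, chi_eq hq0]; simp

theorem gen_zero_mem (q : ℂ) : gen q 0 ∈ homComp q (1, 0) := gen_mem q 0
theorem gen_one_mem (q : ℂ) : gen q 1 ∈ homComp q (0, 1) := gen_mem q 1

/-- Both skew derivations kill the difference of the two sides. This relation and its mirror image
for the Y's are the only commutation rules verified by direct differentiation. -/
theorem xv_zero_mul_one (hq0 : q ≠ 0) : xv q 0 * xv q 1 = q • (xv q 1 * xv q 0) := by
  have hx := gen_zero_mem q
  have he := ev_mem q
  have hX : xv q 1 ∈ homComp q (2, 1) := xv_mem hq0 1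
  have d0 : der q 0 (xv q 1) = 0 := by
    rw [xv_one, map_sub, der_mul_of_mem q 0 _ he, der_mul_of_mem q 0 _ hx, der_zero_ev,
      der_gen_self, chi_letter_zero hq0]
    simp
  have d1 : der q 1 (xv q 1) = ((1 - q⁻¹ ^ 2) * (1 - q⁻¹)) • (gen q 0 * gen q 0) := by
    rw [xv_one, map_sub, der_mul_of_mem q 1 _ he, der_mul_of_mem q 1 _ hx, der_one_ev,
      der_gen_of_ne q (by decide), chi_letter_one hq0, chi_letter_one hq0]
    simp only [mul_smul_comm, smul_mul_assoc]
    simp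
    module
  rw [← sub_eq_zero]
  refine eq_zero_of_der q (counit_of_mem (α := (3, 1)) (by simp) ?_) fun i => ?_
  · exact sub_mem (mul_mem_homComp hx hX) (Submodule.smul_mem _ _ (mul_mem_homComp hX hx))
  · change der q i (gen q 0 * xv q 1 - q • (xv q 1 * gen q 0)) = 0
    rw [map_sub, map_smul, der_mul_of_mem q i _ hX, der_mul_of_mem q i _ hx]
    fin_cases i
    · simp only [Fin.zero_eta]
      rw [d0, der_gen_self, chi_letter_zero hq0, chi_letter_zero hq0]
      simp
    · simp only [Fin.mk_one]
      rw [d1, der_gen_of_ne q (by decide), chi_letter_one hq0, chi_letter_one hq0]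
      simp [mul_assoc, smul_smul, hq0]

theorem yv_one_mul_zero (hq0 : q ≠ 0) : yv q 1 * yv q 0 = q • (yv q 0 * yv q 1) := by
  have hy := gen_one_mem q
  have he := ev_mem q
  have hY : yv q 1 ∈ homComp q (1, 2) := yv_mem hq0 1
  have d0 : der q 0 (yv q 1) = 0 := by
    rw [yv_one, map_add, der_mul_of_mem q 0 _ he, der_mul_of_mem q 0 _ hy, der_zero_ev,
      der_gen_of_ne q (by decide)]
    simp
  have d1 : der q 1 (yv q 1) = (-theta q) • ev q := by
    rw [yv_one, map_add, der_mul_of_mem q 1 _ he, der_mul_of_mem q 1 _ hy, der_one_ev,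
      der_gen_self, chi_letter_one hq0, chi_letter_one hq0, ev, theta]
    simp only [mul_smul_comm, smul_mul_assoc, mul_one, one_mul, Nat.cast_one, Nat.cast_zero,
      sub_self, sub_zero, zpow_zero, zpow_one, pow_one]
    match_scalars <;> field_simp <;> ring
  rw [← sub_eq_zero]
  refine eq_zero_of_der q (counit_of_mem (α := (1, 3)) (by simp) ?_) fun i => ?_
  · exact sub_mem (mul_mem_homComp hY hy) (Submodule.smul_mem _ _ (mul_mem_homComp hy hY))
  · change der q i (yv q 1 * gen q 1 - q • (gen q 1 * yv q 1)) = 0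
    rw [map_sub, map_smul, der_mul_of_mem q i _ hY, der_mul_of_mem q i _ hy]
    fin_cases i
    · simp only [Fin.zero_eta]
      rw [d0, der_gen_of_ne q (by decide)]
      simp
    · simp only [Fin.mk_one]
      rw [d1, der_gen_self, chi_letter_one hq0, chi_letter_one hq0, yv_one, theta]
      simp only [mul_smul_comm, smul_mul_assoc, mul_one, one_mul, Nat.cast_one, Nat.cast_zero,
        Nat.cast_ofNat, sub_zero, zpow_one, pow_one]
      rw [show ((2 : ℤ) - 1) = 1 by norm_num, zpow_one]
      match_scalars <;> field_simp <;> ring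

end

/-! ### Coproducts -/

section

variable {q : ℂ}

theorem coprodOp_tmul {β : Deg} {a : NA q} (ha : a ∈ homComp q β) (b x : NA q) :
    coprodOp q x (a ⊗ₜ b) = rightMul q β a b (coprod q x) := by
  obtain ⟨t, rfl⟩ := proj_surjective q x
  have h := coprodOpAux_rightMul ha b t (1 ⊗ₜ 1)
  have h' : rightMul q β a b (1 ⊗ₜ 1) = a ⊗ₜ b := by simp [rightMul]
  rw [h', ← coprodOp_proj] at h
  rw [h, ← coprod]

theorem rightMul_tmul (β : Deg) (a b c d : NA q) :
    rightMul q β a b (c ⊗ₜ d) = (c * a) ⊗ₜ (twist q β d * b) := by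
  simp [rightMul]

theorem rightMul_mem {β : Deg} (hβ : β.2 ≤ β.1) {a : NA q} (ha : a ∈ homComp q β) (b : NA q)
    {z : NA q ⊗[ℂ] NA q} (hz : z ∈ BgeTensor q) : rightMul q β a b z ∈ BgeTensor q := by
  refine BgeTensor_induction (P := fun z => rightMul q β a b z ∈ BgeTensor q) ?_ ?_ _ hz
  · intro c hc d
    rw [rightMul_tmul]
    exact tmul_mem_BgeTensor (mul_mem_Bge hc (mem_Bge hβ ha)) _
  · intro c d hc hd
    rw [map_add]
    exact add_mem hc hd

theorem coprodOp_mem {x : NA q} (hx : x ∈ Kge q) {z : NA q ⊗[ℂ] NA q} (hz : z ∈ BgeTensor q) :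
    coprodOp q x z ∈ BgeTensor q := by
  refine BgeTensor_induction (P := fun z => coprodOp q x z ∈ BgeTensor q) ?_ ?_ _ hz
  · intro a ha b
    refine Bge_induction (P := fun a => coprodOp q x (a ⊗ₜ b) ∈ BgeTensor q) ?_ ?_ ?_ a ha
    · intro β hβ a ha
      rw [coprodOp_tmul ha]
      exact rightMul_mem hβ ha b hx
    · simp
    · intro c d hc hd
      rw [TensorProduct.add_tmul, map_add]
      exact add_mem hc hd
  · intro c d hc hd
    rw [map_add]
    exact add_mem hc hd

theorem coprod_mul (x y : NA q) : coprod q (x * y) = coprodOp q x (coprod q y) := by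
  rw [coprod, map_mul, Module.End.mul_apply, ← coprod]

theorem coprod_add (x y : NA q) : coprod q (x + y) = coprod q x + coprod q y := by
  rw [coprod, map_add]; rfl

theorem coprod_smul (r : ℂ) (x : NA q) : coprod q (r • x) = r • coprod q x := by
  rw [coprod, map_smul]; rfl

theorem coprod_sub (x y : NA q) : coprod q (x - y) = coprod q x - coprod q y := by
  rw [coprod, map_sub]; rfl

theorem coprodOp_gen (i : Fin 2) (a b : NA q) : coprodOp q (gen q i) (a ⊗ₜ b) =
    (gen q i * a) ⊗ₜ b + twist q (letterDeg i) a ⊗ₜ (gen q i * b) := by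
  rw [gen, coprodOp_proj, coprodOpAux, FreeAlgebra.lift_ι_apply]
  simp [gen]

theorem coprod_gen (i : Fin 2) : coprod q (gen q i) = gen q i ⊗ₜ 1 + 1 ⊗ₜ gen q i := by
  rw [coprod, coprodOp_gen]; simp

theorem coprod_ev : coprod q (ev q) =
    ev q ⊗ₜ 1 + (1 - q⁻¹ ^ 2) • (gen q 0 ⊗ₜ[ℂ] gen q 1) + 1 ⊗ₜ ev q := by
  have e1 : chi q (letterDeg 0) (letterDeg 1) = q⁻¹ := by simp [chi, letterDeg, braidingMatrix]
  have e2 : chi q (letterDeg 1) (letterDeg 0) = q⁻¹ := by simp [chi, letterDeg, braidingMatrix]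
  rw [ev, coprod_sub, coprod_smul, coprod_mul, coprod_mul, coprod_gen, coprod_gen, map_add,
    map_add, coprodOp_gen, coprodOp_gen, coprodOp_gen, coprodOp_gen,
    twist_of_mem _ (gen_mem q 0), twist_of_mem _ (gen_mem q 1), map_one, map_one, e1, e2]
  simp only [mul_one, TensorProduct.sub_tmul, TensorProduct.tmul_sub, TensorProduct.smul_tmul,
    TensorProduct.tmul_smul]
  module

theorem gen_zero_mem_Kge (q : ℂ) : gen q 0 ∈ Kge q := by
  change coprod q (gen q 0) ∈ BgeTensor q
  rw [coprod_gen]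
  exact add_mem (tmul_mem_BgeTensor (mem_Bge (by simp) (gen_zero_mem q)) _)
    (tmul_mem_BgeTensor (mem_Bge le_rfl (one_mem_homComp q)) _)

theorem ev_mem_Kge (q : ℂ) : ev q ∈ Kge q := by
  change coprod q (ev q) ∈ BgeTensor q
  rw [coprod_ev]
  exact add_mem (add_mem (tmul_mem_BgeTensor (mem_Bge (by simp) (ev_mem q)) _)
    (Submodule.smul_mem _ _ (tmul_mem_BgeTensor (mem_Bge (by simp) (gen_zero_mem q)) _)))
    (tmul_mem_BgeTensor (mem_Bge le_rfl (one_mem_homComp q)) _)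

theorem xv_mem_Kge (q : ℂ) (i : ℕ) : xv q i ∈ Kge q := by
  induction i with
  | zero => exact gen_zero_mem_Kge q
  | succ i ih =>
    exact sub_mem (mul_mem ih (ev_mem_Kge q))
      ((Kge q).smul_mem (mul_mem (ev_mem_Kge q) ih) _)

/-- `Δ(Y_{j+1}) - Y_{j+1} ⊗ 1` lies in `B_{≥ 1} ⊗ B(V)`. -/
theorem coprod_yv (hq0 : q ≠ 0) (j : ℕ) :
    coprod q (yv q j) - yv q j ⊗ₜ 1 ∈ BgeTensor q := by
  induction j with
  | zero =>
    rw [yv, coprod_gen, add_sub_cancel_left]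
    exact tmul_mem_BgeTensor (mem_Bge le_rfl (one_mem_homComp q)) _
  | succ j ih =>
    have hY := yv_mem hq0 j
    have he := ev_mem q
    obtain ⟨r, hr⟩ : ∃ r, r = coprod q (yv q j) - yv q j ⊗ₜ 1 := ⟨_, rfl⟩
    rw [← hr] at ih
    have hc : coprod q (yv q j) = yv q j ⊗ₜ 1 + r := by rw [hr]; abel
    have h1 : coprod q (ev q * yv q j) = (ev q * yv q j) ⊗ₜ 1 +
        ((1 - q⁻¹ ^ 2) * chi q (j, j + 1) (letterDeg 1)) • ((gen q 0 * yv q j) ⊗ₜ gen q 1) +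
        (chi q (j, j + 1) (1, 1)) • (yv q j ⊗ₜ ev q) + coprodOp q (ev q) r := by
      rw [coprod_mul, hc, map_add, coprodOp_tmul hY, coprod_ev, map_add, map_add, map_smul,
        rightMul_tmul, rightMul_tmul, rightMul_tmul, map_one, twist_of_mem _ (gen_mem q 1),
        twist_of_mem _ he, one_mul, mul_one, mul_one, one_mul, TensorProduct.tmul_smul,
        TensorProduct.tmul_smul, smul_smul]
    have h2 : coprod q (yv q j * ev q) = (yv q j * ev q) ⊗ₜ 1 +
        (1 - q⁻¹ ^ 2) • ((yv q j * gen q 0) ⊗ₜ gen q 1) + yv q j ⊗ₜ ev q +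
        (rightMul q (1, 1) (ev q) 1 r +
          (1 - q⁻¹ ^ 2) • rightMul q (1, 0) (gen q 0) (gen q 1) r +
          rightMul q 0 1 (ev q) r) := by
      rw [coprod_mul, coprod_ev, map_add, map_add, map_smul, coprodOp_tmul he,
        coprodOp_tmul (gen_zero_mem q), coprodOp_tmul (one_mem_homComp q), hc, map_add, map_add,
        map_add, rightMul_tmul, rightMul_tmul, rightMul_tmul, map_one, map_one, map_one, one_mul,
        mul_one, one_mul, one_mul]
      module
    -- The two contributions Y_{j+1} ⊗ L₁ cancel because of this sign.
    have e1 : chi q (j, j + 1) (1, 1) = - (-1) ^ j := by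
      rw [chi_eq hq0]; simp [pow_succ]
    have h3 : coprod q (yv q (j + 1)) - yv q (j + 1) ⊗ₜ 1 =
        ((1 - q⁻¹ ^ 2) * chi q (j, j + 1) (letterDeg 1)) • ((gen q 0 * yv q j) ⊗ₜ gen q 1) +
        coprodOp q (ev q) r + (-1 : ℂ) ^ j • ((1 - q⁻¹ ^ 2) • ((yv q j * gen q 0) ⊗ₜ gen q 1) +
        (rightMul q (1, 1) (ev q) 1 r +
          (1 - q⁻¹ ^ 2) • rightMul q (1, 0) (gen q 0) (gen q 1) r +
          rightMul q 0 1 (ev q) r)) := by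
      rw [yv, coprod_add, coprod_smul, h1, h2, e1, TensorProduct.add_tmul,
        ← TensorProduct.smul_tmul']
      module
    rw [h3]
    have m1 : gen q 0 * yv q j ∈ Bge q :=
      mem_Bge (by simp) (mul_mem_homComp (gen_zero_mem q) hY)
    have m2 : yv q j * gen q 0 ∈ Bge q :=
      mem_Bge (by simp) (mul_mem_homComp hY (gen_zero_mem q))
    exact add_mem (add_mem (Submodule.smul_mem _ _ (tmul_mem_BgeTensor m1 _))
      (coprodOp_mem (ev_mem_Kge q) ih)) (Submodule.smul_mem _ _ (add_mem (Submodule.smul_mem _ _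
        (tmul_mem_BgeTensor m2 _)) (add_mem (add_mem (rightMul_mem le_rfl he _ ih)
        (Submodule.smul_mem _ _ (rightMul_mem (by simp) (gen_zero_mem q) _ ih)))
        (rightMul_mem le_rfl (one_mem_homComp q) _ ih))))

/-- Δ(Y_{j+1}) leaves B_{≥1} ⊗ B only through Y_{j+1} ⊗ 1. In the braided commutator with x₁ the
cross terms Y_{j+1} ⊗ x₁ cancel, and the leading terms have left degree (j + 1)δ. -/
theorem zv_zero_mem_Kge (hq0 : q ≠ 0) (j : ℕ) : zv q 0 j ∈ Kge q := by
  have hY := yv_mem hq0 j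
  have hx := gen_zero_mem q
  obtain ⟨r, hr⟩ : ∃ r, r = coprod q (yv q j) - yv q j ⊗ₜ 1 := ⟨_, rfl⟩
  have ih := coprod_yv hq0 j
  rw [← hr] at ih
  have hc : coprod q (yv q j) = yv q j ⊗ₜ 1 + r := by rw [hr]; abel
  have e1 : chi q (j, j + 1) (1, 0) = q⁻¹ := by
    rw [chi_eq hq0]; simp
  have h1 : coprod q (gen q 0 * yv q j) = (gen q 0 * yv q j) ⊗ₜ 1 +
      q⁻¹ • (yv q j ⊗ₜ gen q 0) + coprodOp q (gen q 0) r := by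
    rw [coprod_mul, hc, map_add, coprodOp_tmul hY, coprod_gen, map_add,
      rightMul_tmul, rightMul_tmul, map_one, twist_of_mem _ hx, one_mul, mul_one, one_mul,
      TensorProduct.tmul_smul, e1]
  have h2 : coprod q (yv q j * gen q 0) = (yv q j * gen q 0) ⊗ₜ 1 + yv q j ⊗ₜ gen q 0 +
      (rightMul q (1, 0) (gen q 0) 1 r + rightMul q 0 1 (gen q 0) r) := by
    rw [coprod_mul, coprod_gen, map_add, coprodOp_tmul hx, coprodOp_tmul (one_mem_homComp q), hc,
      map_add, map_add, rightMul_tmul, rightMul_tmul, map_one, map_one, one_mul, mul_one, one_mul]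
    abel
  have h3 : coprod q (zv q 0 j) = (gen q 0 * yv q j) ⊗ₜ 1 - q⁻¹ • ((yv q j * gen q 0) ⊗ₜ 1) +
      coprodOp q (gen q 0) r - q⁻¹ • (rightMul q (1, 0) (gen q 0) 1 r +
        rightMul q 0 1 (gen q 0) r) := by
    rw [zv, zero_mul, pow_zero, one_mul, xv, coprod_sub, coprod_smul, h1, h2]
    module
  change coprod q (zv q 0 j) ∈ BgeTensor q
  rw [h3]
  have m1 : gen q 0 * yv q j ∈ Bge q :=
    mem_Bge (by simp) (mul_mem_homComp hx hY)
  have m2 : yv q j * gen q 0 ∈ Bge q :=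
    mem_Bge (by simp) (mul_mem_homComp hY hx)
  exact sub_mem (add_mem (sub_mem (tmul_mem_BgeTensor m1 _)
    (Submodule.smul_mem _ _ (tmul_mem_BgeTensor m2 _))) (coprodOp_mem (gen_zero_mem_Kge q) ih))
    (Submodule.smul_mem _ _ (add_mem (rightMul_mem (by simp) hx _ ih)
      (rightMul_mem le_rfl (one_mem_homComp q) _ ih)))

end

/-! ### Identities in algebras -/

section identities

variable {A : Type*} [Ring A] [Algebra ℂ A] {q : ℂ}

/-- Bracketing the q-commutation of `x` and `x'` with `y`: the bracket of `x` with [x', y] is traded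
for one of `x'` with [x, y]. The parameters `a`, `b` will be the signs in the braided brackets. -/
theorem commutator_left_of_qcommute (hq0 : q ≠ 0) {x x' y z z' : A} {a b : ℂ}
    (h : x * x' = q • (x' * x))
    (hz : z = x * y - (a * q⁻¹) • (y * x)) (hz' : z' = x' * y - (b * q⁻¹) • (y * x')) :
    x * z' - a • (z' * x) = q • (x' * z) - (b * q⁻¹) • (z * x') := by
  subst hz hz'
  linear_combination (norm := skip) h * y - (a * b * q⁻¹ * q⁻¹) • (y * h)
  simp only [mul_sub, sub_mul, smul_mul_assoc, mul_smul_comm, mul_assoc, smul_sub, smul_smul]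
  match_scalars <;> field_simp <;> ring

theorem commutator_right_of_qcommute (hq0 : q ≠ 0) {x y y' z z' : A} {a b : ℂ}
    (h : y' * y = q • (y * y'))
    (hz : z = x * y - (a * q⁻¹) • (y * x)) (hz' : z' = x * y' - (b * q⁻¹) • (y' * x)) :
    z' * y - a • (y * z') = q • (z * y') - (b * q⁻¹) • (y' * z) := by
  subst hz hz'
  linear_combination (norm := skip) x * h - (a * b * q⁻¹ * q⁻¹) • (h * x)
  simp only [mul_sub, sub_mul, smul_mul_assoc, mul_smul_comm, mul_assoc, smul_sub, smul_smul]
  match_scalars <;> field_simp <;> ring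

/-- The anticommutator of `e` with the q-commutation of neighbours yields a relation between
elements at distance two. -/
theorem left_qcommute_distance_two {e x0 x1 x2 : A} {s : ℂ} (hs : s = 1 ∨ s = -1)
    (h : x0 * x1 = q • (x1 * x0)) (h1 : x1 = x0 * e - s • (e * x0))
    (h2 : x2 = x1 * e + s • (e * x1)) :
    x0 * x2 = (s + q) • (x1 * x1) + (q * s) • (x2 * x0) := by
  subst h2 h1
  linear_combination (norm := skip) h * e + e * h
  simp only [mul_add, add_mul, mul_sub, sub_mul, smul_mul_assoc, mul_smul_comm, mul_assoc,
    smul_add, smul_sub, smul_smul]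
  rcases hs with rfl | rfl <;> match_scalars <;> ring

theorem right_qcommute_distance_two {e y0 y1 y2 : A} {s : ℂ} (hs : s = 1 ∨ s = -1)
    (h : y1 * y0 = q • (y0 * y1)) (h1 : y1 = e * y0 + s • (y0 * e))
    (h2 : y2 = e * y1 - s • (y1 * e)) :
    y2 * y0 = (q - s) • (y1 * y1) - (q * s) • (y0 * y2) := by
  subst h2 h1
  linear_combination (norm := skip) h * e + e * h
  simp only [mul_add, add_mul, mul_sub, sub_mul, smul_mul_assoc, mul_smul_comm, mul_assoc,
    smul_add, smul_sub, smul_smul]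
  rcases hs with rfl | rfl <;> match_scalars <;> ring

/-- The distance-two relation bracketed with `y0`. -/
theorem commutator_left_distance_two (hq0 : q ≠ 0) {x0 x1 x2 y0 e z1 z2 : A}
    (h : x0 * x2 = (1 + q) • (x1 * x1) + q • (x2 * x0))
    (he : e = x0 * y0 - q⁻¹ • (y0 * x0)) (hz1 : z1 = x1 * y0 + q⁻¹ • (y0 * x1))
    (hz2 : z2 = x2 * y0 - q⁻¹ • (y0 * x2)) :
    x0 * z2 - z2 * x0 = q • (x2 * e) - q⁻¹ • (e * x2) +
      (1 + q) • (x1 * z1 - q⁻¹ • (z1 * x1)) := by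
  subst he hz1 hz2
  linear_combination (norm := skip) h * y0 - (q⁻¹ * q⁻¹) • (y0 * h)
  simp only [mul_add, add_mul, mul_sub, sub_mul, smul_mul_assoc, mul_smul_comm, mul_assoc,
    smul_add, smul_sub, smul_smul]
  match_scalars <;> field_simp <;> ring

theorem commutator_right_distance_two (hq0 : q ≠ 0) {x0 y0 y1 y2 e z1 z2 : A}
    (h : y2 * y0 = (q - 1) • (y1 * y1) - q • (y0 * y2))
    (he : e = x0 * y0 - q⁻¹ • (y0 * x0)) (hz1 : z1 = x0 * y1 - q⁻¹ • (y1 * x0))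
    (hz2 : z2 = x0 * y2 - q⁻¹ • (y2 * x0)) :
    z2 * y0 + y0 * z2 = - (q • (e * y2)) - q⁻¹ • (y2 * e) +
      (q - 1) • (z1 * y1 + q⁻¹ • (y1 * z1)) := by
  subst he hz1 hz2
  linear_combination (norm := skip) x0 * h - (q⁻¹ * q⁻¹) • (h * x0)
  simp only [mul_sub, sub_mul, smul_mul_assoc, mul_smul_comm, mul_assoc,
    smul_add, smul_sub, smul_smul]
  match_scalars <;> field_simp <;> ring

/-- Substituting the action of `h` on `x0` and the formula for `z2` into `hc` produces q² + q + 1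
times the claim, so primitive cube roots of unity must be excluded. The mirror statement needs q² -
q + 1 ≠ 0 instead. -/
theorem commutator_h_left_one (hq0 : q ≠ 0) (hq3 : q ^ 2 + q + 1 ≠ 0) {e h x0 x1 x2 x3 z2 : A}
    (h1 : x1 = x0 * e - e * x0) (h2 : x2 = x1 * e + e * x1) (h3 : x3 = x2 * e - e * x2)
    (hK : x0 * h - h * x0 = (1 + q) • x2 - (q - q⁻¹) • (e * x1))
    (hz : z2 = (2⁻¹ : ℂ) • ((q - q⁻¹) • (e * h + h * e) - (h * e - e * h)))
    (hc : x0 * z2 - z2 * x0 = q • (x2 * e) - q⁻¹ • (e * x2) +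
      (1 + q) • (x1 * (h - e * e) - q⁻¹ • ((h - e * e) * x1))) :
    h * x1 - x1 * h = - ((q - q⁻¹) • (e * x2)) - (q - 1) • x3 := by
  subst h3 h2 h1 hz
  refine smul_right_injective A hq3 ?_
  dsimp only
  linear_combination (norm := skip) q • ((2 : ℂ) • hc -
    (q - q⁻¹ - 1) • (hK * e) - (q - q⁻¹ + 1) • (e * hK))
  simp only [mul_add, add_mul, mul_sub, sub_mul, smul_mul_assoc, mul_smul_comm, mul_assoc,
    smul_add, smul_sub, smul_smul]
  match_scalars <;> field_simp <;> ring

theorem commutator_h_right_one (hq0 : q ≠ 0) (hq3 : q ^ 2 - q + 1 ≠ 0) {e h y0 y1 y2 y3 z2 : A}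
    (h1 : y1 = e * y0 + y0 * e) (h2 : y2 = e * y1 - y1 * e) (h3 : y3 = e * y2 + y2 * e)
    (hK : h * y0 - y0 * h = (q - 1) • y2 + (q - q⁻¹) • (y1 * e))
    (hz : z2 = (2⁻¹ : ℂ) • ((q - q⁻¹) • (e * h + h * e) - (h * e - e * h)))
    (hc : z2 * y0 + y0 * z2 = - (q • (e * y2)) - q⁻¹ • (y2 * e) +
      (q - 1) • ((h + e * e) * y1 + q⁻¹ • (y1 * (h + e * e)))) :
    h * y1 - y1 * h = - ((q - q⁻¹) • (y2 * e)) + (q + 1) • y3 := by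
  subst h3 h2 h1 hz
  refine smul_right_injective A hq3 ?_
  dsimp only
  linear_combination (norm := skip) (-q) • ((2 : ℂ) • hc +
    (q - q⁻¹ - 1) • (hK * e) - (q - q⁻¹ + 1) • (e * hK))
  simp only [mul_add, add_mul, mul_sub, sub_mul, smul_mul_assoc, mul_smul_comm, mul_assoc,
    smul_add, smul_sub, smul_smul]
  match_scalars <;> field_simp <;> ring

/-- The Leibniz rule for [h, ·] on a braided bracket of an X and a Y. The sign conditions reflect
how braiding signs change when one index is raised. -/
theorem commutator_h_bracket (hq0 : q ≠ 0) {e h x0 x1 x2 y0 y1 y2 : A} {s t a b c : ℂ}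
    (hs : s = 1 ∨ s = -1) (ht : t = 1 ∨ t = -1) (ha : a = 1 ∨ a = -1) (hb : b = - t * a)
    (hc : c = s * a)
    (h1 : x1 = x0 * e - s • (e * x0)) (h2 : y1 = e * y0 + t • (y0 * e))
    (hx : h * x0 - x0 * h = ((q - q⁻¹) * s) • (e * x1) - (q + s) • x2)
    (hy : h * y0 - y0 * h = ((q - q⁻¹) * t) • (y1 * e) + (q - t) • y2) :
    h * (x0 * y0 - (a * q⁻¹) • (y0 * x0)) - (x0 * y0 - (a * q⁻¹) • (y0 * x0)) * h =
      (q - q⁻¹) • (s • (e * (x1 * y0 - (b * q⁻¹) • (y0 * x1))) +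
        t • ((x0 * y1 - (c * q⁻¹) • (y1 * x0)) * e)) -
      (q + s) • (x2 * y0 - (a * q⁻¹) • (y0 * x2)) +
      (q - t) • (x0 * y2 - (a * q⁻¹) • (y2 * x0)) := by
  subst h1 h2 hb hc
  linear_combination (norm := skip) hx * y0 + x0 * hy - (a * q⁻¹) • (hy * x0 + y0 * hx)
  simp only [mul_add, add_mul, mul_sub, sub_mul, smul_mul_assoc, mul_smul_comm, mul_assoc,
    smul_add, smul_sub, smul_smul]
  rcases hs with rfl | rfl <;> rcases ht with rfl | rfl <;> rcases ha with rfl | rfl <;>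
    match_scalars <;> field_simp <;> ring

/-- The two computed commutators have left sides adding up to zero. Eliminating the remaining `z`'s
by `hE`, `hE'` leaves q² + 1 times the commutator of `e * e` with `h`. -/
theorem commute_square_h (hq0 : q ≠ 0) (hq4 : q ^ 2 + 1 ≠ 0) {e h z02 z11 z03 z12 z21 z30 : A}
    (h11 : z11 = z02 + (h * e - e * h))
    (h01 : h * (h + e * e) - (h + e * e) * h =
      (q - q⁻¹) • (e * z11 - z02 * e) - (q + 1) • z21 + (q + 1) • z03)
    (h10 : h * (h - e * e) - (h - e * e) * h =
      (q - q⁻¹) • (z11 * e - e * z02) - (q - 1) • z30 + (q - 1) • z12)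
    (hE : z03 - z21 = e * e * h - h * (e * e)) (hE' : z12 - z30 = e * e * h - h * (e * e)) :
    e * e * h = h * (e * e) := by
  subst h11
  refine smul_right_injective A hq4 ?_
  dsimp only
  linear_combination (norm := skip) (-q) • (h01 + h10 + (q + 1) • hE +
    (q - 1) • hE')
  simp only [mul_add, add_mul, mul_sub, sub_mul, smul_mul_assoc, mul_smul_comm, mul_assoc,
    smul_add, smul_sub, smul_smul]
  match_scalars <;> field_simp <;> ring

/-- Commuting `h` with the relation `r` and correcting by the commutator of e² with `r` and the
anticommutator of e with `r` yields the next relation, up to the factor q² + 1. -/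
theorem left_qcommute_succ (hq0 : q ≠ 0) (hq4 : q ^ 2 + 1 ≠ 0) {e h x0 x1 x2 x3 : A} {s : ℂ}
    (hs : s = 1 ∨ s = -1)
    (r : x0 * x1 = q • (x1 * x0)) (h1 : x1 = x0 * e - s • (e * x0))
    (h2 : x2 = x1 * e + s • (e * x1)) (h3 : x3 = x2 * e - s • (e * x2))
    (hx : h * x0 - x0 * h = ((q - q⁻¹) * s) • (e * x1) - (q + s) • x2)
    (hx1 : h * x1 - x1 * h = -(((q - q⁻¹) * s) • (e * x2)) - (q - s) • x3) :
    x1 * x2 = q • (x2 * x1) := by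
  subst h3 h2 h1
  refine smul_right_injective A hq4 ?_
  dsimp only
  linear_combination (norm := skip) (s * q) • ((h * r - r * h) -
    (hx * (x0 * e - s • (e * x0)) + x0 * hx1 - q • (hx1 * x0) -
      q • ((x0 * e - s • (e * x0)) * hx)) - (q - s) • (e * e * r - r * (e * e)) +
      (q - q⁻¹) • (e * (r * e + e * r)))
  simp only [mul_add, add_mul, mul_sub, sub_mul, smul_mul_assoc, mul_smul_comm, mul_assoc,
    smul_add, smul_sub, smul_smul, mul_neg, neg_mul, smul_neg]
  rcases hs with rfl | rfl <;> match_scalars <;> field_simp <;> ring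

theorem right_qcommute_succ (hq0 : q ≠ 0) (hq4 : q ^ 2 + 1 ≠ 0) {e h y0 y1 y2 y3 : A} {s : ℂ}
    (hs : s = 1 ∨ s = -1)
    (r : y1 * y0 = q • (y0 * y1)) (h1 : y1 = e * y0 + s • (y0 * e))
    (h2 : y2 = e * y1 - s • (y1 * e)) (h3 : y3 = e * y2 + s • (y2 * e))
    (hy : h * y0 - y0 * h = ((q - q⁻¹) * s) • (y1 * e) + (q - s) • y2)
    (hy1 : h * y1 - y1 * h = -(((q - q⁻¹) * s) • (y2 * e)) + (q + s) • y3) :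
    y2 * y1 = q • (y1 * y2) := by
  subst h3 h2 h1
  refine smul_right_injective A hq4 ?_
  dsimp only
  linear_combination (norm := skip) (s * q) • ((h * r - r * h) -
    (hy1 * y0 + (e * y0 + s • (y0 * e)) * hy - q • (y0 * hy1) -
      q • (hy * (e * y0 + s • (y0 * e)))) - (q + s) • (e * e * r - r * (e * e)) -
      (q - q⁻¹) • ((r * e + e * r) * e))
  simp only [mul_add, add_mul, mul_sub, sub_mul, smul_mul_assoc, mul_smul_comm, mul_assoc,
    smul_add, smul_sub, smul_smul, mul_neg, neg_mul, smul_neg]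
  rcases hs with rfl | rfl <;> match_scalars <;> field_simp <;> ring

end identities

/-! ### The action of `L_1` and `L_2` on the `X_i`, `Y_j` and `[X_i, Y_j]` -/

/-- `q` is not a root of unity. -/
def Generic (q : ℂ) : Prop := q ≠ 0 ∧ ∀ n : ℕ, 0 < n → q ^ n ≠ 1

section generic

variable {q : ℂ}

theorem Generic.ne_zero (hq : Generic q) : q ≠ 0 := hq.1

theorem Generic.theta_ne (hq : Generic q) : q - q⁻¹ ≠ 0 := theta_ne_zero hq.1 hq.2

theorem Generic.three (hq : Generic q) : q ^ 2 + q + 1 ≠ 0 := fun h =>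
  hq.2 3 (by norm_num) (by linear_combination (q - 1) * h)

theorem Generic.six (hq : Generic q) : q ^ 2 - q + 1 ≠ 0 := fun h =>
  hq.2 6 (by norm_num) (by linear_combination (q ^ 4 + q ^ 3 - q - 1) * h)

theorem Generic.four (hq : Generic q) : q ^ 2 + 1 ≠ 0 := fun h =>
  hq.2 4 (by norm_num) (by linear_combination (q ^ 2 - 1) * h)

end generic

theorem neg_one_pow_cases (n : ℕ) : (-1 : ℂ) ^ n = 1 ∨ (-1 : ℂ) ^ n = -1 :=
  neg_one_pow_eq_or ℂ n

theorem sign_succ_left (i j : ℕ) :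
    (-1 : ℂ) ^ ((i + 1) * (j + 1)) = - (-1) ^ j * (-1) ^ (i * (j + 1)) := by ring

theorem sign_succ_right (i j : ℕ) :
    (-1 : ℂ) ^ (i * (j + 1 + 1)) = (-1) ^ i * (-1) ^ (i * (j + 1)) := by ring

theorem zv_zero_zero (q : ℂ) : zv q 0 0 = ev q := by simp [zv, ev, xv, yv]

/-- The super-derivation given by `L_1`. -/
theorem ev_zv (q : ℂ) (i j : ℕ) : ev q * zv q i j - (-1 : ℂ) ^ (i + j + 1) • (zv q i j * ev q) =
    (-1 : ℂ) ^ i • (zv q i (j + 1) - zv q (i + 1) j) := by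
  simp only [zv, sign_succ_left, sign_succ_right, xv, yv, pow_succ, pow_add]
  have hs := neg_one_pow_cases i
  have ht := neg_one_pow_cases j
  generalize (-1 : ℂ) ^ (i * (j + 1)) = a
  generalize (-1 : ℂ) ^ i = s at *
  generalize (-1 : ℂ) ^ j = t at *
  generalize xv q i = x
  generalize yv q j = y
  generalize ev q = e
  simp only [mul_add, add_mul, mul_sub, sub_mul, smul_mul_assoc, mul_smul_comm, mul_assoc,
    smul_add, smul_sub, smul_smul]
  rcases hs with rfl | rfl <;> rcases ht with rfl | rfl <;> match_scalars <;> ring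

/-- The square of the odd superderivation given by L₁ is the commutator with L₁², so it shifts the
index by two; the sign differs for the X's and the Y's. -/
theorem ev_sq_xv (q : ℂ) (i : ℕ) :
    ev q * ev q * xv q i - xv q i * (ev q * ev q) = - xv q (i + 2) := by
  have hs := neg_one_pow_cases i
  simp only [xv, pow_succ]
  generalize (-1 : ℂ) ^ i = s at *
  simp only [mul_sub, sub_mul, smul_mul_assoc, mul_smul_comm, mul_assoc, smul_sub, smul_smul]
  rcases hs with rfl | rfl <;> match_scalars <;> ring

theorem ev_sq_yv (q : ℂ) (j : ℕ) :
    ev q * ev q * yv q j - yv q j * (ev q * ev q) = yv q (j + 2) := by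
  have hs := neg_one_pow_cases j
  simp only [yv, pow_succ]
  generalize (-1 : ℂ) ^ j = s at *
  simp only [mul_add, add_mul, smul_mul_assoc, mul_smul_comm, mul_assoc, smul_add, smul_smul]
  rcases hs with rfl | rfl <;> match_scalars <;> ring

/-- Hence L₁² commutes with [X_{i+1}, Y_{j+1}] exactly when two may be moved from one index to the
other. -/
theorem ev_sq_zv (q : ℂ) (i j : ℕ) :
    ev q * ev q * zv q i j - zv q i j * (ev q * ev q) = zv q i (j + 2) - zv q (i + 2) j := by
  have h1 := ev_sq_xv q i
  have h2 := ev_sq_yv q j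
  have e1 : (-1 : ℂ) ^ ((i + 2) * (j + 1)) = (-1 : ℂ) ^ (i * (j + 1)) := by
    rw [add_mul, pow_add, pow_mul (-1) 2]; simp
  have e2 : (-1 : ℂ) ^ (i * (j + 2 + 1)) = (-1 : ℂ) ^ (i * (j + 1)) := by
    rw [show i * (j + 2 + 1) = i * (j + 1) + 2 * i by ring, pow_add, pow_mul (-1) 2]; simp
  simp only [zv, e1, e2]
  linear_combination (norm := skip) h1 * yv q j + xv q i * h2 -
    ((-1 : ℂ) ^ (i * (j + 1)) * q⁻¹) • (h2 * xv q i + yv q j * h1)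
  simp only [mul_sub, sub_mul, smul_mul_assoc, mul_smul_comm, mul_assoc, smul_sub, smul_add,
    neg_mul, mul_neg]
  module

/-- `L̃_2`. -/
def hv (q : ℂ) : NA q := zv q 0 1 - ev q * ev q

theorem zv_zero_one (q : ℂ) : zv q 0 1 = hv q + ev q * ev q := by rw [hv]; abel

theorem zv_one_zero (q : ℂ) : zv q 1 0 = hv q - ev q * ev q := by
  have := ev_zv q 0 0
  rw [zv_zero_zero] at this
  rw [hv]
  linear_combination (norm := skip) this
  simp

section action

variable {q : ℂ}

theorem hv_xv_zero (hq0 : q ≠ 0) : hv q * xv q 0 - xv q 0 * hv q =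
    (q - q⁻¹) • (ev q * xv q 1) - (q + 1) • xv q 2 := by
  have h := commutator_left_of_qcommute (a := 1) (b := -1) hq0 (xv_zero_mul_one hq0)
    (z := ev q) (z' := zv q 1 0) (y := yv q 0) (by simp [ev, xv, yv]) (by simp [zv])
  rw [zv_one_zero] at h
  have h1 := ev_sq_xv q 0
  have h2 : xv q 2 = xv q 1 * ev q + ev q * xv q 1 := by rw [xv]; simp
  rw [zero_add, h2] at h1
  rw [h2]
  linear_combination (norm := skip) h1 - h
  simp only [mul_sub, sub_mul]
  module

theorem hv_yv_zero (hq0 : q ≠ 0) : hv q * yv q 0 - yv q 0 * hv q =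
    (q - q⁻¹) • (yv q 1 * ev q) + (q - 1) • yv q 2 := by
  have h := commutator_right_of_qcommute (a := 1) (b := 1) hq0 (yv_one_mul_zero hq0)
    (z := ev q) (z' := zv q 0 1) (x := xv q 0) (by simp [ev, xv, yv]) (by simp [zv])
  rw [zv_zero_one] at h
  have h1 := ev_sq_yv q 0
  have h2 : yv q 2 = ev q * yv q 1 - yv q 1 * ev q := by rw [yv]; simp [sub_eq_add_neg]
  rw [zero_add, h2] at h1
  rw [h2]
  linear_combination (norm := skip) h - h1
  simp only [add_mul, mul_add]
  module

/-- The action of `L̃_2` on `[X_i, Y_j]`. -/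
theorem hv_zv (hq0 : q ≠ 0) {i j : ℕ}
    (hx : hv q * xv q i - xv q i * hv q =
      ((q - q⁻¹) * (-1) ^ i) • (ev q * xv q (i + 1)) - (q + (-1) ^ i) • xv q (i + 2))
    (hy : hv q * yv q j - yv q j * hv q =
      ((q - q⁻¹) * (-1) ^ j) • (yv q (j + 1) * ev q) + (q - (-1) ^ j) • yv q (j + 2)) :
    hv q * zv q i j - zv q i j * hv q =
      (q - q⁻¹) • ((-1 : ℂ) ^ i • (ev q * zv q (i + 1) j) + (-1 : ℂ) ^ j • (zv q i (j + 1) * ev q))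
      - (q + (-1) ^ i) • zv q (i + 2) j + (q - (-1) ^ j) • zv q i (j + 2) := by
  have e1 : (-1 : ℂ) ^ ((i + 2) * (j + 1)) = (-1 : ℂ) ^ (i * (j + 1)) := by
    rw [add_mul, pow_add, pow_mul (-1) 2]; simp
  have e2 : (-1 : ℂ) ^ (i * (j + 2 + 1)) = (-1 : ℂ) ^ (i * (j + 1)) := by
    rw [show i * (j + 2 + 1) = i * (j + 1) + 2 * i by ring, pow_add, pow_mul (-1) 2]; simp
  have := commutator_h_bracket hq0 (neg_one_pow_cases i) (neg_one_pow_cases j)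
    (neg_one_pow_cases (i * (j + 1))) rfl rfl (xv.eq_2 q i) (yv.eq_2 q j) hx hy
  simp only [zv, e1, e2, sign_succ_left, sign_succ_right]
  exact this

/-- The action of `hv` on [X₁, Y₁] = L₁. Since L₁² commutes with L₁, the brackets with indices (2,
0) and (0, 2) agree, and the formula can be solved for them. -/
theorem zv_zero_two_aux (hq0 : q ≠ 0) : zv q 0 2 = (2⁻¹ : ℂ) • ((q - q⁻¹) •
    (ev q * hv q + hv q * ev q) - (hv q * ev q - ev q * hv q)) ∧ zv q 2 0 = zv q 0 2 := by
  have h1 := hv_zv hq0 (i := 0) (j := 0) (by simpa using hv_xv_zero hq0)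
    (by simpa using hv_yv_zero hq0)
  have h2 := ev_sq_zv q 0 0
  rw [zv_zero_zero, mul_assoc, sub_self, eq_comm, sub_eq_zero] at h2
  simp only [zero_add, pow_zero, one_smul, zv_zero_zero, zv_one_zero, zv_zero_one] at h1 h2
  rw [← h2] at h1
  refine ⟨?_, h2.symm⟩
  linear_combination (norm := skip) (2⁻¹ : ℂ) • h1
  simp only [mul_sub, add_mul, mul_assoc]
  module

/-- Bracketing `hv_xv_zero` with L₁ would bring in the unknown [h, L₁]. Instead the distance-two
relation is combined with the formula for [X₁, Y₃]. -/
theorem hv_xv_one (hq : Generic q) : hv q * xv q 1 - xv q 1 * hv q =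
    - ((q - q⁻¹) • (ev q * xv q 2)) - (q - 1) • xv q 3 := by
  have hq0 := hq.ne_zero
  obtain ⟨hz, hz2⟩ := zv_zero_two_aux hq0
  have e1 : xv q 1 = xv q 0 * ev q - ev q * xv q 0 := by rw [xv.eq_2]; simp
  have e2 : xv q 2 = xv q 1 * ev q + ev q * xv q 1 := by rw [xv.eq_2]; simp
  have e3 : xv q 3 = xv q 2 * ev q - ev q * xv q 2 := by rw [xv.eq_2]; simp
  have c2 := left_qcommute_distance_two (s := 1) (Or.inl rfl) (xv_zero_mul_one hq0)
    (by simpa using e1) (by simpa using e2)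
  have hc := commutator_left_distance_two (y0 := yv q 0) (e := ev q) (z1 := zv q 1 0)
    (z2 := zv q 2 0) hq0 (by simpa using c2) (by simp [ev, xv, yv]) (by simp [zv]) (by simp [zv])
  rw [zv_one_zero] at hc
  refine commutator_h_left_one hq0 hq.three e1 e2 e3 ?_ (hz2.trans hz) hc
  linear_combination (norm := module) - hv_xv_zero hq0

theorem hv_yv_one (hq : Generic q) : hv q * yv q 1 - yv q 1 * hv q =
    - ((q - q⁻¹) • (yv q 2 * ev q)) + (q + 1) • yv q 3 := by
  have hq0 := hq.ne_zero
  obtain ⟨hz, -⟩ := zv_zero_two_aux hq0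
  have e1 : yv q 1 = ev q * yv q 0 + yv q 0 * ev q := by rw [yv.eq_2]; simp
  have e2 : yv q 2 = ev q * yv q 1 - yv q 1 * ev q := by rw [yv.eq_2]; simp [sub_eq_add_neg]
  have e3 : yv q 3 = ev q * yv q 2 + yv q 2 * ev q := by rw [yv.eq_2]; simp
  have c2 := right_qcommute_distance_two (s := 1) (Or.inl rfl) (yv_one_mul_zero hq0)
    (by simpa using e1) (by simpa using e2)
  have hc := commutator_right_distance_two (x0 := xv q 0) (e := ev q) (z1 := zv q 0 1)
    (z2 := zv q 0 2) hq0 (by simpa using c2) (by simp [ev, xv, yv]) (by simp [zv]) (by simp [zv])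
  rw [zv_zero_one] at hc
  refine commutator_h_right_one hq0 hq.six e1 e2 e3 ?_ hz hc
  linear_combination (norm := module) hv_yv_zero hq0

theorem zv_one_one (q : ℂ) : zv q 1 1 = zv q 0 2 + (hv q * ev q - ev q * hv q) := by
  have := ev_zv q 0 1
  rw [zv_zero_one] at this
  simp only [zero_add, pow_zero, one_smul] at this
  linear_combination (norm := skip) this
  simp only [mul_add, add_mul, mul_assoc]
  norm_num
  abel

/-- The starting point for centrality of L₁². The actions of `hv` on [X₁, Y₂] = h + L₁² and on [X₂,
Y₁] = h - L₁² are compared. -/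
theorem ev_sq_hv (hq : Generic q) : ev q * ev q * hv q = hv q * (ev q * ev q) := by
  have hq0 := hq.ne_zero
  obtain ⟨-, hz2⟩ := zv_zero_two_aux hq0
  have x0 := hv_xv_zero hq0
  have x1 := hv_xv_one hq
  have y0 := hv_yv_zero hq0
  have y1 := hv_yv_one hq
  have h01 := hv_zv hq0 (i := 0) (j := 1) (by simpa using x0)
    (by rw [y1]; simp; module)
  have h10 := hv_zv hq0 (i := 1) (j := 0) (by rw [x1]; simp; module) (by simpa using y0)
  have E1 := ev_sq_zv q 0 1
  have E2 := ev_sq_zv q 1 0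
  simp only [zero_add, pow_zero, one_smul, zv_one_zero, zv_zero_one, pow_one, neg_smul,
    Nat.reduceAdd, hz2] at h01 h10 E1 E2
  refine commute_square_h hq0 hq.four (z02 := zv q 0 2) (z11 := zv q 1 1) (z03 := zv q 0 3)
    (z12 := zv q 1 2) (z21 := zv q 2 1) (z30 := zv q 3 0) (zv_one_one q) ?_ ?_ ?_ ?_
  · rw [h01]; module
  · rw [h10]; module
  · rw [← E1]; simp only [mul_add, add_mul, mul_assoc]; abel
  · rw [← E2]; simp only [mul_sub, sub_mul, mul_assoc]; abel

/-- The first two cases propagate, since L₁² commutes with `hv` and its commutator raises indices by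
two. -/
theorem hv_xv (hq : Generic q) (i : ℕ) : hv q * xv q i - xv q i * hv q =
    ((q - q⁻¹) * (-1) ^ i) • (ev q * xv q (i + 1)) - (q + (-1) ^ i) • xv q (i + 2) := by
  induction i using Nat.twoStepInduction with
  | zero => simpa using hv_xv_zero hq.ne_zero
  | one => rw [hv_xv_one hq]; simp; module
  | more i ih _ =>
    have hE := ev_sq_hv hq
    have e0 : xv q (i + 2) = xv q i * (ev q * ev q) - ev q * ev q * xv q i := by
      linear_combination (norm := abel) ev_sq_xv q i
    have e1 : xv q (i + 3) = xv q (i + 1) * (ev q * ev q) - ev q * ev q * xv q (i + 1) := by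
      linear_combination (norm := abel) ev_sq_xv q (i + 1)
    have e2 : xv q (i + 4) = xv q (i + 2) * (ev q * ev q) - ev q * ev q * xv q (i + 2) := by
      linear_combination (norm := abel) ev_sq_xv q (i + 2)
    rw [pow_add, neg_one_sq, mul_one, show i + 2 + 1 = i + 3 by rfl, show i + 2 + 2 = i + 4 by rfl,
      e1, e2]
    nth_rewrite 1 2 [e0]
    linear_combination (norm := skip) ih * (ev q * ev q) - ev q * ev q * ih + hE * xv q i -
      xv q i * hE
    simp only [mul_add, add_mul, mul_sub, sub_mul, smul_mul_assoc, mul_smul_comm, mul_assoc,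
      smul_add, smul_sub, smul_smul]
    module

theorem hv_yv (hq : Generic q) (j : ℕ) : hv q * yv q j - yv q j * hv q =
    ((q - q⁻¹) * (-1) ^ j) • (yv q (j + 1) * ev q) + (q - (-1) ^ j) • yv q (j + 2) := by
  induction j using Nat.twoStepInduction with
  | zero => simpa using hv_yv_zero hq.ne_zero
  | one => rw [hv_yv_one hq]; simp; module
  | more i ih _ =>
    have hE := ev_sq_hv hq
    have e0 := ev_sq_yv q i
    have e1 := ev_sq_yv q (i + 1)
    have e2 := ev_sq_yv q (i + 2)
    rw [pow_add, neg_one_sq, mul_one, show i + 2 + 1 = i + 1 + 2 by rfl, ← e1, ← e2]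
    nth_rewrite 1 2 [← e0]
    linear_combination (norm := skip) ev q * ev q * ih - ih * (ev q * ev q) - hE * yv q i +
      yv q i * hE
    simp only [mul_add, add_mul, mul_sub, sub_mul, smul_mul_assoc, mul_smul_comm, mul_assoc,
      smul_add, smul_sub, smul_smul]
    module

theorem xv_mul_succ (hq : Generic q) (i : ℕ) :
    xv q i * xv q (i + 1) = q • (xv q (i + 1) * xv q i) := by
  induction i with
  | zero => exact xv_zero_mul_one hq.ne_zero
  | succ i ih =>
    have hs := neg_one_pow_cases i
    refine left_qcommute_succ hq.ne_zero hq.four hs ih (xv.eq_2 q i) ?_ ?_ (hv_xv hq i) ?_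
      (x3 := xv q (i + 3))
    · rw [xv.eq_2, pow_succ]; module
    · rw [xv.eq_2, pow_succ, pow_succ]; module
    · rw [hv_xv hq (i + 1), pow_succ]; module

theorem yv_succ_mul (hq : Generic q) (i : ℕ) :
    yv q (i + 1) * yv q i = q • (yv q i * yv q (i + 1)) := by
  induction i with
  | zero => exact yv_one_mul_zero hq.ne_zero
  | succ i ih =>
    have hs := neg_one_pow_cases i
    refine right_qcommute_succ hq.ne_zero hq.four hs ih (yv.eq_2 q i) ?_ ?_ (hv_yv hq i) ?_
      (y3 := yv q (i + 3))
    · rw [yv.eq_2, pow_succ]; module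
    · rw [yv.eq_2, pow_succ, pow_succ]; module
    · rw [hv_yv hq (i + 1), pow_succ]; module

end action

/-! ### Centrality of the square of `L_1` and consequences -/

section identities

variable {A : Type*} [Ring A] [Algebra ℂ A] {q : ℂ}

/-- Here `h2` is the relation `h0` with x₀, x₁ replaced by their commutators with `f`. As `f`
commutes with `w`, subtracting the commutator of `h0` with `f` leaves only the statement that [f, z]
commutes with x₀. -/
theorem commute_of_shift {f x0 x1 w z : A} {c d : ℂ} (hw : f * w = w * f)
    (h0 : x0 * z - z * x0 = c • (x1 * w) - d • (w * x1))
    (h2 : (x0 * f - f * x0) * z - z * (x0 * f - f * x0) =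
      c • ((x1 * f - f * x1) * w) - d • (w * (x1 * f - f * x1))) :
    (f * z - z * f) * x0 = x0 * (f * z - z * f) := by
  linear_combination (norm := skip) h0 * f - f * h0 - h2 - (c • (x1 * hw) - d • (hw * x1))
  simp only [mul_sub, sub_mul, smul_mul_assoc, mul_smul_comm, mul_assoc, smul_sub, smul_smul]
  module

/-- The commutator of `lN'` with `lM`, itself a bracket of `x0` and `y`, is expanded by the Leibniz
rule; the resulting brackets with `x0` and `y` are then rewritten by `c1`-`c4`. -/
theorem bracket_exchange (hq0 : q ≠ 0) {x0 x1 y y' lN1 lN2 lN' lN1' lM lM1 lM1' lM2' : A}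
    (h1 : lM = x0 * y - q⁻¹ • (y * x0)) (h2 : lM1 = x0 * y' - q⁻¹ • (y' * x0))
    (h3 : lM1' = x1 * y - q⁻¹ • (y * x1)) (h4 : lM2' = x1 * y' + q⁻¹ • (y' * x1))
    (c1 : x0 * lN' - lN' * x0 = q • (x1 * lN1) + q⁻¹ • (lN1 * x1))
    (c2 : lN' * y - y * lN' = q • (lN1' * y') + q⁻¹ • (y' * lN1'))
    (c3 : lN1 * y - y * lN1 = q • (lN2 * y') - q⁻¹ • (y' * lN2))
    (c4 : x0 * lN1' - lN1' * x0 = q • (x1 * lN2) - q⁻¹ • (lN2 * x1)) :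
    (lN' * lM - lM * lN') + (lN2 * lM2' - lM2' * lN2) =
      q • (lN1' * lM1 - lM1' * lN1) + q⁻¹ • (lM1 * lN1' - lN1 * lM1') := by
  subst h1 h2 h3 h4
  linear_combination (norm := skip) x0 * c2 - c1 * y - q⁻¹ • (c2 * x0 - y * c1) - q • (x1 * c3)
    - (q⁻¹ * q⁻¹) • (c3 * x1) + q • (c4 * y') + (q⁻¹ * q⁻¹) • (y' * c4)
  simp only [mul_add, add_mul, mul_sub, sub_mul, smul_mul_assoc, mul_smul_comm, mul_assoc,
    smul_add, smul_sub, smul_smul]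
  match_scalars <;> field_simp <;> ring

end identities

section

variable {q : ℂ}

theorem ev_mul_ev_mem (q : ℂ) : ev q * ev q ∈ homComp q (2, 2) :=
  mul_mem_homComp (ev_mem q) (ev_mem q)

theorem zv_one_mem_Kge (hq0 : q ≠ 0) (j : ℕ) : zv q 1 j ∈ Kge q := by
  have h := ev_zv q 0 j
  have e : zv q 1 j = zv q 0 (j + 1) - (ev q * zv q 0 j - (-1 : ℂ) ^ (0 + j + 1) •
      (zv q 0 j * ev q)) := by rw [h]; simp
  rw [e]
  have h0 := ev_mem_Kge q
  have h1 := zv_zero_mem_Kge hq0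
  exact sub_mem (h1 _) (sub_mem (mul_mem h0 (h1 _)) ((Kge q).smul_mem (mul_mem (h1 _) h0) _))

/-- The square of `L_1` commutes with all `[X_i, Y_j]`. -/
theorem ev_sq_comm_zv (hq : Generic q) : ∀ n i j, i + j = n →
    ev q * ev q * zv q i j = zv q i j * (ev q * ev q) := by
  have hq0 := hq.ne_zero
  have hE := ev_sq_hv hq
  obtain ⟨h02, h20⟩ := zv_zero_two_aux hq0
  have hE' : ev q * (ev q * hv q) = hv q * (ev q * ev q) := by rw [← hE, mul_assoc]
  have c02 : ev q * ev q * zv q 0 2 = zv q 0 2 * (ev q * ev q) := by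
    rw [h02]
    simp only [mul_add, add_mul, mul_sub, sub_mul, smul_mul_assoc, mul_smul_comm, mul_assoc]
    have e1 : hv q * (ev q * (ev q * ev q)) = ev q * (ev q * (hv q * ev q)) := by
      rw [← mul_assoc (ev q) (ev q) (hv q * ev q), ← mul_assoc (ev q * ev q), hE]
      simp only [mul_assoc]
    have e2 : ev q * (hv q * (ev q * ev q)) = ev q * (ev q * (ev q * hv q)) := by
      rw [hE']
    rw [e1, e2]
  intro n
  induction n using Nat.strong_induction_on with
  | _ n ih =>
    -- By `ev_sq_zv`, commutation at a smaller index sum is periodicity there.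
    have per : ∀ i j, i + j < n → zv q i (j + 2) = zv q (i + 2) j := by
      intro i j hij
      have := ev_sq_zv q i j
      rw [ih _ hij i j rfl, sub_self, eq_comm, sub_eq_zero] at this
      exact this
    match n with
    | 0 =>
      intro i j hij
      obtain ⟨rfl, rfl⟩ : i = 0 ∧ j = 0 := by omega
      rw [zv_zero_zero, mul_assoc]
    | 1 =>
      intro i j hij
      have : (i = 0 ∧ j = 1) ∨ (i = 1 ∧ j = 0) := by omega
      rcases this with ⟨rfl, rfl⟩ | ⟨rfl, rfl⟩
      · rw [zv_zero_one, mul_add, add_mul, hE]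
      · rw [zv_one_zero, mul_sub, sub_mul, hE]
    | 2 =>
      intro i j hij
      have : (i = 0 ∧ j = 2) ∨ (i = 1 ∧ j = 1) ∨ (i = 2 ∧ j = 0) := by omega
      rcases this with ⟨rfl, rfl⟩ | ⟨rfl, rfl⟩ | ⟨rfl, rfl⟩
      · exact c02
      · rw [zv_one_one, mul_add, add_mul, c02]
        congr 1
        simp only [mul_sub, sub_mul]
        rw [← mul_assoc (ev q * ev q), hE]
        simp only [mul_assoc]
        rw [hE']
      · rw [h20, c02]
    | m + 3 =>
      -- The exchange relations for (X₁, X₂) and (X₃, X₄) contain the same brackets, thanks to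
      -- `per`, while X₃, X₄ are commutators of X₁, X₂ with L₁². So the commutator of L₁² with `zv q
      -- 1 (m + 2)` commutes with x₁ and lies in K_{≥1}, hence vanishes.
      have step1 : ev q * ev q * zv q 1 (m + 2) - zv q 1 (m + 2) * (ev q * ev q) = 0 := by
        have b3 : (-1 : ℂ) ^ ((2 + 1) * (m + 1)) = (-1) ^ ((0 + 1) * (m + 2 + 1)) := by
          rw [show (2 + 1) * (m + 1) = 2 * m + (0 + 1) * (m + 2 + 1) by ring, pow_add, pow_mul]
          simp
        have a2 : (-1 : ℂ) ^ (2 * (m + 1)) = 1 := by rw [pow_mul]; simp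
        have c0 := commutator_left_of_qcommute hq0 (xv_mul_succ hq 0)
          (y := yv q (m + 2)) (a := (-1 : ℂ) ^ (0 * (m + 2 + 1)))
          (b := (-1 : ℂ) ^ ((0 + 1) * (m + 2 + 1))) (z := zv q 0 (m + 2)) (z' := zv q 1 (m + 2))
          rfl rfl
        have c2 := commutator_left_of_qcommute hq0 (xv_mul_succ hq 2)
          (y := yv q m) (a := (-1 : ℂ) ^ (2 * (m + 1)))
          (b := (-1 : ℂ) ^ ((2 + 1) * (m + 1))) (z := zv q 2 m) (z' := zv q 3 m)
          rfl rfl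
        rw [a2, b3, ← per 0 m (by omega), ← per 1 m (by omega)] at c2
        have e2 : xv q 2 = xv q 0 * (ev q * ev q) - ev q * ev q * xv q 0 := by
          linear_combination (norm := abel) ev_sq_xv q 0
        have e3 : xv q (2 + 1) = xv q 1 * (ev q * ev q) - ev q * ev q * xv q 1 := by
          linear_combination (norm := abel) ev_sq_xv q 1
        rw [e2, e3, one_smul] at c2
        rw [zero_mul, pow_zero, one_smul] at c0
        have hw := ih (m + 2) (by omega) 0 (m + 2) (by omega)
        have key := commute_of_shift hw c0 c2
        have hz : zv q 1 (m + 2) ∈ homComp q (m + 4, m + 4) := by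
          convert zv_mem hq0 1 (m + 2) using 3 <;> omega
        refine eq_zero_of_commute_gen (N := m + 6) hq.1 hq.2 (by omega) ?_ ?_ key
        · refine sub_mem ?_ (mul_mem_homComp hz (ev_mul_ev_mem q))
          have := mul_mem_homComp (ev_mul_ev_mem q) hz
          rwa [add_comm] at this
        · have h0 := ev_mem_Kge q
          have h1 := zv_one_mem_Kge hq0 (m + 2)
          exact sub_mem (mul_mem (mul_mem h0 h0) h1) (mul_mem h1 (mul_mem h0 h0))
      -- `zv q 0 (m + 3)` differs from `zv q 1 (m + 2)` by a superbracket of L₁ with an element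
      -- already treated.
      have step2 : ev q * ev q * zv q 0 (m + 3) = zv q 0 (m + 3) * (ev q * ev q) := by
        have h := ev_zv q 0 (m + 2)
        rw [pow_zero, one_smul, zero_add] at h
        have hw := ih (m + 2) (by omega) 0 (m + 2) (by omega)
        have hz : zv q 0 (m + 3) = zv q 1 (m + 2) + (ev q * zv q 0 (m + 2) -
            (-1 : ℂ) ^ (m + 2 + 1) • (zv q 0 (m + 2) * ev q)) := by
          rw [h]; abel
        rw [hz]
        linear_combination (norm := skip) step1 + ev q * hw -
          (-1 : ℂ) ^ (m + 2 + 1) • (hw * ev q)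
        simp only [mul_add, add_mul, mul_sub, sub_mul, smul_mul_assoc, mul_smul_comm, mul_assoc,
          smul_add, smul_sub, smul_smul]
        module
      have step3 : ∀ i j, i + j = m + 3 →
          ev q * ev q * zv q i j = zv q i j * (ev q * ev q) := by
        intro i
        induction i using Nat.twoStepInduction with
        | zero => intro j hj; obtain rfl : j = m + 3 := by omega
                  exact step2
        | one => intro j hj; obtain rfl : j = m + 2 := by omega
                 exact sub_eq_zero.1 step1
        | more i ih1 _ =>
          intro j hj
          rw [← per i j (by omega)]
          exact ih1 _ (by omega)
      exact step3

theorem commute_ev_sq_zv (hq : Generic q) (i j : ℕ) : Commute (ev q * ev q) (zv q i j) :=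
  ev_sq_comm_zv hq _ i j rfl

/-! ### Periodicity of the brackets [X_i, Y_j], and the exchange relations of the L's and L''s -/

theorem zv_add_two (hq : Generic q) (i j : ℕ) : zv q (i + 2) j = zv q i (j + 2) := by
  have := ev_sq_zv q i j
  rw [commute_ev_sq_zv hq i j, sub_self, eq_comm, sub_eq_zero] at this
  exact this.symm

theorem zv_add_even (hq : Generic q) (i j k : ℕ) :
    zv q (i + 2 * k) j = zv q i (j + 2 * k) := by
  induction k generalizing j with
  | zero => rfl
  | succ k ih =>
    rw [show i + 2 * (k + 1) = i + 2 * k + 2 by ring, zv_add_two hq, ih]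
    congr 1
    ring

theorem zv_even (hq : Generic q) (j k : ℕ) : zv q (2 * k) j = L q (2 * k + j + 1) := by
  have := zv_add_even hq 0 j k
  rw [zero_add] at this
  rw [this, L_succ hq.ne_zero]
  congr 1
  ring

theorem zv_odd (hq : Generic q) (j k : ℕ) : zv q (2 * k + 1) j = L' q (2 * k + j + 2) := by
  have := zv_add_even hq 1 j k
  rw [add_comm] at this
  rw [this, L'_succ hq.ne_zero]
  congr 1
  ring

theorem L'_zero (q : ℂ) : L' q 0 = L q 0 := by rw [L', if_pos (by omega)]
theorem L'_one (q : ℂ) : L' q 1 = L q 1 := by rw [L', if_pos (by omega)]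
theorem L_zero (q : ℂ) : L q 0 = (q - q⁻¹)⁻¹ • (1 : NA q) := by
  rw [L, if_pos rfl, Algebra.algebraMap_eq_smul_one]; rfl

theorem commute_ev_sq_L (hq : Generic q) (n : ℕ) : Commute (ev q * ev q) (L q n) := by
  cases n with
  | zero => rw [L_zero]; exact (Commute.one_right _).smul_right _
  | succ n => rw [L_succ hq.ne_zero]; exact commute_ev_sq_zv hq _ _

theorem commute_ev_sq_L' (hq : Generic q) (n : ℕ) : Commute (ev q * ev q) (L' q n) := by
  match n with
  | 0 => rw [L'_zero]; exact commute_ev_sq_L hq _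
  | 1 => rw [L'_one]; exact commute_ev_sq_L hq _
  | n + 2 => rw [L'_succ hq.ne_zero]; exact commute_ev_sq_zv hq _ _

/-- `L_{2n+1}` and `Y_{2j+2}`. -/
theorem L_odd_yv (hq : Generic q) (n j : ℕ) :
    L q (2 * n + 1) * yv q (2 * j + 1) - yv q (2 * j + 1) * L q (2 * n + 1) =
      q • (L q (2 * n) * yv q (2 * j + 2)) - q⁻¹ • (yv q (2 * j + 2) * L q (2 * n)) := by
  have hq0 := hq.ne_zero
  induction j with
  | zero =>
    cases n with
    | zero =>
      have h2 : yv q 2 = ev q * yv q 1 - yv q 1 * ev q := by rw [yv]; simp [sub_eq_add_neg]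
      simp only [mul_zero, zero_add]
      rw [L_one hq0, L_zero, ← h2]
      simp only [smul_mul_assoc, one_mul, mul_smul_comm, mul_one, smul_smul]
      -- The normalization L₀ = 1/θ is what makes the relation hold for n = 0.
      rw [← sub_smul, ← sub_mul, mul_inv_cancel₀ hq.theta_ne, one_smul]
    | succ n =>
      have h := commutator_right_of_qcommute hq0 (yv_succ_mul hq 1) (x := xv q (2 * n))
        (z := zv q (2 * n) 1) (z' := zv q (2 * n) 2) rfl rfl
      rw [zv_even hq, zv_even hq] at h
      have a1 : (-1 : ℂ) ^ (2 * n * (1 + 1)) = 1 := by rw [mul_assoc, pow_mul]; simp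
      have a2 : (-1 : ℂ) ^ (2 * n * (2 + 1)) = 1 := by rw [mul_assoc, pow_mul]; simp
      rw [a1, a2, one_smul, one_mul] at h
      exact h
  | succ j ih =>
    have h1 := ev_sq_yv q (2 * j + 1)
    have h2 := ev_sq_yv q (2 * j + 2)
    have k1 := (commute_ev_sq_L hq (2 * n + 1)).eq
    have k2 := (commute_ev_sq_L hq (2 * n)).eq
    rw [show 2 * (j + 1) + 1 = 2 * j + 1 + 2 by ring, show 2 * (j + 1) + 2 = 2 * j + 2 + 2 by ring,
      ← h1, ← h2]
    linear_combination (norm := skip) (ev q * ev q) * ih - ih * (ev q * ev q) -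
      k1 * yv q (2 * j + 1) + yv q (2 * j + 1) * k1 + q • (k2 * yv q (2 * j + 2))
      - q⁻¹ • (yv q (2 * j + 2) * k2)
    simp only [mul_sub, sub_mul, smul_mul_assoc, mul_smul_comm, mul_assoc, smul_sub, smul_smul]
    module

/-- `L'_{2n+2}` and `Y_{2j+2}`. -/
theorem L'_even_yv (hq : Generic q) (n j : ℕ) :
    L' q (2 * n + 2) * yv q (2 * j + 1) - yv q (2 * j + 1) * L' q (2 * n + 2) =
      q • (L' q (2 * n + 1) * yv q (2 * j + 2)) + q⁻¹ • (yv q (2 * j + 2) * L' q (2 * n + 1)) := by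
  have hq0 := hq.ne_zero
  induction j with
  | zero =>
    cases n with
    | zero =>
      have h2 : yv q 3 = ev q * yv q 2 + yv q 2 * ev q := by rw [yv]; simp
      have h3 := hv_yv_one hq
      have h4 := ev_sq_yv q 1
      rw [h2] at h3 h4
      simp only [mul_zero, zero_add]
      rw [L'_one, L_one hq0, (L'_succ hq0 0 : L' q 2 = zv q 1 0), zv_one_zero]
      linear_combination (norm := skip) h3 - h4
      simp only [mul_sub, sub_mul, zero_add]
      module
    | succ n =>
      have h := commutator_right_of_qcommute hq0 (yv_succ_mul hq 1) (x := xv q (2 * n + 1))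
        (z := zv q (2 * n + 1) 1) (z' := zv q (2 * n + 1) 2) rfl rfl
      rw [zv_odd hq, zv_odd hq] at h
      have a1 : (-1 : ℂ) ^ ((2 * n + 1) * (1 + 1)) = 1 := by rw [mul_comm, pow_mul]; simp
      have a2 : (-1 : ℂ) ^ ((2 * n + 1) * (2 + 1)) = -1 := by
        rw [show (2 * n + 1) * (2 + 1) = 2 * (3 * n + 1) + 1 by ring, pow_succ, pow_mul]; simp
      rw [a1, a2, one_smul, neg_one_mul, neg_smul, sub_neg_eq_add] at h
      exact h
  | succ j ih =>
    have h1 := ev_sq_yv q (2 * j + 1)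
    have h2 := ev_sq_yv q (2 * j + 2)
    have k1 := (commute_ev_sq_L' hq (2 * n + 2)).eq
    have k2 := (commute_ev_sq_L' hq (2 * n + 1)).eq
    rw [show 2 * (j + 1) + 1 = 2 * j + 1 + 2 by ring, show 2 * (j + 1) + 2 = 2 * j + 2 + 2 by ring,
      ← h1, ← h2]
    linear_combination (norm := skip) (ev q * ev q) * ih - ih * (ev q * ev q) -
      k1 * yv q (2 * j + 1) + yv q (2 * j + 1) * k1 + q • (k2 * yv q (2 * j + 2))
      + q⁻¹ • (yv q (2 * j + 2) * k2)
    simp only [mul_add, add_mul, mul_sub, sub_mul, smul_mul_assoc, mul_smul_comm, mul_assoc,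
      smul_sub, smul_add, smul_smul]
    module

theorem xv_zero_L'_even (hq : Generic q) (n : ℕ) :
    xv q 0 * L' q (2 * n + 2) - L' q (2 * n + 2) * xv q 0 =
      q • (xv q 1 * L q (2 * n + 1)) + q⁻¹ • (L q (2 * n + 1) * xv q 1) := by
  have h := commutator_left_of_qcommute hq.ne_zero (xv_mul_succ hq 0) (y := yv q (2 * n))
    (z := zv q 0 (2 * n)) (z' := zv q 1 (2 * n)) rfl rfl
  have a1 : (-1 : ℂ) ^ (1 * (2 * n + 1)) = -1 := by rw [one_mul, pow_succ, pow_mul]; simp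
  rw [← L_succ hq.ne_zero, ← L'_succ hq.ne_zero, zero_mul, pow_zero, one_smul, a1, neg_one_mul,
    neg_smul, sub_neg_eq_add] at h
  exact h

theorem xv_zero_L'_odd (hq : Generic q) (n : ℕ) :
    xv q 0 * L' q (2 * n + 1) - L' q (2 * n + 1) * xv q 0 =
      q • (xv q 1 * L q (2 * n)) - q⁻¹ • (L q (2 * n) * xv q 1) := by
  have hq0 := hq.ne_zero
  cases n with
  | zero =>
    rw [mul_zero, zero_add, L'_one, L_one hq0, L_zero, xv_one]
    simp only [smul_mul_assoc, one_mul, mul_smul_comm, mul_one, smul_smul]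
    rw [← sub_smul, ← sub_mul, mul_inv_cancel₀ hq.theta_ne, one_smul]
    rfl
  | succ n =>
    have h := commutator_left_of_qcommute hq0 (xv_mul_succ hq 0) (y := yv q (2 * n + 1))
      (z := zv q 0 (2 * n + 1)) (z' := zv q 1 (2 * n + 1)) rfl rfl
    have a1 : (-1 : ℂ) ^ (1 * (2 * n + 1 + 1)) = 1 := by
      rw [one_mul, show 2 * n + 1 + 1 = 2 * (n + 1) by ring, pow_mul]; simp
    rw [← L_succ hq.ne_zero, ← L'_succ hq.ne_zero, zero_mul, pow_zero, one_smul, a1, one_mul] at h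
    exact h

/-- The quadratic relations from which commutativity of the L̃_{2n} is extracted later. -/
theorem L_L'_exchange (hq : Generic q) (n m : ℕ) :
    (L' q (2 * n + 2) * L q (2 * m + 2) - L q (2 * m + 2) * L' q (2 * n + 2)) +
      (L q (2 * n) * L' q (2 * m + 4) - L' q (2 * m + 4) * L q (2 * n)) =
      q • (L' q (2 * n + 1) * L q (2 * m + 3) - L' q (2 * m + 3) * L q (2 * n + 1)) +
      q⁻¹ • (L q (2 * m + 3) * L' q (2 * n + 1) - L q (2 * n + 1) * L' q (2 * m + 3)) := by
  have hq0 := hq.ne_zero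
  have s1 : (-1 : ℂ) ^ (1 * (2 * m + 1 + 1)) = 1 := by
    rw [one_mul, show 2 * m + 1 + 1 = 2 * (m + 1) by ring, pow_mul]; simp
  have s2 : (-1 : ℂ) ^ (1 * (2 * m + 2 + 1)) = -1 := by
    rw [one_mul, show 2 * m + 2 + 1 = 2 * (m + 1) + 1 by ring, pow_succ, pow_mul]; simp
  refine bracket_exchange hq0 (x0 := xv q 0) (x1 := xv q 1) (y := yv q (2 * m + 1))
    (y' := yv q (2 * m + 2)) ?_ ?_ ?_ ?_ (xv_zero_L'_even hq n) (L'_even_yv hq n m)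
    (L_odd_yv hq n m) (xv_zero_L'_odd hq n)
  · rw [L_succ hq0, zv]; simp
  · rw [L_succ hq0, zv]; simp
  · rw [L'_succ hq0, zv, s1, one_mul]
  · rw [L'_succ hq0, zv, s2]; simp

end

/-! ### The action of L̃₂ on the L's, and the relations between the L̃_{2n} and the M's -/

section

variable {q : ℂ}

theorem hv_L_even (hq : Generic q) (k : ℕ) :
    hv q * L q (2 * k) - L q (2 * k) * hv q =
      (q - q⁻¹) • (ev q * L' q (2 * k + 1) - L q (2 * k + 1) * ev q) := by
  cases k with
  | zero => rw [mul_zero, zero_add, L'_one, L_one hq.ne_zero, L_zero]; simp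
  | succ k =>
    have h := hv_zv hq.ne_zero (hv_xv hq 0) (hv_yv hq (2 * k + 1))
    have s : (-1 : ℂ) ^ (2 * k + 1) = -1 := by rw [pow_succ, pow_mul]; simp
    have e1 : zv q (0 + 2) (2 * k + 1) = L q (2 * k + 4) := by
      rw [show 0 + 2 = 2 * 1 by rfl, zv_even hq]; congr 1; ring
    have e2 : zv q (0 + 1) (2 * k + 1) = L' q (2 * k + 3) := (L'_succ hq.ne_zero _).symm
    rw [e1, e2, s, ← L_succ hq.ne_zero, ← L_succ hq.ne_zero, ← L_succ hq.ne_zero] at h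
    rw [show 2 * (k + 1) = 2 * k + 1 + 1 by ring]
    refine h.trans ?_
    simp only [pow_zero, one_smul]
    module

theorem hv_L_odd (hq : Generic q) (k : ℕ) :
    hv q * L q (2 * k + 1) - L q (2 * k + 1) * hv q =
      (q - q⁻¹) • (ev q * L' q (2 * k + 2) + L q (2 * k + 2) * ev q)
        - (2 : ℂ) • L q (2 * k + 3) := by
  have h := hv_zv hq.ne_zero (hv_xv hq 0) (hv_yv hq (2 * k))
  have s : (-1 : ℂ) ^ (2 * k) = 1 := by rw [pow_mul]; simp
  have e1 : zv q (0 + 2) (2 * k) = L q (2 * k + 3) := by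
    rw [show 0 + 2 = 2 * 1 by rfl, zv_even hq]; congr 1; ring
  have e2 : zv q (0 + 1) (2 * k) = L' q (2 * k + 2) := (L'_succ hq.ne_zero _).symm
  rw [e1, e2, s, ← L_succ hq.ne_zero, ← L_succ hq.ne_zero, ← L_succ hq.ne_zero] at h
  refine h.trans ?_
  simp only [pow_zero, one_smul]
  module

theorem hv_L'_even (hq : Generic q) (k : ℕ) :
    hv q * L' q (2 * k) - L' q (2 * k) * hv q =
      (q - q⁻¹) • (L' q (2 * k + 1) * ev q - ev q * L q (2 * k + 1)) := by
  cases k with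
  | zero => rw [mul_zero, zero_add, L'_zero, L'_one, L_one hq.ne_zero, L_zero]; simp
  | succ k =>
    have h := hv_zv hq.ne_zero (hv_xv hq 1) (hv_yv hq (2 * k))
    have s : (-1 : ℂ) ^ (2 * k) = 1 := by rw [pow_mul]; simp
    have e1 : zv q (1 + 2) (2 * k) = L' q (2 * k + 4) := by
      rw [show 1 + 2 = 2 * 1 + 1 by rfl, zv_odd hq]; congr 1; ring
    have e2 : zv q (1 + 1) (2 * k) = L q (2 * k + 3) := by
      rw [show 1 + 1 = 2 * 1 by rfl, zv_even hq]; congr 1; ring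
    rw [e1, e2, s, ← L'_succ hq.ne_zero, ← L'_succ hq.ne_zero, ← L'_succ hq.ne_zero] at h
    rw [show 2 * (k + 1) = 2 * k + 2 by ring]
    refine h.trans ?_
    simp only [pow_one, one_smul]
    module

theorem zv_zero_two (hq : Generic q) : zv q 0 2 = (2⁻¹ : ℂ) • ((q - q⁻¹) •
    (ev q * hv q + hv q * ev q) - (hv q * ev q - ev q * hv q)) := (zv_zero_two_aux hq.ne_zero).1

theorem hv_L'_odd (hq : Generic q) (k : ℕ) :
    hv q * L' q (2 * k + 1) - L' q (2 * k + 1) * hv q =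
      (2 : ℂ) • L' q (2 * k + 3) -
      (q - q⁻¹) • (ev q * L q (2 * k + 2) + L' q (2 * k + 2) * ev q) := by
  cases k with
  | zero =>
    simp only [mul_zero, zero_add]
    rw [L'_one, L_one hq.ne_zero, (L'_succ hq.ne_zero 0 : L' q 2 = _),
      (L'_succ hq.ne_zero 1 : L' q 3 = _), (L_succ hq.ne_zero 1 : L q 2 = _), zv_one_one,
      zv_zero_two hq, zv_one_zero, zv_zero_one]
    simp only [mul_add, add_mul, mul_sub, sub_mul, mul_assoc]
    module
  | succ k =>
    have h := hv_zv hq.ne_zero (hv_xv hq 1) (hv_yv hq (2 * k + 1))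
    have s : (-1 : ℂ) ^ (2 * k + 1) = -1 := by rw [pow_succ, pow_mul]; simp
    have e1 : zv q (1 + 2) (2 * k + 1) = L' q (2 * k + 5) := by
      rw [show 1 + 2 = 2 * 1 + 1 by rfl, zv_odd hq]; congr 1; ring
    have e2 : zv q (1 + 1) (2 * k + 1) = L q (2 * k + 4) := by
      rw [show 1 + 1 = 2 * 1 by rfl, zv_even hq]; congr 1; ring
    rw [e1, e2, s, ← L'_succ hq.ne_zero, ← L'_succ hq.ne_zero, ← L'_succ hq.ne_zero] at h
    rw [show 2 * (k + 1) + 1 = 2 * k + 1 + 2 by ring]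
    refine h.trans ?_
    simp only [pow_one]
    module

/-- The relations between the elements `x n = L̃_{2n}` and `m n = M_{2n+1}` from which the others
follow. -/
structure ImaginaryRelations {A : Type*} [Ring A] [Algebra ℂ A] (q : ℂ) (x m : ℕ → A) : Prop where
  zero : (q - q⁻¹) • x 0 = 1
  one : ∀ j, x 1 * m j - m j * x 1 = m (j + 1)
  step : ∀ n j, x (n + 2) * m j - m j * x (n + 2) =
    ((q - q⁻¹) / 2) • (x (n + 1) * m (j + 1) + m (j + 1) * x (n + 1)) +
      (1 / 4 : ℂ) • (x n * m (j + 2) - m (j + 2) * x n)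
  sq : ∀ n, Commute (m 0 * m 0) (x n)

theorem hv_eq (hq : Generic q) : hv q = Ltilde q 2 := by
  rw [Ltilde, (L'_succ hq.ne_zero 0 : L' q 2 = _), (L_succ hq.ne_zero 1 : L q 2 = _),
    zv_one_zero, zv_zero_one]
  module

theorem L_two (hq : Generic q) : L q 2 = hv q + ev q * ev q := by
  rw [(L_succ hq.ne_zero 1 : L q 2 = _), zv_zero_one]

theorem L'_two (hq : Generic q) : L' q 2 = hv q - ev q * ev q := by
  rw [(L'_succ hq.ne_zero 0 : L' q 2 = _), zv_one_zero]

theorem bracket_diag (hq0 : q ≠ 0) {a b : ℕ} {x y : NA q} (hx : x ∈ homComp q (a, a))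
    (hy : y ∈ homComp q (b, b)) : bracket q x y = x * y - (-1 : ℂ) ^ (a * b) • (y * x) := by
  rw [bracket_of_mem hx hy, chi_eq hq0]
  simp

/-- The M's are defined with L₂ = h + L₁²; since L₁² commutes with them, h alone produces the next
one. Both statements are proved together because each step needs the other. -/
theorem M_succ_eq (hq : Generic q) (j : ℕ) : Commute (ev q * ev q) (M q (2 * j + 1)) ∧
    hv q * M q (2 * j + 1) - M q (2 * j + 1) * hv q = M q (2 * (j + 1) + 1) := by
  have key : ∀ j, Commute (ev q * ev q) (M q (2 * j + 1)) →
      hv q * M q (2 * j + 1) - M q (2 * j + 1) * hv q = M q (2 * (j + 1) + 1) := by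
    intro j h
    rw [M_succ, bracket_diag hq.ne_zero (L_mem hq.ne_zero 2) (M_mem hq.ne_zero j), L_two hq, pow_mul]
    simp only [even_two, Even.neg_pow, one_pow, one_smul, mul_add, add_mul]
    rw [h.eq]
    abel
  induction j with
  | zero =>
    have h : Commute (ev q * ev q) (M q (2 * 0 + 1)) := by
      rw [mul_zero, zero_add, M_zero hq.ne_zero]
      exact mul_assoc _ _ _
    exact ⟨h, key 0 h⟩
  | succ j ih =>
    have h : Commute (ev q * ev q) (M q (2 * (j + 1) + 1)) := by
      rw [← ih.2]
      have h1 : Commute (ev q * ev q) (hv q) := ev_sq_hv hq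
      exact (h1.mul_right ih.1).sub_right (ih.1.mul_right h1)
    exact ⟨h, key _ h⟩

theorem L_sub_L' (hq : Generic q) (n : ℕ) : L q (n + 1) - L' q (n + 1) =
    ev q * L q n - (-1 : ℂ) ^ n • (L q n * ev q) := by
  cases n with
  | zero => rw [L'_one, L_zero]; simp
  | succ n =>
    have h := ev_zv q 0 n
    rw [zero_add, ← L_succ hq.ne_zero, ← L_succ hq.ne_zero, zero_add, ← L'_succ hq.ne_zero, pow_zero,
      one_smul] at h
    exact h.symm

theorem L_sub_L'_prime (hq : Generic q) (n : ℕ) : L q (n + 1) - L' q (n + 1) =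
    ev q * L' q n - (-1 : ℂ) ^ n • (L' q n * ev q) := by
  match n with
  | 0 => rw [L'_one, L'_zero, L_zero]; simp
  | 1 => rw [L'_one, L_sub_L' hq 1]
  | n + 2 =>
    have h := ev_zv q 1 n
    have e2 : zv q (1 + 1) n = L q (n + 3) := by
      rw [show 1 + 1 = 2 * 1 by rfl, zv_even hq]; congr 1; ring
    rw [e2, ← L'_succ hq.ne_zero, ← L'_succ hq.ne_zero] at h
    rw [show n + 2 = 1 + n + 1 by ring] at h ⊢
    rw [h]
    rw [show 1 + n + 1 + 1 = n + 1 + 2 by ring, show n + 1 + 2 = n + 3 by ring]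
    simp

/-- The difference is the superbracket of L₁ with L_n and also with L'_n, hence with their mean. So
L and L' can be recovered from the L̃'s and L₁. -/
theorem L_sub_L'_Ltilde (hq : Generic q) (n : ℕ) : L q (n + 1) - L' q (n + 1) =
    ev q * Ltilde q n - (-1 : ℂ) ^ n • (Ltilde q n * ev q) := by
  rw [Ltilde]
  linear_combination (norm := skip) (1 / 2 : ℂ) • L_sub_L' hq n + (1 / 2 : ℂ) • L_sub_L'_prime hq n
  simp only [mul_add, add_mul, smul_mul_assoc, mul_smul_comm]
  module

theorem commute_ev_sq_Ltilde (hq : Generic q) (n : ℕ) : Commute (ev q * ev q) (Ltilde q n) :=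
  ((commute_ev_sq_L hq n).add_right (commute_ev_sq_L' hq n)).smul_right _

/-- In the mean of the formulas for L and L' the right sides collapse to a multiple of the
commutator of L₁² with L̃_{2k}, which is zero. -/
theorem hv_Ltilde_even (hq : Generic q) (k : ℕ) :
    hv q * Ltilde q (2 * k) = Ltilde q (2 * k) * hv q := by
  have h1 := hv_L_even hq k
  have h2 := hv_L'_even hq k
  have h3 := L_sub_L'_Ltilde hq (2 * k)
  have h4 := (commute_ev_sq_Ltilde hq (2 * k)).eq
  rw [pow_mul, neg_one_sq, one_pow, one_smul] at h3
  have h5 : Ltilde q (2 * k) = (1 / 2 : ℂ) • (L q (2 * k) + L' q (2 * k)) := rfl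
  linear_combination (norm := skip) (1 / 2 : ℂ) • h1 + (1 / 2 : ℂ) • h2
    - ((q - q⁻¹) / 2) • (ev q * h3 + h3 * ev q + h4) + hv q * h5 - h5 * hv q
  simp only [mul_add, add_mul, mul_sub, sub_mul, smul_mul_assoc, mul_smul_comm, mul_assoc]
  module

theorem hv_Ltilde_odd (hq : Generic q) (k : ℕ) :
    hv q * Ltilde q (2 * k + 1) - Ltilde q (2 * k + 1) * hv q =
      Ltilde q (2 * k + 2) * ev q - ev q * Ltilde q (2 * k + 2) := by
  have h1 := hv_L_odd hq k
  have h2 := hv_L'_odd hq k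
  have h3 := L_sub_L'_Ltilde hq (2 * k + 1)
  have h6 := L_sub_L'_Ltilde hq (2 * k + 2)
  have h4 := (commute_ev_sq_Ltilde hq (2 * k + 1)).eq
  rw [pow_succ, pow_mul, neg_one_sq, one_pow, one_mul] at h3
  rw [pow_add, pow_mul, neg_one_sq, one_pow, one_mul, one_smul] at h6
  have h5 : Ltilde q (2 * k + 1) = (1 / 2 : ℂ) • (L q (2 * k + 1) + L' q (2 * k + 1)) := rfl
  linear_combination (norm := skip) (1 / 2 : ℂ) • h1 + (1 / 2 : ℂ) • h2
    - ((q - q⁻¹) / 2) • (ev q * h3 - h3 * ev q + h4) - h6 + hv q * h5 - h5 * hv q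
  simp only [mul_add, add_mul, mul_sub, sub_mul, smul_mul_assoc, mul_smul_comm, mul_assoc]
  module

theorem hv_ev (hq : Generic q) : hv q * ev q - ev q * hv q = M q 3 := by
  have := (M_succ_eq hq 0).2
  rw [mul_zero, zero_add, M_zero hq.ne_zero] at this
  exact this

/-- Comes from the difference of the formulas for [h, L_{2k+1}] and [h, L'_{2k+1}], where the L̃'s
of odd index appear undifferentiated. It makes the odd L̃'s redundant as generators. -/
theorem Ltilde_odd (hq : Generic q) (k : ℕ) : Ltilde q (2 * k + 3) =
    ((q - q⁻¹) / 2) • (ev q * Ltilde q (2 * k + 2) + Ltilde q (2 * k + 2) * ev q) -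
      (1 / 4 : ℂ) • (M q 3 * Ltilde q (2 * k) - Ltilde q (2 * k) * M q 3) := by
  have h1 := hv_L_odd hq k
  have h2 := hv_L'_odd hq k
  have h3 := L_sub_L'_Ltilde hq (2 * k)
  have h4 := hv_Ltilde_even hq k
  rw [pow_mul, neg_one_sq, one_pow, one_smul] at h3
  rw [← hv_ev hq]
  have h5 : Ltilde q (2 * k + 2) = (1 / 2 : ℂ) • (L q (2 * k + 2) + L' q (2 * k + 2)) := rfl
  have h6 : Ltilde q (2 * k + 3) = (1 / 2 : ℂ) • (L q (2 * k + 3) + L' q (2 * k + 3)) := rfl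
  linear_combination (norm := skip) (1 / 4 : ℂ) • (h1 - h2) - (1 / 4 : ℂ) • (hv q * h3 - h3 * hv q
    + ev q * h4 - h4 * ev q) + h6 - ((q - q⁻¹) / 2) • (ev q * h5 + h5 * ev q)
  simp only [mul_add, add_mul, mul_sub, sub_mul, smul_mul_assoc, mul_smul_comm, mul_assoc]
  module

theorem imaginaryRelations (hq : Generic q) :
    ImaginaryRelations q (fun n => Ltilde q (2 * n)) (fun n => M q (2 * n + 1)) where
  zero := by
    simp only [mul_zero]
    rw [Ltilde, L'_zero, L_zero, ← smul_add, smul_smul, smul_smul, ← two_smul ℂ, smul_smul]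
    rw [show (q - q⁻¹) * (1 / 2) * (q - q⁻¹)⁻¹ * 2 = (q - q⁻¹) * (q - q⁻¹)⁻¹ by ring,
      mul_inv_cancel₀ hq.theta_ne, one_smul]
  one j := by
    have := (M_succ_eq hq j).2
    rw [hv_eq hq] at this
    exact this
  sq n := by
    simp only [mul_zero, zero_add]
    rw [M_zero hq.ne_zero]
    exact commute_ev_sq_Ltilde hq _
  step n j := by
    -- For j = 0, bracket `Ltilde_odd` with h and compare with `hv_Ltilde_odd`. Afterwards [h, ·]
    -- fixes the L̃_{2n} and sends each M to the next one, so it turns case j into case j + 1.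
    induction j with
    | zero =>
      have a := Ltilde_odd hq n
      have b := hv_Ltilde_odd hq (n + 1)
      have c1 := hv_Ltilde_even hq n
      have c2 := hv_Ltilde_even hq (n + 1)
      have d1 := (M_succ_eq hq 1).2
      have d0 := hv_ev hq
      simp only [mul_zero, zero_add]
      rw [M_zero hq.ne_zero]
      rw [show 2 * (n + 1) + 1 = 2 * n + 3 by ring, show 2 * (n + 1) + 2 = 2 * (n + 2) by ring] at b
      rw [show 2 * n + 2 = 2 * (n + 1) by ring] at a
      linear_combination (norm := skip) (hv q * a - a * hv q) - b
        + ((q - q⁻¹) / 2) • (d0 * Ltilde q (2 * (n + 1)) + Ltilde q (2 * (n + 1)) * d0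
          + ev q * c2 + c2 * ev q)
        + (1 / 4 : ℂ) • (- d1 * Ltilde q (2 * n) + Ltilde q (2 * n) * d1 - M q 3 * c1 + c1 * M q 3)
      simp only [mul_add, add_mul, mul_sub, sub_mul, smul_mul_assoc, mul_smul_comm, mul_assoc,
        neg_mul]
      module
    | succ j ih =>
      have c0 := hv_Ltilde_even hq n
      have c1 := hv_Ltilde_even hq (n + 1)
      have c2 := hv_Ltilde_even hq (n + 2)
      have d0 := (M_succ_eq hq j).2
      have d1 := (M_succ_eq hq (j + 1)).2
      have d2 := (M_succ_eq hq (j + 2)).2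
      linear_combination (norm := skip) hv q * ih - ih * hv q
        - (Ltilde q (2 * (n + 2)) * d0 - d0 * Ltilde q (2 * (n + 2)))
        - c2 * M q (2 * j + 1) + M q (2 * j + 1) * c2
        + ((q - q⁻¹) / 2) • (Ltilde q (2 * (n + 1)) * d1 + d1 * Ltilde q (2 * (n + 1))
          + c1 * M q (2 * (j + 1) + 1) + M q (2 * (j + 1) + 1) * c1)
        + (1 / 4 : ℂ) • (Ltilde q (2 * n) * d2 - d2 * Ltilde q (2 * n)
          + c0 * M q (2 * (j + 2) + 1) - M q (2 * (j + 2) + 1) * c0)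
      simp only [mul_add, add_mul, mul_sub, sub_mul, smul_mul_assoc, mul_smul_comm, mul_assoc]
      module

/-- The boundary case m = -1 of `L_L'_exchange`, where L₀ is a scalar and one commutator disappears.
-/
theorem L_L'_two_exchange (hq : Generic q) (n : ℕ) :
    L q (2 * n) * L' q 2 - L' q 2 * L q (2 * n) =
      q • (L' q (2 * n + 1) * ev q - ev q * L q (2 * n + 1)) +
      q⁻¹ • (ev q * L' q (2 * n + 1) - L q (2 * n + 1) * ev q) := by
  have h1 := hv_L_even hq n
  have h2 := (commute_ev_sq_L hq (2 * n)).eq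
  have h3 := L_sub_L' hq (2 * n)
  rw [pow_mul, neg_one_sq, one_pow, one_smul] at h3
  rw [L'_two hq]
  linear_combination (norm := skip) - h1 + h2 + q • (h3 * ev q + ev q * h3 + h2)
  simp only [mul_add, add_mul, mul_sub, sub_mul, smul_mul_assoc, mul_smul_comm, mul_assoc]
  module

end

/-! ### Power series: Euler derivation, rescaling, and series weighted by a sequence -/

section

variable {A : Type*} [Ring A] [Algebra ℂ A]

/-- The Euler derivation `X d/dX` of power series. -/
def euler : PowerSeries A →ₗ[ℂ] PowerSeries A where
  toFun f := PowerSeries.mk fun n => (n : ℂ) • PowerSeries.coeff n f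
  map_add' f g := by ext n; simp
  map_smul' r f := by ext n; simp [smul_comm r]

@[simp] theorem coeff_euler (n : ℕ) (f : PowerSeries A) :
    PowerSeries.coeff n (euler f) = (n : ℂ) • PowerSeries.coeff n f := by simp [euler]

theorem euler_mul (f g : PowerSeries A) : euler (f * g) = euler f * g + f * euler g := by
  ext n
  simp only [coeff_euler, map_add, PowerSeries.coeff_mul, Finset.smul_sum, smul_mul_assoc,
    mul_smul_comm]
  rw [← Finset.sum_add_distrib]
  refine Finset.sum_congr rfl fun p hp => ?_
  rw [← add_smul, ← Finset.HasAntidiagonal.mem_antidiagonal.1 hp, Nat.cast_add]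

/-- The substitution `X ↦ cX`. -/
def scale (c : ℂ) : PowerSeries A →ₐ[ℂ] PowerSeries A where
  toFun f := PowerSeries.mk fun n => c ^ n • PowerSeries.coeff n f
  map_one' := by
    ext n
    simp only [PowerSeries.coeff_mk, PowerSeries.coeff_one]
    split_ifs with h <;> simp [h]
  map_mul' f g := by
    ext n
    simp only [PowerSeries.coeff_mk, PowerSeries.coeff_mul, Finset.smul_sum]
    refine Finset.sum_congr rfl fun p hp => ?_
    rw [← Finset.HasAntidiagonal.mem_antidiagonal.1 hp, pow_add, smul_mul_smul_comm]
  map_zero' := by ext n; simp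
  map_add' f g := by ext n; simp
  commutes' r := by
    ext n
    simp only [PowerSeries.coeff_mk, PowerSeries.algebraMap_apply, PowerSeries.coeff_C]
    split_ifs with h <;> simp [h]

@[simp] theorem coeff_scale (c : ℂ) (n : ℕ) (f : PowerSeries A) :
    PowerSeries.coeff n (scale c f) = c ^ n • PowerSeries.coeff n f := by simp [scale]

theorem scale_X (c : ℂ) : scale c (PowerSeries.X : PowerSeries A) = c • PowerSeries.X := by
  ext n
  simp only [coeff_scale, PowerSeries.coeff_X, PowerSeries.coeff_smul]
  split_ifs with h <;> simp [h]

/-- `∑ fⱼ Xʲ ↦ ∑ fⱼ m_{j+k} Xʲ`. -/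
def weighted (m : ℕ → A) (k : ℕ) : PowerSeries ℂ →ₗ[ℂ] PowerSeries A where
  toFun f := PowerSeries.mk fun j => PowerSeries.coeff j f • m (j + k)
  map_add' f g := by ext n; simp [add_smul]
  map_smul' r f := by ext n; simp [mul_smul]

@[simp] theorem coeff_weighted (m : ℕ → A) (k j : ℕ) (f : PowerSeries ℂ) :
    PowerSeries.coeff j (weighted m k f) = PowerSeries.coeff j f • m (j + k) := by simp [weighted]

theorem weighted_X_mul (m : ℕ → A) (k : ℕ) (f : PowerSeries ℂ) :
    weighted m k (PowerSeries.X * f) = PowerSeries.X * weighted m (k + 1) f := by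
  ext n
  cases n with
  | zero => simp
  | succ n =>
    rw [coeff_weighted, PowerSeries.coeff_succ_X_mul, PowerSeries.coeff_succ_X_mul, coeff_weighted]
    congr 2
    ring

theorem weighted_one (m : ℕ → A) (k : ℕ) : weighted m k 1 = PowerSeries.C (m k) := by
  ext n
  simp only [coeff_weighted, PowerSeries.coeff_one, PowerSeries.coeff_C]
  split_ifs with h <;> simp [h]

theorem scale_weighted (c : ℂ) (m : ℕ → A) (k : ℕ) (f : PowerSeries ℂ) :
    scale c (weighted m k f) = weighted m k (scale c f) := by
  ext n; simp [smul_smul]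

theorem euler_weighted (m : ℕ → A) (k : ℕ) (f : PowerSeries ℂ) :
    euler (weighted m k f) = weighted m k (euler f) := by
  ext n; simp [smul_smul]

theorem coeff_mul_weighted (l : PowerSeries A) (m : ℕ → A) (k n : ℕ) (f : PowerSeries ℂ) :
    PowerSeries.coeff n (l * weighted m k f) = ∑ p ∈ Finset.HasAntidiagonal.antidiagonal n,
      PowerSeries.coeff p.2 f • PowerSeries.coeff p.1 (l * PowerSeries.C (m (p.2 + k))) := by
  rw [PowerSeries.coeff_mul]
  simp

theorem coeff_weighted_mul (l : PowerSeries A) (m : ℕ → A) (k n : ℕ) (f : PowerSeries ℂ) :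
    PowerSeries.coeff n (weighted m k f * l) = ∑ p ∈ Finset.HasAntidiagonal.antidiagonal n,
      PowerSeries.coeff p.2 f • PowerSeries.coeff p.1 (PowerSeries.C (m (p.2 + k)) * l) := by
  rw [PowerSeries.coeff_mul, ← Finset.Nat.sum_antidiagonal_swap]
  simp


/-- A relation that holds for the constants `m_j` extends to `weighted`. -/
theorem weighted_relation {l : PowerSeries A} {m : ℕ → A} {θ : ℂ}
    (h : ∀ j, l * PowerSeries.C (m j) - PowerSeries.C (m j) * l =
      PowerSeries.X * (θ • (l * PowerSeries.C (m (j + 1)) + PowerSeries.C (m (j + 1)) * l) +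
        PowerSeries.X * (l * PowerSeries.C (m (j + 2)) - PowerSeries.C (m (j + 2)) * l)))
    (k : ℕ) (f : PowerSeries ℂ) :
    l * weighted m k f - weighted m k f * l =
      PowerSeries.X * (θ • (l * weighted m (k + 1) f + weighted m (k + 1) f * l) +
        PowerSeries.X * (l * weighted m (k + 2) f - weighted m (k + 2) f * l)) := by
  -- Both sides have the form ∑ⱼ fⱼ Xʲ F'ⱼ, written coefficientwise, so relations F'ⱼ = X G'ⱼ
  -- holding for each j can be summed.
  have e : ∀ (n : ℕ) (F G : PowerSeries A) (F' G' : ℕ → PowerSeries A),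
      (∀ n, PowerSeries.coeff n F = ∑ p ∈ Finset.HasAntidiagonal.antidiagonal n,
        PowerSeries.coeff p.2 f • PowerSeries.coeff p.1 (F' p.2)) →
      (∀ n, PowerSeries.coeff n G = ∑ p ∈ Finset.HasAntidiagonal.antidiagonal n,
        PowerSeries.coeff p.2 f • PowerSeries.coeff p.1 (G' p.2)) →
      (∀ j, F' j = PowerSeries.X * G' j) →
      PowerSeries.coeff n F = PowerSeries.coeff n (PowerSeries.X * G) := by
    intro n F G F' G' hF hG hj
    rw [hF]
    cases n with
    | zero => simp [hj]
    | succ n =>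
      rw [PowerSeries.coeff_succ_X_mul, hG, Finset.Nat.sum_antidiagonal_succ]
      simp [hj, PowerSeries.coeff_succ_X_mul]
  ext n
  refine e n _ _ (fun j => l * PowerSeries.C (m (j + k)) - PowerSeries.C (m (j + k)) * l)
    (fun j => θ • (l * PowerSeries.C (m (j + k + 1)) + PowerSeries.C (m (j + k + 1)) * l) +
        PowerSeries.X * (l * PowerSeries.C (m (j + k + 2)) - PowerSeries.C (m (j + k + 2)) * l))
    ?_ ?_ (fun j => h (j + k))
  · intro n
    rw [map_sub, coeff_mul_weighted, coeff_weighted_mul, ← Finset.sum_sub_distrib]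
    refine Finset.sum_congr rfl fun p _ => ?_
    rw [map_sub, smul_sub]
  · intro n
    have e2 : PowerSeries.coeff n (PowerSeries.X * (l * weighted m (k + 2) f -
        weighted m (k + 2) f * l)) = ∑ p ∈ Finset.HasAntidiagonal.antidiagonal n,
        PowerSeries.coeff p.2 f • PowerSeries.coeff p.1 (PowerSeries.X *
          (l * PowerSeries.C (m (p.2 + (k + 2))) - PowerSeries.C (m (p.2 + (k + 2))) * l)) := by
      cases n with
      | zero => simp
      | succ n =>
        rw [PowerSeries.coeff_succ_X_mul, Finset.Nat.sum_antidiagonal_succ, map_sub,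
          coeff_mul_weighted, coeff_weighted_mul, ← Finset.sum_sub_distrib]
        simp [PowerSeries.coeff_succ_X_mul, smul_sub]
    rw [map_add, e2, PowerSeries.coeff_smul, map_add, coeff_mul_weighted, coeff_weighted_mul,
      ← Finset.sum_add_distrib, Finset.smul_sum, ← Finset.sum_add_distrib]
    refine Finset.sum_congr rfl fun p _ => ?_
    simp only [map_add, PowerSeries.coeff_smul, smul_add, add_assoc]
    simp only [smul_comm θ]

/-- `1 - θX - X²`. -/
def dplus (q : ℂ) : PowerSeries ℂ := 1 - (q - q⁻¹) • PowerSeries.X - PowerSeries.X * PowerSeries.X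
/-- `1 + θX - X²`. -/
def dminus (q : ℂ) : PowerSeries ℂ := 1 + (q - q⁻¹) • PowerSeries.X - PowerSeries.X * PowerSeries.X

/-- `(1 - θX - X²)⁻¹`. -/
def dinv (q : ℂ) : PowerSeries ℂ := (dplus q)⁻¹

theorem dplus_mul_dinv (q : ℂ) : dplus q * dinv q = 1 :=
  PowerSeries.mul_inv_cancel _ (by simp [dplus])

/-- The generating series of the elements `2ⁿθ xₙ`. -/
def genSeries (q : ℂ) (x : ℕ → A) : PowerSeries A :=
  PowerSeries.mk fun n => ((q - q⁻¹) * 2 ^ n) • x n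

/-- `∑ (qⁿ - q⁻ⁿ + (-q⁻¹)ⁿ - (-q)ⁿ) Xⁿ`. -/
def logSeries (q : ℂ) : PowerSeries ℂ :=
  PowerSeries.mk fun n => q ^ n - q⁻¹ ^ n + (-q⁻¹) ^ n - (-q) ^ n

theorem mk_pow_mul (c : ℂ) : PowerSeries.mk (fun n => c ^ n) * (1 - c • PowerSeries.X) = 1 := by
  ext n
  cases n with
  | zero => simp [mul_sub]
  | succ n =>
    rw [mul_sub, mul_one, mul_smul_comm, map_sub, PowerSeries.coeff_smul,
      PowerSeries.coeff_succ_mul_X, PowerSeries.coeff_mk, PowerSeries.coeff_mk,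
      PowerSeries.coeff_one, if_neg (Nat.succ_ne_zero n), pow_succ, smul_eq_mul]
    ring

theorem euler_one : euler (1 : PowerSeries A) = 0 := by
  ext n
  rw [coeff_euler, PowerSeries.coeff_one]
  split_ifs with h <;> simp [h]

theorem euler_X : euler (PowerSeries.X : PowerSeries A) = PowerSeries.X := by
  ext n
  rw [coeff_euler, PowerSeries.coeff_X]
  split_ifs with h <;> simp [h]

theorem euler_dplus (q : ℂ) : euler (dplus q) =
    - (q - q⁻¹) • PowerSeries.X - 2 * (PowerSeries.X * PowerSeries.X) := by
  simp only [dplus, map_sub, map_smul, euler_mul, euler_X, euler_one]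
  rw [neg_smul]
  ring

theorem euler_dminus (q : ℂ) : euler (dminus q) =
    (q - q⁻¹) • PowerSeries.X - 2 * (PowerSeries.X * PowerSeries.X) := by
  simp only [dminus, map_sub, map_add, map_smul, euler_mul, euler_X, euler_one]
  ring

/-- 1 - θX - X² = (1 - qX)(1 + q⁻¹X) and 1 + θX - X² = (1 + qX)(1 - q⁻¹X). The logarithmic
derivative of their quotient is therefore a sum of four geometric series, with constant terms
cancelling. -/
theorem logSeries_mul {q : ℂ} (hq0 : q ≠ 0) : logSeries q * (dplus q * dminus q) =
    euler (dminus q) * dplus q - dminus q * euler (dplus q) := by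
  have e : logSeries q = PowerSeries.mk (fun n => q ^ n) - PowerSeries.mk (fun n => q⁻¹ ^ n) +
      PowerSeries.mk (fun n => (-q⁻¹) ^ n) - PowerSeries.mk (fun n => (-q) ^ n) := by
    ext n; simp [logSeries]
  have h1 := mk_pow_mul q
  have h2 := mk_pow_mul q⁻¹
  have h3 := mk_pow_mul (-q⁻¹)
  have h4 := mk_pow_mul (-q)
  rw [e, euler_dplus, euler_dminus, dplus, dminus]
  simp only [PowerSeries.smul_eq_C_mul, map_neg, map_sub] at *
  have hc : PowerSeries.C q * PowerSeries.C q⁻¹ = (1 : PowerSeries ℂ) := by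
    rw [← map_mul, mul_inv_cancel₀ hq0, map_one]
  generalize PowerSeries.mk (fun n => q ^ n) = g1 at *
  generalize PowerSeries.mk (fun n => q⁻¹ ^ n) = g2 at *
  generalize PowerSeries.mk (fun n => (-q⁻¹) ^ n) = g3 at *
  generalize PowerSeries.mk (fun n => (-q) ^ n) = g4 at *
  generalize PowerSeries.C q = a at *
  generalize PowerSeries.C q⁻¹ = b at *
  generalize (PowerSeries.X : PowerSeries ℂ) = X at *
  have d1 : 1 - (a - b) * X - X * X = (1 - a * X) * (1 + b * X) := by
    linear_combination (X * X) * hc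
  have d2 : 1 + (a - b) * X - X * X = (1 + a * X) * (1 - b * X) := by
    linear_combination (X * X) * hc
  rw [d1, d2]
  have k1 : g1 * ((1 - a * X) * (1 + b * X) * ((1 + a * X) * (1 - b * X))) =
    (1 + b * X) * ((1 + a * X) * (1 - b * X)) := by linear_combination ((1 + b * X) * ((1 + a * X) * (1 - b * X))) * h1
  have k2 : g2 * ((1 - a * X) * (1 + b * X) * ((1 + a * X) * (1 - b * X))) =
    (1 - a * X) * (1 + b * X) * (1 + a * X) := by linear_combination ((1 - a * X) * (1 + b * X) * (1 + a * X)) * h2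
  have k3 : g3 * ((1 - a * X) * (1 + b * X) * ((1 + a * X) * (1 - b * X))) =
    (1 - a * X) * ((1 + a * X) * (1 - b * X)) := by linear_combination ((1 - a * X) * ((1 + a * X) * (1 - b * X))) * h3
  have k4 : g4 * ((1 - a * X) * (1 + b * X) * ((1 + a * X) * (1 - b * X))) =
    (1 - a * X) * (1 + b * X) * (1 - b * X) := by linear_combination ((1 - a * X) * (1 + b * X) * (1 - b * X)) * h4
  rw [sub_mul, add_mul, sub_mul, k1, k2, k3, k4]
  have x2 : X * X = a * b * (X * X) := by rw [hc, one_mul]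
  rw [x2]
  ring

theorem logSeries_mul_dminus {q : ℂ} (hq0 : q ≠ 0) :
    logSeries q * (dminus q * dinv q) = euler (dminus q * dinv q) := by
  have h1 := dplus_mul_dinv q
  have h2 : euler (dplus q * dinv q) = 0 := by rw [h1, euler_one]
  rw [euler_mul] at h2 ⊢
  linear_combination (dinv q * dinv q) * logSeries_mul hq0 - dminus q * dinv q * h2
    - (logSeries q * dminus q * dinv q - dminus q * euler (dinv q) - euler (dminus q) * dinv q) * h1

end

/-! ### Conjugation of the M's by the generating series, and its logarithmic derivative -/

section

variable {A : Type*} [Ring A] [Algebra ℂ A] {q : ℂ} {x m : ℕ → A}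

theorem ImaginaryRelations.constantCoeff (h : ImaginaryRelations q x m) :
    PowerSeries.constantCoeff (genSeries q x) = 1 := by
  simp [genSeries, h.zero]

/-- The recursion `step` as a power series identity. The weights 2ⁿ in `genSeries` absorb the
denominators 2 and 4 of the recursion. -/
theorem ImaginaryRelations.genSeries_C (h : ImaginaryRelations q x m) (j : ℕ) :
    genSeries q x * PowerSeries.C (m j) - PowerSeries.C (m j) * genSeries q x =
      PowerSeries.X * ((q - q⁻¹) • (genSeries q x * PowerSeries.C (m (j + 1)) +
        PowerSeries.C (m (j + 1)) * genSeries q x) + PowerSeries.X *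
        (genSeries q x * PowerSeries.C (m (j + 2)) - PowerSeries.C (m (j + 2)) * genSeries q x)) := by
  ext n
  match n with
  | 0 =>
    simp [genSeries, h.zero]
  | 1 =>
    rw [show (1 : ℕ) = 0 + 1 by rfl, PowerSeries.coeff_succ_X_mul]
    simp [genSeries, h.zero]
    rw [← smul_sub, h.one]
    module
  | n + 2 =>
    rw [show n + 2 = n + 1 + 1 by rfl, PowerSeries.coeff_succ_X_mul, map_add,
      PowerSeries.coeff_succ_X_mul]
    simp only [genSeries, map_sub, map_add, PowerSeries.coeff_smul, PowerSeries.coeff_mul_C,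
      PowerSeries.coeff_C_mul, PowerSeries.coeff_mk, smul_mul_assoc, mul_smul_comm]
    linear_combination (norm := module) ((q - q⁻¹) * 2 ^ (n + 2)) • h.step n j

/-- Raising the index of m with a factor X amounts to multiplying the scalar series by X. With D =
`dplus q` and D̄ = `dminus q` the three-term relation becomes ℓ·w(D f) = w(D̄ f)·ℓ, so conjugation
by ℓ is multiplication of the scalar series by D̄/D. -/
theorem ImaginaryRelations.genSeries_weighted (h : ImaginaryRelations q x m) (k : ℕ)
    (f : PowerSeries ℂ) : genSeries q x * weighted m k f =
      weighted m k (dminus q * dinv q * f) * genSeries q x := by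
  have hd := dplus_mul_dinv q
  have e1 : f = dinv q * f - (q - q⁻¹) • (PowerSeries.X * (dinv q * f)) -
      PowerSeries.X * (PowerSeries.X * (dinv q * f)) := by
    rw [dplus] at hd
    simp only [PowerSeries.smul_eq_C_mul] at *
    linear_combination -f * hd
  have e2 : dminus q * dinv q * f = dinv q * f + (q - q⁻¹) • (PowerSeries.X * (dinv q * f)) -
      PowerSeries.X * (PowerSeries.X * (dinv q * f)) := by
    rw [dminus]
    simp only [PowerSeries.smul_eq_C_mul] at *
    ring
  rw [e2]
  conv_lhs => rw [e1]
  have key := weighted_relation h.genSeries_C k (dinv q * f)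
  simp only [map_sub, map_add, map_smul, weighted_X_mul]
  have hX : ∀ g : PowerSeries A, genSeries q x * (PowerSeries.X * g) =
    PowerSeries.X * (genSeries q x * g) := fun g => by
      rw [← mul_assoc, ← PowerSeries.X_mul, mul_assoc]
  simp only [mul_sub, mul_add, mul_smul_comm, hX, sub_mul, add_mul, smul_mul_assoc, mul_assoc] at *
  linear_combination (norm := module) key

/-- The inverse of a power series with constant coefficient `1`. -/
theorem exists_inv_of_constantCoeff_eq_one {R : Type*} [Ring R] {f : PowerSeries R}
    (h : PowerSeries.constantCoeff f = 1) : ∃ g, f * g = 1 ∧ g * f = 1 :=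
  ⟨f.invOfUnit 1, PowerSeries.mul_invOfUnit f 1 (by simpa using h),
    PowerSeries.invOfUnit_mul f 1 (by simpa using h)⟩

/-- The logarithmic derivative of the generating series. -/
theorem ImaginaryRelations.exists_log (h : ImaginaryRelations q x m) :
    ∃ l : PowerSeries A, l * genSeries q x = euler (genSeries q x) := by
  obtain ⟨g, hg, hg'⟩ := exists_inv_of_constantCoeff_eq_one h.constantCoeff
  exact ⟨euler (genSeries q x) * g, by rw [mul_assoc, hg', mul_one]⟩

theorem ImaginaryRelations.mul_right_cancel (h : ImaginaryRelations q x m) {f f' : PowerSeries A}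
    (hf : f * genSeries q x = f' * genSeries q x) : f = f' := by
  obtain ⟨g, hg, hg'⟩ := exists_inv_of_constantCoeff_eq_one h.constantCoeff
  rw [← mul_one f, ← hg, ← mul_assoc, hf, mul_assoc, hg, mul_one]

/-- Choosing f inverse to D̄/D makes ℓ w(f) ℓ⁻¹ the constant m_k. Differentiating by the Euler
operator then gives the commutator of the logarithmic derivative with m_k. -/
theorem ImaginaryRelations.log_C (h : ImaginaryRelations q x m) (hq0 : q ≠ 0) {l : PowerSeries A}
    (hl : l * genSeries q x = euler (genSeries q x)) (k : ℕ) :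
    l * PowerSeries.C (m k) - PowerSeries.C (m k) * l = weighted m k (logSeries q) := by
  have hd := dplus_mul_dinv q
  -- the factor `G = D̄/D` is invertible
  obtain ⟨f, hf⟩ : ∃ f : PowerSeries ℂ, dminus q * dinv q * f = 1 := by
    have : PowerSeries.constantCoeff (dminus q) ≠ 0 := by simp [dminus]
    refine ⟨dplus q * (dminus q)⁻¹, ?_⟩
    linear_combination (PowerSeries.mul_inv_cancel _ this) + dminus q * (dminus q)⁻¹ * hd
  have h1 := h.genSeries_weighted k f
  have h2 := congrArg euler h1
  have h3 := h.genSeries_weighted k (euler f)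
  have h4 : euler (dminus q * dinv q * f) = 0 := by rw [hf, euler_one]
  have h5 : dminus q * dinv q * euler f = - logSeries q := by
    rw [euler_mul, ← logSeries_mul_dminus hq0] at h4
    linear_combination h4 - logSeries q * hf
  rw [euler_mul, euler_mul, euler_weighted, euler_weighted, h4, map_zero, zero_mul, zero_add,
    h3, h5, ← hl, hf, weighted_one, mul_assoc, h1, hf, weighted_one, map_neg, neg_mul] at h2
  apply h.mul_right_cancel
  rw [sub_mul]
  linear_combination (norm := (simp only [mul_assoc]; abel)) h2

theorem ImaginaryRelations.coeff_log (h : ImaginaryRelations q x m) (hq0 : q ≠ 0)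
    {l : PowerSeries A} (hl : l * genSeries q x = euler (genSeries q x)) (n k : ℕ) :
    PowerSeries.coeff n l * m k - m k * PowerSeries.coeff n l =
      (q ^ n - q⁻¹ ^ n + (-q⁻¹) ^ n - (-q) ^ n) • m (n + k) := by
  have := congrArg (PowerSeries.coeff n) (h.log_C hq0 hl k)
  simpa [logSeries] using this

end

/-! ### Anticommutators of the M's, and commutation of their squares -/

section

variable {A : Type*} [Ring A] [Algebra ℂ A] {q : ℂ} {x m : ℕ → A}

theorem log_coeff_even (q : ℂ) {n : ℕ} (hn : Even n) :
    q ^ n - q⁻¹ ^ n + (-q⁻¹) ^ n - (-q) ^ n = 0 := by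
  rw [hn.neg_pow, hn.neg_pow]; ring

theorem log_coeff_odd (q : ℂ) {n : ℕ} (hn : Odd n) :
    q ^ n - q⁻¹ ^ n + (-q⁻¹) ^ n - (-q) ^ n = 2 * (q ^ n - q⁻¹ ^ n) := by
  rw [hn.neg_pow, hn.neg_pow]; ring

theorem Generic.pow_sub_ne (hq : Generic q) {n : ℕ} (hn : 0 < n) : q ^ n - q⁻¹ ^ n ≠ 0 := by
  intro h
  refine hq.2 (n + n) (by omega) ?_
  have h0 : q ^ n ≠ 0 := pow_ne_zero _ hq.ne_zero
  rw [inv_pow, sub_eq_zero] at h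
  rw [pow_add]
  nth_rw 2 [h]
  exact mul_inv_cancel₀ h0

/-- An element that commutes with all `x n` commutes with the coefficients of the logarithmic
derivative. -/
theorem ImaginaryRelations.commute_log (h : ImaginaryRelations q x m) {l : PowerSeries A}
    (hl : l * genSeries q x = euler (genSeries q x)) {c : A} (hc : ∀ n, Commute c (x n)) (n : ℕ) :
    Commute c (PowerSeries.coeff n l) := by
  have hg : PowerSeries.C c * genSeries q x = genSeries q x * PowerSeries.C c := by
    ext n
    simp [genSeries, (hc n).eq]
  have he : PowerSeries.C c * euler (genSeries q x) = euler (genSeries q x) * PowerSeries.C c := by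
    ext n
    simp [genSeries, (hc n).eq]
  have : PowerSeries.C c * l = l * PowerSeries.C c := by
    apply h.mul_right_cancel
    rw [mul_assoc, hl, mul_assoc, hg, ← mul_assoc, hl, he]
  have := congrArg (PowerSeries.coeff n) this
  rwa [PowerSeries.coeff_C_mul, PowerSeries.coeff_mul_C] at this

theorem coeff_zero_log {l : PowerSeries A} (h : ImaginaryRelations q x m)
    (hl : l * genSeries q x = euler (genSeries q x)) : PowerSeries.coeff 0 l = 0 := by
  have := congrArg (PowerSeries.coeff 0) hl
  rwa [coeff_euler, Nat.cast_zero, zero_smul, PowerSeries.coeff_zero_eq_constantCoeff_apply,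
    map_mul, h.constantCoeff, mul_one, ← PowerSeries.coeff_zero_eq_constantCoeff_apply] at this

/-- Conversely, an element that commutes with the coefficients of the logarithmic derivative
commutes with all `x n`. -/
theorem ImaginaryRelations.commute_of_commute_log (h : ImaginaryRelations q x m)
    (hq : Generic q) {l : PowerSeries A}
    (hl : l * genSeries q x = euler (genSeries q x)) {c : A}
    (hc : ∀ n, Commute c (PowerSeries.coeff n l)) (n : ℕ) : Commute c (x n) := by
  have key : ∀ n, Commute c (PowerSeries.coeff n (genSeries q x)) := by
    intro n
    induction n using Nat.strong_induction_on with
    | _ n ih =>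
      rcases Nat.eq_zero_or_pos n with rfl | hn
      · rw [PowerSeries.coeff_zero_eq_constantCoeff_apply, h.constantCoeff]
        exact Commute.one_right c
      · have h1 := congrArg (PowerSeries.coeff n) hl
        rw [coeff_euler, PowerSeries.coeff_mul] at h1
        have h2 : PowerSeries.coeff n (genSeries q x) = (n : ℂ)⁻¹ • ((n : ℂ) •
            PowerSeries.coeff n (genSeries q x)) := by
          rw [smul_smul, inv_mul_cancel₀ (by exact_mod_cast hn.ne'), one_smul]
        rw [h2, ← h1]
        refine Commute.smul_right (Commute.sum_right _ _ _ fun p hp => ?_) _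
        have hp := Finset.HasAntidiagonal.mem_antidiagonal.1 hp
        rcases Nat.eq_zero_or_pos p.1 with h0 | h0
        · rw [h0, coeff_zero_log h hl, zero_mul]
          exact Commute.zero_right c
        · exact (hc _).mul_right (ih _ (by omega))
  have := key n
  rw [genSeries, PowerSeries.coeff_mk] at this
  have h0 : (q - q⁻¹) * 2 ^ n ≠ 0 := mul_ne_zero hq.theta_ne (by simp)
  have h2 : x n = ((q - q⁻¹) * 2 ^ n)⁻¹ • (((q - q⁻¹) * 2 ^ n) • x n) := by
    rw [smul_smul, inv_mul_cancel₀ h0, one_smul]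
  rw [h2]
  exact this.smul_right _

/-- The logarithmic coefficients commute with m₀², but their commutator with m₀ is a multiple of
m_n, nonzero for odd n. The Leibniz rule turns this into vanishing of the anticommutator. -/
theorem ImaginaryRelations.anticommute_zero_odd (h : ImaginaryRelations q x m) (hq : Generic q)
    {n : ℕ} (hn : Odd n) : m 0 * m n + m n * m 0 = 0 := by
  obtain ⟨l, hl⟩ := h.exists_log
  have h1 := (h.commute_log hl h.sq n).eq
  have h2 := h.coeff_log hq.ne_zero hl n 0
  rw [log_coeff_odd q hn, add_zero] at h2
  have h3 : (2 * (q ^ n - q⁻¹ ^ n)) • (m 0 * m n + m n * m 0) = 0 := by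
    rw [smul_add, ← mul_smul_comm, ← smul_mul_assoc, ← h2, mul_sub, sub_mul]
    linear_combination (norm := noncomm_ring) -h1
  exact (smul_eq_zero.1 h3).resolve_left (mul_ne_zero two_ne_zero (hq.pow_sub_ne hn.pos))

theorem ImaginaryRelations.bracket_anti (h : ImaginaryRelations q x m) (j k : ℕ) :
    x 1 * (m j * m k + m k * m j) - (m j * m k + m k * m j) * x 1 =
      (m (j + 1) * m k + m k * m (j + 1)) + (m j * m (k + 1) + m (k + 1) * m j) := by
  rw [← h.one, ← h.one]
  noncomm_ring

/-- Applying [x₁, ·] twice to the vanishing anticommutators of index sum 2i + 1 gives a second-order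
linear recurrence for those of index sum 2i + 3, with both end values zero. -/
theorem ImaginaryRelations.anticommute_aux (h : ImaginaryRelations q x m) (hq : Generic q) (i : ℕ) :
    (∀ j k, j + k = 2 * i + 1 → m j * m k + m k * m j = 0) ∧
    (∀ j k, j + k = 2 * i + 1 → m (j + 1) * m k + m k * m (j + 1) +
      (m j * m (k + 1) + m (k + 1) * m j) = 0) := by
  have step : ∀ i, (∀ j k, j + k = 2 * i + 1 → m j * m k + m k * m j = 0) →
    (∀ j k, j + k = 2 * i + 1 → m (j + 1) * m k + m k * m (j + 1) +
      (m j * m (k + 1) + m (k + 1) * m j) = 0) := by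
    intro i hi j k hjk
    rw [← h.bracket_anti, hi j k hjk]
    simp
  induction i with
  | zero =>
    have h0 : ∀ j k, j + k = 2 * 0 + 1 → m j * m k + m k * m j = 0 := by
      intro j k hjk
      have h1 := h.anticommute_zero_odd hq (n := 1) odd_one
      obtain ⟨rfl, rfl⟩ | ⟨rfl, rfl⟩ : (j = 0 ∧ k = 1) ∨ (j = 1 ∧ k = 0) := by omega
      · exact h1
      · rw [add_comm]; exact h1
    exact ⟨h0, step 0 h0⟩
  | succ i ih =>
    suffices h0 : ∀ j k, j + k = 2 * (i + 1) + 1 → m j * m k + m k * m j = 0 from ⟨h0, step _ h0⟩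
    have h2 := ih.2
    set s : ℕ → A := fun j => m j * m (2 * i + 3 - j) + m (2 * i + 3 - j) * m j with hs
    have s0 : s 0 = 0 := h.anticommute_zero_odd hq ⟨i + 1, by omega⟩
    have hrec : ∀ j, j ≤ 2 * i + 1 → s (j + 2) + (2 : ℂ) • s (j + 1) + s j = 0 := by
      intro j hj
      obtain ⟨k, hk⟩ : ∃ k, j + k = 2 * i + 1 := ⟨2 * i + 1 - j, by omega⟩
      have a1 := h.bracket_anti (j + 1) k
      have a2 := h.bracket_anti j (k + 1)
      have a3 : x 1 * (m (j + 1) * m k + m k * m (j + 1) +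
          (m j * m (k + 1) + m (k + 1) * m j)) - (m (j + 1) * m k + m k * m (j + 1) +
          (m j * m (k + 1) + m (k + 1) * m j)) * x 1 = 0 := by rw [h2 j k hk]; simp
      simp only [hs]
      rw [show 2 * i + 3 - (j + 2) = k by omega, show 2 * i + 3 - (j + 1) = k + 1 by omega,
        show 2 * i + 3 - j = k + 2 by omega]
      rw [mul_add, add_mul] at a3
      linear_combination (norm := module) a3 - a1 - a2
    -- The characteristic root -1 is double, so the solutions vanishing at 0 are multiples of
    -- j(-1)^{j+1}.
    have form : ∀ j, j ≤ 2 * i + 2 → s j = (j : ℂ) • ((-1 : ℂ) ^ (j + 1) • s 1) ∧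
        s (j + 1) = ((j : ℂ) + 1) • ((-1 : ℂ) ^ j • s 1) := by
      intro j
      induction j with
      | zero => intro _; simp [s0]
      | succ j ihj =>
        intro hj
        obtain ⟨e1, e2⟩ := ihj (by omega)
        have := hrec j (by omega)
        refine ⟨by rw [e2, pow_succ (-1 : ℂ) (j + 1), pow_succ]; push_cast; simp, ?_⟩
        rw [e1, e2] at this
        push_cast
        linear_combination (norm := skip) this
        simp only [pow_succ]
        module
    have hl := (form (2 * i + 2) le_rfl).2
    -- By the symmetry of the anticommutator the last value equals the first one, and this forces s₁
    -- = 0.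
    have hl0 : s (2 * i + 2 + 1) = 0 := by
      simp only [hs] at s0 ⊢
      rw [show 2 * i + 3 - (2 * i + 2 + 1) = 0 by omega]
      rw [show 2 * i + 3 - 0 = 2 * i + 2 + 1 by omega] at s0
      rw [add_comm]
      exact s0
    rw [hl0, smul_smul] at hl
    have s1 : s 1 = 0 := by
      refine (smul_eq_zero.1 hl.symm).resolve_left (mul_ne_zero ?_ (by simp))
      norm_cast
    intro j k hjk
    rcases Nat.eq_zero_or_pos j with rfl | hj
    · have := s0
      simp only [hs] at this
      rwa [show 2 * i + 3 - 0 = k by omega] at this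
    · have := (form (j - 1) (by omega)).2
      rw [s1, smul_zero, smul_zero, show j - 1 + 1 = j by omega] at this
      simp only [hs] at this
      rwa [show 2 * i + 3 - j = k by omega] at this

theorem ImaginaryRelations.anticommute_of_odd (h : ImaginaryRelations q x m) (hq : Generic q)
    {j k : ℕ} (hjk : Odd (j + k)) : m j * m k + m k * m j = 0 := by
  obtain ⟨i, hi⟩ := hjk
  exact (h.anticommute_aux hq i).1 j k hi

/-- For odd j + k this is [x₁, ·] applied to a vanishing anticommutator; for even j + k both sides
are zero. Iterating moves the indices to their midpoint, where a square appears. -/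
theorem ImaginaryRelations.anti_succ (h : ImaginaryRelations q x m) (hq : Generic q) (j k : ℕ) :
    m (j + 1) * m k + m k * m (j + 1) = - (m j * m (k + 1) + m (k + 1) * m j) := by
  rcases Nat.even_or_odd (j + k) with he | ho
  · rw [h.anticommute_of_odd hq (by rw [add_right_comm]; exact he.add_one),
      h.anticommute_of_odd hq (j := j) (k := k + 1) (by rw [← add_assoc]; exact he.add_one), neg_zero]
  · obtain ⟨i, hi⟩ := ho
    exact eq_neg_of_add_eq_zero_left ((h.anticommute_aux hq i).2 j k hi)

theorem ImaginaryRelations.anti_add (h : ImaginaryRelations q x m) (hq : Generic q) (j k r : ℕ) :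
    m (j + r) * m k + m k * m (j + r) = (-1 : ℂ) ^ r • (m j * m (k + r) + m (k + r) * m j) := by
  induction r generalizing k with
  | zero => simp
  | succ r ih =>
    rw [← add_assoc, h.anti_succ hq, ih, pow_succ, mul_neg_one, neg_smul,
      show k + 1 + r = k + (r + 1) by ring]

theorem ImaginaryRelations.anti_even (h : ImaginaryRelations q x m) (hq : Generic q) (k r : ℕ) :
    m (k + 2 * r) * m k + m k * m (k + 2 * r) = ((-1 : ℂ) ^ r * 2) • m (k + r) ^ 2 := by
  have := h.anti_add hq (k + r) k r
  rw [show k + r + r = k + 2 * r by ring] at this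
  rw [this, pow_two, mul_smul, two_smul]

theorem ImaginaryRelations.commute_sq_zero (h : ImaginaryRelations q x m) (k : ℕ) :
    Commute (m 0 * m 0) (m k) := by
  induction k with
  | zero => exact mul_assoc _ _ _
  | succ k ih =>
    rw [← h.one]
    exact ((h.sq 1).mul_right ih).sub_right (ih.mul_right (h.sq 1))

/-- The squares of the `m i` commute with the `m k`. -/
theorem ImaginaryRelations.commute_sq (h : ImaginaryRelations q x m) (hq : Generic q) (i k : ℕ) :
    Commute (m i ^ 2) (m k) := by
  have anti : ∀ a b c : A, a * c + c * a = 0 → b * c + c * b = 0 → Commute (a * b) c := by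
    intro a b c h1 h2
    have e1 := eq_neg_of_add_eq_zero_left h1
    have e2 := eq_neg_of_add_eq_zero_left h2
    change a * b * c = c * (a * b)
    rw [mul_assoc, e2, mul_neg, ← mul_assoc, e1, neg_mul, neg_neg, mul_assoc]
  rcases Nat.even_or_odd (i + k) with he | ho
  · cases i with
    | zero => rw [pow_two]; exact h.commute_sq_zero k
    | succ i =>
      -- The square is a multiple of the anticommutator of its neighbours. Their indices have parity
      -- opposite to that of k, so each neighbour anticommutes with m_k and each product of the two
      -- commutes with it.
      have e : m (i + 1) ^ 2 = (-(1 / 2) : ℂ) • (m (i + 2) * m i + m i * m (i + 2)) := by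
        have := h.anti_even hq i 1
        rw [mul_one, pow_one] at this
        rw [this, smul_smul]
        norm_num
      have o1 : Odd (i + k) := by
        rw [add_right_comm] at he
        exact (Nat.not_even_iff_odd.1 fun h => by simp [Nat.even_add_one, h] at he)
      have o2 : Odd (i + 2 + k) := by
        rw [add_right_comm]; exact o1.add_even even_two
      have a1 := h.anticommute_of_odd hq o1
      have a2 := h.anticommute_of_odd hq o2
      rw [e]
      exact Commute.smul_left ((anti _ _ _ a2 a1).add_left (anti _ _ _ a1 a2)) _
  · have a1 := h.anticommute_of_odd hq ho
    rw [pow_two]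
    exact anti _ _ _ a1 a1

/-- It suffices to test the logarithmic coefficients. Their commutator with m_i² is a scalar times
the anticommutator of m_i and m_{n+i}: the scalar is zero for even n, the anticommutator for odd n.
-/
theorem ImaginaryRelations.commute_sq_x (h : ImaginaryRelations q x m) (hq : Generic q)
    (i n : ℕ) : Commute (m i ^ 2) (x n) := by
  obtain ⟨l, hl⟩ := h.exists_log
  refine h.commute_of_commute_log hq hl (fun n => ?_) n
  have h1 := h.coeff_log hq.ne_zero hl n i
  set γ := q ^ n - q⁻¹ ^ n + (-q⁻¹) ^ n - (-q) ^ n with hγ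
  have h2 : γ • (m i * m (n + i) + m (n + i) * m i) = 0 := by
    rcases Nat.even_or_odd n with he | ho
    · rw [hγ, log_coeff_even q he, zero_smul]
    · rw [h.anticommute_of_odd hq, smul_zero]
      rw [add_left_comm, ← two_mul]
      exact ho.add_even (even_two_mul i)
  rw [pow_two]
  change m i * m i * _ = _ * (m i * m i)
  rw [← sub_eq_zero, ← neg_eq_zero, ← h2, smul_add, ← mul_smul_comm, ← smul_mul_assoc, ← h1]
  noncomm_ring

end

/-! ### Identities in a Clifford-like algebra, and factoring the exchange relation -/

section

variable {B : Type*} [Ring B] [Algebra ℂ B]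

/-- The elements r₀, …, r₃ can be put in order: all pairs anticommute except those at distance two,
whose anticommutator is minus twice the square of the middle one. Both sides are expanded and
ordered. -/
theorem clifford_two {q c θ : ℂ} (hq : q ≠ 0) (hθ : θ = q - q⁻¹) {r0 r1 r2 r3 p p' s s' pb pb' sb sb' : B}
    (h10 : r1 * r0 = - (r0 * r1)) (h20 : r2 * r0 = -(2 : ℂ) • (r1 * r1) - r0 * r2)
    (h30 : r3 * r0 = - (r0 * r3)) (h21 : r2 * r1 = - (r1 * r2))
    (h31 : r3 * r1 = -(2 : ℂ) • (r2 * r2) - r1 * r3) (h32 : r3 * r2 = - (r2 * r3))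
    (hp : p = r0 - (θ * c) • r1 - (c * c) • r2) (hp' : p' = r1 - (θ * c) • r2 - (c * c) • r3)
    (hs : s = r0 - θ • r1 - r2) (hs' : s' = c • (r1 - θ • r2 - r3))
    (hpb : pb = r0 + (θ * c) • r1 - (c * c) • r2) (hpb' : pb' = r1 + (θ * c) • r2 - (c * c) • r3)
    (hsb : sb = r0 + θ • r1 - r2) (hsb' : sb' = c • (r1 + θ • r2 - r3)) :
    (c - 1) • (c • (sb * sb' - s * s') - (p * p' - pb * pb')) = 
      c • (q • ((p + p') * (sb - sb') - (s + s') * (pb - pb')) - 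
       q⁻¹ • ((p - p') * (sb + sb') - (s - s') * (pb + pb'))) := by
  subst hp hp' hs hs' hpb hpb' hsb hsb' hθ
  simp only [mul_add, add_mul, mul_sub, sub_mul, smul_mul_assoc, mul_smul_comm, h10, h20, h30, h21,
    h31, h32]
  match_scalars <;> field_simp <;> ring


set_option maxHeartbeats 1600000 in
-- The quartic counterpart, needed for the products Q·Sb and S·Qb in `exchange_factor`.
theorem clifford_four {c θ : ℂ} {r0 r1 r2 r3 p p' s s' pb pb' sb sb' : B}
    (h10 : r1 * r0 = - (r0 * r1)) (h20 : r2 * r0 = -(2 : ℂ) • (r1 * r1) - r0 * r2)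
    (h30 : r3 * r0 = - (r0 * r3)) (h21 : r2 * r1 = - (r1 * r2))
    (h31 : r3 * r1 = -(2 : ℂ) • (r2 * r2) - r1 * r3) (h32 : r3 * r2 = - (r2 * r3))
    (hp : p = r0 - (θ * c) • r1 - (c * c) • r2) (hp' : p' = r1 - (θ * c) • r2 - (c * c) • r3)
    (hs : s = r0 - θ • r1 - r2) (hs' : s' = c • (r1 - θ • r2 - r3))
    (hpb : pb = r0 + (θ * c) • r1 - (c * c) • r2) (hpb' : pb' = r1 + (θ * c) • r2 - (c * c) • r3)
    (hsb : sb = r0 + θ • r1 - r2) (hsb' : sb' = c • (r1 + θ • r2 - r3)) :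
    (p * p + p' * p' + θ • (p * p')) * (sb * sb + sb' * sb' + θ • (sb * sb')) =
    (s * s + s' * s' + θ • (s * s')) * (pb * pb + pb' * pb' + θ • (pb * pb')) := by
  have h10' : ∀ z, r1 * (r0 * z) = - (r0 * (r1 * z)) := fun z => by
    rw [← mul_assoc, h10, neg_mul, mul_assoc]
  have h20' : ∀ z, r2 * (r0 * z) = -(2 : ℂ) • (r1 * (r1 * z)) - r0 * (r2 * z) := fun z => by
    rw [← mul_assoc, h20, sub_mul, smul_mul_assoc, mul_assoc, mul_assoc]
  have h30' : ∀ z, r3 * (r0 * z) = - (r0 * (r3 * z)) := fun z => by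
    rw [← mul_assoc, h30, neg_mul, mul_assoc]
  have h21' : ∀ z, r2 * (r1 * z) = - (r1 * (r2 * z)) := fun z => by
    rw [← mul_assoc, h21, neg_mul, mul_assoc]
  have h31' : ∀ z, r3 * (r1 * z) = -(2 : ℂ) • (r2 * (r2 * z)) - r1 * (r3 * z) := fun z => by
    rw [← mul_assoc, h31, sub_mul, smul_mul_assoc, mul_assoc, mul_assoc]
  have h32' : ∀ z, r3 * (r2 * z) = - (r2 * (r3 * z)) := fun z => by
    rw [← mul_assoc, h32, neg_mul, mul_assoc]
  -- All four quadratic expressions have this shape, so a single normal form serves them before the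
  -- quartic products are expanded.
  have key : ∀ α β γ δ ε ζ : ℂ, ∀ a b : B, a = r0 + α • r1 + β • r2 → 
     b = γ • r1 + δ • r2 + ε • r3 →
     a * a + b * b + θ • (a * b) = r0 * r0 + (α * α - 2 * β + γ * γ) • (r1 * r1) + 
      (β * β + δ * δ - 2 * γ * ε) • (r2 * r2) + (ε * ε) • (r3 * r3) + 
      θ • (γ • (r0 * r1) + δ • (r0 * r2) + ε • (r0 * r3) + (α * γ) • (r1 * r1) + 
        (α * δ - β * γ) • (r1 * r2) + (α * ε) • (r1 * r3) + (β * δ) • (r2 * r2) + (β * ε) • (r2 * r3)) := by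
    rintro α β γ δ ε ζ a b rfl rfl
    simp only [mul_add, add_mul, smul_mul_assoc, mul_smul_comm, h10, h20, h30, h21, h31, h32]
    match_scalars <;> ring
  rw [key (-(θ * c)) (-(c * c)) 1 (-(θ * c)) (-(c * c)) 0 p p' (by rw [hp]; module) (by rw [hp']; module),
    key (-θ) (-1) c (-(θ * c)) (-c) 0 s s' (by rw [hs]; module) (by rw [hs']; module),
    key ((θ * c)) (-(c * c)) 1 ((θ * c)) (-(c * c)) 0 pb pb' (by rw [hpb]; module) (by rw [hpb']; module),
    key (θ) (-1) c ((θ * c)) (-c) 0 sb sb' (by rw [hsb]; module) (by rw [hsb']; module)]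
  simp only [mul_add, add_mul, mul_sub, mul_neg, neg_mul, smul_mul_assoc, mul_smul_comm, h10, h20, h30, h21,
    h31, h32, mul_assoc, h10', h20', h30', h21', h31', h32', smul_add, smul_sub, smul_neg]
  match_scalars <;> ring


/-- Reversing the signs of θ and d affects only mixed terms of neighbouring r's, and these vanish by
anticommutation. -/
theorem clifford_norm {c θ : ℂ} {r0 r1 r2 r3 : B}
    (h10 : r1 * r0 = - (r0 * r1)) (h21 : r2 * r1 = - (r1 * r2)) (h32 : r3 * r2 = - (r2 * r3))
    {a b b' d : ℂ} :
    (a • r0 - θ • r1 - b • r2) * (a • r0 - θ • r1 - b • r2) +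
      (c • r1 - d • r2 - b' • r3) * (c • r1 - d • r2 - b' • r3) =
    (a • r0 + θ • r1 - b • r2) * (a • r0 + θ • r1 - b • r2) +
      (c • r1 + d • r2 - b' • r3) * (c • r1 + d • r2 - b' • r3) := by
  simp only [mul_add, add_mul, mul_sub, sub_mul, smul_mul_assoc, mul_smul_comm, h10, h21, h32]
  module

/-- The two sides of the exchange relation, with `l` and `k` moved to the right. -/
theorem exchange_factor {q c θ : ℂ} {z p p' s s' pb pb' sb sb' l k Q Qb S Sb : B}
    (hz : ∀ b, b * z = z * b)
    (n1 : p * p + p' * p' = pb * pb + pb' * pb') (n2 : s * s + s' * s' = sb * sb + sb' * sb')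
    (e1 : (c - 1) • (c • (sb * sb' - s * s') - (p * p' - pb * pb')) =
      c • (q • ((p + p') * (sb - sb') - (s + s') * (pb - pb')) -
       q⁻¹ • ((p - p') * (sb + sb') - (s - s') * (pb + pb'))))
    (e2 : (p * p + p' * p' + θ • (p * p')) * (sb * sb + sb' * sb' + θ • (sb * sb')) =
      (s * s + s' * s' + θ • (s * s')) * (pb * pb + pb' * pb' + θ • (pb * pb')))
    (hQ : Q = (2 : ℂ) • (p * p + p' * p' + θ • (p * p')))
    (hQb : Qb = (2 : ℂ) • (pb * pb + pb' * pb' + θ • (pb * pb')))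
    (hS : S = (2 : ℂ) • (s * s + s' * s' + θ • (s * s')))
    (hSb : Sb = (2 : ℂ) • (sb * sb + sb' * sb' + θ • (sb * sb')))
    (kp : k * p = pb * k) (kp' : k * p' = pb' * k) (ls : l * s = sb * l) (ls' : l * s' = sb' * l)
    (star : c • ((1 - θ • (z * Q)) * l * ((1 + (c * θ) • (z * S)) * k) -
        (1 + (c * θ) • (z * S)) * k * ((1 - θ • (z * Q)) * l)) +
      ((1 + θ • (z * Q)) * l * ((1 - (c * θ) • (z * S)) * k) -
        (1 - (c * θ) • (z * S)) * k * ((1 + θ • (z * Q)) * l)) =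
      (2 * c) • (z * (q • (θ • ((p + p') * l) * θ • ((s - s') * k) -
          θ • ((s + s') * k) * θ • ((p - p') * l)) +
        q⁻¹ • (θ • ((s - s') * k) * θ • ((p + p') * l) -
          θ • ((p - p') * l) * θ • ((s + s') * k))))) :
    ((1 + c) • (1 : B) + z * (((c - 1) * θ) • (c • Sb - Q) - ((1 + c) * c * θ * θ) • (z * (Q * Sb))
      - (2 * c * θ * θ) • (q • ((p + p') * (sb - sb')) - q⁻¹ • ((p - p') * (sb + sb'))))) *
      (l * k - k * l) = 0 := by
  have lS : ∀ b, l * (S * b) = Sb * (l * b) := fun b => by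
    have e : l * S = Sb * l := by
      rw [hS, hSb, mul_smul_comm, smul_mul_assoc, mul_add, mul_add, mul_smul_comm, ← mul_assoc,
        ← mul_assoc, ← mul_assoc, ls, ls', mul_assoc, mul_assoc, mul_assoc, ls, ls', add_mul,
        add_mul, smul_mul_assoc, mul_assoc, mul_assoc, mul_assoc]
    rw [← mul_assoc, e, mul_assoc]
  have kQ : ∀ b, k * (Q * b) = Qb * (k * b) := fun b => by
    have e : k * Q = Qb * k := by
      rw [hQ, hQb, mul_smul_comm, smul_mul_assoc, mul_add, mul_add, mul_smul_comm, ← mul_assoc,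
        ← mul_assoc, ← mul_assoc, kp, kp', mul_assoc, mul_assoc, mul_assoc, kp, kp', add_mul,
        add_mul, smul_mul_assoc, mul_assoc, mul_assoc, mul_assoc]
    rw [← mul_assoc, e, mul_assoc]
  have kpb : ∀ b, k * (p * b) = pb * (k * b) := fun b => by rw [← mul_assoc, kp, mul_assoc]
  have kpb' : ∀ b, k * (p' * b) = pb' * (k * b) := fun b => by rw [← mul_assoc, kp', mul_assoc]
  have lsb : ∀ b, l * (s * b) = sb * (l * b) := fun b => by rw [← mul_assoc, ls, mul_assoc]
  have lsb' : ∀ b, l * (s' * b) = sb' * (l * b) := fun b => by rw [← mul_assoc, ls', mul_assoc]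
  have zc : ∀ a b, a * (z * b) = z * (a * b) := fun a b => by rw [← mul_assoc, hz, mul_assoc]
  -- the coefficients of `l * k` and `k * l` agree
  have hQS : Q * Sb = S * Qb := by
    rw [hQ, hQb, hS, hSb, smul_mul_smul_comm, smul_mul_smul_comm, e2]
  have hlin : (c - 1) • (c • Sb - Q - (c • S - Qb)) = (2 * c * θ) •
      (q • ((p + p') * (sb - sb') - (s + s') * (pb - pb')) -
       q⁻¹ • ((p - p') * (sb + sb') - (s - s') * (pb + pb'))) := by
    rw [hQ, hQb, hS, hSb]
    linear_combination (norm := module) (2 * θ) • e1 - (2 * (c - 1)) • n1 - (2 * (c - 1) * c) • n2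
  have hAB : ((c - 1) * θ) • (c • Sb - Q) - ((1 + c) * c * θ * θ) • (z * (Q * Sb))
      - (2 * c * θ * θ) • (q • ((p + p') * (sb - sb')) - q⁻¹ • ((p - p') * (sb + sb'))) =
      ((c - 1) * θ) • (c • S - Qb) - ((1 + c) * c * θ * θ) • (z * (S * Qb))
      - (2 * c * θ * θ) • (q • ((s + s') * (pb - pb')) - q⁻¹ • ((s - s') * (pb + pb'))) := by
    rw [hQS]
    linear_combination (norm := module) θ • hlin
  rw [mul_sub]
  have h2 : ∀ F : B, F = ((c - 1) * θ) • (c • Sb - Q) - ((1 + c) * c * θ * θ) • (z * (Q * Sb))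
      - (2 * c * θ * θ) • (q • ((p + p') * (sb - sb')) - q⁻¹ • ((p - p') * (sb + sb'))) →
      ((1 + c) • (1 : B) + z * F) * (l * k) - ((1 + c) • (1 : B) + z * F) * (k * l) = 0 := by
    intro F hF
    -- Moving l and k to the right in `star` produces Q, Sb in front of l·k but S, Qb in front of
    -- k·l. By `hAB` both are the same factor.
    nth_rw 1 [hF]
    rw [hF.trans hAB]
    clear hF hAB hlin hQS e1 e2 n1 n2 hQ hQb hS hSb
    simp only [mul_add, add_mul, mul_sub, sub_mul, smul_mul_assoc, mul_smul_comm, mul_assoc, one_mul,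
      mul_one, zc, lS, kQ, kpb, kpb', lsb, lsb', smul_add, smul_sub, smul_smul] at star ⊢
    linear_combination (norm := module) star
  exact h2 _ rfl

end

/-! ### The generating series commutes with its rescalings -/

section

variable {A : Type*} [Ring A] [Algebra ℂ A] {q : ℂ} {x m : ℕ → A}

/-- The series form of `anti_succ`: a factor X may change sides at the cost of a sign. -/
theorem weighted_anti (h : ImaginaryRelations q x m) (hq : Generic q) (f g : PowerSeries ℂ) :
    weighted m 0 (PowerSeries.X * f) * weighted m 0 g +
      weighted m 0 g * weighted m 0 (PowerSeries.X * f) =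
    - (weighted m 0 f * weighted m 0 (PowerSeries.X * g) +
      weighted m 0 (PowerSeries.X * g) * weighted m 0 f) := by
  have e : ∀ a b : PowerSeries A, a * (PowerSeries.X * b) = PowerSeries.X * (a * b) :=
    fun a b => by rw [← mul_assoc, ← PowerSeries.X_mul, mul_assoc]
  rw [weighted_X_mul, weighted_X_mul, mul_assoc, e, e, mul_assoc, ← mul_add, ← mul_add, ← mul_neg]
  congr 1
  ext n
  rw [map_add, map_neg, map_add, PowerSeries.coeff_mul, PowerSeries.coeff_mul,
    PowerSeries.coeff_mul, PowerSeries.coeff_mul,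
    ← Finset.Nat.sum_antidiagonal_swap (f := fun p => PowerSeries.coeff p.1 (weighted m 0 g) *
      PowerSeries.coeff p.2 (weighted m (0 + 1) f)),
    ← Finset.Nat.sum_antidiagonal_swap (f := fun p => PowerSeries.coeff p.1
      (weighted m (0 + 1) g) * PowerSeries.coeff p.2 (weighted m 0 f)),
    ← Finset.sum_add_distrib, ← Finset.sum_add_distrib, ← Finset.sum_neg_distrib]
  refine Finset.sum_congr rfl fun p _ => ?_
  simp only [coeff_weighted, Prod.fst_swap, Prod.snd_swap, add_zero, zero_add,
    smul_mul_smul_comm]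
  rw [mul_comm (PowerSeries.coeff p.2 g), ← smul_add, ← smul_add, ← smul_neg, h.anti_succ hq]

theorem weighted_anti_self (h : ImaginaryRelations q x m) (hq : Generic q) (f : PowerSeries ℂ) :
    weighted m 0 (PowerSeries.X * f) * weighted m 0 f =
    - (weighted m 0 f * weighted m 0 (PowerSeries.X * f)) := by
  have h1 := weighted_anti h hq f f
  set a := weighted m 0 (PowerSeries.X * f) * weighted m 0 f
  set b := weighted m 0 f * weighted m 0 (PowerSeries.X * f)
  have h2 : (2 : ℂ) • (a + b) = 0 := by linear_combination (norm := module) h1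
  exact eq_neg_of_add_eq_zero_left ((smul_eq_zero.1 h2).resolve_left two_ne_zero)

theorem scale_dplus (c : ℂ) : scale c (dplus q) =
    1 - ((q - q⁻¹) * c) • PowerSeries.X - (c * c) • (PowerSeries.X * PowerSeries.X) := by
  rw [dplus, map_sub, map_sub, map_one, map_smul, map_mul, scale_X, smul_smul, smul_mul_smul_comm]

theorem scale_dminus (c : ℂ) : scale c (dminus q) =
    1 + ((q - q⁻¹) * c) • PowerSeries.X - (c * c) • (PowerSeries.X * PowerSeries.X) := by
  rw [dminus, map_sub, map_add, map_one, map_smul, map_mul, scale_X, smul_smul, smul_mul_smul_comm]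

theorem ImaginaryRelations.scale_genSeries_weighted (h : ImaginaryRelations q x m) (c : ℂ) (k : ℕ)
    (f g : PowerSeries ℂ) (hfg : scale c (dminus q * dinv q) * f = g) :
    scale c (genSeries q x) * weighted m k f = weighted m k g * scale c (genSeries q x) := by
  subst hfg
  -- Rescaling by 0 is not invertible, but it sends every series with constant term 1 to 1.
  by_cases hc : c = 0
  · have e : ∀ (F : PowerSeries ℂ),
        PowerSeries.constantCoeff F = 1 → scale 0 F = 1 := by
      intro F hF
      ext n
      rw [coeff_scale, PowerSeries.coeff_one]
      split_ifs with hn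
      · simp [hn, hF]
      · simp [hn]
    have e1 : scale 0 (genSeries q x) = 1 := by
      ext n
      rw [coeff_scale, PowerSeries.coeff_one]
      split_ifs with hn
      · simp [hn, h.constantCoeff]
      · simp [hn]
    have e2 : scale 0 (dminus q * dinv q) = 1 := by
      apply e
      simp [dminus, dinv, dplus]
    rw [hc, e1, e2, one_mul, one_mul, mul_one]
  · have e : f = scale c (scale c⁻¹ f) := by
      ext n
      simp [← mul_assoc, ← mul_pow, hc]
    have := congrArg (scale c) (h.genSeries_weighted k (scale c⁻¹ f))
    rwa [map_mul, map_mul, scale_weighted, scale_weighted, map_mul (scale c) (dminus q * dinv q),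
      ← e] at this

/-- The generating series of the `x n` commutes with its rescalings. -/
theorem ImaginaryRelations.genSeries_commute (h : ImaginaryRelations q x m) (hq : Generic q)
    {c : ℂ} (hc : 1 + c ≠ 0) {Q E E' O O' : PowerSeries A}
    (hQ : Q = (2 : ℂ) • (weighted m 0 (dinv q) * weighted m 0 (dinv q) +
      weighted m 0 (PowerSeries.X * dinv q) * weighted m 0 (PowerSeries.X * dinv q) +
      (q - q⁻¹) • (weighted m 0 (dinv q) * weighted m 0 (PowerSeries.X * dinv q))))
    (hE : E = (1 + (q - q⁻¹) • (PowerSeries.X * Q)) * genSeries q x)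
    (hE' : E' = (1 - (q - q⁻¹) • (PowerSeries.X * Q)) * genSeries q x)
    (hO : O = (q - q⁻¹) • ((weighted m 0 (dinv q) - weighted m 0 (PowerSeries.X * dinv q)) *
      genSeries q x))
    (hO' : O' = (q - q⁻¹) • ((weighted m 0 (dinv q) + weighted m 0 (PowerSeries.X * dinv q)) *
      genSeries q x))
    (star : c • (E' * scale c E - scale c E * E') + (E * scale c E' - scale c E' * E) =
      (2 * c) • (PowerSeries.X * (q • (O' * scale c O - scale c O' * O) +
        q⁻¹ • (scale c O * O' - O * scale c O')))) :
    genSeries q x * scale c (genSeries q x) = scale c (genSeries q x) * genSeries q x := by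
  set u := dinv q with hu
  -- The common denominator of 1/D(X) and 1/D(cX): all the weighted series below are combinations of
  -- w(Xⁱd) with i ≤ 3.
  set d := u * scale c u with hd
  set θ := q - q⁻¹ with hθ
  have hDu : dplus q * u = 1 := dplus_mul_dinv q
  have hDu' : scale c (dplus q) * scale c u = 1 := by rw [← map_mul, hDu, map_one]
  -- the anticommutation relations
  set r0 := weighted m 0 d with hr0
  set r1 := weighted m 0 (PowerSeries.X * d) with hr1
  set r2 := weighted m 0 (PowerSeries.X * (PowerSeries.X * d)) with hr2
  set r3 := weighted m 0 (PowerSeries.X * (PowerSeries.X * (PowerSeries.X * d))) with hr3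
  have h10 : r1 * r0 = - (r0 * r1) := weighted_anti_self h hq d
  have h21 : r2 * r1 = - (r1 * r2) := weighted_anti_self h hq _
  have h32 : r3 * r2 = - (r2 * r3) := weighted_anti_self h hq _
  have h20 : r2 * r0 = -(2 : ℂ) • (r1 * r1) - r0 * r2 := by
    linear_combination (norm := module) weighted_anti h hq (PowerSeries.X * d) d
  have h31 : r3 * r1 = -(2 : ℂ) • (r2 * r2) - r1 * r3 := by
    linear_combination (norm := module)
      weighted_anti h hq (PowerSeries.X * (PowerSeries.X * d)) (PowerSeries.X * d)
  have h30 : r3 * r0 = - (r0 * r3) := by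
    have := weighted_anti h hq (PowerSeries.X * (PowerSeries.X * d)) d
    rw [← hr3, ← hr0, ← hr1, ← hr2, h21] at this
    exact eq_neg_of_add_eq_zero_left (by rw [this]; abel)
  -- the eight series
  have w0 : ∀ a b : ℂ, weighted m 0 ((1 - a • PowerSeries.X - b • (PowerSeries.X * PowerSeries.X))
      * d) = r0 - a • r1 - b • r2 := by
    intro a b
    rw [hr0, hr1, hr2, ← map_smul, ← map_smul, ← map_sub, ← map_sub]
    congr 1
    rw [sub_mul, sub_mul, one_mul, smul_mul_assoc, smul_mul_assoc, mul_assoc]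
  have w1 : ∀ a b : ℂ, weighted m 0 (PowerSeries.X * ((1 - a • PowerSeries.X - b •
      (PowerSeries.X * PowerSeries.X)) * d)) = r1 - a • r2 - b • r3 := by
    intro a b
    rw [hr1, hr2, hr3, ← map_smul, ← map_smul, ← map_sub, ← map_sub]
    congr 1
    rw [sub_mul, sub_mul, one_mul, smul_mul_assoc, smul_mul_assoc, mul_assoc, mul_sub, mul_sub,
      mul_smul_comm, mul_smul_comm]
  have hp0 : u = (1 - (θ * c) • PowerSeries.X - (c * c) • (PowerSeries.X * PowerSeries.X)) * d := by
    rw [← scale_dplus, hd]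
    linear_combination -u * hDu'
  have hs0 : scale c u = (1 - θ • PowerSeries.X - (1 : ℂ) • (PowerSeries.X * PowerSeries.X)) * d := by
    rw [one_smul, ← dplus, hd]
    linear_combination -(scale c u) * hDu
  set p := r0 - (θ * c) • r1 - (c * c) • r2 with hp
  set p' := r1 - (θ * c) • r2 - (c * c) • r3 with hp'
  set s := r0 - θ • r1 - r2 with hs
  set s' := c • (r1 - θ • r2 - r3) with hs'
  set pb := r0 + (θ * c) • r1 - (c * c) • r2 with hpb
  set pb' := r1 + (θ * c) • r2 - (c * c) • r3 with hpb'
  set sb := r0 + θ • r1 - r2 with hsb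
  set sb' := c • (r1 + θ • r2 - r3) with hsb'
  have ep : weighted m 0 u = p := by rw [hp0, w0]
  have ep' : weighted m 0 (PowerSeries.X * u) = p' := by rw [hp0, w1]
  have es : scale c (weighted m 0 u) = s := by
    rw [scale_weighted, hs0, w0, one_smul]
  have es' : scale c (weighted m 0 (PowerSeries.X * u)) = s' := by
    rw [scale_weighted, map_mul, scale_X, smul_mul_assoc, map_smul, hs0, w1, one_smul]
  have epb : pb = weighted m 0 ((1 - (-(θ * c)) • PowerSeries.X -
      (c * c) • (PowerSeries.X * PowerSeries.X)) * d) := by rw [w0, hpb]; module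
  have epb' : pb' = weighted m 0 (PowerSeries.X * ((1 - (-(θ * c)) • PowerSeries.X -
      (c * c) • (PowerSeries.X * PowerSeries.X)) * d)) := by rw [w1, hpb']; module
  have esb : sb = weighted m 0 ((1 - (-θ) • PowerSeries.X -
      (1 : ℂ) • (PowerSeries.X * PowerSeries.X)) * d) := by rw [w0, hsb]; module
  have esb' : sb' = c • weighted m 0 (PowerSeries.X * ((1 - (-θ) • PowerSeries.X -
      (1 : ℂ) • (PowerSeries.X * PowerSeries.X)) * d)) := by rw [w1, hsb']; module
  have sdm : scale c (dminus q * u) * u = (1 - (-(θ * c)) • PowerSeries.X -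
      (c * c) • (PowerSeries.X * PowerSeries.X)) * d := by
    rw [map_mul, scale_dminus, hd]
    simp only [neg_smul, sub_neg_eq_add]
    ring
  have dm : dminus q * u * scale c u = (1 - (-θ) • PowerSeries.X -
      (1 : ℂ) • (PowerSeries.X * PowerSeries.X)) * d := by
    rw [dminus, hd]
    simp only [neg_smul, sub_neg_eq_add, one_smul]
    ring
  set l := genSeries q x with hl
  set k := scale c l with hk
  have kp : k * p = pb * k := by
    rw [← ep, epb]
    exact h.scale_genSeries_weighted c 0 _ _ sdm
  have kp' : k * p' = pb' * k := by
    rw [← ep', epb']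
    exact h.scale_genSeries_weighted c 0 _ _ (by rw [mul_left_comm, sdm])
  have ls : l * s = sb * l := by
    rw [← es, esb, scale_weighted, ← dm]
    exact h.genSeries_weighted 0 _
  have ls' : l * s' = sb' * l := by
    rw [← es', esb', scale_weighted, map_mul, scale_X, smul_mul_assoc, map_smul, ← dm,
      mul_smul_comm, smul_mul_assoc, mul_left_comm]
    rw [h.genSeries_weighted 0 _, mul_left_comm]
  have n1 : p * p + p' * p' = pb * pb + pb' * pb' := by
    have := clifford_norm h10 h21 h32 (c := 1) (θ := θ * c) (a := 1) (b := c * c) (b' := c * c)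
      (d := θ * c)
    simpa only [one_smul] using this
  have n2 : s * s + s' * s' = sb * sb + sb' * sb' := by
    have := clifford_norm h10 h21 h32 (c := c) (θ := θ) (a := 1) (b := 1) (b' := c) (d := c * θ)
    simp only [one_smul, mul_smul] at this
    simpa only [hs, hs', hsb, hsb', smul_add, smul_sub] using this
  have e1 := clifford_two hq.ne_zero hθ h10 h20 h30 h21 h31 h32 hp hp' hs hs' hpb hpb' hsb hsb'
  have e2 := clifford_four h10 h20 h30 h21 h31 h32 hp hp' hs hs' hpb hpb' hsb hsb'
  rw [ep, ep'] at hQ hO hO'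
  have hSc : scale c Q = (2 : ℂ) • (s * s + s' * s' + θ • (s * s')) := by
    rw [hQ, ← ep, ← ep', map_smul, map_add, map_add, map_smul, map_mul (scale c),
      map_mul (scale c), map_mul (scale c), es, es']
  have hEc : scale c E = (1 + (c * θ) • (PowerSeries.X * scale c Q)) * k := by
    rw [hE, map_mul, map_add, map_one, map_smul, map_mul, scale_X, smul_mul_assoc, smul_smul,
      mul_comm θ]
  have hEc' : scale c E' = (1 - (c * θ) • (PowerSeries.X * scale c Q)) * k := by
    rw [hE', map_mul, map_sub, map_one, map_smul, map_mul, scale_X, smul_mul_assoc, smul_smul,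
      mul_comm θ]
  have hOc : scale c O = θ • ((s - s') * k) := by
    rw [hO, ← ep, ← ep', map_smul, map_mul, map_sub, es, es']
  have hOc' : scale c O' = θ • ((s + s') * k) := by
    rw [hO', ← ep, ← ep', map_smul, map_mul, map_add, es, es']
  rw [hEc, hEc', hOc, hOc', hE, hE', hO, hO'] at star
  have key := exchange_factor (z := PowerSeries.X) (fun b => (PowerSeries.X_mul).symm)
    n1 n2 e1 e2 hQ rfl hSc rfl kp kp' ls ls' star
  set F := ((c - 1) * θ) • (c • ((2 : ℂ) • (sb * sb + sb' * sb' + θ • (sb * sb'))) - Q) -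
    ((1 + c) * c * θ * θ) • (PowerSeries.X * (Q * ((2 : ℂ) • (sb * sb + sb' * sb' +
      θ • (sb * sb')))))
      - (2 * c * θ * θ) • (q • ((p + p') * (sb - sb')) - q⁻¹ • ((p - p') * (sb + sb')))
  -- After division by 1 + c the factor found above has constant term 1, so it can be cancelled.
  have hinv : PowerSeries.constantCoeff (1 + (1 + c)⁻¹ • (PowerSeries.X * F)) = 1 := by
    rw [map_add, map_one, ← PowerSeries.coeff_zero_eq_constantCoeff_apply, PowerSeries.coeff_smul]
    simp
  obtain ⟨G, -, hG⟩ := exists_inv_of_constantCoeff_eq_one hinv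
  have key2 : (1 + (1 + c)⁻¹ • (PowerSeries.X * F)) * (l * k - k * l) = 0 := by
    have : (1 + (1 + c)⁻¹ • (PowerSeries.X * F)) =
        (1 + c)⁻¹ • ((1 + c) • (1 : PowerSeries A) + PowerSeries.X * F) := by
      rw [smul_add, smul_smul, inv_mul_cancel₀ hc, one_smul]
    rw [this, smul_mul_assoc, key, smul_zero]
  rw [← sub_eq_zero, ← one_mul (l * k - k * l), ← hG, mul_assoc, key2, mul_zero]

/-- A vector polynomial with infinitely many zeros vanishes. -/
theorem eq_zero_of_sum_pow_smul {V : Type*} [AddCommGroup V] [Module ℂ V] (N : ℕ) (v : ℕ → V)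
    (h : ∀ c : ℂ, 1 + c ≠ 0 → ∑ j ∈ Finset.range N, c ^ j • v j = 0) (j : ℕ) (hj : j < N) :
    v j = 0 := by
  rw [← Module.forall_dual_apply_eq_zero_iff ℂ]
  intro φ
  set P : Polynomial ℂ := ∑ i ∈ Finset.range N, Polynomial.monomial i (φ (v i)) with hP
  have hz : P = 0 := by
    apply Polynomial.eq_zero_of_infinite_isRoot
    refine Set.Infinite.mono (s := {c : ℂ | 1 + c ≠ 0}) ?_ ?_
    · intro c hc
      have := congrArg φ (h c hc)
      simp only [map_sum, map_smul, smul_eq_mul, map_zero] at this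
      simp only [Set.mem_ofPred_eq, Polynomial.IsRoot, hP, Polynomial.eval_finsetSum,
        Polynomial.eval_monomial]
      rw [← this]
      exact Finset.sum_congr rfl fun _ _ => mul_comm _ _
    · have : {c : ℂ | 1 + c ≠ 0} = {-1}ᶜ := by
        ext c
        simp [add_eq_zero_iff_eq_neg']
      rw [this]
      exact (Set.finite_singleton _).infinite_compl
  have := congrArg (fun P => Polynomial.coeff P j) hz
  simp only [hP, Polynomial.finsetSum_coeff, Polynomial.coeff_monomial, Polynomial.coeff_zero] at this
  rw [Finset.sum_eq_single j] at this
  · simpa using this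
  · intro b _ hb; simp [hb]
  · intro hb; exact absurd (Finset.mem_range.2 hj) hb

/-- The coefficient of X^{i+j} in the commutator is a polynomial in c whose coefficients are the
commutators of the coefficients of ℓ. It vanishes for all c ≠ -1, hence identically. -/
theorem commute_of_genSeries_commute (hq : Generic q)
    (hc : ∀ c : ℂ, 1 + c ≠ 0 →
      genSeries q x * scale c (genSeries q x) = scale c (genSeries q x) * genSeries q x)
    (i j : ℕ) : Commute (x i) (x j) := by
  set l := genSeries q x with hl
  have key := eq_zero_of_sum_pow_smul (i + j + 1) (fun j' =>
    PowerSeries.coeff (i + j - j') l * PowerSeries.coeff j' l -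
    PowerSeries.coeff j' l * PowerSeries.coeff (i + j - j') l) (by
      intro c hc'
      have h1 := congrArg (PowerSeries.coeff (i + j)) (hc c hc')
      rw [PowerSeries.coeff_mul, PowerSeries.coeff_mul, ← Finset.Nat.sum_antidiagonal_swap,
        Finset.Nat.sum_antidiagonal_eq_sum_range_succ_mk,
        Finset.Nat.sum_antidiagonal_eq_sum_range_succ_mk, ← sub_eq_zero,
        ← Finset.sum_sub_distrib] at h1
      rw [← h1]
      refine Finset.sum_congr rfl fun p _ => ?_
      simp [smul_sub]) j (by omega)
  rw [Nat.add_sub_cancel] at key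
  have e : ∀ n, x n = ((q - q⁻¹) * 2 ^ n)⁻¹ • PowerSeries.coeff n l := by
    intro n
    have h0 : (q - q⁻¹) * 2 ^ n ≠ 0 := mul_ne_zero hq.theta_ne (by simp)
    rw [hl, genSeries, PowerSeries.coeff_mk, smul_smul, inv_mul_cancel₀ h0, one_smul]
  rw [e i, e j]
  exact Commute.smul_left (Commute.smul_right (sub_eq_zero.1 key) _) _

end

/-! ### Quadratic relations of coefficients as relations of series -/

section

variable {A : Type*} [Ring A] [Algebra ℂ A]

theorem coeff_mul_scale (c : ℂ) (f g : PowerSeries A) (n : ℕ) :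
    PowerSeries.coeff n (f * scale c g) = ∑ p ∈ Finset.HasAntidiagonal.antidiagonal n,
      c ^ p.2 • (PowerSeries.coeff p.1 f * PowerSeries.coeff p.2 g) := by
  rw [PowerSeries.coeff_mul]
  simp

theorem coeff_scale_mul (c : ℂ) (f g : PowerSeries A) (n : ℕ) :
    PowerSeries.coeff n (scale c g * f) = ∑ p ∈ Finset.HasAntidiagonal.antidiagonal n,
      c ^ p.2 • (PowerSeries.coeff p.2 g * PowerSeries.coeff p.1 f) := by
  rw [PowerSeries.coeff_mul, ← Finset.Nat.sum_antidiagonal_swap]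
  simp

/-- A family of quadratic relations between coefficients, as a relation of power series. -/
theorem exchange_series {q : ℂ} {E E' O O' : PowerSeries A} (h0 : PowerSeries.coeff 0 E = 1)
    (h0' : PowerSeries.coeff 0 E' = 1)
    (h : ∀ i j, (PowerSeries.coeff (i + 1) E' * PowerSeries.coeff j E -
        PowerSeries.coeff j E * PowerSeries.coeff (i + 1) E') +
      (PowerSeries.coeff i E * PowerSeries.coeff (j + 1) E' -
        PowerSeries.coeff (j + 1) E' * PowerSeries.coeff i E) =
      (2 : ℂ) • (q • (PowerSeries.coeff i O' * PowerSeries.coeff j O -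
        PowerSeries.coeff j O' * PowerSeries.coeff i O) +
      q⁻¹ • (PowerSeries.coeff j O * PowerSeries.coeff i O' -
        PowerSeries.coeff i O * PowerSeries.coeff j O'))) (c : ℂ) :
    c • (E' * scale c E - scale c E * E') + (E * scale c E' - scale c E' * E) =
      (2 * c) • (PowerSeries.X * (q • (O' * scale c O - scale c O' * O) +
        q⁻¹ • (scale c O * O' - O * scale c O'))) := by
  ext n
  rw [map_add, PowerSeries.coeff_smul, PowerSeries.coeff_smul, map_sub, map_sub, coeff_mul_scale,
    coeff_scale_mul, coeff_mul_scale, coeff_scale_mul, ← Finset.sum_sub_distrib,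
    ← Finset.sum_sub_distrib]
  cases n with
  | zero =>
    rw [PowerSeries.coeff_zero_eq_constantCoeff_apply] at h0 h0'
    simp [h0, h0']
  | succ n =>
    rw [Finset.Nat.sum_antidiagonal_succ, Finset.Nat.sum_antidiagonal_succ',
      PowerSeries.coeff_succ_X_mul, map_add, PowerSeries.coeff_smul, PowerSeries.coeff_smul, map_sub,
      map_sub, coeff_mul_scale, coeff_scale_mul, coeff_mul_scale, coeff_scale_mul,
      ← Finset.sum_sub_distrib, ← Finset.sum_sub_distrib, Finset.smul_sum, Finset.smul_sum,
      ← Finset.sum_add_distrib, Finset.smul_sum]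
    simp only [h0, h0', one_mul, mul_one, sub_self, zero_add, add_zero]
    rw [Finset.smul_sum, ← Finset.sum_add_distrib]
    refine Finset.sum_congr rfl fun p _ => ?_
    have := h p.1 p.2
    linear_combination (norm := skip) (c ^ (p.2 + 1)) • this
    simp only [pow_succ]
    module

end

/-! ### Commutativity of the L̃_{2n} -/

section

variable {q : ℂ}

/-- `2ⁿθ f(2n)`, `2ⁿθ f(2n+1)`. -/
def evenSeries (q : ℂ) (f : ℕ → NA q) : PowerSeries (NA q) :=
  PowerSeries.mk fun n => ((q - q⁻¹) * 2 ^ n) • f (2 * n)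

def oddSeries (q : ℂ) (f : ℕ → NA q) : PowerSeries (NA q) :=
  PowerSeries.mk fun n => ((q - q⁻¹) * 2 ^ n) • f (2 * n + 1)

/-- The sum of the even indices in `L_L'_exchange` exceeds by two what 2^{i+j} accounts for; this is
the factor 2 on the right. The case j = 0 is the boundary relation `L_L'_two_exchange`. -/
theorem exchange_L (hq : Generic q) (c : ℂ) :
    c • (evenSeries q (L' q) * scale c (evenSeries q (L q)) -
      scale c (evenSeries q (L q)) * evenSeries q (L' q)) +
      (evenSeries q (L q) * scale c (evenSeries q (L' q)) -
        scale c (evenSeries q (L' q)) * evenSeries q (L q)) =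
      (2 * c) • (PowerSeries.X * (q • (oddSeries q (L' q) * scale c (oddSeries q (L q)) -
        scale c (oddSeries q (L' q)) * oddSeries q (L q)) +
        q⁻¹ • (scale c (oddSeries q (L q)) * oddSeries q (L' q) -
          oddSeries q (L q) * scale c (oddSeries q (L' q))))) := by
  have h0 : (q - q⁻¹) • L q 0 = 1 := by
    rw [L_zero, smul_smul, mul_inv_cancel₀ hq.theta_ne, one_smul]
  refine exchange_series ?_ ?_ ?_ c
  · simp only [evenSeries, PowerSeries.coeff_mk, pow_zero, mul_one, mul_zero, h0]
  · simp only [evenSeries, PowerSeries.coeff_mk, pow_zero, mul_one, mul_zero, L'_zero, h0]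
  · intro i j
    simp only [evenSeries, oddSeries, PowerSeries.coeff_mk, smul_mul_smul_comm]
    cases j with
    | zero =>
      have h := L_L'_two_exchange hq i
      simp only [mul_zero, zero_add, mul_one, pow_zero, pow_one]
      rw [L'_one, L_one hq.ne_zero, L_zero]
      simp only [mul_smul_comm, smul_mul_assoc, one_mul, mul_one]
      linear_combination (norm := module) (2 * ((q - q⁻¹) * 2 ^ i * (q - q⁻¹))) • h
    | succ j =>
      have h := L_L'_exchange hq i j
      rw [show 2 * (i + 1) = 2 * i + 2 by ring, show 2 * (j + 1) = 2 * j + 2 by ring,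
        show 2 * (j + 1 + 1) = 2 * j + 4 by ring, show 2 * j + 2 + 1 = 2 * j + 3 by ring]
      linear_combination (norm := skip) ((q - q⁻¹) * 2 ^ (i + 1) * ((q - q⁻¹) * 2 ^ (j + 1))) • h
      simp only [pow_succ]
      module

theorem Ltilde_one (hq : Generic q) : Ltilde q 1 = ev q := by
  rw [Ltilde, L'_one, L_one hq.ne_zero]
  module

theorem L_eq_Ltilde (n : ℕ) : L q n = Ltilde q n + (1 / 2 : ℂ) • (L q n - L' q n) := by
  rw [Ltilde]; module

theorem L'_eq_Ltilde (n : ℕ) : L' q n = Ltilde q n - (1 / 2 : ℂ) • (L q n - L' q n) := by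
  rw [Ltilde]; module

/-- L₁ is the weighted series of 1, and D̄/D = 1 + 2θX/D gives its commutator with ℓ. For the odd
series the same rule is inserted into `Ltilde_odd`. -/
theorem weighted_dinv_series (hq : Generic q) {l ρ ρ' : PowerSeries (NA q)}
    (hl : l = genSeries q (fun n => Ltilde q (2 * n)))
    (hρ : ρ = weighted (fun n => M q (2 * n + 1)) 0 (dinv q))
    (hρ' : ρ' = weighted (fun n => M q (2 * n + 1)) 0 (PowerSeries.X * dinv q)) :
    PowerSeries.C (ev q) * l - l * PowerSeries.C (ev q) = -(2 * (q - q⁻¹)) • (ρ' * l) ∧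
    oddSeries q (Ltilde q) = (q - q⁻¹) • (ρ * l) := by
  have h := imaginaryRelations hq
  have c0 : PowerSeries.C (ev q) = weighted (fun n => M q (2 * n + 1)) 0 1 := by
    rw [weighted_one]; simp only [mul_zero, zero_add]; rw [M_zero hq.ne_zero]
  have c1 : PowerSeries.X * PowerSeries.C (M q 3) =
      weighted (fun n => M q (2 * n + 1)) 0 (PowerSeries.X * 1) := by
    rw [weighted_X_mul, weighted_one]
  have hd := dplus_mul_dinv q
  have e1 : dminus q * dinv q * 1 = 1 + (2 * (q - q⁻¹)) • (PowerSeries.X * dinv q) := by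
    rw [dplus] at hd
    rw [dminus]
    simp only [PowerSeries.smul_eq_C_mul, map_mul, map_ofNat] at *
    linear_combination hd
  have k1 : l * PowerSeries.C (ev q) =
      PowerSeries.C (ev q) * l + (2 * (q - q⁻¹)) • (ρ' * l) := by
    rw [c0, hl, h.genSeries_weighted, e1, map_add, map_smul, add_mul, smul_mul_assoc, ← hρ']
  refine ⟨by rw [k1]; module, ?_⟩
  have e2 : oddSeries q (Ltilde q) = ((q - q⁻¹) / 2) • (PowerSeries.C (ev q) * l +
      l * PowerSeries.C (ev q)) - (1 / 2 : ℂ) • (PowerSeries.X * PowerSeries.C (M q 3) * l -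
      l * (PowerSeries.X * PowerSeries.C (M q 3))) := by
    have hX : l * (PowerSeries.X * PowerSeries.C (M q 3)) =
        PowerSeries.X * (l * PowerSeries.C (M q 3)) := by
      rw [← mul_assoc, ← PowerSeries.X_mul, mul_assoc]
    rw [hX, mul_assoc, ← mul_sub]
    ext n
    rw [map_sub, PowerSeries.coeff_smul, PowerSeries.coeff_smul, map_add]
    cases n with
    | zero =>
      have h0 := h.zero
      simp only [mul_zero] at h0
      simp only [hl, oddSeries, genSeries, PowerSeries.coeff_C_mul, PowerSeries.coeff_mul_C,
        PowerSeries.coeff_mk, pow_zero, mul_one, mul_zero, zero_add, h0, one_mul,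
        PowerSeries.coeff_zero_X_mul, Ltilde_one hq]
      module
    | succ n =>
      simp only [hl, oddSeries, genSeries, PowerSeries.coeff_succ_X_mul, PowerSeries.coeff_C_mul,
        PowerSeries.coeff_mul_C, PowerSeries.coeff_mk, map_sub]
      have := Ltilde_odd hq n
      rw [show 2 * (n + 1) + 1 = 2 * n + 3 by ring, this, show 2 * n + 2 = 2 * (n + 1) by ring]
      simp only [mul_smul_comm, smul_mul_assoc, pow_succ]
      module
  rw [e2, c1, c0, hl, h.genSeries_weighted, h.genSeries_weighted, ← add_mul, ← sub_mul,
    ← smul_mul_assoc, ← smul_mul_assoc, ← sub_mul, ← smul_mul_assoc, hρ]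
  congr 1
  rw [← map_add, ← map_sub, ← map_smul, ← map_smul, ← map_smul, ← map_sub]
  congr 1
  rw [dplus] at hd
  rw [dminus]
  have h2 : PowerSeries.C (2⁻¹ : ℂ) * 2 = (1 : PowerSeries ℂ) := by
    rw [← map_ofNat (PowerSeries.C (R := ℂ)) 2, ← map_mul]; norm_num
  simp only [PowerSeries.smul_eq_C_mul, map_mul, div_eq_mul_inv, one_mul, mul_one] at *
  generalize PowerSeries.C (q - q⁻¹) = θ at *
  generalize PowerSeries.C (2⁻¹ : ℂ) = t at *
  linear_combination (-θ * t + PowerSeries.X * t) * hd + θ * dinv q * h2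

/-- All even and odd series of the L's and L''s are expressed through ℓ, ρ and ρ', so that the
exchange relation takes the form required by `ImaginaryRelations.genSeries_commute`. -/
theorem commute_Ltilde (hq : Generic q) (i j : ℕ) :
    Commute (Ltilde q (2 * i)) (Ltilde q (2 * j)) := by
  have h := imaginaryRelations hq
  refine commute_of_genSeries_commute (x := fun n => Ltilde q (2 * n)) hq (fun c hc => ?_) i j
  set l := genSeries q (fun n => Ltilde q (2 * n)) with hl
  set ρ := weighted (fun n => M q (2 * n + 1)) 0 (dinv q) with hρ
  set ρ' := weighted (fun n => M q (2 * n + 1)) 0 (PowerSeries.X * dinv q) with hρ'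
  obtain ⟨k1, k2⟩ := weighted_dinv_series hq hl hρ hρ'
  have s1 : ∀ f : ℕ → NA q, ∀ n, PowerSeries.coeff n (oddSeries q f) =
    ((q - q⁻¹) * 2 ^ n) • f (2 * n + 1) := fun f n => PowerSeries.coeff_mk _ _
  have s2 : ∀ f : ℕ → NA q, ∀ n, PowerSeries.coeff n (evenSeries q f) =
    ((q - q⁻¹) * 2 ^ n) • f (2 * n) := fun f n => PowerSeries.coeff_mk _ _
  have dO : oddSeries q (fun n => L q n - L' q n) = -(2 * (q - q⁻¹)) • (ρ' * l) := by
    rw [← k1]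
    ext n
    have := L_sub_L'_Ltilde hq (2 * n)
    rw [pow_mul, neg_one_sq, one_pow, one_smul] at this
    rw [s1, this, map_sub, PowerSeries.coeff_C_mul, PowerSeries.coeff_mul_C, hl, genSeries,
      PowerSeries.coeff_mk, smul_mul_assoc, mul_smul_comm, smul_sub]
  have dE : evenSeries q (fun n => L q n - L' q n) = (2 : ℂ) • (PowerSeries.X *
      (PowerSeries.C (ev q) * oddSeries q (Ltilde q) +
        oddSeries q (Ltilde q) * PowerSeries.C (ev q))) := by
    ext n
    cases n with
    | zero => rw [s2, mul_zero, L'_zero]; simp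
    | succ n =>
      have := L_sub_L'_Ltilde hq (2 * n + 1)
      rw [pow_succ, pow_mul, neg_one_sq, one_pow, one_mul] at this
      rw [s2, show 2 * (n + 1) = 2 * n + 1 + 1 by ring, this, PowerSeries.coeff_smul,
        PowerSeries.coeff_succ_X_mul, map_add, PowerSeries.coeff_C_mul, PowerSeries.coeff_mul_C, s1,
        smul_mul_assoc, mul_smul_comm, pow_succ]
      module
  have hd := dplus_mul_dinv q
  have c0 : PowerSeries.C (ev q) = weighted (fun n => M q (2 * n + 1)) 0 1 := by
    rw [weighted_one]; simp only [mul_zero, zero_add]; rw [M_zero hq.ne_zero]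
  obtain ⟨Q, hQ⟩ : ∃ Q, Q = (2 : ℂ) • (ρ * ρ + ρ' * ρ' + (q - q⁻¹) • (ρ * ρ')) := ⟨_, rfl⟩
  have hQ' : PowerSeries.C (ev q) * oddSeries q (Ltilde q) +
        oddSeries q (Ltilde q) * PowerSeries.C (ev q) = (q - q⁻¹) • (Q * l) := by
    have k3 : l * PowerSeries.C (ev q) =
        PowerSeries.C (ev q) * l + (2 * (q - q⁻¹)) • (ρ' * l) := by
      linear_combination (norm := module) -k1
    rw [k2, mul_smul_comm, smul_mul_assoc, mul_assoc, k3, ← smul_add, ← mul_assoc, mul_add,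
      mul_smul_comm, ← mul_assoc, ← mul_assoc, ← smul_mul_assoc, ← add_mul, ← add_mul]
    congr 2
    have e3 : PowerSeries.C (ev q) = ρ - (q - q⁻¹) • ρ' - weighted (fun n => M q (2 * n + 1)) 0
        (PowerSeries.X * (PowerSeries.X * dinv q)) := by
      rw [c0, hρ, hρ', ← map_smul, ← map_sub, ← map_sub, ← hd, dplus]
      congr 1
      rw [sub_mul, sub_mul, one_mul, smul_mul_assoc, mul_assoc]
    have a1 : ρ' * ρ = - (ρ * ρ') := weighted_anti_self h hq _
    have a2 := weighted_anti h hq (PowerSeries.X * dinv q) (dinv q)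
    rw [← hρ, ← hρ'] at a2
    rw [e3, hQ]
    simp only [sub_mul, mul_sub, smul_mul_assoc, mul_smul_comm, a1]
    linear_combination (norm := module) -a2
  rw [hQ'] at dE
  refine h.genSeries_commute hq hc hQ ?_ ?_ ?_ ?_ (exchange_L hq c)
  · rw [← hl]
    have : evenSeries q (L q) = l + (1 / 2 : ℂ) • evenSeries q (fun n => L q n - L' q n) := by
      ext n
      rw [map_add, PowerSeries.coeff_smul, s2, s2, hl, genSeries, PowerSeries.coeff_mk]
      linear_combination (norm := module) ((q - q⁻¹) * 2 ^ n) • L_eq_Ltilde (q := q) (2 * n)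
    rw [this, dE, add_mul, one_mul, smul_mul_assoc, mul_smul_comm, mul_assoc]
    module
  · rw [← hl]
    have : evenSeries q (L' q) = l - (1 / 2 : ℂ) • evenSeries q (fun n => L q n - L' q n) := by
      ext n
      rw [map_sub, PowerSeries.coeff_smul, s2, s2, hl, genSeries, PowerSeries.coeff_mk]
      linear_combination (norm := module) ((q - q⁻¹) * 2 ^ n) • L'_eq_Ltilde (q := q) (2 * n)
    rw [this, dE, sub_mul, one_mul, smul_mul_assoc, mul_smul_comm, mul_assoc]
    module
  · rw [← hl]
    have : oddSeries q (L q) = oddSeries q (Ltilde q) +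
        (1 / 2 : ℂ) • oddSeries q (fun n => L q n - L' q n) := by
      ext n
      rw [map_add, PowerSeries.coeff_smul, s1, s1, s1]
      linear_combination (norm := module) ((q - q⁻¹) * 2 ^ n) • L_eq_Ltilde (q := q) (2 * n + 1)
    rw [this, dO, k2, sub_mul]
    module
  · rw [← hl]
    have : oddSeries q (L' q) = oddSeries q (Ltilde q) -
        (1 / 2 : ℂ) • oddSeries q (fun n => L q n - L' q n) := by
      ext n
      rw [map_sub, PowerSeries.coeff_smul, s1, s1, s1]
      linear_combination (norm := module) ((q - q⁻¹) * 2 ^ n) • L'_eq_Ltilde (q := q) (2 * n + 1)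
    rw [this, dO, k2, add_mul]
    module

end

/-! ### Exponentials of power series with noncommuting coefficients -/

section exponential

variable {A : Type*} [Ring A] [Algebra ℂ A]

theorem coeff_pow_eq_zero_of_lt {R : Type*} [Ring R] {f : PowerSeries R} (h0 : PowerSeries.coeff 0 f = 0) :
    ∀ {k n : ℕ}, n < k → PowerSeries.coeff n (f ^ k) = 0
  | 0, n, h => by omega
  | k + 1, n, h => by
    rw [pow_succ', PowerSeries.coeff_mul]
    refine Finset.sum_eq_zero fun p hp => ?_
    have hp := Finset.HasAntidiagonal.mem_antidiagonal.1 hp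
    rcases Nat.eq_zero_or_pos p.1 with h1 | h1
    · rw [h1, h0, zero_mul]
    · rw [coeff_pow_eq_zero_of_lt h0 (by omega), mul_zero]

theorem coeff_pow_congr {R : Type*} [Ring R] {f g : PowerSeries R} {n : ℕ}
    (h : ∀ i < n, PowerSeries.coeff i f = PowerSeries.coeff i g) :
    ∀ k, ∀ i < n, PowerSeries.coeff i (f ^ k) = PowerSeries.coeff i (g ^ k)
  | 0, i, _ => by simp
  | k + 1, i, hi => by
    rw [pow_succ', pow_succ', PowerSeries.coeff_mul, PowerSeries.coeff_mul]
    refine Finset.sum_congr rfl fun p hp => ?_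
    have hp := Finset.HasAntidiagonal.mem_antidiagonal.1 hp
    rw [h _ (by omega), coeff_pow_congr h k _ (by omega)]

/-- Without constant term, the coefficient of degree n in a power of exponent at least two involves
only coefficients of degree below n. So in the exponential the n-th coefficient of f enters degree n
linearly, which gives injectivity. -/
theorem coeff_pow_add_two_congr {R : Type*} [Ring R] {f g : PowerSeries R} {n : ℕ}
    (h0 : PowerSeries.coeff 0 f = 0) (h0' : PowerSeries.coeff 0 g = 0)
    (h : ∀ i < n, PowerSeries.coeff i f = PowerSeries.coeff i g) (k : ℕ) :
    PowerSeries.coeff n (f ^ (k + 2)) = PowerSeries.coeff n (g ^ (k + 2)) := by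
  rw [pow_succ', pow_succ' g, PowerSeries.coeff_mul, PowerSeries.coeff_mul]
  refine Finset.sum_congr rfl fun p hp => ?_
  have hp := Finset.HasAntidiagonal.mem_antidiagonal.1 hp
  rcases Nat.eq_zero_or_pos p.1 with h1 | h1
  · rw [h1, h0, h0', zero_mul, zero_mul]
  rcases Nat.eq_zero_or_pos p.2 with h2 | h2
  · rw [h2, coeff_pow_eq_zero_of_lt h0 (by omega), coeff_pow_eq_zero_of_lt h0' (by omega),
      mul_zero, mul_zero]
  · rw [h _ (by omega), coeff_pow_congr h _ _ (by omega)]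

theorem coeff_expSeries (f : PowerSeries A) (n : ℕ) : PowerSeries.coeff n (expSeries f) =
    ∑ k ∈ Finset.range (n + 1), ((k.factorial : ℂ)⁻¹) • PowerSeries.coeff n (f ^ k) :=
  PowerSeries.coeff_mk _ _

theorem expSeries_injective {f g : PowerSeries A} (h0 : PowerSeries.coeff 0 f = 0)
    (h0' : PowerSeries.coeff 0 g = 0) (h : expSeries f = expSeries g) : f = g := by
  ext n
  induction n using Nat.strong_induction_on with
  | _ n ih =>
    rcases Nat.eq_zero_or_pos n with rfl | hn
    · rw [h0, h0']
    have h1 := congrArg (PowerSeries.coeff n) h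
    rw [coeff_expSeries, coeff_expSeries, ← sub_eq_zero, ← Finset.sum_sub_distrib,
      Finset.sum_eq_single 1] at h1
    · simpa [sub_eq_zero] using h1
    · intro k _ hk
      match k, hk with
      | 0, _ => simp
      | 1, hk => exact absurd rfl hk
      | k + 2, _ => rw [coeff_pow_add_two_congr h0 h0' ih, sub_self]
    · intro h; exact absurd (Finset.mem_range.2 (by omega)) h

theorem euler_pow_succ {f : PowerSeries A} (hf : Commute f (euler f)) (k : ℕ) :
    euler (f ^ (k + 1)) = ((k : ℂ) + 1) • (euler f * f ^ k) := by
  induction k with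
  | zero => simp
  | succ k ih =>
    rw [pow_succ', euler_mul, ih, mul_smul_comm, ← mul_assoc, hf.eq, mul_assoc, ← pow_succ']
    push_cast
    module

/-- The usual rule for differentiating an exponential, valid here because f commutes with its
derivative. -/
theorem euler_expSeries {f : PowerSeries A} (h0 : PowerSeries.coeff 0 f = 0)
    (hf : Commute f (euler f)) : euler (expSeries f) = euler f * expSeries f := by
  ext n
  have h1 : PowerSeries.coeff n (euler f * expSeries f) =
      ∑ k ∈ Finset.range n, ((k.factorial : ℂ)⁻¹) • PowerSeries.coeff n (euler f * f ^ k) := by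
    simp only [PowerSeries.coeff_mul, Finset.smul_sum]
    rw [Finset.sum_comm]
    refine Finset.sum_congr rfl fun p hp => ?_
    have hp := Finset.HasAntidiagonal.mem_antidiagonal.1 hp
    rcases Nat.eq_zero_or_pos p.1 with h2 | h2
    · simp [h2]
    rw [coeff_expSeries, Finset.mul_sum]
    simp only [mul_smul_comm]
    refine Finset.sum_subset (fun k hk => ?_) fun k _ hk => ?_
    · exact Finset.mem_range.2 (by have := Finset.mem_range.1 hk; omega)
    · rw [coeff_pow_eq_zero_of_lt h0 (by have := mt Finset.mem_range.2 hk; omega), mul_zero, smul_zero]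
  rw [h1, coeff_euler, coeff_expSeries, Finset.smul_sum, Finset.sum_range_succ']
  have h2 : (n : ℂ) • ((Nat.factorial 0 : ℂ)⁻¹) • PowerSeries.coeff n (f ^ 0) = 0 := by
    rw [pow_zero, smul_comm, ← coeff_euler, euler_one]; simp
  rw [h2, add_zero]
  refine Finset.sum_congr rfl fun k _ => ?_
  rw [smul_comm, ← coeff_euler, euler_pow_succ hf, PowerSeries.coeff_smul, smul_smul,
    Nat.factorial_succ]
  congr 1
  have : (k : ℂ) + 1 ≠ 0 := by norm_cast
  push_cast
  field_simp

/-- Uniqueness for a first-order linear equation: if l has no constant term, the coefficient of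
degree n is determined by lower ones. -/
theorem eq_of_euler_eq {l f g : PowerSeries A} (hl : PowerSeries.coeff 0 l = 0)
    (hf : euler f = l * f) (hg : euler g = l * g)
    (h0 : PowerSeries.coeff 0 f = PowerSeries.coeff 0 g) : f = g := by
  ext n
  induction n using Nat.strong_induction_on with
  | _ n ih =>
    rcases Nat.eq_zero_or_pos n with rfl | hn
    · exact h0
    have h1 : PowerSeries.coeff n (l * f) = PowerSeries.coeff n (l * g) := by
      rw [PowerSeries.coeff_mul, PowerSeries.coeff_mul]
      refine Finset.sum_congr rfl fun p hp => ?_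
      have hp := Finset.HasAntidiagonal.mem_antidiagonal.1 hp
      rcases Nat.eq_zero_or_pos p.1 with h2 | h2
      · rw [h2, hl, zero_mul, zero_mul]
      · rw [ih _ (by omega)]
    rw [← hf, ← hg, coeff_euler, coeff_euler] at h1
    exact smul_right_injective A (by exact_mod_cast hn.ne' : (n : ℂ) ≠ 0) h1

theorem euler_scale (c : ℂ) (f : PowerSeries A) : euler (scale c f) = scale c (euler f) := by
  ext n
  simp [smul_comm (n : ℂ)]

end exponential

/-! ### The elements L̄_{2n} and the bracket formulas -/

section

variable {q : ℂ}

/-- The elements `L̄_{2n}`, with their brackets. -/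
theorem exists_Lbar (hq : Generic q) : ∃ b : ℕ → NA q, IsLbar q b ∧
    (∀ n, b n ∈ homComp q (2 * n, 2 * n)) ∧ (∀ m n, Commute (b m) (b n)) ∧
    (∀ n j, 1 ≤ n → b n * M q (2 * j + 1) - M q (2 * j + 1) * b n =
      ((q - q⁻¹)⁻¹ * ((n : ℂ) * 2 ^ n)⁻¹ * (q ^ n - q⁻¹ ^ n + (-q⁻¹) ^ n - (-q) ^ n)) •
        M q (2 * (n + j) + 1)) := by
  have h := imaginaryRelations hq
  obtain ⟨l, hl⟩ := h.exists_log
  have hcx : ∀ i n, Commute (Ltilde q (2 * i)) (PowerSeries.coeff n l) := fun i n =>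
    h.commute_log hl (fun j => commute_Ltilde hq i j) n
  have hcl : ∀ i n, Commute (PowerSeries.coeff i l) (PowerSeries.coeff n l) := fun i n =>
    h.commute_log hl (fun j => (hcx j i).symm) n
  have hl0 := coeff_zero_log h hl
  set g := genSeries q (fun n => Ltilde q (2 * n)) with hg
  have hgm : ∀ n, PowerSeries.coeff n g ∈ homComp q (2 * n, 2 * n) := fun n => by
    rw [hg, genSeries, PowerSeries.coeff_mk, Ltilde]
    exact Submodule.smul_mem _ _ (Submodule.smul_mem _ _
      (add_mem (L_mem hq.ne_zero _) (L'_mem hq.ne_zero _)))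
  have hlm : ∀ n, PowerSeries.coeff n l ∈ homComp q (2 * n, 2 * n) := by
    intro n
    induction n using Nat.strong_induction_on with
    | _ n ih =>
      have h1 := congrArg (PowerSeries.coeff n) hl
      rw [coeff_euler, PowerSeries.coeff_mul, Finset.Nat.sum_antidiagonal_eq_sum_range_succ_mk,
        Finset.sum_range_succ, Nat.sub_self, PowerSeries.coeff_zero_eq_constantCoeff_apply g,
        h.constantCoeff, mul_one, ← eq_sub_iff_add_eq'] at h1
      rw [h1]
      refine sub_mem (Submodule.smul_mem _ _ (hgm n)) (Submodule.sum_mem _ fun i hi => ?_)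
      have hi := Finset.mem_range.1 hi
      have := mul_mem_homComp (ih i hi) (hgm (n - i))
      rwa [Prod.mk_add_mk, show 2 * i + 2 * (n - i) = 2 * n by omega] at this
  -- Dividing by n inverts the Euler operator, and 2ⁿ undoes the weights of `genSeries`.
  set f : PowerSeries (NA q) := PowerSeries.mk fun n => ((n : ℂ) * 2 ^ n)⁻¹ • PowerSeries.coeff n l
    with hf
  have hf0 : PowerSeries.coeff 0 f = 0 := by simp [hf]
  have hef : euler f = scale (1 / 2) l := by
    ext n
    rw [coeff_euler, coeff_scale, hf, PowerSeries.coeff_mk, smul_smul]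
    rcases Nat.eq_zero_or_pos n with rfl | hn
    · rw [hl0, smul_zero, smul_zero]
    · congr 1
      have : (n : ℂ) ≠ 0 := by exact_mod_cast hn.ne'
      rw [one_div, inv_pow]
      field_simp
  have hfc : Commute f (euler f) := by
    rw [hef]
    change f * scale (1 / 2) l = scale (1 / 2) l * f
    ext n
    rw [coeff_mul_scale, coeff_scale_mul]
    refine Finset.sum_congr rfl fun p _ => ?_
    rw [hf, PowerSeries.coeff_mk, smul_mul_assoc, mul_smul_comm, (hcl _ _).eq]
  -- Both sides have constant term 1 and the same logarithmic derivative. That f commutes with its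
  -- derivative rests on the commutativity of the L̃_{2n}.
  have hexp : expSeries f = scale (1 / 2) g := by
    refine eq_of_euler_eq (l := scale (1 / 2) l) ?_ ?_ ?_ ?_
    · rw [coeff_scale, hl0, smul_zero]
    · rw [euler_expSeries hf0 hfc, hef]
    · rw [euler_scale, ← hl, map_mul]
    · rw [coeff_scale, coeff_expSeries, PowerSeries.coeff_zero_eq_constantCoeff_apply g,
        h.constantCoeff]
      simp
  have hθ := hq.theta_ne
  refine ⟨fun n => (q - q⁻¹)⁻¹ • PowerSeries.coeff n f, ⟨?_, ?_⟩, ?_, ?_, ?_⟩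
  · simp only [hf0, smul_zero]
  · have e : (PowerSeries.mk fun n => theta q • (q - q⁻¹)⁻¹ • PowerSeries.coeff n f) = f := by
      ext n
      rw [PowerSeries.coeff_mk, smul_smul, theta, mul_inv_cancel₀ hθ, one_smul]
    rw [e, hexp]
    ext n
    rw [PowerSeries.coeff_mk, coeff_scale, hg, genSeries, PowerSeries.coeff_mk, smul_smul, theta]
    congr 1
    rw [one_div, inv_pow]
    field_simp
  · intro n
    simp only [hf, PowerSeries.coeff_mk]
    exact Submodule.smul_mem _ _ (Submodule.smul_mem _ _ (hlm n))
  · intro i j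
    simp only [hf, PowerSeries.coeff_mk]
    exact Commute.smul_left (Commute.smul_right (Commute.smul_left (Commute.smul_right (hcl i j) _) _) _) _
  · intro n j _
    have := h.coeff_log hq.ne_zero hl n j
    simp only [hf, PowerSeries.coeff_mk]
    rw [smul_mul_assoc, smul_mul_assoc, mul_smul_comm, mul_smul_comm, ← smul_sub, ← smul_sub, this,
      smul_smul, smul_smul, mul_assoc]

theorem IsLbar.unique (hq : Generic q) {b b' : ℕ → NA q} (h : IsLbar q b) (h' : IsLbar q b') :
    b = b' := by
  have h0 : ∀ b : ℕ → NA q, IsLbar q b →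
      PowerSeries.coeff 0 (PowerSeries.mk fun n => theta q • b n) = 0 := fun b hb => by
    rw [PowerSeries.coeff_mk, hb.1, smul_zero]
  have := expSeries_injective (h0 b h) (h0 b' h') (h.2.symm.trans h'.2)
  funext n
  have := congrArg (PowerSeries.coeff n) this
  rw [PowerSeries.coeff_mk, PowerSeries.coeff_mk] at this
  exact smul_right_injective _ hq.theta_ne this

theorem existsUnique_Lbar (hq : Generic q) : ∃! b : ℕ → NA q, IsLbar q b := by
  obtain ⟨b, hb, -⟩ := exists_Lbar hq
  exact ⟨b, hb, fun b' hb' => hb'.unique hq hb⟩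

theorem IsLbar.brackets (hq : Generic q) {b : ℕ → NA q} (hb : IsLbar q b) :
    (∀ m n : ℕ, 1 ≤ m → 1 ≤ n → bracket q (b m) (b n) = 0) ∧
      (∀ m n : ℕ, 1 ≤ m → bracket q (b (2 * m)) (M q (2 * n + 1)) = 0) ∧
      (∀ m n : ℕ, bracket q (b (2 * m + 1)) (M q (2 * n + 1)) =
        (1 / 2 ^ (2 * m) * (qInt q (2 * m + 1) / (2 * m + 1))) •
          M q (2 * (2 * m + 1) + 2 * n + 1)) := by
  obtain ⟨b', hb', hm, hc, hM⟩ := exists_Lbar hq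
  obtain rfl := hb.unique hq hb'
  have hb2 : ∀ (n : ℕ) {k : ℕ} {y : NA q}, y ∈ homComp q (k, k) →
      bracket q (b n) y = b n * y - y * b n := by
    intro n k y hy
    rw [bracket_diag hq.ne_zero (hm n) hy, mul_assoc, pow_mul]
    simp
  refine ⟨fun m n _ _ => ?_, fun m n h1 => ?_, fun m n => ?_⟩
  · rw [hb2 m (hm n), (hc m n).eq, sub_self]
  · rw [hb2 _ (M_mem hq.ne_zero n), hM _ _ (by omega), log_coeff_even q (even_two_mul m), mul_zero,
      zero_smul]
  · rw [hb2 _ (M_mem hq.ne_zero n), hM _ _ (by omega), log_coeff_odd q (odd_two_mul_add_one m),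
      mul_add 2, qInt]
    congr 1
    have : ((2 * m + 1 : ℕ) : ℂ) ≠ 0 := Nat.cast_ne_zero.2 (Nat.succ_ne_zero _)
    push_cast at this ⊢
    have hθ := hq.theta_ne
    generalize q - q⁻¹ = θ at hθ
    generalize q ^ (2 * m + 1) - q⁻¹ ^ (2 * m + 1) = z
    rw [pow_succ]
    field_simp

theorem bracket_Ltilde (hq : Generic q) (m n : ℕ) :
    bracket q (Ltilde q (2 * m)) (Ltilde q (2 * n)) = 0 := by
  have hm : ∀ n, Ltilde q (2 * n) ∈ homComp q (2 * n, 2 * n) := fun n =>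
    Submodule.smul_mem _ _ (add_mem (L_mem hq.ne_zero _) (L'_mem hq.ne_zero _))
  rw [bracket_diag hq.ne_zero (hm m) (hm n), mul_assoc, pow_mul, (commute_Ltilde hq m n).eq]
  simp

theorem bracket_M (hq : Generic q) (m n : ℕ) :
    (Odd (m + n) → bracket q (M q (2 * m + 1)) (M q (2 * n + 1)) = 0) ∧
      (Even (m + n) → bracket q (M q (2 * m + 1)) (M q (2 * n + 1)) =
        ((-1 : ℂ) ^ (((m : ℤ) - (n : ℤ)) / 2) * 2) • M q (m + n + 1) ^ 2) := by
  have h := imaginaryRelations hq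
  have e : bracket q (M q (2 * m + 1)) (M q (2 * n + 1)) =
      M q (2 * m + 1) * M q (2 * n + 1) + M q (2 * n + 1) * M q (2 * m + 1) := by
    rw [bracket_diag hq.ne_zero (M_mem hq.ne_zero m) (M_mem hq.ne_zero n),
      ((odd_two_mul_add_one m).mul (odd_two_mul_add_one n)).neg_one_pow]
    module
  rw [e]
  refine ⟨fun ho => h.anticommute_of_odd hq ho, fun he => ?_⟩
  rcases le_total n m with hnm | hnm
  · obtain ⟨r, rfl⟩ : ∃ r, m = n + 2 * r := by
      obtain ⟨k, hk⟩ := he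
      exact ⟨k - n, by omega⟩
    have := h.anti_even hq n r
    rw [this]
    congr 2
    · rw [show ((n + 2 * r : ℕ) : ℤ) - (n : ℤ) = 2 * r by push_cast; ring,
        Int.mul_ediv_cancel_left _ two_ne_zero, zpow_natCast]
    · congr 1; ring
  · obtain ⟨r, rfl⟩ : ∃ r, n = m + 2 * r := by
      obtain ⟨k, hk⟩ := he
      exact ⟨k - m, by omega⟩
    have := h.anti_even hq m r
    rw [add_comm (M q _ * _), this]
    congr 2
    · rw [show (m : ℤ) - ((m + 2 * r : ℕ) : ℤ) = 2 * (-(r : ℤ)) by push_cast; ring,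
        Int.mul_ediv_cancel_left _ two_ne_zero, zpow_neg, zpow_natCast, ← inv_pow]
      norm_num
    · congr 1; ring

theorem commute_M_sq_ev (hq : Generic q) (m : ℕ) : Commute (M q (2 * m + 1) ^ 2) (ev q) := by
  have := (imaginaryRelations hq).commute_sq hq m 0
  simp only [mul_zero, zero_add] at this
  rwa [M_zero hq.ne_zero] at this

/-- The odd indices follow from the even ones, L₁ and M₃ by `Ltilde_odd`. -/
theorem commute_M_sq_Ltilde (hq : Generic q) (m n : ℕ) :
    Commute (M q (2 * m + 1) ^ 2) (Ltilde q n) := by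
  have h := imaginaryRelations hq
  rcases Nat.even_or_odd' n with ⟨k, rfl | rfl⟩
  · exact h.commute_sq_x hq m k
  · cases k with
    | zero => rw [mul_zero, zero_add, Ltilde_one hq]; exact commute_M_sq_ev hq m
    | succ k =>
      rw [show 2 * (k + 1) + 1 = 2 * k + 3 by ring, Ltilde_odd hq,
        show 2 * k + 2 = 2 * (k + 1) by ring]
      have h0 := commute_M_sq_ev hq m
      have h1 : Commute (M q (2 * m + 1) ^ 2) (M q 3) := h.commute_sq hq m 1
      have h2 := h.commute_sq_x hq m
      exact (((h0.mul_right (h2 _)).add_right ((h2 _).mul_right h0)).smul_right _).sub_right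
        (((h1.mul_right (h2 _)).sub_right ((h2 _).mul_right h1)).smul_right _)

theorem commute_M_sq_L (hq : Generic q) (m n : ℕ) :
    Commute (M q (2 * m + 1) ^ 2) (L q n) ∧ Commute (M q (2 * m + 1) ^ 2) (L' q n) := by
  have hd : Commute (M q (2 * m + 1) ^ 2) (L q n - L' q n) := by
    cases n with
    | zero => rw [L'_zero, sub_self]; exact Commute.zero_right _
    | succ n =>
      rw [L_sub_L'_Ltilde hq]
      have h0 := commute_M_sq_ev hq m
      have h1 := commute_M_sq_Ltilde hq m n
      exact (h0.mul_right h1).sub_right ((h1.mul_right h0).smul_right _)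
  constructor
  · rw [L_eq_Ltilde]
    exact (commute_M_sq_Ltilde hq m n).add_right (hd.smul_right _)
  · rw [L'_eq_Ltilde]
    exact (commute_M_sq_Ltilde hq m n).sub_right (hd.smul_right _)

theorem M_sq_mem (hq : Generic q) (m : ℕ) :
    M q (2 * m + 1) ^ 2 ∈ homComp q (2 * (2 * m + 1), 2 * (2 * m + 1)) := by
  have := mul_mem_homComp (M_mem hq.ne_zero m) (M_mem hq.ne_zero m)
  rw [pow_two]
  rwa [Prod.mk_add_mk, ← two_mul] at this

theorem bracket_M_sq_L (hq : Generic q) (m n : ℕ) :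
    bracket q (M q (2 * m + 1) ^ 2) (L q n) = 0 := by
  rw [bracket_diag hq.ne_zero (M_sq_mem hq m) (L_mem hq.ne_zero n), mul_assoc, pow_mul,
    (commute_M_sq_L hq m n).1.eq]
  simp

end

/-! ### Algebras of imaginary elements and commutators with L_{2n} -/

section

variable {q : ℂ}

theorem L_even_yv (hq : Generic q) (n j : ℕ) :
    L q (2 * n + 2) * yv q (2 * j) - yv q (2 * j) * L q (2 * n + 2) =
      q • (L q (2 * n + 1) * yv q (2 * j + 1)) - q⁻¹ • (yv q (2 * j + 1) * L q (2 * n + 1)) := by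
  have hq0 := hq.ne_zero
  induction j with
  | zero =>
    have h := commutator_right_of_qcommute hq0 (yv_succ_mul hq 0) (x := xv q (2 * n))
      (z := zv q (2 * n) 0) (z' := zv q (2 * n) 1) rfl rfl
    rw [zv_even hq, zv_even hq] at h
    have a1 : (-1 : ℂ) ^ (2 * n * (0 + 1)) = 1 := by rw [mul_assoc, pow_mul]; simp
    have a2 : (-1 : ℂ) ^ (2 * n * (1 + 1)) = 1 := by rw [mul_assoc, pow_mul]; simp
    rw [a1, a2, one_smul, one_mul] at h
    exact h
  | succ j ih =>
    have h1 := ev_sq_yv q (2 * j)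
    have h2 := ev_sq_yv q (2 * j + 1)
    have k1 := (commute_ev_sq_L hq (2 * n + 2)).eq
    have k2 := (commute_ev_sq_L hq (2 * n + 1)).eq
    rw [show 2 * (j + 1) = 2 * j + 2 by ring, show 2 * j + 2 + 1 = 2 * j + 1 + 2 by ring,
      ← h1, ← h2]
    linear_combination (norm := skip) (ev q * ev q) * ih - ih * (ev q * ev q) -
      k1 * yv q (2 * j) + yv q (2 * j) * k1 + q • (k2 * yv q (2 * j + 1))
      - q⁻¹ • (yv q (2 * j + 1) * k2)
    simp only [mul_sub, sub_mul, smul_mul_assoc, mul_smul_comm, mul_assoc, smul_sub, smul_smul]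
    module

/-- Odd L̃'s come from `Ltilde_odd`, and each difference L - L' is a superbracket of L₁ with the
preceding L̃. At index 2n only the difference is available, not L_{2n} itself. -/
theorem mem_of_Ltilde_mem (hq : Generic q) (S : Subalgebra ℂ (NA q))
    (hM : ∀ j, M q (2 * j + 1) ∈ S) {n : ℕ} (hx : ∀ k < n, Ltilde q (2 * k) ∈ S) :
    (∀ j < 2 * n, L q j ∈ S ∧ L' q j ∈ S) ∧ L q (2 * n) - L' q (2 * n) ∈ S := by
  have he : ev q ∈ S := by have := hM 0; rwa [mul_zero, zero_add, M_zero hq.ne_zero] at this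
  have hy : ∀ k < n, Ltilde q (2 * k + 1) ∈ S := by
    intro k hk
    cases k with
    | zero => rw [mul_zero, zero_add, Ltilde_one hq]; exact he
    | succ k =>
      rw [show 2 * (k + 1) + 1 = 2 * k + 3 by ring, Ltilde_odd hq,
        show 2 * k + 2 = 2 * (k + 1) by ring]
      have h0 := hx _ hk
      have h1 := hx k (by omega)
      have h2 : M q 3 ∈ S := hM 1
      exact sub_mem (S.smul_mem (add_mem (mul_mem he h0) (mul_mem h0 he)) _)
        (S.smul_mem (sub_mem (mul_mem h2 h1) (mul_mem h1 h2)) _)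
  have ht : ∀ j < 2 * n, Ltilde q j ∈ S := by
    intro j hj
    rcases Nat.even_or_odd' j with ⟨k, rfl | rfl⟩
    · exact hx k (by omega)
    · exact hy k (by omega)
  have hd : ∀ j ≤ 2 * n, L q j - L' q j ∈ S := by
    intro j hj
    cases j with
    | zero => rw [L'_zero, sub_self]; exact zero_mem S
    | succ j =>
      rw [L_sub_L'_Ltilde hq]
      have := ht j (by omega)
      exact sub_mem (mul_mem he this) (S.smul_mem (mul_mem this he) _)
  refine ⟨fun j hj => ⟨?_, ?_⟩, hd _ le_rfl⟩
  · rw [L_eq_Ltilde]; exact add_mem (ht j hj) (S.smul_mem (hd j hj.le) _)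
  · rw [L'_eq_Ltilde]; exact sub_mem (ht j hj) (S.smul_mem (hd j hj.le) _)

/-- L_{2k} and L̃_{2k} differ by elements generated at lower index, so the change between them is
triangular. -/
theorem Ltilde_mem_of_L_mem (hq : Generic q) (S : Subalgebra ℂ (NA q))
    (hM : ∀ j, M q (2 * j + 1) ∈ S) {n : ℕ} (hL : ∀ k < n, L q (2 * k) ∈ S) (k : ℕ) (hk : k < n) :
    Ltilde q (2 * k) ∈ S := by
  induction k using Nat.strong_induction_on with
  | _ k ih =>
    have := (mem_of_Ltilde_mem hq S hM fun k' hk' => ih k' hk' (by omega)).2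
    have h2 := L_eq_Ltilde (q := q) (2 * k)
    rw [← sub_eq_iff_eq_add] at h2
    rw [← h2]
    exact sub_mem (hL k hk) (S.smul_mem this _)

/-- The subalgebra generated by the `L̃_{2k}` with `k < n` and the `M_{2j+1}`. -/
def imagAlg (q : ℂ) (n : ℕ) : Subalgebra ℂ (NA q) :=
  Algebra.adjoin ℂ ({z | ∃ k < n, z = Ltilde q (2 * k)} ∪ {z | ∃ j, z = M q (2 * j + 1)})

theorem Ltilde_mem_imagAlg {n k : ℕ} (hk : k < n) : Ltilde q (2 * k) ∈ imagAlg q n :=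
  Algebra.subset_adjoin (Or.inl ⟨k, hk, rfl⟩)

theorem M_mem_imagAlg (n j : ℕ) : M q (2 * j + 1) ∈ imagAlg q n :=
  Algebra.subset_adjoin (Or.inr ⟨j, rfl⟩)

theorem L_mem_imagAlg (hq : Generic q) {n j : ℕ} (hj : j < 2 * n) :
    L q j ∈ imagAlg q n ∧ L' q j ∈ imagAlg q n :=
  (mem_of_Ltilde_mem hq _ (M_mem_imagAlg n) fun _ hk => Ltilde_mem_imagAlg hk).1 j hj

theorem imagAlg_le (hq : Generic q) {n : ℕ} {S : Subalgebra ℂ (NA q)}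
    (hM : ∀ j, M q (2 * j + 1) ∈ S) (hL : ∀ k < n, L q (2 * k) ∈ S) : imagAlg q n ≤ S := by
  refine Algebra.adjoin_le ?_
  rintro _ (⟨k, hk, rfl⟩ | ⟨j, rfl⟩)
  · exact Ltilde_mem_of_L_mem hq S hM hL k hk
  · exact hM j

/-- The commutator with `x` maps `adjoin s` to `S` if it does so on `s`. -/
theorem commutator_mem_of_adjoin {A : Type*} [Ring A] [Algebra ℂ A] {s : Set A} {x : A}
    {S : Subalgebra ℂ A} (hs : s ⊆ S) (h : ∀ z ∈ s, x * z - z * x ∈ S) {z : A}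
    (hz : z ∈ Algebra.adjoin ℂ s) : x * z - z * x ∈ S := by
  have hle := Algebra.adjoin_le (S := S) hs
  induction hz using Algebra.adjoin_induction with
  | mem z hz => exact h z hz
  | algebraMap r => rw [Algebra.commutes, sub_self]; exact zero_mem S
  | add a b ha hb iha ihb =>
    have : x * (a + b) - (a + b) * x = (x * a - a * x) + (x * b - b * x) := by noncomm_ring
    rw [this]; exact add_mem iha ihb
  | mul a b ha hb iha ihb =>
    have : x * (a * b) - (a * b) * x = (x * a - a * x) * b + a * (x * b - b * x) := by noncomm_ring
    rw [this]; exact add_mem (mul_mem iha (hle hb)) (mul_mem (hle ha) ihb)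

/-- The recursion `step` expresses the commutator through L̃'s of smaller index. -/
theorem commutator_Ltilde_M (hq : Generic q) (n j : ℕ) :
    Ltilde q (2 * n) * M q (2 * j + 1) - M q (2 * j + 1) * Ltilde q (2 * n) ∈ imagAlg q n := by
  have h := imaginaryRelations hq
  match n with
  | 0 =>
    have : Ltilde q (2 * 0) = (q - q⁻¹)⁻¹ • 1 := by
      have h0 := h.zero
      rw [← h0, smul_smul, inv_mul_cancel₀ hq.theta_ne, one_smul]
    rw [this]; simp
  | 1 => rw [h.one j]; exact M_mem_imagAlg _ _
  | n + 2 =>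
    rw [h.step n j]
    have a1 : Ltilde q (2 * (n + 1)) ∈ imagAlg q (n + 2) := Ltilde_mem_imagAlg (by omega)
    have a0 : Ltilde q (2 * n) ∈ imagAlg q (n + 2) := Ltilde_mem_imagAlg (by omega)
    have b := M_mem_imagAlg (q := q) (n + 2)
    exact add_mem (Subalgebra.smul_mem _ (add_mem (mul_mem a1 (b _)) (mul_mem (b _) a1)) _)
      (Subalgebra.smul_mem _ (sub_mem (mul_mem a0 (b _)) (mul_mem (b _) a0)) _)

theorem commutator_Ltilde_mem (hq : Generic q) {n : ℕ} {z : NA q} (hz : z ∈ imagAlg q n) :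
    Ltilde q (2 * n) * z - z * Ltilde q (2 * n) ∈ imagAlg q n := by
  refine commutator_mem_of_adjoin Algebra.subset_adjoin ?_ hz
  rintro _ (⟨k, hk, rfl⟩ | ⟨j, rfl⟩)
  · rw [(commute_Ltilde hq n k).eq, sub_self]; exact zero_mem _
  · exact commutator_Ltilde_M hq n j

theorem commutator_L_mem (hq : Generic q) {n : ℕ} {z : NA q} (hz : z ∈ imagAlg q n) :
    L q (2 * n) * z - z * L q (2 * n) ∈ imagAlg q n := by
  have hd := (mem_of_Ltilde_mem hq _ (M_mem_imagAlg n) fun _ hk => Ltilde_mem_imagAlg hk).2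
  have h1 := commutator_Ltilde_mem hq hz
  have : L q (2 * n) * z - z * L q (2 * n) = (Ltilde q (2 * n) * z - z * Ltilde q (2 * n)) +
      (1 / 2 : ℂ) • ((L q (2 * n) - L' q (2 * n)) * z - z * (L q (2 * n) - L' q (2 * n))) := by
    linear_combination (norm := skip) L_eq_Ltilde (q := q) (2 * n) * z -
      z * L_eq_Ltilde (q := q) (2 * n)
    simp only [add_mul, mul_add, mul_sub, sub_mul, smul_mul_assoc, mul_smul_comm]
    module
  rw [this]
  exact add_mem h1 (Subalgebra.smul_mem _ (sub_mem (mul_mem hd hz) (mul_mem hz hd)) _)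

/-- `[L_{2n}, Y_j]` lies in the algebra generated by the `Y` and `imagAlg q n`. -/
theorem commutator_L_yv_mem (hq : Generic q) {n : ℕ} {S : Subalgebra ℂ (NA q)}
    (hS : imagAlg q n ≤ S) (hY : ∀ j, yv q j ∈ S) (j : ℕ) :
    L q (2 * n) * yv q j - yv q j * L q (2 * n) ∈ S := by
  cases n with
  | zero => rw [mul_zero, L_zero]; simp
  | succ n =>
    have hL := (L_mem_imagAlg hq (n := n + 1) (j := 2 * n + 1) (by omega))
    have hd := hS (mem_of_Ltilde_mem hq _ (M_mem_imagAlg (n + 1))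
      fun _ hk => Ltilde_mem_imagAlg hk).2
    rcases Nat.even_or_odd' j with ⟨k, rfl | rfl⟩
    · rw [show 2 * (n + 1) = 2 * n + 2 by ring, L_even_yv hq]
      exact sub_mem (S.smul_mem (mul_mem (hS hL.1) (hY _)) _)
        (S.smul_mem (mul_mem (hY _) (hS hL.1)) _)
    · have e : L q (2 * (n + 1)) * yv q (2 * k + 1) - yv q (2 * k + 1) * L q (2 * (n + 1)) =
          (L q (2 * (n + 1)) - L' q (2 * (n + 1))) * yv q (2 * k + 1) -
          yv q (2 * k + 1) * (L q (2 * (n + 1)) - L' q (2 * (n + 1))) +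
          (L' q (2 * (n + 1)) * yv q (2 * k + 1) - yv q (2 * k + 1) * L' q (2 * (n + 1))) := by
        noncomm_ring
      rw [e]
      refine add_mem (sub_mem (mul_mem hd (hY _)) (mul_mem (hY _) hd)) ?_
      rw [show 2 * (n + 1) = 2 * n + 2 by ring, L'_even_yv hq]
      exact add_mem (S.smul_mem (mul_mem (hS hL.2) (hY _)) _)
        (S.smul_mem (mul_mem (hY _) (hS hL.2)) _)

end

/-! ### Triangular decomposition: products of Y's times the positive algebra -/

section

variable {q : ℂ}

/-- The subalgebra generated by the `X_i`, `L̃_{2k}` and `M_{2j+1}`. -/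
def posAlg (q : ℂ) : Subalgebra ℂ (NA q) :=
  Algebra.adjoin ℂ (Set.range (xv q) ∪
    (Set.range (fun k => Ltilde q (2 * k)) ∪ Set.range (fun j => M q (2 * j + 1))))

theorem xv_mem_posAlg (i : ℕ) : xv q i ∈ posAlg q := Algebra.subset_adjoin (Or.inl ⟨i, rfl⟩)
theorem Ltilde_mem_posAlg (k : ℕ) : Ltilde q (2 * k) ∈ posAlg q :=
  Algebra.subset_adjoin (Or.inr (Or.inl ⟨k, rfl⟩))
theorem M_mem_posAlg (j : ℕ) : M q (2 * j + 1) ∈ posAlg q :=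
  Algebra.subset_adjoin (Or.inr (Or.inr ⟨j, rfl⟩))

theorem L_mem_posAlg (hq : Generic q) (j : ℕ) : L q j ∈ posAlg q ∧ L' q j ∈ posAlg q :=
  (mem_of_Ltilde_mem hq (posAlg q) M_mem_posAlg (n := j + 1) fun k _ => Ltilde_mem_posAlg k).1 j
    (by omega)

theorem zv_mem_posAlg (hq : Generic q) (i j : ℕ) : zv q i j ∈ posAlg q := by
  rcases Nat.even_or_odd' i with ⟨k, rfl | rfl⟩
  · rw [zv_even hq]; exact (L_mem_posAlg hq _).1
  · rw [zv_odd hq]; exact (L_mem_posAlg hq _).2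

/-- `∑ Y_k · posAlg + posAlg`. -/
def yvPos (q : ℂ) : Submodule ℂ (NA q) :=
  Submodule.span ℂ ({z | ∃ k, ∃ w ∈ posAlg q, z = yv q k * w} ∪ (posAlg q : Set (NA q)))

theorem yv_mul_mem_yvPos (k : ℕ) {w : NA q} (hw : w ∈ posAlg q) : yv q k * w ∈ yvPos q :=
  Submodule.subset_span (Or.inl ⟨k, w, hw, rfl⟩)

theorem mem_yvPos {w : NA q} (hw : w ∈ posAlg q) : w ∈ yvPos q :=
  Submodule.subset_span (Or.inr hw)

theorem yv_mem_yvPos (k : ℕ) : yv q k ∈ yvPos q := by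
  simpa using yv_mul_mem_yvPos k (one_mem (posAlg q))

theorem yvPos_mul_mem {z w : NA q} (hz : z ∈ yvPos q) (hw : w ∈ posAlg q) : z * w ∈ yvPos q := by
  induction hz using Submodule.span_induction with
  | mem z hz =>
    rcases hz with ⟨k, w', hw', rfl⟩ | hz
    · rw [mul_assoc]; exact yv_mul_mem_yvPos k (mul_mem hw' hw)
    · exact mem_yvPos (mul_mem hz hw)
  | zero => rw [zero_mul]; exact zero_mem _
  | add a b _ _ ha hb => rw [add_mul]; exact add_mem ha hb
  | smul r a _ ha => rw [smul_mul_assoc]; exact Submodule.smul_mem _ _ ha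

theorem mul_mem_yvPos_of {a : NA q} (ha : a ∈ posAlg q) (h : ∀ j, a * yv q j ∈ yvPos q) {z : NA q}
    (hz : z ∈ yvPos q) : a * z ∈ yvPos q := by
  induction hz using Submodule.span_induction with
  | mem z hz =>
    rcases hz with ⟨k, w', hw', rfl⟩ | hz
    · rw [← mul_assoc]; exact yvPos_mul_mem (h k) hw'
    · exact mem_yvPos (mul_mem ha hz)
  | zero => rw [mul_zero]; exact zero_mem _
  | add a b _ _ ha hb => rw [mul_add]; exact add_mem ha hb
  | smul r a _ ha => rw [mul_smul_comm]; exact Submodule.smul_mem _ _ ha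

/-- The elements that can be moved to the right past the `Y_j`. -/
def movable (q : ℂ) : Subalgebra ℂ (NA q) where
  carrier := {a | a ∈ posAlg q ∧ ∀ j, a * yv q j ∈ yvPos q}
  mul_mem' {a b} ha hb := ⟨mul_mem ha.1 hb.1, fun j => by
    rw [mul_assoc]; exact mul_mem_yvPos_of ha.1 ha.2 (hb.2 j)⟩
  add_mem' {a b} ha hb := ⟨add_mem ha.1 hb.1, fun j => by
    rw [add_mul]; exact add_mem (ha.2 j) (hb.2 j)⟩
  algebraMap_mem' r := ⟨algebraMap_mem _ r, fun j => by
    rw [← Algebra.smul_def]; exact Submodule.smul_mem _ _ (yv_mem_yvPos j)⟩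

theorem ev_mem_posAlg (hq : Generic q) : ev q ∈ posAlg q := by
  have := M_mem_posAlg (q := q) 0
  rwa [mul_zero, zero_add, M_zero hq.ne_zero] at this

theorem hv_mem_posAlg (hq : Generic q) : hv q ∈ posAlg q := by
  rw [hv_eq hq]; exact Ltilde_mem_posAlg 1

theorem ev_mem_movable (hq : Generic q) : ev q ∈ movable q :=
  ⟨ev_mem_posAlg hq, fun j => by
    have : ev q * yv q j = yv q (j + 1) - (-1 : ℂ) ^ j • (yv q j * ev q) := by rw [yv]; abel
    rw [this]
    exact sub_mem (yv_mem_yvPos _)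
      (Submodule.smul_mem _ _ (yv_mul_mem_yvPos _ (ev_mem_posAlg hq)))⟩

theorem hv_mem_movable (hq : Generic q) : hv q ∈ movable q :=
  ⟨hv_mem_posAlg hq, fun j => by
    rw [eq_add_of_sub_eq (hv_yv hq j)]
    exact add_mem (add_mem (Submodule.smul_mem _ _ (yv_mul_mem_yvPos _ (ev_mem_posAlg hq)))
      (Submodule.smul_mem _ _ (yv_mem_yvPos _))) (yv_mul_mem_yvPos _ (hv_mem_posAlg hq))⟩

theorem M_mem_movable (hq : Generic q) (j : ℕ) : M q (2 * j + 1) ∈ movable q := by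
  induction j with
  | zero => rw [mul_zero, zero_add, M_zero hq.ne_zero]; exact ev_mem_movable hq
  | succ j ih =>
    rw [← (M_succ_eq hq j).2]
    exact sub_mem (mul_mem (hv_mem_movable hq) ih) (mul_mem ih (hv_mem_movable hq))

/-- Strong induction: for one parity of the Y index L_{2n+2} satisfies an exchange relation, for the
other L'_{2n+2} does. Each differs from L̃_{2n+2} by a multiple of an element already movable. -/
theorem Ltilde_mem_movable (hq : Generic q) (n : ℕ) : Ltilde q (2 * n) ∈ movable q := by
  induction n using Nat.strong_induction_on with
  | _ n ih =>
    cases n with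
    | zero =>
      have : Ltilde q (2 * 0) = (q - q⁻¹)⁻¹ • 1 := by
        have h0 := (imaginaryRelations hq).zero
        rw [← h0, smul_smul, inv_mul_cancel₀ hq.theta_ne, one_smul]
      rw [this]
      exact Subalgebra.smul_mem _ (one_mem _) _
    | succ n =>
      obtain ⟨hL, hd⟩ := mem_of_Ltilde_mem hq (movable q) (M_mem_movable hq) ih
      have hl := hL (2 * n + 1) (by omega)
      refine ⟨Ltilde_mem_posAlg _, fun j => ?_⟩
      have hd' : ∀ z ∈ yvPos q, (L q (2 * (n + 1)) - L' q (2 * (n + 1))) * z ∈ yvPos q :=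
        fun z hz => mul_mem_yvPos_of hd.1 hd.2 hz
      have hl1 := L_mem_posAlg hq (2 * n + 1)
      have hl2 := L_mem_posAlg hq (2 * n + 2)
      rcases Nat.even_or_odd' j with ⟨k, rfl | rfl⟩
      · have e : Ltilde q (2 * (n + 1)) * yv q (2 * k) = L q (2 * n + 2) * yv q (2 * k) -
            (1 / 2 : ℂ) • ((L q (2 * (n + 1)) - L' q (2 * (n + 1))) * yv q (2 * k)) := by
          rw [show 2 * (n + 1) = 2 * n + 2 by ring]
          linear_combination (norm := skip) -(L_eq_Ltilde (q := q) (2 * n + 2)) * yv q (2 * k)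
          simp only [add_mul, mul_add, mul_sub, sub_mul, smul_mul_assoc, mul_smul_comm, neg_mul]
          module
        rw [e, eq_add_of_sub_eq (L_even_yv hq n k)]
        exact sub_mem (add_mem (sub_mem (Submodule.smul_mem _ _ (hl.1.2 _))
          (Submodule.smul_mem _ _ (yv_mul_mem_yvPos _ hl1.1))) (yv_mul_mem_yvPos _ hl2.1))
          (Submodule.smul_mem _ _ (hd' _ (yv_mem_yvPos _)))
      · have e : Ltilde q (2 * (n + 1)) * yv q (2 * k + 1) = L' q (2 * n + 2) * yv q (2 * k + 1) +
            (1 / 2 : ℂ) • ((L q (2 * (n + 1)) - L' q (2 * (n + 1))) * yv q (2 * k + 1)) := by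
          rw [show 2 * (n + 1) = 2 * n + 2 by ring]
          linear_combination (norm := skip) -(L'_eq_Ltilde (q := q) (2 * n + 2)) * yv q (2 * k + 1)
          simp only [add_mul, mul_add, mul_sub, sub_mul, smul_mul_assoc, mul_smul_comm, neg_mul]
          module
        rw [e, eq_add_of_sub_eq (L'_even_yv hq n k)]
        exact add_mem (add_mem (add_mem (Submodule.smul_mem _ _ (hl.2.2 _))
          (Submodule.smul_mem _ _ (yv_mul_mem_yvPos _ hl1.2))) (yv_mul_mem_yvPos _ hl2.2))
          (Submodule.smul_mem _ _ (hd' _ (yv_mem_yvPos _)))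

theorem posAlg_le_movable (hq : Generic q) : posAlg q ≤ movable q := by
  refine Algebra.adjoin_le ?_
  rintro _ (⟨i, rfl⟩ | ⟨k, rfl⟩ | ⟨j, rfl⟩)
  · refine ⟨xv_mem_posAlg i, fun j => ?_⟩
    have : xv q i * yv q j = zv q i j + ((-1 : ℂ) ^ (i * (j + 1)) * q⁻¹) • (yv q j * xv q i) := by
      rw [zv]; abel
    rw [this]
    exact add_mem (mem_yvPos (zv_mem_posAlg hq i j))
      (Submodule.smul_mem _ _ (yv_mul_mem_yvPos _ (xv_mem_posAlg i)))
  · exact Ltilde_mem_movable hq k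
  · exact M_mem_movable hq j

/-- The product of the `Y_j` for `j` in a list. -/
def yvProd (q : ℂ) (l : List ℕ) : NA q := (l.map (yv q)).prod

theorem yvProd_cons (j : ℕ) (l : List ℕ) : yvProd q (j :: l) = yv q j * yvProd q l := by
  simp [yvProd]

theorem yvProd_mem (hq0 : q ≠ 0) (l : List ℕ) :
    yvProd q l ∈ homComp q (l.sum, l.sum + l.length) := by
  induction l with
  | nil => exact one_mem_homComp q
  | cons j l ih =>
    have := mul_mem_homComp (yv_mem hq0 j) ih
    rw [yvProd_cons]
    convert this using 2
    simp only [List.sum_cons, List.length_cons, Prod.mk_add_mk, Prod.mk.injEq, true_and]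
    ring

theorem mul_yvProd_mem (hq : Generic q) (l : List ℕ) : ∀ a ∈ posAlg q, ∀ w ∈ posAlg q,
    a * (yvProd q l * w) ∈
      Submodule.span ℂ {z | ∃ l : List ℕ, ∃ w ∈ posAlg q, z = yvProd q l * w} := by
  induction l with
  | nil =>
    intro a ha w hw
    refine Submodule.subset_span ⟨[], a * w, mul_mem ha hw, ?_⟩
    simp [yvProd]
  | cons j l ih =>
    intro a ha w hw
    rw [yvProd_cons, mul_assoc, ← mul_assoc a]
    have := (posAlg_le_movable hq ha).2 j
    generalize a * yv q j = u at this ⊢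
    induction this using Submodule.span_induction with
    | mem z hz =>
      rcases hz with ⟨k, w', hw', rfl⟩ | hz
      · rw [mul_assoc]
        have h2 := ih w' hw' w hw
        generalize w' * (yvProd q l * w) = u at h2 ⊢
        induction h2 using Submodule.span_induction with
        | mem z hz =>
          obtain ⟨l', w'', hw'', rfl⟩ := hz
          refine Submodule.subset_span ⟨k :: l', w'', hw'', ?_⟩
          rw [yvProd_cons, mul_assoc]
        | zero => rw [mul_zero]; exact zero_mem _
        | add a b _ _ ha hb => rw [mul_add]; exact add_mem ha hb
        | smul r a _ ha => rw [mul_smul_comm]; exact Submodule.smul_mem _ _ ha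
      · exact ih z hz w hw
    | zero => rw [zero_mul]; exact zero_mem _
    | add a b _ _ ha hb => rw [add_mul]; exact add_mem ha hb
    | smul r a _ ha => rw [smul_mul_assoc]; exact Submodule.smul_mem _ _ ha

/-- The triangular decomposition: products of the `Y_j` times elements of `posAlg` span. -/
theorem mem_span_yvProd_mul (hq : Generic q) (z : NA q) :
    z ∈ Submodule.span ℂ {z | ∃ l : List ℕ, ∃ w ∈ posAlg q, z = yvProd q l * w} := by
  have hw : ∀ w : Word, (w.map (gen q)).prod ∈
      Submodule.span ℂ {z | ∃ l : List ℕ, ∃ w ∈ posAlg q, z = yvProd q l * w} := by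
    intro w
    induction w with
    | nil => exact Submodule.subset_span ⟨[], 1, one_mem _, by simp [yvProd]⟩
    | cons i w ih =>
      rw [List.map_cons, List.prod_cons]
      generalize (w.map (gen q)).prod = u at ih ⊢
      induction ih using Submodule.span_induction with
      | mem z hz =>
        obtain ⟨l, w', hw', rfl⟩ := hz
        fin_cases i
        · exact mul_yvProd_mem hq l _ (xv_mem_posAlg 0) _ hw'
        · refine Submodule.subset_span ⟨0 :: l, w', hw', ?_⟩
          rw [yvProd_cons, mul_assoc]; rfl
      | zero => rw [mul_zero]; exact zero_mem _
      | add a b _ _ ha hb => rw [mul_add]; exact add_mem ha hb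
      | smul r a _ ha => rw [mul_smul_comm]; exact Submodule.smul_mem _ _ ha
  refine Submodule.span_le.2 ?_ (mem_span_words q z)
  rintro _ ⟨w, rfl⟩
  exact hw w

theorem posAlg_le_Kge (hq : Generic q) : posAlg q ≤ Kge q := by
  have hzv : ∀ i j, zv q i j ∈ Kge q := fun i j => by
    rcases Nat.even_or_odd' i with ⟨k, rfl | rfl⟩
    · have := zv_add_even hq 0 j k
      rw [zero_add] at this
      rw [this]; exact zv_zero_mem_Kge hq.ne_zero _
    · have := zv_add_even hq 1 j k
      rw [add_comm] at this
      rw [this]; exact zv_one_mem_Kge hq.ne_zero _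
  have hL : ∀ n, L q n ∈ Kge q := fun n => by
    cases n with
    | zero => rw [L_zero]; exact Subalgebra.smul_mem _ (one_mem _) _
    | succ n => rw [L_succ hq.ne_zero]; exact hzv _ _
  have hL' : ∀ n, L' q n ∈ Kge q := fun n => by
    match n with
    | 0 => rw [L'_zero]; exact hL 0
    | 1 => rw [L'_one]; exact hL 1
    | n + 2 => rw [L'_succ hq.ne_zero]; exact hzv _ _
  have hx : ∀ n, Ltilde q n ∈ Kge q := fun n => Subalgebra.smul_mem _ (add_mem (hL n) (hL' n)) _
  refine Algebra.adjoin_le ?_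
  rintro _ (⟨i, rfl⟩ | ⟨k, rfl⟩ | ⟨j, rfl⟩)
  · exact xv_mem_Kge q i
  · exact hx _
  · induction j with
    | zero => simp only [mul_zero, zero_add, M_zero hq.ne_zero]; exact ev_mem_Kge q
    | succ j ih =>
      simp only at ih ⊢
      have hh : hv q ∈ Kge q := by rw [hv_eq hq]; exact hx _
      rw [← (M_succ_eq hq j).2]
      exact sub_mem (mul_mem hh ih) (mul_mem ih hh)

end

/-! ### K_{≥1} is the positive algebra, and centrality in the subquotient -/

section

variable {q : ℂ}

/-- The span of the `a ⊗ b` with `a` homogeneous of degree `α`, `α₂ < α₁ + r`. -/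
def excessLT (q : ℂ) (r : ℕ) : Submodule ℂ (NA q ⊗[ℂ] NA q) :=
  Submodule.span ℂ {z | ∃ α : Deg, α.2 < α.1 + r ∧ ∃ a ∈ homComp q α, ∃ b, z = a ⊗ₜ b}

theorem tmul_mem_excessLT {r : ℕ} {α : Deg} (hα : α.2 < α.1 + r) {a : NA q}
    (ha : a ∈ homComp q α) (b : NA q) : a ⊗ₜ[ℂ] b ∈ excessLT q r :=
  Submodule.subset_span ⟨α, hα, a, ha, b, rfl⟩

theorem BgeTensor_le_excessLT : BgeTensor q ≤ excessLT q 1 := by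
  refine BgeTensor_induction (P := fun z => z ∈ excessLT q 1) ?_ fun _ _ => add_mem
  intro a ha b
  refine Bge_induction (P := fun a => a ⊗ₜ[ℂ] b ∈ excessLT q 1) ?_ ?_ ?_ a ha
  · intro α hα a ha
    exact tmul_mem_excessLT (by omega) ha b
  · simp
  · intro x y hx hy
    rw [TensorProduct.add_tmul]; exact add_mem hx hy

theorem excessLT_mono {r s : ℕ} (h : r ≤ s) : excessLT q r ≤ excessLT q s := by
  refine Submodule.span_mono ?_
  rintro _ ⟨α, hα, a, ha, b, rfl⟩
  exact ⟨α, by omega, a, ha, b, rfl⟩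

theorem rightMul_mem_excessLT {r t : ℕ} {β : Deg} (hβ : β.2 + r ≤ β.1 + t) {a : NA q}
    (ha : a ∈ homComp q β) (b : NA q) {z : NA q ⊗[ℂ] NA q} (hz : z ∈ excessLT q r) :
    rightMul q β a b z ∈ excessLT q t := by
  induction hz using Submodule.span_induction with
  | mem z hz =>
    obtain ⟨α, hα, c, hc, d, rfl⟩ := hz
    rw [rightMul_tmul]
    refine tmul_mem_excessLT ?_ (mul_mem_homComp hc ha) _
    simp only [Prod.fst_add, Prod.snd_add]
    omega
  | zero => rw [map_zero]; exact zero_mem _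
  | add a b _ _ ha hb => rw [map_add]; exact add_mem ha hb
  | smul r a _ ha => rw [map_smul]; exact Submodule.smul_mem _ _ ha

theorem coprodOp_mem_excessLT {r s t : ℕ} (hrs : r + s ≤ t + 1) {x : NA q}
    (hx : coprod q x ∈ excessLT q r) {z : NA q ⊗[ℂ] NA q} (hz : z ∈ excessLT q s) :
    coprodOp q x z ∈ excessLT q t := by
  induction hz using Submodule.span_induction with
  | mem z hz =>
    obtain ⟨α, hα, c, hc, d, rfl⟩ := hz
    rw [coprodOp_tmul hc]
    exact rightMul_mem_excessLT (by omega) hc d hx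
  | zero => rw [map_zero]; exact zero_mem _
  | add a b _ _ ha hb => rw [map_add]; exact add_mem ha hb
  | smul r a _ ha => rw [map_smul]; exact Submodule.smul_mem _ _ ha

/-- Call α₂ - α₁ the excess of a degree. In Δ of a product of r Y's, the only term whose left factor
has excess r is the product tensored with 1. -/
theorem coprod_yvProd (hq0 : q ≠ 0) (l : List ℕ) :
    coprod q (yvProd q l) - yvProd q l ⊗ₜ 1 ∈ excessLT q l.length := by
  induction l with
  | nil => simp [yvProd, coprod]
  | cons j l ih =>
    have h1 := BgeTensor_le_excessLT (coprod_yv hq0 j)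
    have h2 : coprod q (yv q j) ∈ excessLT q 2 := by
      rw [← sub_add_cancel (coprod q (yv q j)) (yv q j ⊗ₜ 1)]
      exact add_mem (excessLT_mono (by omega) h1) (tmul_mem_excessLT (by simp) (yv_mem hq0 j) 1)
    have hy := yvProd_mem hq0 l
    rw [yvProd_cons, coprod_mul]
    have e : coprodOp q (yv q j) (coprod q (yvProd q l)) - (yv q j * yvProd q l) ⊗ₜ 1 =
        rightMul q (l.sum, l.sum + l.length) (yvProd q l) 1 (coprod q (yv q j) - yv q j ⊗ₜ 1) +
        coprodOp q (yv q j) (coprod q (yvProd q l) - yvProd q l ⊗ₜ 1) := by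
      rw [map_sub, map_sub, coprodOp_tmul hy, rightMul_tmul, map_one, mul_one]
      abel
    rw [e]
    refine add_mem (rightMul_mem_excessLT ?_ hy 1 h1) (coprodOp_mem_excessLT ?_ h2 ih)
    · simp
    · simp; omega

/-- The component of the left tensor factor in degree `D`. -/
def compL (q : ℂ) (D : Deg) : NA q ⊗[ℂ] NA q →ₗ[ℂ] NA q ⊗[ℂ] NA q :=
  TensorProduct.map (comp q D) LinearMap.id

theorem compL_tmul_self {D : Deg} {a : NA q} (ha : a ∈ homComp q D) (b : NA q) :
    compL q D (a ⊗ₜ b) = a ⊗ₜ b := by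
  rw [compL, TensorProduct.map_tmul, comp_of_mem ha]; rfl

theorem compL_tmul_ne {D α : Deg} (h : α ≠ D) {a : NA q} (ha : a ∈ homComp q α) (b : NA q) :
    compL q D (a ⊗ₜ b) = 0 := by
  rw [compL, TensorProduct.map_tmul, comp_of_mem_ne h ha, TensorProduct.zero_tmul]

theorem compL_excessLT {r : ℕ} {D : Deg} (hD : D.1 + r ≤ D.2) {z : NA q ⊗[ℂ] NA q}
    (hz : z ∈ excessLT q r) : compL q D z = 0 := by
  induction hz using Submodule.span_induction with
  | mem z hz =>
    obtain ⟨α, hα, c, hc, d, rfl⟩ := hz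
    exact compL_tmul_ne (by rintro rfl; omega) hc d
  | zero => rw [map_zero]
  | add a b _ _ ha hb => rw [map_add, ha, hb, add_zero]
  | smul r a _ ha => rw [map_smul, ha, smul_zero]

theorem tensor_induction {P : NA q ⊗[ℂ] NA q → Prop}
    (tmul : ∀ β, ∀ a ∈ homComp q β, ∀ b, P (a ⊗ₜ b)) (add : ∀ x y, P x → P y → P (x + y))
    (z : NA q ⊗[ℂ] NA q) : P z := by
  have h0 : P 0 := by simpa using tmul 0 0 (zero_mem _) 0
  induction z using TensorProduct.induction_on with
  | zero => exact h0
  | tmul a b =>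
    refine Submodule.iSup_induction _ (motive := fun a => P (a ⊗ₜ b)) (mem_iSup_homComp q a)
      (fun β a ha => tmul β a ha b) (by simpa using h0) ?_
    intro c d hc hd
    rw [TensorProduct.add_tmul]; exact add _ _ hc hd
  | add a b ha hb => exact add _ _ ha hb

theorem compL_zero_coprodOp_gen (i : Fin 2) (z : NA q ⊗[ℂ] NA q) :
    compL q 0 (coprodOp q (gen q i) z) =
      TensorProduct.map LinearMap.id (LinearMap.mulLeft ℂ (gen q i)) (compL q 0 z) := by
  induction z using tensor_induction with
  | tmul β a ha b =>
    have hne : letterDeg i + β ≠ 0 := by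
      fin_cases i <;> simp [letterDeg, Prod.ext_iff]
    rw [coprodOp_gen, map_add, compL_tmul_ne hne (mul_mem_homComp (gen_mem q i) ha), zero_add,
      twist_of_mem _ ha, ← TensorProduct.smul_tmul', map_smul]
    by_cases hβ : β = 0
    · subst hβ
      rw [compL_tmul_self ha, compL_tmul_self ha, chi_zero_right, one_smul,
        TensorProduct.map_tmul]
      rfl
    · rw [compL_tmul_ne hβ ha, compL_tmul_ne hβ ha, smul_zero, map_zero]
  | add x y hx hy => rw [map_add, map_add, hx, hy, map_add, map_add]

/-- The left counit axiom, with the counit replaced by the projection to degree zero. -/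
theorem compL_zero_coprod (x : NA q) : compL q 0 (coprod q x) = 1 ⊗ₜ x := by
  induction mem_span_words q x using Submodule.span_induction with
  | mem z hz =>
    obtain ⟨w, rfl⟩ := hz
    dsimp only
    induction w with
    | nil => simpa [coprod] using compL_tmul_self (one_mem_homComp q) 1
    | cons i w ih =>
      rw [List.map_cons, List.prod_cons, coprod_mul, compL_zero_coprodOp_gen, ih,
        TensorProduct.map_tmul]
      rfl
  | zero => simp [coprod]
  | add a b _ _ ha hb => rw [coprod_add, map_add, ha, hb, TensorProduct.tmul_add]
  | smul r a _ ha => rw [coprod_smul, map_smul, ha, TensorProduct.tmul_smul]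

theorem coprodOp_yvProd (hq0 : q ≠ 0) (l : List ℕ) {z : NA q ⊗[ℂ] NA q}
    (hz : z ∈ excessLT q 1) : coprodOp q (yvProd q l) z -
      TensorProduct.map (LinearMap.mulLeft ℂ (yvProd q l)) LinearMap.id z ∈
        excessLT q l.length := by
  induction hz using Submodule.span_induction with
  | mem z hz =>
    obtain ⟨α, hα, c, hc, d, rfl⟩ := hz
    have := rightMul_mem_excessLT (t := l.length) (by omega) hc d (coprod_yvProd hq0 l)
    rw [map_sub, rightMul_tmul, map_one, one_mul, ← coprodOp_tmul hc] at this
    exact this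
  | zero => simp
  | add a b _ _ ha hb => rw [map_add, map_add, add_sub_add_comm]; exact add_mem ha hb
  | smul r a _ ha =>
    rw [map_smul, map_smul]
    have hs : ∀ u v : NA q ⊗[ℂ] NA q, r • u - r • v = r • (u - v) :=
      fun u v => (smul_sub r u v).symm
    convert Submodule.smul_mem _ r ha using 1
    exact hs _ _

theorem compL_coprod_yvProd_mul (hq : Generic q) {l : List ℕ} {w : NA q} (hw : w ∈ posAlg q)
    {D : Deg} (hD : D.1 + l.length ≤ D.2) :
    compL q D (coprod q (yvProd q l * w)) =
      compL q D (TensorProduct.map (LinearMap.mulLeft ℂ (yvProd q l)) LinearMap.id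
        (coprod q w)) := by
  have h := coprodOp_yvProd hq.ne_zero l (BgeTensor_le_excessLT (posAlg_le_Kge hq hw))
  rw [← coprod_mul] at h
  exact sub_eq_zero.1 ((map_sub _ _ _).symm.trans (compL_excessLT hD h))

/-- The left factors in `z` have excess at most 0. Multiplying by y therefore cannot raise the
excess, and it keeps the excess without changing the degree only if the first coordinate also stays
fixed; the hypothesis on D and D' excludes reaching D otherwise. -/
theorem compL_mulLeft_eq_zero {D D' : Deg} {y : NA q} (hy : y ∈ homComp q D') (hne : D ≠ D')
    (h : D.1 + D'.2 < D.2 + D'.1 ∨ D.1 ≤ D'.1 ∧ D.1 + D'.2 = D.2 + D'.1)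
    {z : NA q ⊗[ℂ] NA q} (hz : z ∈ excessLT q 1) :
    compL q D (TensorProduct.map (LinearMap.mulLeft ℂ y) LinearMap.id z) = 0 := by
  induction hz using Submodule.span_induction with
  | mem z hz =>
    obtain ⟨α, hα, c, hc, d, rfl⟩ := hz
    refine compL_tmul_ne (α := D' + α) ?_ (mul_mem_homComp hy hc) d
    rintro rfl
    simp only [Prod.fst_add, Prod.snd_add, ne_eq, Prod.ext_iff] at *
    omega
  | zero => simp
  | add a b _ _ ha hb => rw [map_add, map_add, ha, hb, add_zero]
  | smul r a _ ha => rw [map_smul, map_smul, ha, smul_zero]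

theorem compL_mulLeft_self {D : Deg} {y : NA q} (hy : y ∈ homComp q D) (z : NA q ⊗[ℂ] NA q) :
    compL q D (TensorProduct.map (LinearMap.mulLeft ℂ y) LinearMap.id z) =
      TensorProduct.map (LinearMap.mulLeft ℂ y) LinearMap.id (compL q 0 z) := by
  induction z using tensor_induction with
  | tmul β a ha b =>
    by_cases hβ : β = 0
    · subst hβ
      rw [compL_tmul_self ha]
      have := mul_mem_homComp hy ha
      rw [add_zero] at this
      exact compL_tmul_self this b
    · rw [compL_tmul_ne hβ ha, map_zero]
      exact compL_tmul_ne (α := D + β) (by simpa using hβ) (mul_mem_homComp hy ha) b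
  | add x y hx hy => rw [map_add, map_add, hx, hy, map_add, map_add]

/-- The span of the `y ⊗ w` with `y` a product of the `Y_j`, of degree `D`, and `w ∈ posAlg`. -/
def yvTensor (q : ℂ) (D : Deg) : Submodule ℂ (NA q ⊗[ℂ] NA q) :=
  Submodule.span ℂ {z | ∃ l : List ℕ, (l.sum, l.sum + l.length) = D ∧
    ∃ w ∈ posAlg q, z = yvProd q l ⊗ₜ w}

/-- `t ↦ Δ(mul t)`, projected to degree `D` on the left. -/
def compLMul (q : ℂ) (D : Deg) : NA q ⊗[ℂ] NA q →ₗ[ℂ] NA q ⊗[ℂ] NA q :=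
  (compL q D).comp (((LinearMap.applyₗ (1 ⊗ₜ 1)).comp (coprodOp q).toLinearMap).comp
    (LinearMap.mul' ℂ (NA q)))

theorem compLMul_apply (D : Deg) (t : NA q ⊗[ℂ] NA q) :
    compLMul q D t = compL q D (coprod q (LinearMap.mul' ℂ _ t)) := rfl

/-- For w in K_{≥1} the part of Δ(yw) with left degree equal to that of y is y ⊗ w, coming from the
term 1 ⊗ w of Δ(w). So the tensor can be read off from the product. -/
theorem compLMul_self (hq : Generic q) {D : Deg} {t : NA q ⊗[ℂ] NA q} (ht : t ∈ yvTensor q D) :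
    compLMul q D t = t := by
  induction ht using Submodule.span_induction with
  | mem z hz =>
    obtain ⟨l, rfl, w, hw, rfl⟩ := hz
    rw [compLMul_apply, LinearMap.mul'_apply, compL_coprod_yvProd_mul hq hw (by simp),
      compL_mulLeft_self (yvProd_mem hq.ne_zero l), compL_zero_coprod, TensorProduct.map_tmul,
      LinearMap.mulLeft_apply, mul_one]
    rfl
  | zero => simp
  | add a b _ _ ha hb => rw [map_add, ha, hb]
  | smul r a _ ha => rw [map_smul, ha]

theorem compLMul_eq_zero (hq : Generic q) {D D' : Deg} (hne : D ≠ D')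
    (h : D.1 + D'.2 < D.2 + D'.1 ∨ D.1 ≤ D'.1 ∧ D.1 + D'.2 = D.2 + D'.1)
    {t : NA q ⊗[ℂ] NA q} (ht : t ∈ yvTensor q D') : compLMul q D t = 0 := by
  induction ht using Submodule.span_induction with
  | mem z hz =>
    obtain ⟨l, rfl, w, hw, rfl⟩ := hz
    rw [compLMul_apply, LinearMap.mul'_apply, compL_coprod_yvProd_mul hq hw (by simp at h; omega),
      compL_mulLeft_eq_zero (yvProd_mem hq.ne_zero l) hne h
        (BgeTensor_le_excessLT (posAlg_le_Kge hq hw))]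
  | zero => simp
  | add a b _ _ ha hb => rw [map_add, ha, hb, add_zero]
  | smul r a _ ha => rw [map_smul, ha, smul_zero]

theorem mul_mem_posAlg {D : Deg} (hD : D.2 ≤ D.1) {t : NA q ⊗[ℂ] NA q} (ht : t ∈ yvTensor q D) :
    LinearMap.mul' ℂ _ t ∈ posAlg q := by
  induction ht using Submodule.span_induction with
  | mem z hz =>
    obtain ⟨l, rfl, w, hw, rfl⟩ := hz
    have : l = [] := List.length_eq_zero_iff.1 (by simp at hD; simpa using hD)
    subst this
    simpa [yvProd] using hw
  | zero => rw [map_zero]; exact zero_mem _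
  | add a b _ _ ha hb => rw [map_add]; exact add_mem ha hb
  | smul r a _ ha => rw [map_smul]; exact Subalgebra.smul_mem _ ha _

theorem exists_yvTensor (hq : Generic q) (z : NA q) :
    ∃ t ∈ ⨆ D, yvTensor q D, LinearMap.mul' ℂ _ t = z := by
  change z ∈ (⨆ D, yvTensor q D).map (LinearMap.mul' ℂ (NA q))
  refine Submodule.span_le.2 ?_ (mem_span_yvProd_mul hq z)
  rintro _ ⟨l, w, hw, rfl⟩
  exact ⟨_, Submodule.mem_iSup_of_mem _ (Submodule.subset_span ⟨l, rfl, w, hw, rfl⟩), rfl⟩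

/-- The triangular decomposition is separated by the left degrees in Δ. For an element of K_{≥1} no
component can contain a Y, since the extreme one would be visible in a left degree with a₁ < a₂. -/
theorem Kge_le_posAlg (hq : Generic q) : Kge q ≤ posAlg q := by
  intro z hz
  obtain ⟨t, ht, htz⟩ := exists_yvTensor hq z
  obtain ⟨f, hf, hft⟩ := (Submodule.mem_iSup_iff_exists_finsupp _ _).1 ht
  have hsum : ∑ D ∈ f.support, f D = t := hft
  by_cases hbad : ∃ D ∈ f.support, D.1 < D.2
  · exfalso
    obtain ⟨D₀, hD₀, hlt₀⟩ := hbad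
    -- Among the degrees that occur, take one of maximal excess and then of least first coordinate;
    -- no other component contributes to the left degree D.
    obtain ⟨D₁, hD₁, hmax⟩ := Finset.exists_max_image f.support
      (fun D => (D.2 : ℤ) - D.1) ⟨D₀, hD₀⟩
    obtain ⟨D, hD, hmin⟩ := Finset.exists_min_image
      (f.support.filter fun D => (D.2 : ℤ) - D.1 = D₁.2 - D₁.1) (fun D => D.1)
      ⟨D₁, by simpa using hD₁⟩
    rw [Finset.mem_filter] at hD
    have hlt : D.1 < D.2 := by have := hmax _ hD₀; omega
    have h0 : compLMul q D t = 0 := by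
      rw [compLMul_apply, htz]
      exact compL_excessLT (by omega) (BgeTensor_le_excessLT hz)
    rw [← hsum, map_sum, Finset.sum_eq_single D, compLMul_self hq (hf D)] at h0
    · exact Finsupp.mem_support_iff.1 hD.1 h0
    · intro D' hD' hne
      refine compLMul_eq_zero hq hne.symm ?_ (hf D')
      have h1 := hmax _ hD'
      by_cases h2 : (D'.2 : ℤ) - D'.1 = D₁.2 - D₁.1
      · have := hmin D' (Finset.mem_filter.2 ⟨hD', h2⟩)
        omega
      · omega
    · exact fun h => absurd hD.1 h
  · push Not at hbad
    rw [← htz, ← hsum, map_sum]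
    exact sum_mem fun D hD => mul_mem_posAlg (hbad D hD) (hf D)

theorem M_sq_mem_Kge (hq : Generic q) (m : ℕ) : M q (2 * m + 1) ^ 2 ∈ Kge q :=
  pow_mem (posAlg_le_Kge hq (M_mem_posAlg m)) 2

/-- By the Leibniz rule only generators matter: the X's lie in B_{>1}, and the square commutes
exactly with the L̃_{2k} and the M's. -/
theorem commutator_M_sq_mem_Bgt (hq : Generic q) (m : ℕ) {z : NA q} (hz : z ∈ posAlg q) :
    M q (2 * m + 1) ^ 2 * z - z * M q (2 * m + 1) ^ 2 ∈ Bgt q := by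
  have hc := Kge_le_Bge (M_sq_mem_Kge hq m)
  induction hz using Algebra.adjoin_induction with
  | mem z hz =>
    rcases hz with ⟨i, rfl⟩ | ⟨k, rfl⟩ | ⟨j, rfl⟩
    · have hx : xv q i ∈ Bgt q := mem_Bgt (by simp) (xv_mem hq.ne_zero i)
      exact sub_mem (mul_mem_Bgt hc hx) (Bgt_mul_mem hx hc)
    · dsimp only
      rw [(commute_M_sq_Ltilde hq m (2 * k)).eq, sub_self]; exact zero_mem _
    · dsimp only
      rw [((imaginaryRelations hq).commute_sq hq m j).eq, sub_self]; exact zero_mem _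
  | algebraMap r => rw [Algebra.commutes, sub_self]; exact zero_mem _
  | add a b _ _ iha ihb =>
    rw [mul_add, add_mul, add_sub_add_comm]; exact add_mem iha ihb
  | mul a b ha hb iha ihb =>
    have : ∀ c : NA q, c * (a * b) - (a * b) * c = (c * a - a * c) * b + a * (c * b - b * c) :=
      fun c => by noncomm_ring
    rw [this]
    exact add_mem (Bgt_mul_mem iha (Kge_le_Bge (posAlg_le_Kge hq hb)))
      (mul_mem_Bgt (Kge_le_Bge (posAlg_le_Kge hq ha)) ihb)

/-- The class of `M_{2m+1}²` in the subquotient is central. -/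
theorem M_sq_mem_center (hq : Generic q) (m : ℕ) :
    Ideal.Quotient.mk (Kgt q) ⟨M q (2 * m + 1) ^ 2, M_sq_mem_Kge hq m⟩ ∈
      Subalgebra.center ℂ (Subquotient q) := by
  rw [Subalgebra.mem_center_iff]
  intro b
  obtain ⟨z, rfl⟩ := Ideal.Quotient.mk_surjective b
  rw [← map_mul, ← map_mul, eq_comm, Ideal.Quotient.eq]
  exact commutator_M_sq_mem_Bgt hq m (Kge_le_posAlg hq z.2)

end

/-! ### Bracketing as a skew derivation, and the X's against the imaginary elements -/

section

variable {q : ℂ}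

/-- The skew derivation `[x, ·]` for `x` of degree `α`. -/
def sk (q : ℂ) (α : Deg) (x y : NA q) : NA q := x * y - twist q α y * x

theorem sk_mul (α : Deg) (x y z : NA q) :
    sk q α x (y * z) = sk q α x y * z + twist q α y * sk q α x z := by
  simp only [sk, map_mul]; noncomm_ring

theorem sk_of_mem {α β : Deg} (x : NA q) {y : NA q} (hy : y ∈ homComp q β) :
    sk q α x y = x * y - chi q α β • (y * x) := by
  rw [sk, twist_of_mem _ hy, smul_mul_assoc]

theorem bracket_eq_sk {α β : Deg} {x y : NA q} (hx : x ∈ homComp q α) (hy : y ∈ homComp q β) :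
    bracket q x y = sk q α x y := by
  rw [bracket_of_mem hx hy, sk_of_mem x hy]

theorem twist_mem_adjoin {s : Set (NA q)} (hs : ∀ x ∈ s, ∃ β, x ∈ homComp q β) (α : Deg)
    {z : NA q} (hz : z ∈ Algebra.adjoin ℂ s) : twist q α z ∈ Algebra.adjoin ℂ s := by
  refine (Algebra.adjoin_le (S := (Algebra.adjoin ℂ s).comap (twist q α)) ?_) hz
  intro x hx
  obtain ⟨β, hβ⟩ := hs x hx
  change twist q α x ∈ Algebra.adjoin ℂ s
  rw [twist_of_mem _ hβ]
  exact Subalgebra.smul_mem _ (Algebra.subset_adjoin hx) _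

/-- The elements of `I` that `[x, ·]` maps to the `I`-bimodule `T`. -/
def skStab (α : Deg) (x : NA q) (I : Subalgebra ℂ (NA q)) (T : Submodule ℂ (NA q))
    (hI : ∀ z ∈ I, twist q α z ∈ I) (hl : ∀ a ∈ I, ∀ t ∈ T, a * t ∈ T)
    (hr : ∀ a ∈ I, ∀ t ∈ T, t * a ∈ T) : Subalgebra ℂ (NA q) where
  carrier := {z | z ∈ I ∧ sk q α x z ∈ T}
  mul_mem' {a b} ha hb := ⟨mul_mem ha.1 hb.1, by
    rw [sk_mul]
    exact add_mem (hr _ hb.1 _ ha.2) (hl _ (hI _ ha.1) _ hb.2)⟩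
  add_mem' {a b} ha hb := ⟨add_mem ha.1 hb.1, by
    have : sk q α x (a + b) = sk q α x a + sk q α x b := by
      simp only [sk, map_add]; noncomm_ring
    rw [this]; exact add_mem ha.2 hb.2⟩
  algebraMap_mem' r := ⟨algebraMap_mem _ r, by
    have : sk q α x (algebraMap ℂ (NA q) r) = 0 := by
      rw [sk, AlgHom.commutes, Algebra.commutes, sub_self]
    rw [this]; exact zero_mem _⟩

/-- `[x, ·]` maps `adjoin s` to `S ⊇ s` if it does so on `s`. -/
theorem sk_mem_of_adjoin {α : Deg} {x : NA q} {s t : Set (NA q)}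
    (ht : ∀ x ∈ t, ∃ β, x ∈ homComp q β) (hst : s ⊆ Algebra.adjoin ℂ t)
    (h : ∀ y ∈ s, sk q α x y ∈ Algebra.adjoin ℂ t) {z : NA q}
    (hz : z ∈ Algebra.adjoin ℂ s) : sk q α x z ∈ Algebra.adjoin ℂ t := by
  have := Algebra.adjoin_le (S := skStab α x (Algebra.adjoin ℂ t)
    (Subalgebra.toSubmodule (Algebra.adjoin ℂ t)) (fun z hz => twist_mem_adjoin ht α hz)
    (fun a ha t ht => mul_mem (s := Algebra.adjoin ℂ _) ha ht)
    (fun a ha t ht => mul_mem (s := Algebra.adjoin ℂ _) ht ha))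
    (s := s) (fun y hy => ⟨hst hy, h y hy⟩)
  exact (this hz).2

theorem Ltilde_mem (hq0 : q ≠ 0) (n : ℕ) : Ltilde q n ∈ homComp q (n, n) :=
  Submodule.smul_mem _ _ (add_mem (L_mem hq0 n) (L'_mem hq0 n))

/-- The subalgebra generated by the `L̃_{2k}` and the `M_{2j+1}`. -/
def imagTop (q : ℂ) : Subalgebra ℂ (NA q) :=
  Algebra.adjoin ℂ (Set.range (fun k => Ltilde q (2 * k)) ∪ Set.range (fun j => M q (2 * j + 1)))

theorem Ltilde_mem_imagTop (k : ℕ) : Ltilde q (2 * k) ∈ imagTop q :=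
  Algebra.subset_adjoin (Or.inl ⟨k, rfl⟩)

theorem M_mem_imagTop (j : ℕ) : M q (2 * j + 1) ∈ imagTop q :=
  Algebra.subset_adjoin (Or.inr ⟨j, rfl⟩)

theorem L_mem_imagTop (hq : Generic q) (j : ℕ) : L q j ∈ imagTop q ∧ L' q j ∈ imagTop q :=
  (mem_of_Ltilde_mem hq (imagTop q) M_mem_imagTop (n := j + 1) fun _ _ => Ltilde_mem_imagTop _).1 j
    (by omega)

theorem imagTop_le (hq : Generic q) {S : Subalgebra ℂ (NA q)} (hM : ∀ j, M q (2 * j + 1) ∈ S)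
    (hL : ∀ k, L q (2 * k) ∈ S) : imagTop q ≤ S := by
  refine Algebra.adjoin_le ?_
  rintro _ (⟨k, rfl⟩ | ⟨j, rfl⟩)
  · exact Ltilde_mem_of_L_mem hq S hM (n := k + 1) (fun k _ => hL k) k (by omega)
  · exact hM j

theorem imagTop_generator_mem (hq0 : q ≠ 0) {z : NA q}
    (hz : z ∈ Set.range (fun k => Ltilde q (2 * k)) ∪ Set.range (fun j => M q (2 * j + 1))) :
    ∃ k, z ∈ homComp q (k, k) := by
  rcases hz with ⟨k, rfl⟩ | ⟨j, rfl⟩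
  · exact ⟨_, Ltilde_mem hq0 _⟩
  · exact ⟨_, M_mem hq0 _⟩

theorem twist_mem_imagTop (hq0 : q ≠ 0) (α : Deg) {z : NA q} (hz : z ∈ imagTop q) :
    twist q α z ∈ imagTop q :=
  twist_mem_adjoin (fun _ hx =>
    (imagTop_generator_mem hq0 hx).elim fun _ hk => ⟨_, hk⟩) α hz

theorem commute_ev_sq_imagTop (hq : Generic q) {z : NA q} (hz : z ∈ imagTop q) :
    Commute (ev q * ev q) z := by
  have : imagTop q ≤ Subalgebra.centralizer ℂ {ev q * ev q} := by
    refine Algebra.adjoin_le ?_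
    rintro _ (⟨k, rfl⟩ | ⟨j, rfl⟩) <;> intro g hg <;> rw [Set.mem_singleton_iff] at hg <;> subst hg
    · exact (commute_ev_sq_Ltilde hq _).eq
    · exact (M_succ_eq hq j).1.eq
  exact this hz _ rfl

/-- `∑_{k > m} I X_k I`, with `I` the algebra `imagTop`. -/
def xvMod (q : ℂ) (m : ℕ) : Submodule ℂ (NA q) :=
  Submodule.span ℂ {z | ∃ k, m < k ∧ ∃ a ∈ imagTop q, ∃ b ∈ imagTop q, z = a * xv q k * b}

theorem mul_xv_mul_mem {m k : ℕ} (hk : m < k) {a b : NA q} (ha : a ∈ imagTop q)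
    (hb : b ∈ imagTop q) : a * xv q k * b ∈ xvMod q m :=
  Submodule.subset_span ⟨k, hk, a, ha, b, hb, rfl⟩

theorem mul_xv_mem {m k : ℕ} (hk : m < k) {a : NA q} (ha : a ∈ imagTop q) :
    a * xv q k ∈ xvMod q m := by simpa using mul_xv_mul_mem hk ha (one_mem _)

theorem xv_mul_mem {m k : ℕ} (hk : m < k) {a : NA q} (ha : a ∈ imagTop q) :
    xv q k * a ∈ xvMod q m := by simpa using mul_xv_mul_mem hk (one_mem _) ha

theorem xv_mem_xvMod {m k : ℕ} (hk : m < k) : xv q k ∈ xvMod q m := by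
  simpa using mul_xv_mem hk (one_mem (imagTop q))

theorem mul_mem_xvMod {m : ℕ} (a : NA q) (ha : a ∈ imagTop q) (t : NA q) (ht : t ∈ xvMod q m) :
    a * t ∈ xvMod q m := by
  induction ht using Submodule.span_induction with
  | mem z hz =>
    obtain ⟨k, hk, c, hc, d, hd, rfl⟩ := hz
    rw [← mul_assoc, ← mul_assoc]
    exact mul_xv_mul_mem hk (mul_mem ha hc) hd
  | zero => rw [mul_zero]; exact zero_mem _
  | add a b _ _ ha hb => rw [mul_add]; exact add_mem ha hb
  | smul r a _ ha => rw [mul_smul_comm]; exact Submodule.smul_mem _ _ ha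

theorem xvMod_mul_mem {m : ℕ} (a : NA q) (ha : a ∈ imagTop q) (t : NA q) (ht : t ∈ xvMod q m) :
    t * a ∈ xvMod q m := by
  induction ht using Submodule.span_induction with
  | mem z hz =>
    obtain ⟨k, hk, c, hc, d, hd, rfl⟩ := hz
    rw [mul_assoc]
    exact mul_xv_mul_mem hk hc (mul_mem hd ha)
  | zero => rw [zero_mul]; exact zero_mem _
  | add a b _ _ ha hb => rw [add_mul]; exact add_mem ha hb
  | smul r a _ ha => rw [smul_mul_assoc]; exact Submodule.smul_mem _ _ ha

/-- L₁² commutes with the imaginary algebra and raises the index of an X by two; this carries the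
induction on m in steps of two. -/
theorem xvMod_shift (hq : Generic q) {m : ℕ} {t : NA q} (ht : t ∈ xvMod q m) :
    t * (ev q * ev q) - ev q * ev q * t ∈ xvMod q (m + 2) := by
  induction ht using Submodule.span_induction with
  | mem z hz =>
    obtain ⟨k, hk, c, hc, d, hd, rfl⟩ := hz
    have h1 := (commute_ev_sq_imagTop hq hc).eq
    have h2 := (commute_ev_sq_imagTop hq hd).eq
    have h3 := ev_sq_xv q k
    have : c * xv q k * d * (ev q * ev q) - ev q * ev q * (c * xv q k * d) =
        c * xv q (k + 2) * d := by
      generalize ev q * ev q = f at h1 h2 h3 ⊢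
      rw [mul_assoc (c * xv q k), ← h2, ← mul_assoc f, ← mul_assoc f, h1,
        ← neg_neg (xv q (k + 2)), ← h3]
      noncomm_ring
    rw [this]
    exact mul_xv_mul_mem (by omega) hc hd
  | zero => rw [zero_mul, mul_zero, sub_zero]; exact zero_mem _
  | add a b _ _ ha hb => rw [mul_add, add_mul, add_sub_add_comm]; exact add_mem ha hb
  | smul r a _ ha =>
    rw [mul_smul_comm, smul_mul_assoc, ← smul_sub]; exact Submodule.smul_mem _ _ ha

/-- The elements of `imagTop` that `[X_m, ·]` maps to `xvMod q m`. -/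
def xvStab (hq0 : q ≠ 0) (m : ℕ) : Subalgebra ℂ (NA q) :=
  skStab (m + 1, m) (xv q m) (imagTop q) (xvMod q m) (fun _ hz => twist_mem_imagTop hq0 _ hz)
    mul_mem_xvMod xvMod_mul_mem

theorem sk_xv_of_mem (hq0 : q ≠ 0) (m : ℕ) {k : ℕ} {z : NA q} (hz : z ∈ homComp q (k, k)) :
    sk q (m + 1, m) (xv q m) z = xv q m * z - (-1 : ℂ) ^ (m * k) • (z * xv q m) := by
  rw [sk_of_mem _ hz, chi_eq hq0]; simp

theorem mem_xvStab (hq0 : q ≠ 0) {m k : ℕ} {z : NA q} (hz : z ∈ homComp q (k, k))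
    (hI : z ∈ imagTop q) (h : xv q m * z - (-1 : ℂ) ^ (m * k) • (z * xv q m) ∈ xvMod q m) :
    z ∈ xvStab hq0 m := ⟨hI, by rwa [sk_xv_of_mem hq0 m hz]⟩

theorem ev_mem_imagTop (hq : Generic q) : ev q ∈ imagTop q := by
  have := M_mem_imagTop (q := q) 0
  rwa [mul_zero, zero_add, M_zero hq.ne_zero] at this

theorem ev_mem_xvStab (hq : Generic q) (m : ℕ) : ev q ∈ xvStab hq.ne_zero m := by
  refine mem_xvStab hq.ne_zero (ev_mem q) (ev_mem_imagTop hq) ?_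
  rw [mul_one]
  exact xv_mem_xvMod (k := m + 1) (by omega)

theorem hv_mem_xvStab (hq : Generic q) (m : ℕ) : hv q ∈ xvStab hq.ne_zero m := by
  have h2 : hv q ∈ homComp q (2, 2) := by rw [hv_eq hq]; exact Ltilde_mem hq.ne_zero 2
  refine mem_xvStab hq.ne_zero h2 (by rw [hv_eq hq]; exact Ltilde_mem_imagTop 1) ?_
  rw [pow_mul', neg_one_sq, one_pow, one_smul, ← neg_sub, hv_xv hq]
  exact neg_mem (sub_mem (Submodule.smul_mem _ _ (mul_xv_mem (by omega) (ev_mem_imagTop hq)))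
    (Submodule.smul_mem _ _ (xv_mem_xvMod (by omega))))

theorem M_mem_xvStab (hq : Generic q) (m j : ℕ) : M q (2 * j + 1) ∈ xvStab hq.ne_zero m := by
  induction j with
  | zero => rw [mul_zero, zero_add, M_zero hq.ne_zero]; exact ev_mem_xvStab hq m
  | succ j ih =>
    rw [← (M_succ_eq hq j).2]
    have := hv_mem_xvStab hq m
    exact sub_mem (mul_mem this ih) (mul_mem ih this)

/-- X₁ has a direct exchange relation with L'_{2n+2}, producing X₂. The passage from L' to L̃ costs
only elements already covered. -/
theorem imagTop_le_xvStab_zero (hq : Generic q) : imagTop q ≤ xvStab hq.ne_zero 0 := by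
  have key : ∀ n, Ltilde q (2 * n) ∈ xvStab hq.ne_zero 0 := by
    intro n
    induction n using Nat.strong_induction_on with
    | _ n ih =>
      cases n with
      | zero =>
        have : Ltilde q (2 * 0) = (q - q⁻¹)⁻¹ • 1 := by
          rw [← (imaginaryRelations hq).zero, smul_smul, inv_mul_cancel₀ hq.theta_ne, one_smul]
        rw [this]
        exact Subalgebra.smul_mem _ (one_mem _) _
      | succ n =>
        have hd := (mem_of_Ltilde_mem hq _ (M_mem_xvStab hq 0) ih).2
        have hL : L' q (2 * (n + 1)) ∈ xvStab hq.ne_zero 0 := by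
          refine mem_xvStab hq.ne_zero (L'_mem hq.ne_zero _) (L_mem_imagTop hq _).2 ?_
          have h1 := (L_mem_imagTop hq (2 * n + 1)).1
          rw [zero_mul, pow_zero, one_smul, show 2 * (n + 1) = 2 * n + 2 by ring,
            xv_zero_L'_even hq]
          exact add_mem (Submodule.smul_mem _ _ (xv_mul_mem (by omega) h1))
            (Submodule.smul_mem _ _ (mul_xv_mem (by omega) h1))
        have e := L'_eq_Ltilde (q := q) (2 * (n + 1))
        rw [eq_sub_iff_add_eq] at e
        rw [← e]
        exact add_mem hL (Subalgebra.smul_mem _ hd _)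
  refine Algebra.adjoin_le ?_
  rintro _ (⟨k, rfl⟩ | ⟨j, rfl⟩)
  · exact key k
  · exact M_mem_xvStab hq 0 j

/-- L_{j+3} = [X₃, Y_{j+1}] and X₂ q-commutes with X₃, so the bracket of X₂ with it is expressed
through X₃ and an L'. The cases L₀ and L₂ are direct. -/
theorem imagTop_le_xvStab_one (hq : Generic q) : imagTop q ≤ xvStab hq.ne_zero 1 := by
  have h3 : ∀ j, L q (j + 3) ∈ xvStab hq.ne_zero 1 := by
    intro j
    refine mem_xvStab hq.ne_zero (L_mem hq.ne_zero _) (L_mem_imagTop hq _).1 ?_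
    have h := commutator_left_of_qcommute hq.ne_zero (xv_mul_succ hq 1) (y := yv q j)
      (z := zv q 1 j) (z' := zv q (1 + 1) j) rfl rfl
    have e1 : zv q (1 + 1) j = L q (j + 3) := by
      have := zv_even hq j 1
      rw [this]; congr 1; ring
    have e2 : zv q 1 j ∈ imagTop q := by
      have := zv_odd hq j 0
      rw [mul_zero, zero_add] at this
      rw [this]; exact (L_mem_imagTop hq _).2
    rw [e1] at h
    have e3 : (-1 : ℂ) ^ (1 * (j + 3)) = (-1) ^ (1 * (j + 1)) := by
      simp [pow_succ]
    rw [e3, h]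
    exact sub_mem (Submodule.smul_mem _ _ (xv_mul_mem (by omega) e2))
      (Submodule.smul_mem _ _ (mul_xv_mem (by omega) e2))
  refine imagTop_le hq (M_mem_xvStab hq 1) fun k => ?_
  match k with
  | 0 =>
    rw [mul_zero, L_zero]
    exact Subalgebra.smul_mem _ (one_mem _) _
  | 1 =>
    rw [mul_one, L_two hq]
    have := ev_mem_xvStab hq 1
    exact add_mem (hv_mem_xvStab hq 1) (mul_mem this this)
  | k + 2 => exact h3 (2 * k + 1)

theorem imagTop_le_xvStab_add_two (hq : Generic q) {m : ℕ} (h : imagTop q ≤ xvStab hq.ne_zero m) :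
    imagTop q ≤ xvStab hq.ne_zero (m + 2) := by
  have : ∀ z k, z ∈ imagTop q → z ∈ homComp q (k, k) → z ∈ xvStab hq.ne_zero (m + 2) := by
    intro z k hz hk
    refine mem_xvStab hq.ne_zero hk hz ?_
    have h1 := (h hz).2
    rw [sk_xv_of_mem hq.ne_zero m hk] at h1
    have h2 := xvMod_shift hq h1
    have hc := (commute_ev_sq_imagTop hq hz).eq
    have h3 := ev_sq_xv q m
    have e : (-1 : ℂ) ^ ((m + 2) * k) = (-1) ^ (m * k) := by
      rw [add_mul, pow_add, pow_mul (-1 : ℂ) 2 k]; simp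
    rw [e]
    convert h2 using 1
    generalize ev q * ev q = f at hc h3 ⊢
    rw [← neg_neg (xv q (m + 2)), ← h3]
    linear_combination (norm := skip) (xv q m) * hc - (-1 : ℂ) ^ (m * k) • (hc * xv q m)
    simp only [mul_sub, sub_mul, smul_mul_assoc, mul_smul_comm, mul_assoc, smul_sub, mul_neg,
      neg_mul, neg_sub]
    module
  refine Algebra.adjoin_le ?_
  intro z hz
  obtain ⟨k, hk⟩ := imagTop_generator_mem hq.ne_zero hz
  exact this z k (Algebra.subset_adjoin hz) hk

/-- `[X_m, z]` is a combination of the `a X_k b`, `k > m`, for `z` in `imagTop`. -/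
theorem imagTop_le_xvStab (hq : Generic q) (m : ℕ) : imagTop q ≤ xvStab hq.ne_zero m := by
  induction m using Nat.twoStepInduction with
  | zero => exact imagTop_le_xvStab_zero hq
  | one => exact imagTop_le_xvStab_one hq
  | more m h _ => exact imagTop_le_xvStab_add_two hq h

theorem sk_xv_imag_mem (hq : Generic q) {m : ℕ} {S : Subalgebra ℂ (NA q)} (hS : imagTop q ≤ S)
    (hX : ∀ k, m < k → xv q k ∈ S) {z : NA q} (hz : z ∈ imagTop q) :
    sk q (m + 1, m) (xv q m) z ∈ S := by
  have : xvMod q m ≤ Subalgebra.toSubmodule S := by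
    refine Submodule.span_le.2 ?_
    rintro _ ⟨k, hk, a, ha, b, hb, rfl⟩
    exact S.mul_mem (S.mul_mem (hS ha) (hX k hk)) (hS hb)
  exact this (imagTop_le_xvStab hq m hz).2

end

/-! ### The order of the words of the `X_n`, `Y_n`, `L_{2n}`, `M_{2n+1}` -/

theorem length_wordPow (w : Word) (n : ℕ) : (wordPow w n).length = n * w.length := by
  simp [wordPow]

theorem length_wordL (n : ℕ) : (wordL n).length = 2 * n + 2 := by
  simp [wordL, wordY, length_wordPow]; ring

theorem length_wordY (n : ℕ) : (wordY n).length = 2 * n + 1 := by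
  simp [wordY, length_wordPow]; ring

theorem length_wordM (n : ℕ) : (wordM n).length = 4 * n + 2 := by
  simp [wordM, length_wordPow]; ring

/-- The monotonicity statements here amount to the order X₁ < X₂ < … < L₄ < L₂ < … < M₃ < M₁ < … <
Y₂ < Y₁ of the words involved. -/
theorem wordX_strictMono : StrictMono wordX :=
  strictMono_nat_of_lt_succ fun n => by rw [wordX_succ]; exact lt_append (by simp)

theorem wordY_strictAnti : StrictAnti wordY :=
  strictAnti_nat_of_succ_lt fun n => by
    induction n with
    | zero => decide
    | succ n ih => rw [wordY_succ, wordY_succ n]; exact (append_lt_append_left_iff _ _ _).2 ih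

theorem wordL_strictAnti : StrictAnti wordL := fun _ _ h =>
  (append_lt_append_left_iff [0] _ _).2 (wordY_strictAnti h)

theorem wordM_strictAnti : StrictAnti wordM :=
  strictAnti_nat_of_succ_lt fun n => by
    induction n with
    | zero => decide
    | succ n ih => rw [wordM_succ, wordM_succ n]; exact (append_lt_append_left_iff _ _ _).2 ih

theorem wordPow_lt_wordY (m n : ℕ) : wordPow [0, 1] n < wordY m := by
  induction m generalizing n with
  | zero =>
    cases n with
    | zero => decide
    | succ n => rw [wordPow_succ]; exact List.cons_lt_cons_iff.2 (Or.inl (by decide))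
  | succ m ih =>
    rw [wordY_succ]
    cases n with
    | zero => exact List.nil_lt_cons _ _
    | succ n => rw [wordPow_succ]; exact (append_lt_append_left_iff _ _ _).2 (ih n)

theorem wordX_lt_wordL (n m : ℕ) : wordX n < wordL m :=
  (append_lt_append_left_iff [0] _ _).2 (wordPow_lt_wordY m n)

theorem wordL_one : wordL 1 = [0, 0, 1, 1] := by decide

theorem wordL_lt_wordM {n : ℕ} (hn : 1 ≤ n) (m : ℕ) : wordL n < wordM m :=
  (wordL_strictAnti.antitone hn).trans_lt (wordL_one ▸ lt_wordM m)

theorem wordM_le (n : ℕ) : wordM n ≤ [0, 1] := wordM_strictAnti.antitone (Nat.zero_le n)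

theorem wordM_lt_wordY (m n : ℕ) : wordM m < wordY n := (wordM_le m).trans_lt (lt_wordY n)

theorem wordL_lt_wordY (m n : ℕ) : wordL m < wordY n :=
  (wordL_strictAnti.antitone (Nat.zero_le m)).trans_lt (lt_wordY n)

theorem wordX_lt_wordM (n m : ℕ) : wordX n < wordM m :=
  (wordX_lt_wordL n 1).trans (wordL_lt_wordM le_rfl m)

theorem wordX_lt_wordY (n m : ℕ) : wordX n < wordY m := (wordX_lt n).trans (lt_wordY m)

/-- The words of the `X_n`, `Y_n`, `L_{2n}` and `M_{2n+1}`. -/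
def IsBasicWord (w : Word) : Prop :=
  (∃ n, w = wordX n) ∨ (∃ n, w = wordL (2 * n + 1)) ∨ (∃ n, w = wordM n) ∨ ∃ n, w = wordY n

theorem IsBasicWord.isLyndon {w : Word} (h : IsBasicWord w) : IsLyndon w := by
  rcases h with ⟨n, rfl⟩ | ⟨n, rfl⟩ | ⟨n, rfl⟩ | ⟨n, rfl⟩
  · exact isLyndon_wordX n
  · exact isLyndon_wordL _
  · exact isLyndon_wordM n
  · exact isLyndon_wordY n

section

variable {q : ℂ} {P : Word → Prop}

/-- The subalgebra generated by the super-letters of the basic words with the property `P`. -/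
def adj (q : ℂ) (P : Word → Prop) : Subalgebra ℂ (NA q) :=
  Algebra.adjoin ℂ (superLetter q '' {c | IsBasicWord c ∧ P c})

theorem superLetter_mem_adj {c : Word} (hc : IsBasicWord c) (h : P c) :
    superLetter q c ∈ adj q P := Algebra.subset_adjoin ⟨c, ⟨hc, h⟩, rfl⟩

theorem adj_mono {Q : Word → Prop} (h : ∀ c, IsBasicWord c → P c → Q c) : adj q P ≤ adj q Q :=
  Algebra.adjoin_mono (Set.image_mono fun c hc => ⟨hc.1, h c hc.1 hc.2⟩)

theorem adj_generator_mem (P : Word → Prop) (x : NA q)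
    (hx : x ∈ superLetter q '' {c | IsBasicWord c ∧ P c}) : ∃ β, x ∈ homComp q β := by
  obtain ⟨c, -, rfl⟩ := hx
  exact ⟨_, superLetter_mem q c⟩

theorem twist_mem_adj (α : Deg) {z : NA q} (hz : z ∈ adj q P) : twist q α z ∈ adj q P :=
  twist_mem_adjoin (adj_generator_mem P) α hz

theorem sk_mem_adj_of {Q : Word → Prop} {α : Deg} {x : NA q}
    (hPQ : ∀ c, IsBasicWord c → P c → Q c)
    (h : ∀ c, IsBasicWord c → P c → sk q α x (superLetter q c) ∈ adj q Q) {z : NA q}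
    (hz : z ∈ adj q P) : sk q α x z ∈ adj q Q := by
  refine sk_mem_of_adjoin (adj_generator_mem Q) ?_ ?_ hz
  · rintro _ ⟨c, hc, rfl⟩
    exact superLetter_mem_adj hc.1 (hPQ c hc.1 hc.2)
  · rintro _ ⟨c, hc, rfl⟩
    exact h c hc.1 hc.2

theorem xv_mem_adj (hq : Generic q) {n : ℕ} (h : P (wordX n)) : xv q n ∈ adj q P :=
  xv_eq hq.ne_zero n ▸ superLetter_mem_adj (Or.inl ⟨n, rfl⟩) h

theorem L_mem_adj (hq : Generic q) {n : ℕ} (h : P (wordL (2 * n + 1))) :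
    L q (2 * (n + 1)) ∈ adj q P := by
  have := superLetter_wordL_eq hq.ne_zero (2 * n + 1)
  exact this ▸ superLetter_mem_adj (Or.inr (Or.inl ⟨n, rfl⟩)) h

theorem M_mem_adj (hq : Generic q) {n : ℕ} (h : P (wordM n)) : M q (2 * n + 1) ∈ adj q P :=
  superLetter_wordM_eq hq.ne_zero n ▸ superLetter_mem_adj (Or.inr (Or.inr (Or.inl ⟨n, rfl⟩))) h

theorem yv_mem_adj (hq : Generic q) {n : ℕ} (h : P (wordY n)) : yv q n ∈ adj q P :=
  yv_eq hq.ne_zero n ▸ superLetter_mem_adj (Or.inr (Or.inr (Or.inr ⟨n, rfl⟩))) h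

theorem ev_mem_adj (hq : Generic q) (h : P (wordM 0)) : ev q ∈ adj q P := by
  have := M_mem_adj hq h
  rwa [mul_zero, zero_add, M_zero hq.ne_zero] at this

theorem imagAlg_le_adj (hq : Generic q) {n : ℕ} (hM : ∀ j, P (wordM j))
    (hL : ∀ k, k + 1 < n → P (wordL (2 * k + 1))) : imagAlg q n ≤ adj q P := by
  refine imagAlg_le hq (fun j => M_mem_adj hq (hM j)) fun k hk => ?_
  cases k with
  | zero => rw [mul_zero, L_zero]; exact Subalgebra.smul_mem _ (one_mem _) _
  | succ k => exact L_mem_adj hq (hL k hk)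

theorem imagTop_le_adj (hq : Generic q) (hM : ∀ j, P (wordM j))
    (hL : ∀ k, P (wordL (2 * k + 1))) : imagTop q ≤ adj q P := by
  refine imagTop_le hq (fun j => M_mem_adj hq (hM j)) fun k => ?_
  cases k with
  | zero => rw [mul_zero, L_zero]; exact Subalgebra.smul_mem _ (one_mem _) _
  | succ k => exact L_mem_adj hq (hL k)

/-- Words of odd L's are not basic for positive `N`. Those elements, and all L', are polynomials in
the L's of smaller even index and the M's, whose words are larger; for even index `L` is itself a
generator. -/
theorem L_mem_adj_le (hq : Generic q) {N : ℕ} (hN : 0 < N) :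
    L q (N + 1) ∈ adj q (wordL N ≤ ·) ∧ L' q (N + 1) ∈ adj q (wordL N ≤ ·) := by
  have hI : ∀ n, n ≤ N / 2 + 1 → imagAlg q n ≤ adj q (wordL N ≤ ·) := fun n hn =>
    imagAlg_le_adj hq (fun j => (wordL_lt_wordM hN j).le)
      fun k hk => wordL_strictAnti.antitone (by omega)
  rcases Nat.even_or_odd' N with ⟨k, rfl | rfl⟩
  · have h := L_mem_imagAlg hq (n := k + 1) (j := 2 * k + 1) (by omega)
    have hI := hI (k + 1) (by omega)
    exact ⟨hI h.1, hI h.2⟩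
  · have hd := hI (k + 1) (by omega) (mem_of_Ltilde_mem hq _ (M_mem_imagAlg (k + 1))
      fun _ hk => Ltilde_mem_imagAlg hk).2
    have hL : L q (2 * (k + 1)) ∈ adj q (wordL (2 * k + 1) ≤ ·) := L_mem_adj hq le_rfl
    refine ⟨hL, ?_⟩
    have := sub_mem hL hd
    rwa [sub_sub_cancel] at this

theorem wordX_append_wordY (m n : ℕ) : wordX m ++ wordY n = wordL (m + n) := by
  induction n generalizing m with
  | zero => rfl
  | succ n ih =>
    rw [wordY_succ, ← List.append_assoc, ← wordX_succ, ih]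
    congr 1; omega

/-! ### Brackets of super-letters of basic words -/

theorem sk_xv_mem_adj (hq : Generic q) (m : ℕ) {b : Word} (hb : IsBasicWord b)
    (h : wordX m < b) : sk q (m + 1, m) (xv q m) (superLetter q b) ∈ adj q (wordX m ++ b ≤ ·) := by
  have hI : imagTop q ≤ adj q (wordX (m + 1) ≤ ·) := imagTop_le_adj hq
    (fun j => (wordX_lt_wordM _ _).le) (fun j => (wordX_lt_wordL _ _).le)
  have hX : ∀ k, m < k → xv q k ∈ adj q (wordX (m + 1) ≤ ·) :=
    fun k hk => xv_mem_adj hq (wordX_strictMono.monotone hk)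
  -- As `wordX (m + 1)` is `wordX m` followed by 01, for such b it suffices to land among the words
  -- at least `wordX (m + 1)`.
  have hle : b ≤ [0, 1] → adj q (wordX (m + 1) ≤ ·) ≤ adj q (wordX m ++ b ≤ ·) := by
    intro hb
    refine adj_mono fun c _ hc => le_trans ?_ hc
    rw [wordX_succ]
    rcases hb.lt_or_eq with hb | rfl
    · exact ((append_lt_append_left_iff _ _ _).2 hb).le
    · exact le_rfl
  rcases hb with ⟨n, rfl⟩ | ⟨n, rfl⟩ | ⟨n, rfl⟩ | ⟨n, rfl⟩
  · refine hle (wordX_lt n).le ?_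
    rw [xv_eq hq.ne_zero]
    have hmn : m < n := wordX_strictMono.lt_iff_lt.1 h
    clear h hle
    -- Neighbouring X's q-commute; afterwards X_{n+1} is the bracket of X_n with L₁ and the Leibniz
    -- rule applies.
    induction n, hmn using Nat.le_induction with
    | base =>
      have e : chi q (m + 1, m) (m.succ + 1, m.succ) = q := by
        rw [chi_eq hq.ne_zero, (Nat.even_mul_succ_self m).neg_one_pow, one_mul,
          show (((m + 1 : ℕ) : ℤ) - (m : ℕ)) * (((m.succ + 1 : ℕ) : ℤ) - (m.succ : ℕ)) = 1 by
            push_cast; ring, zpow_one]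
      rw [sk_of_mem _ (xv_mem hq.ne_zero _), e, xv_mul_succ hq, sub_self]
      exact zero_mem _
    | succ n hn ih =>
      have he := ev_mem_imagTop hq
      have h1 := sk_xv_imag_mem hq hI hX he
      have hn' := hX n hn
      have hsub : sk q (m + 1, m) (xv q m) (xv q (n + 1)) =
          sk q (m + 1, m) (xv q m) (xv q n * ev q) -
            (-1 : ℂ) ^ n • sk q (m + 1, m) (xv q m) (ev q * xv q n) := by
        rw [xv]
        simp only [sk, map_sub, map_smul, mul_sub, sub_mul, smul_mul_assoc, mul_smul_comm,
          smul_sub]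
        abel
      rw [hsub, sk_mul, sk_mul]
      exact sub_mem (add_mem (mul_mem ih (hI he)) (mul_mem (twist_mem_adj _ hn') h1))
        (Subalgebra.smul_mem _ (add_mem (mul_mem h1 hn')
          (mul_mem (twist_mem_adj _ (hI he)) ih)) _)
  · refine hle (wordL_strictAnti.antitone (Nat.zero_le _)) ?_
    rw [superLetter_wordL_eq hq.ne_zero]
    exact sk_xv_imag_mem hq hI hX (L_mem_imagTop hq _).1
  · refine hle (wordM_le n) ?_
    rw [superLetter_wordM_eq hq.ne_zero]
    exact sk_xv_imag_mem hq hI hX (M_mem_imagTop n)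
  · rw [yv_eq hq.ne_zero, ← bracket_eq_sk (xv_mem hq.ne_zero m) (yv_mem hq.ne_zero n),
      bracket_xv_yv hq.ne_zero]
    rw [wordX_append_wordY]
    rcases Nat.eq_zero_or_pos (m + n) with h0 | h0
    · obtain ⟨rfl, rfl⟩ : m = 0 ∧ n = 0 := by omega
      rw [zv_zero_zero]
      exact ev_mem_adj hq (by decide)
    · have hL := L_mem_adj_le hq h0
      rcases Nat.even_or_odd' m with ⟨k, rfl | rfl⟩
      · rw [zv_even hq]; exact hL.1
      · rw [zv_odd hq, show 2 * k + n + 2 = 2 * k + 1 + n + 1 by ring]; exact hL.2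

theorem sk_diag_even (a : ℕ) (hq0 : q ≠ 0) (x : NA q) {β : Deg} {y : NA q}
    (hy : y ∈ homComp q β) : sk q (2 * a, 2 * a) x y = x * y - y * x := by
  rw [sk_of_mem x hy, ← Prod.mk.eta (p := β), chi_eq hq0]
  simp [mul_assoc, pow_mul]

theorem sk_diag_odd (a : ℕ) (hq0 : q ≠ 0) (x : NA q) {β : Deg} {y : NA q}
    (hy : y ∈ homComp q β) :
    sk q (2 * a + 1, 2 * a + 1) x y = x * y - (-1 : ℂ) ^ β.2 • (y * x) := by
  rw [sk_of_mem x hy, ← Prod.mk.eta (p := β), chi_eq hq0]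
  rw [pow_mul, (odd_two_mul_add_one a).neg_one_pow]
  simp

theorem sk_L_mem_adj (hq : Generic q) (p : ℕ) {b : Word} (hb : IsBasicWord b)
    (h : wordL (2 * p + 1) < b) : sk q (2 * (p + 1), 2 * (p + 1)) (L q (2 * (p + 1)))
      (superLetter q b) ∈ adj q (wordL (2 * p + 1) ++ b ≤ ·) := by
  rw [sk_diag_even _ hq.ne_zero _ (superLetter_mem q b)]
  have hY : ∀ j, yv q j ∈ adj q (wordL (2 * p + 1) ++ b ≤ ·) := fun j =>
    yv_mem_adj hq ((append_lt_of_length_le (g := [0, 1])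
      ((wordL_strictAnti (Nat.succ_pos _)).trans_eq rfl) (by simp [length_wordL]) b).le.trans
      (lt_wordY j).le)
  -- For L₂ the bound is sharp: its bracket with an M is the next M, whose word is exactly the
  -- concatenation. For larger index the commutator drops into elements whose words are strictly
  -- larger, by `append_lt_of_length_le` for shorter generators.
  cases p with
  | zero =>
    simp only [mul_zero, zero_add, mul_one, wordL_one] at h hY ⊢
    have he : ev q ∈ adj q ([0, 0, 1, 1] ++ b ≤ ·) :=
      ev_mem_adj hq (append_lt_of_length_le (g := [0, 1]) (by decide) (by simp) b).le
    rw [L_two hq]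
    rcases hb with ⟨n, rfl⟩ | ⟨n, rfl⟩ | ⟨n, rfl⟩ | ⟨n, rfl⟩
    · exact absurd h (wordL_one ▸ (wordX_lt_wordL n 1).not_gt)
    · exact absurd h (wordL_one ▸ (wordL_strictAnti.antitone (by omega)).not_gt)
    · rw [superLetter_wordM_eq hq.ne_zero, add_mul, mul_add, add_sub_add_comm,
        (M_succ_eq hq n).2, (M_succ_eq hq n).1.eq, sub_self, add_zero]
      exact M_mem_adj hq (wordM_succ n).ge
    · rw [yv_eq hq.ne_zero, add_mul, mul_add, add_sub_add_comm, hv_yv hq, ev_sq_yv]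
      exact add_mem (add_mem (Subalgebra.smul_mem _ (mul_mem (hY _) he) _)
        (Subalgebra.smul_mem _ (hY _) _)) (hY _)
  | succ p =>
    have hI : imagAlg q (p + 1 + 1) ≤ adj q (wordL (2 * (p + 1) + 1) ++ b ≤ ·) := by
      refine imagAlg_le_adj hq (fun j => ?_) fun k hk => ?_
      · exact (append_lt_of_length_le (g := wordL 1) (wordL_strictAnti (by omega))
          (by simp [length_wordL]) b).le.trans (wordL_lt_wordM le_rfl j).le
      · exact (append_lt_of_length_le (wordL_strictAnti (by omega))
          (by simp only [length_wordL]; omega) b).le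
    rcases hb with ⟨n, rfl⟩ | ⟨n, rfl⟩ | ⟨n, rfl⟩ | ⟨n, rfl⟩
    · exact absurd h (wordX_lt_wordL n _).not_gt
    · rw [superLetter_wordL_eq hq.ne_zero]
      have := wordL_strictAnti.lt_iff_gt.1 h
      exact hI (commutator_L_mem hq (L_mem_imagAlg hq (by omega)).1)
    · rw [superLetter_wordM_eq hq.ne_zero]
      exact hI (commutator_L_mem hq (M_mem_imagAlg _ n))
    · rw [yv_eq hq.ne_zero]
      exact commutator_L_yv_mem hq hI hY n

/-- Apply [h, ·] to the case a: it moves each M of index below a up by one and each Y to Y's and L₁,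
so the M's that occur stay below the new a. -/
theorem M_yv_mem (hq : Generic q) (a j : ℕ) :
    M q (2 * a + 1) * yv q j + (-1 : ℂ) ^ j • (yv q j * M q (2 * a + 1)) ∈
      adj q (fun c => (∃ i < a, c = wordM i) ∨ ∃ n, c = wordY n) := by
  induction a with
  | zero =>
    rw [mul_zero, zero_add, M_zero hq.ne_zero]
    exact yv_mem_adj hq (n := j + 1) (Or.inr ⟨_, rfl⟩)
  | succ a ih =>
    have hY : ∀ n, yv q n ∈ adj q (fun c => (∃ i < a + 1, c = wordM i) ∨ ∃ n, c = wordY n) :=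
      fun n => yv_mem_adj hq (Or.inr ⟨_, rfl⟩)
    have hM : ∀ i < a + 1, M q (2 * i + 1) ∈
        adj q (fun c => (∃ i < a + 1, c = wordM i) ∨ ∃ n, c = wordY n) :=
      fun i hi => M_mem_adj hq (Or.inl ⟨i, hi, rfl⟩)
    have he : ev q ∈ adj q (fun c => (∃ i < a + 1, c = wordM i) ∨ ∃ n, c = wordY n) :=
      ev_mem_adj hq (Or.inl ⟨0, by omega, rfl⟩)
    have hh : ∀ n, hv q * yv q n - yv q n * hv q ∈
        adj q (fun c => (∃ i < a + 1, c = wordM i) ∨ ∃ n, c = wordY n) := fun n => by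
      rw [hv_yv hq]
      exact add_mem (Subalgebra.smul_mem _ (mul_mem (hY _) he) _) (Subalgebra.smul_mem _ (hY _) _)
    have h1 : hv q * (M q (2 * a + 1) * yv q j + (-1 : ℂ) ^ j • (yv q j * M q (2 * a + 1))) -
        (M q (2 * a + 1) * yv q j + (-1 : ℂ) ^ j • (yv q j * M q (2 * a + 1))) * hv q ∈
        adj q (fun c => (∃ i < a + 1, c = wordM i) ∨ ∃ n, c = wordY n) := by
      refine commutator_mem_of_adjoin ?_ ?_ ih
      · rintro _ ⟨c, hc, rfl⟩
        refine superLetter_mem_adj hc.1 (hc.2.imp ?_ id)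
        rintro ⟨i, hi, rfl⟩
        exact ⟨i, by omega, rfl⟩
      · rintro _ ⟨c, ⟨-, ⟨i, hi, rfl⟩ | ⟨n, rfl⟩⟩, rfl⟩
        · rw [superLetter_wordM_eq hq.ne_zero, (M_succ_eq hq i).2]
          exact hM _ (by omega)
        · rw [yv_eq hq.ne_zero]; exact hh n
    have e : M q (2 * (a + 1) + 1) * yv q j + (-1 : ℂ) ^ j • (yv q j * M q (2 * (a + 1) + 1)) =
        (hv q * (M q (2 * a + 1) * yv q j + (-1 : ℂ) ^ j • (yv q j * M q (2 * a + 1))) -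
        (M q (2 * a + 1) * yv q j + (-1 : ℂ) ^ j • (yv q j * M q (2 * a + 1))) * hv q) -
        (M q (2 * a + 1) * (hv q * yv q j - yv q j * hv q) +
          (-1 : ℂ) ^ j • ((hv q * yv q j - yv q j * hv q) * M q (2 * a + 1))) := by
      rw [← (M_succ_eq hq a).2]
      simp only [mul_add, add_mul, mul_sub, sub_mul, smul_mul_assoc, mul_smul_comm, mul_assoc,
        smul_sub]
      abel
    rw [e]
    exact sub_mem h1 (add_mem (mul_mem (hM a (by omega)) (hh j))
      (Subalgebra.smul_mem _ (mul_mem (hh j) (hM a (by omega))) _))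

theorem sk_M_mem_adj (hq : Generic q) (a : ℕ) {b : Word} (hb : IsBasicWord b)
    (h : wordM a < b) : sk q (2 * a + 1, 2 * a + 1) (M q (2 * a + 1)) (superLetter q b) ∈
      adj q (wordM a ++ b ≤ ·) := by
  have hM : ∀ j < a, M q (2 * j + 1) ∈ adj q (wordM a ++ b ≤ ·) := fun j hj =>
    M_mem_adj hq (append_lt_of_length_le (wordM_strictAnti hj)
      (by simp only [length_wordM]; omega) b).le
  rcases hb with ⟨n, rfl⟩ | ⟨n, rfl⟩ | ⟨n, rfl⟩ | ⟨n, rfl⟩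
  · exact absurd h (wordX_lt_wordM n _).not_gt
  · exact absurd h (wordL_lt_wordM (by omega) _).not_gt
  · have hn := wordM_strictAnti.lt_iff_gt.1 h
    rw [superLetter_wordM_eq hq.ne_zero, ← bracket_eq_sk (M_mem hq.ne_zero a)
      (M_mem hq.ne_zero n)]
    rcases Nat.even_or_odd (a + n) with he | ho
    · rw [(bracket_M hq a n).2 he]
      obtain ⟨c, hc⟩ := he
      -- The midpoint c of n < a is below a, so the square involves a larger word no longer than
      -- `wordM a`.
      rw [show a + n + 1 = 2 * c + 1 by omega]
      exact Subalgebra.smul_mem _ (pow_mem (hM c (by omega)) 2) _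
    · rw [(bracket_M hq a n).1 ho]; exact zero_mem _
  · rw [yv_eq hq.ne_zero, sk_diag_odd _ hq.ne_zero _ (yv_mem hq.ne_zero n), pow_succ, mul_neg_one,
      neg_smul, sub_neg_eq_add]
    cases a with
    | zero =>
      rw [mul_zero, zero_add, M_zero hq.ne_zero]
      exact yv_mem_adj hq (n := n + 1) (wordY_succ n).ge
    | succ a =>
      refine adj_mono ?_ (M_yv_mem hq (a + 1) n)
      have hlt : ∀ g : Word, g.length ≤ (wordM (a + 1)).length → wordM (a + 1) < g →
          wordM (a + 1) ++ wordY n ≤ g := fun g h1 h2 => (append_lt_of_length_le h2 h1 _).le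
      rintro c - (⟨i, hi, rfl⟩ | ⟨j, rfl⟩)
      · exact hlt _ (by simp only [length_wordM]; omega) (wordM_strictAnti hi)
      · exact (hlt _ (by simp only [length_wordM]; omega) (wordM_strictAnti (Nat.succ_pos a))).trans
          (wordM_lt_wordY 0 j).le

theorem chi_wordY (hq0 : q ≠ 0) (m n : ℕ) :
    chi q (m, m + 1) (n, n + 1) = (-1) ^ ((m + 1) * (n + 1)) * q := by
  rw [chi_eq hq0, show ((m : ℤ) - (m + 1 : ℕ)) * ((n : ℤ) - (n + 1 : ℕ)) = 1 by push_cast; ring,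
    zpow_one]

/-- Induction on m: the superbracket of L₁ with the previous bracket gives the new one up to
products of `yv q m` and `yv q (n + 1)`, whose indices are below m + 1. -/
theorem sk_yv_yv (hq : Generic q) {m n : ℕ} (h : n < m) :
    sk q (m, m + 1) (yv q m) (yv q n) ∈ adj q (fun c => ∃ k < m, c = wordY k) := by
  induction m, h using Nat.le_induction with
  | base =>
    have e : chi q (n.succ, n.succ + 1) (n, n + 1) = q := by
      rw [chi_wordY hq.ne_zero, mul_comm (n.succ + 1),
        (Nat.even_mul_succ_self (n + 1)).neg_one_pow, one_mul]
    rw [sk_of_mem _ (yv_mem hq.ne_zero _), e, yv_succ_mul hq, sub_self]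
    exact zero_mem _
  | succ m hn ih =>
    have hY : ∀ k < m + 1, yv q k ∈ adj q (fun c => ∃ k < m + 1, c = wordY k) :=
      fun k hk => yv_mem_adj hq ⟨k, hk, rfl⟩
    have hD := bracket_mem (yv_mem hq.ne_zero m) (yv_mem hq.ne_zero n)
    rw [bracket_eq_sk (yv_mem hq.ne_zero m) (yv_mem hq.ne_zero n)] at hD
    have h1 : sk q (2 * 0 + 1, 2 * 0 + 1) (ev q) (sk q (m, m + 1) (yv q m) (yv q n)) ∈
        adj q (fun c => ∃ k < m + 1, c = wordY k) := by
      refine sk_mem_adj_of ?_ ?_ ih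
      · rintro c - ⟨k, hk, rfl⟩
        exact ⟨k, by omega, rfl⟩
      · rintro c - ⟨k, hk, rfl⟩
        rw [yv_eq hq.ne_zero, sk_diag_odd 0 hq.ne_zero _ (yv_mem hq.ne_zero k), pow_succ,
          mul_neg_one, neg_smul, sub_neg_eq_add]
        exact hY (k + 1) (by omega)
    rw [sk_diag_odd 0 hq.ne_zero _ hD] at h1
    have h2 := add_mem h1 (add_mem
      (Subalgebra.smul_mem _ (mul_mem (hY m (by omega)) (hY (n + 1) (by omega))) ((-1 : ℂ) ^ m))
      (Subalgebra.smul_mem _ (mul_mem (hY (n + 1) (by omega)) (hY m (by omega)))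
        ((-1 : ℂ) ^ ((m + 1) * (n + 1)) * q)))
    convert h2 using 1
    rw [sk_of_mem _ (yv_mem hq.ne_zero _), sk_of_mem _ (yv_mem hq.ne_zero _),
      chi_wordY hq.ne_zero, chi_wordY hq.ne_zero]
    have e1 : (-1 : ℂ) ^ ((m + 1 + 1) * (n + 1)) =
        - ((-1) ^ n * (-1) ^ ((m + 1) * (n + 1))) := by
      rw [add_mul (m + 1), pow_add, one_mul, pow_succ _ n]; ring
    have e2 : (-1 : ℂ) ^ ((m, m + 1) + (n, n + 1) : Deg).2 = (-1) ^ m * (-1) ^ n := by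
      simp [pow_add]
    rw [e1, e2, yv, yv]
    generalize (-1 : ℂ) ^ ((m + 1) * (n + 1)) = t
    rcases neg_one_pow_cases m with hm | hm <;> rcases neg_one_pow_cases n with hn | hn <;>
      rw [hm, hn] <;>
      simp only [mul_add, add_mul, mul_sub, sub_mul, smul_mul_assoc, mul_smul_comm, mul_assoc,
        smul_sub, smul_add, smul_smul] <;> module

theorem sk_yv_mem_adj (hq : Generic q) (m : ℕ) {b : Word} (hb : IsBasicWord b)
    (h : wordY m < b) : sk q (m, m + 1) (yv q m) (superLetter q b) ∈
      adj q (wordY m ++ b ≤ ·) := by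
  rcases hb with ⟨n, rfl⟩ | ⟨n, rfl⟩ | ⟨n, rfl⟩ | ⟨n, rfl⟩
  · exact absurd h (wordX_lt_wordY n _).not_gt
  · exact absurd h (wordL_lt_wordY _ _).not_gt
  · exact absurd h (wordM_lt_wordY _ _).not_gt
  · rw [yv_eq hq.ne_zero]
    refine adj_mono ?_ (sk_yv_yv hq (wordY_strictAnti.lt_iff_gt.1 h))
    rintro c - ⟨k, hk, rfl⟩
    exact (append_lt_of_length_le (wordY_strictAnti hk)
      (by simp only [length_wordY]; omega) _).le

/-- The bracket of the super-letters of basic words `u < b` lies in the algebra generated by the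
super-letters of the basic words `c ≥ ub`. -/
theorem sk_superLetter_mem_adj (hq : Generic q) {u b : Word} (hu : IsBasicWord u)
    (hb : IsBasicWord b) (h : u < b) :
    sk q (wordDeg u) (superLetter q u) (superLetter q b) ∈ adj q (u ++ b ≤ ·) := by
  rcases hu with ⟨n, rfl⟩ | ⟨n, rfl⟩ | ⟨n, rfl⟩ | ⟨n, rfl⟩
  · rw [wordDeg_wordX, xv_eq hq.ne_zero]; exact sk_xv_mem_adj hq n hb h
  · rw [wordDeg_wordL, superLetter_wordL_eq hq.ne_zero]; exact sk_L_mem_adj hq n hb h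
  · rw [wordDeg_wordM, superLetter_wordM_eq hq.ne_zero]; exact sk_M_mem_adj hq n hb h
  · rw [wordDeg_wordY, yv_eq hq.ne_zero]; exact sk_yv_mem_adj hq n hb h

end

/-! ### Reduction of super-letters of non-basic Lyndon words -/

section

variable {q : ℂ} {P : Word → Prop}

theorem wordDeg_fst_add_snd (w : Word) : (wordDeg w).1 + (wordDeg w).2 = w.length := by
  induction w with
  | nil => rfl
  | cons i w ih =>
    rw [wordDeg_cons, List.length_cons, ← ih]
    fin_cases i <;> simp [letterDeg] <;> ring

theorem pow_mem_homComp {α : Deg} {x : NA q} (hx : x ∈ homComp q α) (k : ℕ) :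
    x ^ k ∈ homComp q (k • α) := by
  induction k with
  | zero => rw [pow_zero, zero_smul]; exact one_mem_homComp q
  | succ k ih => rw [pow_succ, succ_nsmul]; exact mul_mem_homComp ih hx

/-- The product of the super-letters of a list of words. -/
def letterProd (q : ℂ) (l : List Word) : NA q := (l.map (superLetter q)).prod

theorem letterProd_mem (q : ℂ) (l : List Word) :
    letterProd q l ∈ homComp q (wordDeg l.flatten) := by
  induction l with
  | nil => exact one_mem_homComp q
  | cons c l ih =>
    rw [List.flatten_cons, wordDeg_append]
    exact mul_mem_homComp (superLetter_mem q c) ih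

theorem letterProd_mem_adj {l : List Word} (h : ∀ c ∈ l, IsBasicWord c ∧ P c) :
    letterProd q l ∈ adj q P := by
  refine list_prod_mem fun x hx => ?_
  obtain ⟨c, hc, rfl⟩ := List.mem_map.1 hx
  exact superLetter_mem_adj (h c hc).1 (h c hc).2

theorem mem_span_letterProd {z : NA q} (hz : z ∈ adj q P) :
    z ∈ Submodule.span ℂ (Set.range fun l : {l : List Word // ∀ c ∈ l, IsBasicWord c ∧ P c} =>
      letterProd q l.1) := by
  rw [adj, ← Subalgebra.mem_toSubmodule, Algebra.adjoin_eq_span] at hz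
  refine Submodule.span_mono ?_ hz
  intro x hx
  obtain ⟨l, hl, rfl⟩ := Submonoid.exists_list_of_mem_closure hx
  choose! f hf using hl
  refine ⟨⟨l.map f, ?_⟩, ?_⟩
  · intro c hc
    obtain ⟨y, hy, rfl⟩ := List.mem_map.1 hc
    exact (hf y hy).1
  · simp only [letterProd, List.map_map]
    congr 1
    conv_rhs => rw [← List.map_id l]
    exact List.map_congr_left fun y hy => (hf y hy).2

/-- Only words of length at most `|d|` are needed in degree `d`. -/
theorem mem_adj_length {z : NA q} {d : Deg} (hd : z ∈ homComp q d) (hz : z ∈ adj q P) :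
    z ∈ adj q (fun c => P c ∧ c.length ≤ d.1 + d.2) := by
  have := mem_span_of_homogeneous _ _ (fun l : {l : List Word // ∀ c ∈ l, IsBasicWord c ∧ P c} =>
    letterProd_mem q l.1) hd (mem_span_letterProd hz)
  refine (Submodule.span_le (p := Subalgebra.toSubmodule
    (adj q (fun c => P c ∧ c.length ≤ d.1 + d.2)))).2 ?_ this
  rintro _ ⟨l, rfl, rfl⟩
  refine letterProd_mem_adj fun c hc => ⟨(l.2 c hc).1, (l.2 c hc).2, ?_⟩
  rw [wordDeg_fst_add_snd]
  exact (List.sublist_flatten_of_mem hc).length_le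

/-- The super-letter of a Lyndon word that is not basic is a combination of products of
super-letters of larger basic words. -/
theorem superLetter_mem_adj_lt (hq : Generic q) {v : Word} (hv : IsLyndon v)
    (hb : ¬ IsBasicWord v) : superLetter q v ∈ adj q (v < ·) := by
  induction hn : v.length using Nat.strong_induction_on generalizing v with
  | _ n ih =>
    subst hn
    have hl : 2 ≤ v.length := by
      match v, hv, hb with
      | [], hv, _ => exact absurd rfl hv.1
      | [i], _, hb =>
        fin_cases i
        · exact absurd (Or.inl ⟨0, rfl⟩) hb
        · exact absurd (Or.inr (Or.inr (Or.inr ⟨0, rfl⟩))) hb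
      | _ :: _ :: _, _, _ => simp
    obtain ⟨h0, h1, hu, ht⟩ := shirshovLength_spec hv hl
    have htake : (v.take (shirshovLength v)).length = shirshovLength v := by simp; omega
    have hdrop : (v.drop (shirshovLength v)).length < v.length := by simp; omega
    have hvt : v < v.drop (shirshovLength v) := hv.drop_lt h0 h1
    have e := superLetter_append q hu.1 ht.1 (by rw [List.take_append_drop, htake])
    have hv' : v.take (shirshovLength v) ++ v.drop (shirshovLength v) = v :=
      List.take_append_drop _ _
    generalize v.take (shirshovLength v) = u at *
    generalize v.drop (shirshovLength v) = t at *
    subst hv'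
    rw [e, bracket_eq_sk (superLetter_mem q u) (superLetter_mem q t)]
    have htm : superLetter q t ∈ adj q (t ≤ ·) := by
      by_cases hbt : IsBasicWord t
      · exact superLetter_mem_adj hbt le_rfl
      · exact adj_mono (fun c _ hc => le_of_lt hc) (ih _ hdrop ht hbt rfl)
    -- If u is basic, the bracket of [u] with each basic c ≥ t lies above uc ≥ ut. If not, [u] is
    -- already a polynomial in larger words of length at most |u|, which exceed ut, and both
    -- products are harmless.
    by_cases hbu : IsBasicWord u
    · refine sk_mem_adj_of (fun c _ hc => hvt.trans_le hc) (fun c hc htc => ?_) htm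
      have hut : u < c := (lt_append ht.1).trans (hvt.trans_le htc)
      refine adj_mono (fun g hg hle => ?_) (sk_superLetter_mem_adj hq hbu hc hut)
      have h2 : u ++ t ≤ u ++ c := by
        rcases htc.lt_or_eq with h | rfl
        · exact ((append_lt_append_left_iff u _ _).2 h).le
        · exact le_rfl
      -- A basic word cannot equal the non-basic word ut, so the inequality is strict.
      exact (h2.trans hle).lt_of_ne fun h => hb (h ▸ hg)
    · have hum := mem_adj_length (superLetter_mem q u)
        (ih u.length (by rw [htake]; exact h1) hu hbu rfl)
      have hum' : superLetter q u ∈ adj q (u ++ t < ·) :=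
        adj_mono (fun c _ hc => append_lt_of_length_le hc.1
          (by rw [← wordDeg_fst_add_snd u]; exact hc.2) t) hum
      have htm' : superLetter q t ∈ adj q (u ++ t < ·) :=
        adj_mono (fun c _ hc => hvt.trans_le hc) htm
      exact sub_mem (mul_mem hum' htm') (mul_mem (twist_mem_adj _ htm') hum')

/-! ### Ordered products -/

/-- The elements `z [u]^k` with `z` a product of super-letters of basic words greater than `u`
span `adj q (u ≤ ·)`. -/
theorem mem_span_letterProd_mul_pow (hq : Generic q) {u : Word} (hu : IsBasicWord u) {z : NA q}
    (hz : z ∈ adj q (u ≤ ·)) : z ∈ Submodule.span ℂ (Set.range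
      fun p : {l : List Word // ∀ c ∈ l, IsBasicWord c ∧ u < c} × ℕ =>
        letterProd q p.1.1 * superLetter q u ^ p.2) := by
  set T := Submodule.span ℂ (Set.range
      fun p : {l : List Word // ∀ c ∈ l, IsBasicWord c ∧ u < c} × ℕ =>
        letterProd q p.1.1 * superLetter q u ^ p.2) with hT
  have hmem : ∀ a ∈ adj q (u < ·), ∀ k, a * superLetter q u ^ k ∈ T := by
    intro a ha k
    have hs := mem_span_letterProd ha
    clear ha
    induction hs using Submodule.span_induction with
    | mem z hz =>
      obtain ⟨l, rfl⟩ := hz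
      exact Submodule.subset_span ⟨(l, k), rfl⟩
    | zero => rw [zero_mul]; exact zero_mem _
    | add a b _ _ ha hb => rw [add_mul]; exact add_mem ha hb
    | smul r a _ ha => rw [smul_mul_assoc]; exact Submodule.smul_mem _ _ ha
  have hsk : ∀ a ∈ adj q (u < ·), sk q (wordDeg u) (superLetter q u) a ∈ adj q (u < ·) := by
    intro a ha
    refine sk_mem_adj_of (fun _ _ h => h) (fun c hc huc => ?_) ha
    have hne : c ≠ [] := hc.isLyndon.1
    exact adj_mono (fun g _ h => (lt_append hne).trans_le h)
      (sk_superLetter_mem_adj hq hu hc huc)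
  have hleft : ∀ c, IsBasicWord c → u ≤ c → ∀ t ∈ T, superLetter q c * t ∈ T := by
    intro c hc huc t ht
    induction ht using Submodule.span_induction with
    | mem z hz =>
      obtain ⟨⟨⟨l, hl⟩, k⟩, rfl⟩ := hz
      have hla : letterProd q l ∈ adj q (u < ·) := letterProd_mem_adj hl
      dsimp only
      rcases huc.lt_or_eq with h | rfl
      · rw [← mul_assoc]
        exact hmem _ (mul_mem (superLetter_mem_adj hc h) hla) k
      -- Moving [u] to the right past larger letters costs a twist and a bracket, and the bracket
      -- involves only words larger than u.
      · have e : superLetter q u * (letterProd q l * superLetter q u ^ k) =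
            twist q (wordDeg u) (letterProd q l) * superLetter q u ^ (k + 1) +
            sk q (wordDeg u) (superLetter q u) (letterProd q l) * superLetter q u ^ k := by
          rw [sk, pow_succ']; noncomm_ring
        rw [e]
        exact add_mem (hmem _ (twist_mem_adj _ hla) _) (hmem _ (hsk _ hla) _)
    | zero => rw [mul_zero]; exact zero_mem _
    | add a b _ _ ha hb => rw [mul_add]; exact add_mem ha hb
    | smul r a _ ha => rw [mul_smul_comm]; exact Submodule.smul_mem _ _ ha
  refine Submodule.span_le.2 ?_ (mem_span_letterProd hz)
  rintro _ ⟨⟨l, hl⟩, rfl⟩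
  dsimp only
  induction l with
  | nil => exact Submodule.subset_span ⟨(⟨[], by simp⟩, 0), by simp [letterProd]⟩
  | cons c l ih =>
    have e : letterProd q (c :: l) = superLetter q c * letterProd q l := by simp [letterProd]
    rw [e]
    have hc := hl c List.mem_cons_self
    exact hleft c hc.1 hc.2 _ (ih fun g hg => hl g (List.mem_cons_of_mem _ hg))

theorem wordPow_one (w : Word) : wordPow w 1 = w := by simp [wordPow]

theorem one_mem_largerProducts (q : ℂ) (w : Word) : 1 ∈ largerProducts q w :=
  ⟨[], by simp, by simp, by simp⟩

theorem mul_pow_mem_largerProducts {w u : Word} (hu : IsBasicWord u) (h : w < u) {z : NA q}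
    (hz : z ∈ largerProducts q u) (k : ℕ) : z * superLetter q u ^ k ∈ largerProducts q w := by
  obtain ⟨l, h1, h2, rfl⟩ := hz
  have h1' : ∀ t ∈ l, IsCandidate q t.1.1 t.1.2 ∧ 0 < t.2 ∧ w < wordPow t.1.1 t.1.2 :=
    fun t ht => ⟨(h1 t ht).1, (h1 t ht).2.1, h.trans (h1 t ht).2.2⟩
  rcases Nat.eq_zero_or_pos k with rfl | hk
  · exact ⟨l, h1', h2, by rw [pow_zero, mul_one]⟩
  · refine ⟨l ++ [((u, 1), k)], ?_, ?_, ?_⟩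
    · intro t ht
      rcases List.mem_append.1 ht with ht | ht
      · exact h1' t ht
      · rw [List.mem_singleton] at ht
        subst ht
        exact ⟨⟨hu.isLyndon, Or.inl rfl⟩, hk, by rwa [wordPow_one]⟩
    · rw [List.pairwise_append]
      refine ⟨h2, List.pairwise_singleton _ _, fun s hs t ht => ?_⟩
      rw [List.mem_singleton] at ht
      subst ht
      rw [wordPow_one]
      exact (h1 s hs).2.2
    · simp [candidateVector]

/-- The homogeneous elements of `adj q (w < ·)` are combinations of ordered products of
candidates greater than `w`. -/
theorem mem_span_largerProducts (hq : Generic q) (w : Word) {d : Deg} {z : NA q}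
    (hd : z ∈ homComp q d) (hz : z ∈ adj q (w < ·)) :
    z ∈ Submodule.span ℂ (largerProducts q w) := by
  classical
  -- A length bound leaves finitely many basic words above w; the induction is on their number,
  -- splitting off powers of the smallest one at the right end.
  obtain ⟨N, hN⟩ : ∃ N, d.1 + d.2 ≤ N := ⟨_, le_rfl⟩
  have hfin : {c : Word | c.length ≤ N ∧ IsBasicWord c}.Finite :=
    (List.finite_length_le (Fin 2) N).subset fun c hc => hc.1
  obtain ⟨S, hS⟩ : ∃ S : Finset Word, ∀ c, c ∈ S ↔ c.length ≤ N ∧ IsBasicWord c :=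
    ⟨hfin.toFinset, fun c => hfin.mem_toFinset⟩
  induction hn : (S.filter (w < ·)).card using Nat.strong_induction_on generalizing w d z with
  | _ n ih =>
    subst hn
    have hz' := mem_adj_length hd hz
    rcases (S.filter (w < ·)).eq_empty_or_nonempty with h0 | h0
    · have : z ∈ (⊥ : Subalgebra ℂ (NA q)) := by
        rw [adj] at hz'
        convert hz'
        rw [eq_comm, ← le_bot_iff, Algebra.adjoin_le_iff]
        rintro _ ⟨c, ⟨hc, hwc, hlc⟩, rfl⟩
        exact absurd (Finset.mem_filter.2 ⟨(hS c).2 ⟨hlc.trans hN, hc⟩, hwc⟩) (by simp [h0])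
      obtain ⟨r, rfl⟩ := Algebra.mem_bot.1 this
      rw [Algebra.algebraMap_eq_smul_one]
      exact Submodule.smul_mem _ _ (Submodule.subset_span (one_mem_largerProducts q w))
    · obtain ⟨u, hu, hmin⟩ := Finset.exists_min_image _ id h0
      rw [Finset.mem_filter, hS] at hu
      have hzu : z ∈ adj q (u ≤ ·) := by
        refine adj_mono (fun c hc h => ?_) hz'
        exact hmin c (Finset.mem_filter.2 ⟨(hS c).2 ⟨h.2.trans hN, hc⟩, h.1⟩)
      have hs := mem_span_of_homogeneous _
        (fun p : {l : List Word // ∀ c ∈ l, IsBasicWord c ∧ u < c} × ℕ =>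
          wordDeg p.1.1.flatten + p.2 • wordDeg u) (fun p => mul_mem_homComp
            (letterProd_mem q p.1.1) (pow_mem_homComp (superLetter_mem q u) p.2)) hd
            (mem_span_letterProd_mul_pow hq hu.1.2 hzu)
      refine Submodule.span_le.2 ?_ hs
      rintro _ ⟨⟨⟨l, hl⟩, k⟩, hp, rfl⟩
      have hlt : (S.filter (u < ·)).card < (S.filter (w < ·)).card := by
        refine Finset.card_lt_card (Finset.ssubset_iff_of_subset ?_ |>.2 ⟨u, ?_, ?_⟩)
        · intro c hc
          rw [Finset.mem_filter] at hc ⊢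
          exact ⟨hc.1, hu.2.trans hc.2⟩
        · exact Finset.mem_filter.2 ⟨(hS u).2 hu.1, hu.2⟩
        · simp
      have hdeg : (wordDeg l.flatten).1 + (wordDeg l.flatten).2 ≤ N := by
        have : wordDeg l.flatten + k • wordDeg u = d := hp
        have h1 := congrArg Prod.fst this
        have h2 := congrArg Prod.snd this
        simp only [Prod.fst_add, Prod.snd_add] at h1 h2
        omega
      have := ih _ hlt u (letterProd_mem q l) (letterProd_mem_adj hl) hdeg rfl
      dsimp only
      generalize letterProd q l = y at this
      change _ ∈ Submodule.span ℂ (largerProducts q w)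
      induction this using Submodule.span_induction with
      | mem y hy =>
        exact Submodule.subset_span (mul_pow_mem_largerProducts hu.1.2 hu.2 hy k)
      | zero => rw [zero_mul]; exact zero_mem _
      | add a b _ _ ha hb => rw [add_mul]; exact add_mem ha hb
      | smul r a _ ha => rw [smul_mul_assoc]; exact Submodule.smul_mem _ _ ha

/-! ### Imaginary root vectors -/

theorem wordDeg_wordPow (v : Word) (k : ℕ) : wordDeg (wordPow v k) = k • wordDeg v := by
  induction k with
  | zero => rw [zero_smul]; rfl
  | succ k ih => rw [wordPow_succ, wordDeg_append, ih, succ_nsmul']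

/-- χ(aδ, aδ) = (-1)^a, so proper powers that are imaginary candidates are squares of super-letters
of degree aδ with a odd. -/
theorem orderOf_chi_diag (hq0 : q ≠ 0) (a : ℕ) :
    orderOf (chi q (a, a) (a, a)) = if Even a then 1 else 2 := by
  rw [chi_eq hq0]
  split_ifs with h
  · rw [(h.mul_right a).neg_one_pow]; simp
  · rw [Nat.not_even_iff_odd] at h
    rw [(h.mul h).neg_one_pow]
    simp [orderOf_neg_one]

theorem IsRootVector.isBasicWord (hq : Generic q) {v : Word} (h : IsRootVector q v 1) :
    IsBasicWord v := by
  by_contra hb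
  refine h.2 ?_
  rw [wordPow_one, candidateVector, pow_one]
  exact mem_span_largerProducts hq v (superLetter_mem q v) (superLetter_mem_adj_lt hq h.1.1 hb)

/-- The larger words that express a non-basic [v] may be taken no longer than v, so they exceed vv
as well, and the square reduces too. -/
theorem IsRootVector.isBasicWord_of_two (hq : Generic q) {v : Word} (h : IsRootVector q v 2) :
    IsBasicWord v := by
  by_contra hb
  refine h.2 ?_
  have e : wordPow v 2 = v ++ v := by rw [wordPow_succ, wordPow_one]
  have hm := mem_adj_length (superLetter_mem q v) (superLetter_mem_adj_lt hq h.1.1 hb)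
  have hm' : superLetter q v ∈ adj q (v ++ v < ·) :=
    adj_mono (fun c _ hc => append_lt_of_length_le hc.1
      (by rw [← wordDeg_fst_add_snd v]; exact hc.2) v) hm
  rw [e, candidateVector]
  exact mem_span_largerProducts hq _ (pow_mem_homComp (superLetter_mem q v) 2) (pow_mem hm' 2)

theorem IsRootVector.imaginary_of_one (hq : Generic q) {v : Word} {N : ℕ}
    (h : IsRootVector q v 1) (hd : wordDeg v = (N, N)) :
    (∃ n : ℕ, 1 ≤ n ∧ N = 4 * n ∧ candidateVector q v 1 = L q (4 * n)) ∨
    (∃ n : ℕ, N = 4 * n + 2 ∧ (candidateVector q v 1 = L q (4 * n + 2) ∨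
      candidateVector q v 1 = M q (2 * n + 1) ^ 2)) ∨
    (∃ n : ℕ, N = 2 * n + 1 ∧ candidateVector q v 1 = M q (2 * n + 1)) := by
  rw [candidateVector, pow_one]
  rcases h.isBasicWord hq with ⟨n, rfl⟩ | ⟨n, rfl⟩ | ⟨n, rfl⟩ | ⟨n, rfl⟩
  · rw [wordDeg_wordX, Prod.mk.injEq] at hd; omega
  · rw [wordDeg_wordL, Prod.mk.injEq] at hd
    rw [superLetter_wordL_eq hq.ne_zero]
    rcases Nat.even_or_odd' n with ⟨m, rfl | rfl⟩
    · refine Or.inr (Or.inl ⟨m, by omega, Or.inl ?_⟩)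
      congr 1; ring
    · refine Or.inl ⟨m + 1, by omega, by omega, ?_⟩
      congr 1; ring
  · rw [wordDeg_wordM, Prod.mk.injEq] at hd
    exact Or.inr (Or.inr ⟨n, by omega, superLetter_wordM_eq hq.ne_zero n⟩)
  · rw [wordDeg_wordY, Prod.mk.injEq] at hd; omega

/-- The possible imaginary root vectors. -/
theorem IsRootVector.imaginary (hq : Generic q) {v : Word} {k N : ℕ}
    (hv : IsRootVector q v k) (hd : wordDeg (wordPow v k) = (N, N)) :
    (∃ n : ℕ, 1 ≤ n ∧ N = 4 * n ∧ candidateVector q v k = L q (4 * n)) ∨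
    (∃ n : ℕ, N = 4 * n + 2 ∧ (candidateVector q v k = L q (4 * n + 2) ∨
      candidateVector q v k = M q (2 * n + 1) ^ 2)) ∨
    (∃ n : ℕ, N = 2 * n + 1 ∧ candidateVector q v k = M q (2 * n + 1)) := by
  have one : k = 1 → _ := fun hk => (hk ▸ hv : IsRootVector q v 1).imaginary_of_one hq
    (N := N) (by rwa [hk, wordPow_one] at hd)
  rcases hv.1.2 with hk | ⟨hk, hk0⟩
  · subst hk; exact one rfl
  · rw [wordDeg_wordPow] at hd
    obtain ⟨a, ha⟩ : ∃ a, wordDeg v = (a, a) := by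
      refine ⟨(wordDeg v).1, Prod.ext rfl ?_⟩
      have h1 := congrArg Prod.fst hd
      have h2 := congrArg Prod.snd hd
      simp only [Prod.smul_fst, Prod.smul_snd, smul_eq_mul] at h1 h2
      exact Nat.eq_of_mul_eq_mul_left hk0 (h2.trans h1.symm)
    rw [ha, orderOf_chi_diag hq.ne_zero] at hk
    split_ifs at hk with hev
    · subst hk; exact one rfl
    · subst hk
      rw [ha, Prod.smul_mk, Prod.mk.injEq, smul_eq_mul] at hd
      rcases hv.isBasicWord_of_two hq with ⟨n, rfl⟩ | ⟨n, rfl⟩ | ⟨n, rfl⟩ | ⟨n, rfl⟩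
      · rw [wordDeg_wordX, Prod.mk.injEq] at ha; omega
      · rw [wordDeg_wordL, Prod.mk.injEq] at ha
        exact absurd ⟨n + 1, by omega⟩ hev
      · rw [wordDeg_wordM, Prod.mk.injEq] at ha
        refine Or.inr (Or.inl ⟨n, by omega, Or.inr ?_⟩)
        rw [candidateVector, superLetter_wordM_eq hq.ne_zero]
      · rw [wordDeg_wordY, Prod.mk.injEq] at ha; omega

end

end NicholsA02

end

theorem mainTheorem5 (q : ℂ) (hq0 : q ≠ 0) (hq : ∀ n : ℕ, 0 < n → q ^ n ≠ 1) :
    -- the brackets of the `M_{2n+1}`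
    (∀ m n : ℕ,
      (Odd (m + n) → bracket q (M q (2 * m + 1)) (M q (2 * n + 1)) = 0) ∧
      (Even (m + n) → bracket q (M q (2 * m + 1)) (M q (2 * n + 1)) =
        ((-1 : ℂ) ^ (((m : ℤ) - (n : ℤ)) / 2) * 2) • M q (m + n + 1) ^ 2)) ∧
    -- the squares `M_{2m+1}²` commute with all `L_n`
    (∀ m n : ℕ, bracket q (M q (2 * m + 1) ^ 2) (L q n) = 0 ∧
      Commute (M q (2 * m + 1) ^ 2) (L q n)) ∧
    -- and are central in the subquotient
    (∀ m : ℕ, ∃ h : M q (2 * m + 1) ^ 2 ∈ Kge q,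
      Ideal.Quotient.mk (Kgt q) ⟨M q (2 * m + 1) ^ 2, h⟩ ∈
        Subalgebra.center ℂ (Subquotient q)) ∧
    -- the brackets that involve `L̃_{2n}` and `L̄_{2n}`
    (∀ m n : ℕ, bracket q (Ltilde q (2 * m)) (Ltilde q (2 * n)) = 0) ∧
    (∃! Lbar : ℕ → NA q, IsLbar q Lbar) ∧
    (∀ Lbar : ℕ → NA q, IsLbar q Lbar →
      (∀ m n : ℕ, 1 ≤ m → 1 ≤ n → bracket q (Lbar m) (Lbar n) = 0) ∧
      (∀ m n : ℕ, 1 ≤ m → bracket q (Lbar (2 * m)) (M q (2 * n + 1)) = 0) ∧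
      (∀ m n : ℕ, bracket q (Lbar (2 * m + 1)) (M q (2 * n + 1)) =
        (1 / 2 ^ (2 * m) * (qInt q (2 * m + 1) / (2 * m + 1))) •
          M q (2 * (2 * m + 1) + 2 * n + 1))) ∧
    -- the only possible imaginary root vectors
    (∀ (v : Word) (k N : ℕ), 1 ≤ N → IsRootVector q v k → wordDeg (wordPow v k) = (N, N) →
      (∃ n : ℕ, 1 ≤ n ∧ N = 4 * n ∧ candidateVector q v k = L q (4 * n)) ∨
      (∃ n : ℕ, N = 4 * n + 2 ∧ (candidateVector q v k = L q (4 * n + 2) ∨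
        candidateVector q v k = M q (2 * n + 1) ^ 2)) ∨
      (∃ n : ℕ, N = 2 * n + 1 ∧ candidateVector q v k = M q (2 * n + 1))) := by
  have h : Generic q := ⟨hq0, hq⟩
  exact ⟨bracket_M h, fun m n => ⟨bracket_M_sq_L h m n, (commute_M_sq_L h m n).1⟩,
    fun m => ⟨M_sq_mem_Kge h m, M_sq_mem_center h m⟩, bracket_Ltilde h, existsUnique_Lbar h,
    fun b hb => hb.brackets h, fun _ _ _ _ hv hd => hv.imaginary h hd⟩
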